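/- Let $P>0$ and let $V:\mathbb R\to\mathbb R$. Let $\mu_V$ be the equilibrium measure, i.e. the minimizer over probability measures on $\mathbb R$ of $$\mathcal E(\mu)=\int\Big[V+\ln\frac{d\mu}{dx}\Big]d\mu-P\iint\ln|x-y|\,d\mu(x)d\mu(y)\ \ (\mu\ll dx),\qquad \mathcal E(\mu)=+\infty\ \text{otherwise},$$ and let $\rho_V$ be its density. Assume: (i) $V\in\mathcal C^3(\mathbb R)$, $V(x)\to+\infty$ and $|V'(x)|\to+\infty$ as $|x|\to\infty$, and $\mu_V$ satisfies a Poincaré inequality: for some $C>0$, $\mathrm{Var}_{\mu_V}(f)\le C\int|f'|^2d\mu_V$ for all $f\in\mathcal C^1_c(\mathbb R)$; (ii) for all $Q\in\mathbb R[X]$ and $\alpha>0$, $Q(V'(x))e^{-V(x)}=o(|x|^{-\alpha})$ as $|x|\to\infty$; (iii) for every real sequence $|x_N|\to\infty$ and all $a<b$, $V'(x_N)^{-2}\sup_{a\le x\le b}|V''(x_N+x)|\to0$; (iv) $V'^{-2}$ is integrable at $\pm\infty$, and $V''/V'$ and $V^{(3)}/V'$ are $O(1)$ as $|x|\to\infty$.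 Derivatives of functions below are weak derivatives. Let $\mathsf H=\{u\in L^2(\mu_V): u'\in L^2(\mu_V),\ \int u\,d\mu_V=0\}$ with $\langle u,v\rangle_{\mathsf H}=\int u'v'\,d\mu_V$. Let $\mathcal H[f](x)=\mathrm{p.v.}\!\int\frac{f(t)}{t-x}dt$ and $\mathcal F[f](x)=\int f(t)e^{-itx}dt$. On $\mathsf H$ define $$\mathcal A[u]=-\frac{(u'\rho_V)'}{\rho_V},\qquad \mathcal W[u]=-\mathcal H[u'\rho_V]+\int\mathcal H[u'\rho_V]\,d\mu_V,$$ with domains $\mathcal D(\mathcal A)=\{u\in\mathsf H:\mathcal A[u]\in\mathsf H\}$ and $\mathcal D(\mathcal W)=\{u\in\mathsf H:\mathcal W[u]\in\mathsf H\}$. Let $-\mathcal L$ be the operator on $\mathsf H$ associated (Friedrichs extension) with the form $$q(u,v)=\langle\mathcal A[u],\mathcal A[v]\rangle_{L^2(\mu_V)}+P\langle\mathcal F[u'\rho_V],\mathcal F[v'\rho_V]\rangle_{L^2(|x|dx)}$$ with form domain $Q=\{u\in\mathsf H:\mathcal A[u]\in L^2(\mu_V),\ \mathcal F[u'\rho_V]\in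 L^2(|x|dx)\}$; that is, $-\mathcal L[v]=f$ means $v\in Q$, $f\in\mathsf H$ and $q(\varphi,v)=\langle\varphi,f\rangle_{\mathsf H}$ for all $\varphi\in Q$. Let $\mathcal K[w](x)=\int k(x,y)w(y)\,d\mu_V(y)$ on $L^2(\mu_V)$, with $$k(x,y)=2P\ln|x-y|-2P\int\ln|z-y|\,d\mu_V(z).$$ For a kernel operator $\mathcal T$ with kernel $\tau$ let $$\det{}_2(\mathsf{id}+\mathcal T)=1+\sum_{n\ge1}\frac1{n!}\int_{\mathbb R^n}\det\big[\tau(t_i,t_j)\mathbf 1_{i\ne j}\big]_{i,j=1}^n\prod_i d\mu_V(t_i).$$ Then: 1. $k\in L^2(\mu_V\otimes\mu_V)$; the integrals and the series defining $\det_2(\mathsf{id}-\mathcal K)$ converge absolutely, and $\det_2(\mathsf{id}-\mathcal K)\neq0$. 2. The integrals and the series in $$r(x,y)=\frac1{\det_2(\mathsf{id}-\mathcal K)}\sum_{n\ge0}\frac{(-1)^{n+1}}{n!}\int_{\mathbb R^n}\begin{vmatrix}k(x,y)&k(x,t_1)&\cdots&k(x,t_n)\\k(t_1,y)&0&\cdots&k(t_1,t_n)\\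 \vdots&&\ddots&\vdots\\k(t_n,y)&k(t_n,t_1)&\cdots&0\end{vmatrix}\prod_i d\mu_V(t_i)$$ converge absolutely for $\mu_V\otimes\mu_V$-a.e. $(x,y)$, $r\in L^2(\mu_V\otimes\mu_V)$, and $\mathcal R[v](x)=\int r(x,y)v(y)\,d\mu_V(y)$ satisfies $(\mathsf{id}-\mathcal K)(\mathsf{id}-\mathcal R)=(\mathsf{id}-\mathcal R)(\mathsf{id}-\mathcal K)=\mathsf{id}$ on $L^2(\mu_V)$. 3. For every $u\in\mathsf H$ such that $x\mapsto\frac1{\rho_V(x)}\int_x^{+\infty}u\rho_V\,dt$ is integrable at $+\infty$, the equations $\mathcal A[a]=u$, $\mathcal A[b]=\mathcal R[u]$ (with $a,b\in\mathcal D(\mathcal A)$) and $-\mathcal L[w]=u$ have unique solutions $a=\mathcal A^{-1}[u]$, $b=\mathcal A^{-1}\mathcal R[u]$, $w=-\mathcal L^{-1}[u]$, with $$-\mathcal L^{-1}[u]=\mathcal A^{-1}[u]-\mathcal A^{-1}\mathcal R[u],$$ $$\mathcal A^{-1}[u](x)=-\int_x^{+\infty}\frac{ds}{\rho_V(s)}\int_s^{+\infty}u(t)\rho_V(t)\,dt+C,\qquad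 C=\int_{\mathbb R}\rho_V(y)\,dy\int_y^{+\infty}\frac{ds}{\rho_V(s)}\int_s^{+\infty}u(t)\rho_V(t)\,dt.$$ Moreover $w\in\mathcal D(\mathcal A)\cap\mathcal D(\mathcal W)$ and $u=\mathcal A[w]+2P\,\mathcal W[w]$. 4. $2P\,\mathcal W\circ\mathcal A^{-1}=-\mathcal K$ on $\mathsf H$. -/

import Mathlib

open MeasureTheory Filter Topology Set
open scoped Asymptotics

noncomputable section

/-! ### The equilibrium measure -/

/-- The (Lebesgue) density `ρ` of a measure `μ` on the line. -/
def lebDensity (μ : Measure ℝ) (x : ℝ) : ℝ := (μ.rnDeriv volume x).toReal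

/-- `μ` is absolutely continuous and all the terms of the energy are absolutely convergent. -/
def HasFiniteEnergy (V : ℝ → ℝ) (μ : Measure ℝ) : Prop :=
  μ ≪ volume ∧ Integrable V μ ∧ Integrable (fun x => Real.log (lebDensity μ x)) μ ∧
    Integrable (fun p : ℝ × ℝ => Real.log |p.1 - p.2|) (μ.prod μ)

open Classical in
/-- The energy `∫ (V + ln(dμ/dx)) dμ - P ∬ ln|x-y| dμ(x) dμ(y)`, with value `+∞` when `μ` is not
absolutely continuous. For `V` growing faster than linearly the energy of a probability
measure `μ ≪ dx` is also `+∞` as soon as one of the three integrals is not absolutely convergent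
(it is bounded below by `∫ V dμ / 4 - C`), so that the value `⊤` below is the right one. -/
def freeEnergy (V : ℝ → ℝ) (P : ℝ) (μ : Measure ℝ) : EReal :=
  if HasFiniteEnergy V μ then
    (((∫ x, (V x + Real.log (lebDensity μ x)) ∂μ)
      - P * ∫ p : ℝ × ℝ, Real.log |p.1 - p.2| ∂(μ.prod μ) : ℝ) : EReal)
  else ⊤

/-- `μ` is the equilibrium measure: the minimizer of the energy among probability measures. -/
def IsEquilibriumMeasure (V : ℝ → ℝ) (P : ℝ) (μ : Measure ℝ) : Prop :=
  IsProbabilityMeasure μ ∧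
    ∀ ν : Measure ℝ, IsProbabilityMeasure ν → freeEnergy V P μ ≤ freeEnergy V P ν

/-! ### Assumptions on the potential -/

/-- The Poincaré inequality for `μ`. -/
def PoincareInequality (μ : Measure ℝ) : Prop :=
  ∃ C : ℝ, 0 < C ∧ ∀ f : ℝ → ℝ, ContDiff ℝ 1 f → HasCompactSupport f →
    ∫ x, (f x - ∫ y, f y ∂μ) ^ 2 ∂μ ≤ C * ∫ x, |deriv f x| ^ 2 ∂μ

/-- The standing assumptions on the potential `V` with equilibrium measure `μ`.
`cocompact ℝ` is the filter `|x| → ∞`. -/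
structure PotentialAssumptions (V : ℝ → ℝ) (μ : Measure ℝ) : Prop where
  contDiff : ContDiff ℝ 3 V
  tendsto : Tendsto V (cocompact ℝ) atTop
  tendsto_deriv : Tendsto (fun x => |deriv V x|) (cocompact ℝ) atTop
  poincare : PoincareInequality μ
  decay : ∀ (Q : Polynomial ℝ) (α : ℝ), 0 < α →
    (fun x => Q.eval (deriv V x) * Real.exp (-V x)) =o[cocompact ℝ] fun x => |x| ^ (-α)
  sup_deriv2 : ∀ ξ : ℕ → ℝ, Tendsto (fun N => |ξ N|) atTop atTop → ∀ a b : ℝ, a < b →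
    Tendsto (fun N => 1 / (deriv V (ξ N)) ^ 2 *
      sSup ((fun x => |iteratedDeriv 2 V (ξ N + x)|) '' Icc a b)) atTop (𝓝 0)
  integrable_inv_sq :
    IntegrableAtFilter (fun x => ((deriv V x) ^ 2)⁻¹) (cocompact ℝ) volume
  deriv2_bound : (fun x => iteratedDeriv 2 V x / deriv V x) =O[cocompact ℝ] fun _ => (1 : ℝ)
  deriv3_bound : (fun x => iteratedDeriv 3 V x / deriv V x) =O[cocompact ℝ] fun _ => (1 : ℝ)

/-! ### Weak derivatives and the space `H` -/

/-- `v` is the weak (distributional) derivative of `u` on the line. -/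
def HasWeakDeriv (u v : ℝ → ℝ) : Prop :=
  LocallyIntegrable u volume ∧ LocallyIntegrable v volume ∧
    ∀ φ : ℝ → ℝ, ContDiff ℝ (⊤ : ℕ∞) φ → HasCompactSupport φ →
      ∫ x, u x * deriv φ x = -∫ x, v x * φ x

open Classical in
/-- The weak derivative (defined up to null sets; `0` if there is none). -/
def weakDeriv (u : ℝ → ℝ) : ℝ → ℝ :=
  if h : ∃ v, HasWeakDeriv u v then h.choose else 0

/-- Membership in `H = {u ∈ L²(μ) | u' ∈ L²(μ), ∫ u dμ = 0}`; elements of `H` are functions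
up to almost everywhere equality. -/
def MemH (μ : Measure ℝ) (u : ℝ → ℝ) : Prop :=
  MemLp u 2 μ ∧ (∃ v, HasWeakDeriv u v) ∧ MemLp (weakDeriv u) 2 μ ∧ ∫ x, u x ∂μ = 0

/-- `⟨u, v⟩_H = ⟨u', v'⟩_{L²(μ)}`. -/
def innerH (μ : Measure ℝ) (u v : ℝ → ℝ) : ℝ := ∫ x, weakDeriv u x * weakDeriv v x ∂μ

/-- The function `u' ρ`. -/
def derivDensity (μ : Measure ℝ) (u : ℝ → ℝ) : ℝ → ℝ := fun x => weakDeriv u x * lebDensity μ x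

/-! ### The operators `A`, `W` and `L` -/

/-- `A[u] = -(u' ρ)' / ρ`, in the weak sense. -/
def opA (μ : Measure ℝ) (u : ℝ → ℝ) : ℝ → ℝ :=
  fun x => -(weakDeriv (derivDensity μ u) x) / lebDensity μ x

/-- `u ∈ D(A) = {u ∈ H | A[u] ∈ H}` and `A[u] = f`. -/
def GraphA (μ : Measure ℝ) (u f : ℝ → ℝ) : Prop :=
  MemH μ u ∧ MemH μ f ∧ (∃ g, HasWeakDeriv (derivDensity μ u) g) ∧ opA μ u =ᵐ[μ] f

/-- `h` is the Hilbert transform of `f ∈ L²(ℝ)`: for almost every `x`, `h x` is the principal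
value of `∫ f(t) / (t - x) dt`. -/
def IsHilbertTransform (f h : ℝ → ℝ) : Prop :=
  MemLp f 2 volume ∧ MemLp h 2 volume ∧
    ∀ᵐ x, Tendsto (fun ε : ℝ => ∫ t in {t : ℝ | ε < |t - x|}, f t / (t - x)) (𝓝[>] 0) (𝓝 (h x))

/-- `u ∈ D(W) = {u ∈ H | W[u] ∈ H}` and `W[u] = g`, where
`W[u] = -ℋ[u' ρ] + ∫ ℋ[u' ρ] dμ`. -/
def GraphW (μ : Measure ℝ) (u g : ℝ → ℝ) : Prop :=
  MemH μ u ∧ MemH μ g ∧ ∃ h, IsHilbertTransform (derivDensity μ u) h ∧ Integrable h μ ∧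
    g =ᵐ[μ] fun x => -h x + ∫ y, h y ∂μ

/-- The Fourier transform `∫ f(t) e^{-itx} dt`. It is only used for `f = u' ρ` with
`u ∈ H`, which is integrable. -/
def fourierT (f : ℝ → ℝ) (x : ℝ) : ℂ := ∫ t, (f t : ℂ) * Complex.exp (-(Complex.I * t * x))

/-- The form domain `Q(L)`: `u ∈ H`, `A[u] ∈ L²(μ)`, and the Fourier transform of `u' ρ` belongs
to `L²(|x| dx)`. -/
def MemFormDomain (μ : Measure ℝ) (u : ℝ → ℝ) : Prop :=
  MemH μ u ∧ (∃ g, HasWeakDeriv (derivDensity μ u) g) ∧ MemLp (opA μ u) 2 μ ∧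
    MemLp (fourierT (derivDensity μ u)) 2 (volume.withDensity fun x => ENNReal.ofReal |x|)

/-- The quadratic form of `-L`:
`q(u,v) = ⟨A[u], A[v]⟩_{L²(μ)} + P ⟨ℱ[u' ρ], ℱ[v' ρ]⟩_{L²(|x| dx)}`. -/
def formL (P : ℝ) (μ : Measure ℝ) (u v : ℝ → ℝ) : ℝ :=
  (∫ x, opA μ u x * opA μ v x ∂μ) +
    P * ∫ x, |x| * (fourierT (derivDensity μ u) x *
      (starRingEnd ℂ) (fourierT (derivDensity μ v) x)).re

/-- `v ∈ D(L)` and `-L[v] = f`: the operator on `H` associated with the form `q` (Friedrichs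
extension), i.e. `q(φ, v) = ⟨φ, f⟩_H` for all `φ` in the form domain, with `f ∈ H`. -/
def GraphNegL (P : ℝ) (μ : Measure ℝ) (v f : ℝ → ℝ) : Prop :=
  MemFormDomain μ v ∧ MemH μ f ∧ ∀ φ, MemFormDomain μ φ → formL P μ φ v = innerH μ φ f

/-- For an operator `T` with graph `G`: `w = T⁻¹[f]`, i.e. `w` is a solution of `T[w] = f` and it
is the only one up to null sets. -/
def IsInverseAt (μ : Measure ℝ) (G : (ℝ → ℝ) → (ℝ → ℝ) → Prop) (f w : ℝ → ℝ) : Prop :=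
  G w f ∧ ∀ w', G w' f → w' =ᵐ[μ] w

/-! ### Explicit expressions -/

/-- `x ↦ (1/ρ(x)) ∫_x^∞ u ρ dt`. -/
def tailQuotient (μ : Measure ℝ) (u : ℝ → ℝ) (x : ℝ) : ℝ :=
  1 / lebDensity μ x * ∫ t in Ioi x, u t * lebDensity μ t

/-- `x ↦ -∫_x^∞ ds/ρ(s) ∫_s^∞ u ρ dt + C` with
`C = ∫ ρ(y) dy ∫_y^∞ ds/ρ(s) ∫_s^∞ u ρ dt`. -/
def explicitInvA (μ : Measure ℝ) (u : ℝ → ℝ) (x : ℝ) : ℝ :=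
  -(∫ s in Ioi x, tailQuotient μ u s) +
    ∫ y, lebDensity μ y * ∫ s in Ioi y, tailQuotient μ u s

/-- The kernel operator `w ↦ ∫ k(·,y) w(y) dμ(y)`. -/
def kernelOp (μ : Measure ℝ) (k : ℝ → ℝ → ℝ) (w : ℝ → ℝ) (x : ℝ) : ℝ := ∫ y, k x y * w y ∂μ

/-- `k(x,y) = 2P ln|x-y| - 2P ∫ ln|z-y| dμ(z)`. -/
def logKernel (P : ℝ) (μ : Measure ℝ) (x y : ℝ) : ℝ :=
  2 * P * Real.log |x - y| - 2 * P * ∫ z, Real.log |z - y| ∂μ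

/-- The matrix `k(t_i, t_j)` with its diagonal replaced by `0`. -/
def offDiagMatrix (k : ℝ → ℝ → ℝ) {n : ℕ} (t : Fin n → ℝ) : Matrix (Fin n) (Fin n) ℝ :=
  Matrix.of fun i j => if i = j then 0 else k (t i) (t j)

/-- The `n`-th term of the series of the Fredholm 2-determinant of `id + K`. -/
def det2Term (μ : Measure ℝ) [SigmaFinite μ] (k : ℝ → ℝ → ℝ) (n : ℕ) : ℝ :=
  1 / (n.factorial : ℝ) * ∫ t : Fin n → ℝ, (offDiagMatrix k t).det ∂(Measure.pi fun _ => μ)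

/-- The Fredholm 2-determinant of `id + K`, where `K` has kernel `k`. -/
def fredholmDet2 (μ : Measure ℝ) [SigmaFinite μ] (k : ℝ → ℝ → ℝ) : ℝ :=
  1 + ∑' n : ℕ, det2Term μ k (n + 1)

/-- The matrix `offDiagMatrix k t` bordered by the row `k(x, t_j)`, the column `k(t_i, y)` and the
corner `k(x, y)`. -/
def borderedMatrix (k : ℝ → ℝ → ℝ) (x y : ℝ) {n : ℕ} (t : Fin n → ℝ) :
    Matrix (Unit ⊕ Fin n) (Unit ⊕ Fin n) ℝ :=
  Matrix.fromBlocks (Matrix.of fun _ _ => k x y) (Matrix.of fun _ j => k x (t j))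
    (Matrix.of fun i _ => k (t i) y) (offDiagMatrix k t)

/-- The `n`-th term of the numerator of the resolvent kernel of `id - K`. -/
def resolventTerm (μ : Measure ℝ) [SigmaFinite μ] (k : ℝ → ℝ → ℝ) (x y : ℝ) (n : ℕ) : ℝ :=
  (-1) ^ (n + 1) / (n.factorial : ℝ) *
    ∫ t : Fin n → ℝ, (borderedMatrix k x y t).det ∂(Measure.pi fun _ => μ)

/-- The resolvent kernel of `id - K`, where `K` has kernel `k`. -/
def resolventKernel (μ : Measure ℝ) [SigmaFinite μ] (k : ℝ → ℝ → ℝ) (x y : ℝ) : ℝ :=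
  1 / fredholmDet2 μ (fun a b => -k a b) * ∑' n : ℕ, resolventTerm μ k x y n

end

/-! Everything rests on the factorisation `-L = (id - K) ∘ A`. If `A[a] = v`, then `a'ρ` is the tail
`∫_x^∞ vρ`, and the Hilbert transform of this tail is the logarithmic potential `U_v(x) = ∫ ln|x-t|
v(t)ρ(t) dt` (`LogCharge.isHilbertTransform`). Hence `2P W[a]` is `-2P` times the centered
potential, that is `-K[v]`. In Fourier space the second term of the form `q` is the logarithmic
energy of two neutral charges, so `q(φ, w) = ∫ A[φ] (A[w] - K[A[w]]) dμ`, while an integration by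
parts gives `⟨φ, u⟩_H = ∫ A[φ] u dμ` (`formL_eq`, `innerH_eq`). The Poincaré inequality makes `A`
surjective onto the mean zero functions of `L²(μ)` (`truncPrimitive_bounds`, `solvesA_invA`), so
`-L[w] = u` says exactly that `(id - K)A[w] = u` (`graphNegL_iff`), and `w = A⁻¹[u - R[u]]`. That
`R[u]` lies in `H` follows from `R[u] = -K[u - R[u]]` and from the fact that potentials of neutral
charges have square integrable weak derivatives (`LogCharge.exists_bound_test`).

The Fredholm theory uses the splitting `k(x,y) = s(x,y) + g(x)`, with `s` the doubly centered
logarithm and `g` of mean zero. The operator `S` is symmetric, kills constants, and is negative: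
`-ln|x-y|` is, up to a term that neutral charges do not see, a superposition of Cauchy kernels,
whose Fourier transforms are positive (`logEnergy_eq_fourier`). The part `g` does not contribute to
the traces. Cofactor expansions yield `n δ_n = -∑ tr(S^m) δ_{n-m}` over `m ≥ 2`, so the `δ_n` are
the coefficients of `δ(z) = det₂(1 - zS)`. For convergence at `z = 1`, split off finitely many
eigenvalues `l_i` so that the rest of `S` has norm at most `1/2`: the logarithmic derivative of
`δ(z) / ∏ (1 - l_i z)` has coefficients `O(2^{-n})`, so this quotient and its inverse are absolutely
summable at `1`. Since `l_i ≤ 0`, the factors `1 - l_i` do not vanish and `δ(1) ≠ 0`. The same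
splitting controls the coefficients of `δ(z)(1 - zS)⁻¹`, whose values on the columns of `k` are the
bordered minors (`fredholm_summable`, `coeFn_resCoeff`).

These arguments need a continuous, positive, rapidly decaying density. Competitors `ρ(1 + εφ)` give
the Euler-Lagrange equation `V + ln ρ - 2P U = c` almost everywhere for `μ`, where `U` is the
potential of `μ`. Putting mass `ε` on the zero set of `ρ` would change the energy by at most `ε (ln
ε + C)`, so `ρ > 0` almost everywhere and `ρ = exp(c - V + 2P U)`. As `U` grows at most
logarithmically and `V` faster than any multiple of the logarithm, `ρ` decays faster than any power
(`IsEquilibriumMeasure.regularDensity`). -/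

set_option linter.unusedSectionVars false

/-! ### Power series with absolutely summable coefficients -/

namespace PowerSeries

/-- The coefficients of `f` are absolutely summable. -/
def AbsSummable (f : PowerSeries ℝ) : Prop := Summable fun n => ‖coeff n f‖

/-- The sum of the coefficients of `f`. -/
noncomputable def coeffSum (f : PowerSeries ℝ) : ℝ := ∑' n, coeff n f

theorem AbsSummable.mul {f g : PowerSeries ℝ} (hf : f.AbsSummable) (hg : g.AbsSummable) :
    (f * g).AbsSummable := by
  have := summable_norm_sum_mul_antidiagonal_of_summable_norm hf hg
  simpa only [AbsSummable, coeff_mul] using this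

theorem coeffSum_mul {f g : PowerSeries ℝ} (hf : f.AbsSummable) (hg : g.AbsSummable) :
    (f * g).coeffSum = f.coeffSum * g.coeffSum := by
  rw [coeffSum, coeffSum, coeffSum, tsum_mul_tsum_eq_tsum_sum_antidiagonal_of_summable_norm hf hg]
  simp only [coeff_mul]

theorem absSummable_one : (1 : PowerSeries ℝ).AbsSummable :=
  summable_of_ne_finset_zero (s := {0}) fun n hn => by
    simp only [Finset.mem_singleton] at hn
    simp [coeff_one, hn]

theorem coeffSum_one : (1 : PowerSeries ℝ).coeffSum = 1 := by
  rw [coeffSum, tsum_eq_single 0] <;> simp +contextual [coeff_one]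

theorem coeff_one_sub_C_mul_X (r : ℝ) (n : ℕ) :
    coeff n (1 - C r * X : PowerSeries ℝ) = if n = 0 then 1 else if n = 1 then -r else 0 := by
  rw [map_sub, coeff_C_mul, coeff_X, coeff_one]
  rcases n with _ | _ | n <;> simp

theorem absSummable_one_sub (r : ℝ) : (1 - C r * X : PowerSeries ℝ).AbsSummable :=
  summable_of_ne_finset_zero (s := {0, 1}) fun n hn => by
    simp only [Finset.mem_insert, Finset.mem_singleton, not_or] at hn
    simp [coeff_one_sub_C_mul_X, hn.1, hn.2]

theorem coeffSum_one_sub (r : ℝ) : (1 - C r * X : PowerSeries ℝ).coeffSum = 1 - r := by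
  rw [coeffSum, tsum_eq_sum (s := {0, 1})]
  · rw [Finset.sum_pair (by norm_num)]
    simp [coeff_one_sub_C_mul_X]; ring
  · intro n hn
    simp only [Finset.mem_insert, Finset.mem_singleton, not_or] at hn
    simp [coeff_one_sub_C_mul_X, hn.1, hn.2]

theorem absSummable_prod {ι : Type*} (s : Finset ι) (f : ι → PowerSeries ℝ)
    (hf : ∀ i ∈ s, (f i).AbsSummable) : (∏ i ∈ s, f i).AbsSummable := by
  classical
  induction s using Finset.induction_on with
  | empty => simpa using absSummable_one
  | insert a s ha ih =>
    rw [Finset.prod_insert ha]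
    exact (hf a (by simp)).mul (ih fun i hi => hf i (by simp [hi]))

theorem coeffSum_prod {ι : Type*} (s : Finset ι) (f : ι → PowerSeries ℝ)
    (hf : ∀ i ∈ s, (f i).AbsSummable) : (∏ i ∈ s, f i).coeffSum = ∏ i ∈ s, (f i).coeffSum := by
  classical
  induction s using Finset.induction_on with
  | empty => simpa using coeffSum_one
  | insert a s ha ih =>
    rw [Finset.prod_insert ha, Finset.prod_insert ha,
      coeffSum_mul (hf a (by simp)) (absSummable_prod s f fun i hi => hf i (by simp [hi])),
      ih fun i hi => hf i (by simp [hi])]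

/-- The Euler operator `X d/dX`. -/
noncomputable def euler (f : PowerSeries ℝ) : PowerSeries ℝ := X * d⁄dX ℝ f

theorem coeff_euler (f : PowerSeries ℝ) (n : ℕ) : coeff n f.euler = n * coeff n f := by
  rcases n with _ | n
  · simp [euler]
  · rw [euler, coeff_succ_X_mul, coeff_derivative]; push_cast; ring

theorem euler_mul (f g : PowerSeries ℝ) : (f * g).euler = f.euler * g + f * g.euler := by
  simp only [euler, Derivation.leibniz, smul_eq_mul]; ring

theorem euler_one : (1 : PowerSeries ℝ).euler = 0 := by
  simp [euler]

/-- Logarithmic derivatives add up under products. -/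
theorem euler_prod {ι : Type*} (s : Finset ι) (f c : ι → PowerSeries ℝ)
    (hf : ∀ i ∈ s, (f i).euler = c i * f i) :
    (∏ i ∈ s, f i).euler = (∑ i ∈ s, c i) * ∏ i ∈ s, f i := by
  classical
  induction s using Finset.induction_on with
  | empty => simp [euler_one]
  | insert a s ha ih =>
    rw [Finset.prod_insert ha, Finset.sum_insert ha, euler_mul, hf a (by simp),
      ih fun i hi => hf i (by simp [hi])]
    ring

/-- A power series whose logarithmic derivative has geometrically decaying coefficients is
absolutely summable. -/
theorem absSummable_of_euler_eq {G c : PowerSeries ℝ} {B : ℝ} (h : G.euler = c * G)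
    (h0 : coeff 0 c = 0) (hc : ∀ n, |coeff n c| ≤ B * (1 / 2) ^ n) : G.AbsSummable := by
  have hB : 0 ≤ B := by simpa [h0] using hc 0
  -- Any ratio strictly between `1/2` and `1` would do in place of `3/4`. Against the decay
  -- `(1/2)^n` of `c` it turns the convolution into a geometric series of ratio `2/3`.
  set s : ℕ → ℝ := fun n => |coeff n G| / (3 / 4) ^ n with hs
  have hs0 : ∀ n, 0 ≤ s n := fun n => by positivity
  have hG : ∀ n, |coeff n G| = s n * (3 / 4) ^ n := fun n => by
    simp only [hs]; field_simp
  -- Comparing coefficients gives `n G_n = ∑ c_j G_{n-j}`, and `c_0 = 0` leaves only earlier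
  -- coefficients of `G` on the right. The factor `2` is `∑_{j ≥ 1} (2/3)^j`.
  have step : ∀ n : ℕ, ∀ K : ℝ, (∀ j < n, s j ≤ K) → 0 ≤ K → n * s n ≤ 2 * B * K := by
    intro n K hK hK0
    have e : (n : ℝ) * coeff n G = ∑ p ∈ Finset.HasAntidiagonal.antidiagonal n, coeff p.1 c * coeff p.2 G := by
      rw [← coeff_euler, h, coeff_mul]
    have b : ∀ p ∈ Finset.HasAntidiagonal.antidiagonal n, |coeff p.1 c * coeff p.2 G| ≤
        (if p.1 = 0 then 0 else B * K * (3 / 4) ^ n * (2 / 3) ^ p.1 : ℝ) := by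
      intro p hp
      rw [Finset.HasAntidiagonal.mem_antidiagonal] at hp
      split_ifs with h1
      · simp [h1, h0]
      · rw [abs_mul, hG p.2]
        have : (3 / 4 : ℝ) ^ n * (2 / 3) ^ p.1 = (1 / 2) ^ p.1 * (3 / 4) ^ p.2 := by
          rw [← hp, pow_add, mul_right_comm, ← mul_pow]; norm_num
        calc |coeff p.1 c| * (s p.2 * (3 / 4) ^ p.2)
            ≤ (B * (1 / 2) ^ p.1) * (K * (3 / 4) ^ p.2) := by
              gcongr
              · exact hc _
              · exact hK _ (by omega)
          _ = B * K * ((1 / 2) ^ p.1 * (3 / 4) ^ p.2) := by ring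
          _ = _ := by rw [← this]; ring
    have geo : ∑ p ∈ Finset.HasAntidiagonal.antidiagonal n,
        (if p.1 = 0 then 0 else B * K * (3 / 4) ^ n * (2 / 3) ^ p.1 : ℝ)
        ≤ B * K * (3 / 4) ^ n * 2 := by
      rw [Finset.Nat.sum_antidiagonal_eq_sum_range_succ_mk, Finset.sum_range_succ']
      simp only [Nat.add_eq_zero_iff, one_ne_zero, and_false, if_false, if_true, add_zero]
      rw [← Finset.mul_sum]
      gcongr
      have : ∑ i ∈ Finset.range n, (2 / 3 : ℝ) ^ (i + 1)
          = 2 / 3 * ∑ i ∈ Finset.range n, (2 / 3 : ℝ) ^ i := by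
        rw [Finset.mul_sum]; exact Finset.sum_congr rfl fun i _ => by ring
      rw [this, geom_sum_eq (by norm_num)]
      have := pow_pos (show (0 : ℝ) < 2 / 3 by norm_num) n
      have e2 : ∀ t : ℝ, 2 / 3 * ((t - 1) / (2 / 3 - 1)) = 2 * (1 - t) := fun t => by ring
      rw [e2]; linarith
    have := (Finset.abs_sum_le_sum_abs _ _).trans ((Finset.sum_le_sum b).trans geo)
    rw [← e, abs_mul, Nat.abs_cast, hG n] at this
    have p : (0 : ℝ) < (3 / 4) ^ n := by positivity
    nlinarith
  -- Beyond `2B` the factor `n` on the left of `step` absorbs the constant, so a bound valid up to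
  -- `N` propagates to all `n`.
  obtain ⟨N, hN⟩ := exists_nat_ge (2 * B)
  obtain ⟨K, hK0, hK⟩ : ∃ K : ℝ, 0 ≤ K ∧ ∀ j < N + 1, s j ≤ K :=
    ⟨∑ j ∈ Finset.range (N + 1), s j, Finset.sum_nonneg fun i _ => hs0 i, fun j hj =>
      Finset.single_le_sum (f := s) (fun i _ => hs0 i) (Finset.mem_range.2 hj)⟩
  have bd : ∀ n, s n ≤ K := by
    intro n
    induction n using Nat.strong_induction_on with
    | _ n ih =>
      by_cases hn : n < N + 1
      · exact hK n hn
      · have h1 := step n K ih hK0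
        have h2 : (N : ℝ) + 1 ≤ n := by exact_mod_cast not_lt.1 hn
        by_contra h3
        push Not at h3
        have : 0 < s n := hK0.trans_lt h3
        nlinarith
  refine Summable.of_nonneg_of_le (fun n => norm_nonneg _) (fun n => ?_)
    ((summable_geometric_of_lt_one (by norm_num) (by norm_num : (3 / 4 : ℝ) < 1)).mul_left K)
  rw [Real.norm_eq_abs, hG n]
  exact mul_le_mul_of_nonneg_right (bd n) (by positivity)

/-- The inverse series has logarithmic derivative `-c`, hence is absolutely summable as well, and
evaluating `G * G⁻¹ = 1` at `1` excludes the value `0`. -/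
theorem coeffSum_ne_zero_of_euler_eq {G c : PowerSeries ℝ} {B : ℝ} (h : G.euler = c * G)
    (h1 : constantCoeff G = 1) (h0 : coeff 0 c = 0)
    (hc : ∀ n, |coeff n c| ≤ B * (1 / 2) ^ n) : G.coeffSum ≠ 0 := by
  have hG : G * G⁻¹ = 1 := PowerSeries.mul_inv_cancel _ (by rw [h1]; exact one_ne_zero)
  have hi : (G⁻¹).euler = -c * G⁻¹ := by
    have := congrArg euler hG
    rw [euler_mul, euler_one, h] at this
    calc (G⁻¹).euler = G⁻¹ * (c * G * G⁻¹ + G * (G⁻¹).euler) - (G * G⁻¹) * c * G⁻¹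
          + (1 - G * G⁻¹) * (G⁻¹).euler := by ring
      _ = _ := by rw [this, hG]; ring
  have s1 := absSummable_of_euler_eq h h0 hc
  have s2 := absSummable_of_euler_eq (B := B) hi (by rw [map_neg, h0, neg_zero]) (by simpa using hc)
  intro h2
  have := coeffSum_mul s1 s2
  rw [hG, coeffSum_one, h2, zero_mul] at this
  exact one_ne_zero this

theorem one_sub_mul_geom (r : ℝ) : (1 - C r * X : PowerSeries ℝ) * mk (fun n => r ^ n) = 1 := by
  ext n
  rw [sub_mul, one_mul, mul_assoc, map_sub, coeff_C_mul, coeff_one]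
  rcases n with _ | n
  · simp
  · rw [coeff_succ_X_mul]; simp [pow_succ']

end PowerSeries

/-! ### Symmetric Hilbert-Schmidt operators -/

section HilbertSchmidt

variable {H : Type*} [NormedAddCommGroup H] [InnerProductSpace ℝ H]

/-- An operator with finite Hilbert-Schmidt norm is compact. -/
theorem isCompactOperator_of_sum_norm_sq_le [CompleteSpace H] (S : H →L[ℝ] H) (B : ℝ)
    (hB : ∀ (n : ℕ) (v : Fin n → H), Orthonormal ℝ v → ∑ i, ‖S (v i)‖ ^ 2 ≤ B) :
    IsCompactOperator S := by
  set A : Set ℝ := {a | ∃ (n : ℕ) (v : Fin n → H), Orthonormal ℝ v ∧ a = ∑ i, ‖S (v i)‖ ^ 2}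
  have hA : BddAbove A := ⟨B, by rintro _ ⟨n, v, hv, rfl⟩; exact hB n v hv⟩
  have hne : A.Nonempty := ⟨0, 0, Fin.elim0, ⟨fun i => i.elim0, fun i => i.elim0⟩, by simp⟩
  have cl := isClosed_setOfPred_isCompactOperator (σ₁₂ := RingHom.id ℝ) (M₁ := H) (M₂ := H)
  suffices h : S ∈ closure {f : H →L[ℝ] H | IsCompactOperator f} by
    rw [cl.closure_eq] at h; exact h
  rw [Metric.mem_closure_iff]
  intro ε hε
  -- Choose a finite orthonormal family that nearly exhausts the Hilbert-Schmidt norm; `S` composed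
  -- with the projection onto its span is the finite rank approximation.
  obtain ⟨_, ⟨n, v, hv, rfl⟩, hlt⟩ := exists_lt_of_lt_csSup hne
    (show sSup A - (ε / 2) ^ 2 < sSup A by have := pow_pos (half_pos hε) 2; linarith)
  set F : Submodule ℝ H := Submodule.span ℝ (range v)
  have : FiniteDimensional ℝ F := FiniteDimensional.span_of_finite ℝ (finite_range v)
  -- A unit vector orthogonal to the family can be adjoined to it, and the enlarged sum is still at
  -- most `sSup A`. So its image has squared norm at most `(ε/2)²`.
  have key : ∀ w ∈ Fᗮ, ‖S w‖ ≤ ε / 2 * ‖w‖ := by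
    intro w hw
    rcases eq_or_ne w 0 with rfl | hw0
    · simp
    have hn : ‖w‖ ≠ 0 := norm_ne_zero_iff.2 hw0
    have ho : Orthonormal ℝ (Matrix.vecCons ((‖w‖⁻¹) • w) v) := by
      rw [orthonormal_vecCons_iff]
      refine ⟨by simp [norm_smul, hn], fun i => ?_, hv⟩
      rw [real_inner_smul_left, real_inner_comm,
        (Submodule.mem_orthogonal F w).1 hw (v i) (Submodule.subset_span ⟨i, rfl⟩), mul_zero]
    have h1 : ∑ i, ‖S (Matrix.vecCons ((‖w‖⁻¹) • w) v i)‖ ^ 2 ≤ sSup A :=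
      le_csSup hA ⟨_, _, ho, rfl⟩
    rw [Fin.sum_univ_succ] at h1
    simp only [Matrix.cons_val_zero, Matrix.cons_val_succ, map_smul, norm_smul, norm_inv,
      norm_norm] at h1
    have h2 : (‖w‖⁻¹ * ‖S w‖) ^ 2 ≤ (ε / 2) ^ 2 := by linarith
    have h4 : ‖w‖⁻¹ * ‖S w‖ ≤ ε / 2 := abs_le_of_sq_le_sq' h2 (by positivity) |>.2
    calc ‖S w‖ = (‖w‖⁻¹ * ‖S w‖) * ‖w‖ := by field_simp
      _ ≤ _ := by gcongr
  refine ⟨S ∘L F.starProjection, ?_, ?_⟩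
  · have : IsCompactOperator (id : F → F) := isCompactOperator_id
    exact (this.comp_clm F.orthogonalProjectionOnto).clm_comp (S ∘L F.subtypeL)
  · rw [dist_eq_norm]
    refine lt_of_le_of_lt (ContinuousLinearMap.opNorm_le_bound _ (half_pos hε).le fun x => ?_)
      (half_lt_self hε)
    have : (S - S ∘L F.starProjection) x = S (Fᗮ.starProjection x) := by
      rw [Submodule.starProjection_orthogonal_val]; simp
    rw [this]
    refine (key _ (Submodule.starProjection_apply_mem _ _)).trans ?_
    gcongr
    exact Submodule.norm_starProjection_apply_le _ _

/-- Finitely many orthonormal eigenvectors of a compact symmetric operator of finite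
Hilbert-Schmidt norm can be split off so that the rest has norm at most `1/2`. -/
theorem exists_orthonormal_eigenvectors [CompleteSpace H] (S : H →L[ℝ] H) (hsym : (S : H →ₗ[ℝ] H).IsSymmetric) (B : ℝ)
    (hB : ∀ (n : ℕ) (v : Fin n → H), Orthonormal ℝ v → ∑ i, ‖S (v i)‖ ^ 2 ≤ B) :
    ∃ (n : ℕ) (e : Fin n → H) (l : Fin n → ℝ), Orthonormal ℝ e ∧ (∀ i, S (e i) = l i • e i) ∧
      ∀ v, (∀ i, inner ℝ (e i) v = 0) → ‖S v‖ ≤ 1 / 2 * ‖v‖ := by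
  by_contra hcon
  push Not at hcon
  have hc := isCompactOperator_of_sum_norm_sq_le S B hB
  -- If no finite family worked, one could always find a further eigenvector with eigenvalue larger
  -- than `1/2` in absolute value.
  have step : ∀ n : ℕ, ∃ (e : Fin n → H) (l : Fin n → ℝ), Orthonormal ℝ e ∧
      (∀ i, S (e i) = l i • e i) ∧ ∀ i, 1 / 2 < |l i| := by
    intro n
    induction n with
    | zero => exact ⟨Fin.elim0, Fin.elim0, ⟨fun i => i.elim0, fun i => i.elim0⟩,
        fun i => i.elim0, fun i => i.elim0⟩
    | succ n ih =>
      obtain ⟨e, l, he, hl, hl2⟩ := ih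
      obtain ⟨v, hv, hv2⟩ := hcon n e l he hl
      set F : Submodule ℝ H := Submodule.span ℝ (range e)
      have hF : ∀ w, w ∈ Fᗮ ↔ ∀ i, inner ℝ (e i) w = 0 := by
        intro w
        constructor
        · intro hw i
          exact (Submodule.mem_orthogonal F w).1 hw _ (Submodule.subset_span ⟨i, rfl⟩)
        · intro hw
          rw [Submodule.mem_orthogonal]
          intro u hu
          induction hu using Submodule.span_induction with
          | mem x hx => obtain ⟨i, rfl⟩ := hx; exact hw i
          | zero => simp
          | add x y _ _ hx hy => rw [inner_add_left, hx, hy, add_zero]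
          | smul a x _ hx => rw [real_inner_smul_left, hx, mul_zero]
      have inv : ∀ w ∈ Fᗮ, S w ∈ Fᗮ := by
        intro w hw
        rw [hF] at hw ⊢
        intro i
        have : inner ℝ (e i) (S w) = inner ℝ (S (e i)) w := (hsym (e i) w).symm
        rw [this, hl, real_inner_smul_left, hw, mul_zero]
      have hRc : IsCompactOperator (S.restrict inv) := hc.restrict' inv
      have hRs : ((S.restrict inv : Fᗮ →L[ℝ] Fᗮ) : Fᗮ →ₗ[ℝ] Fᗮ).IsSymmetric :=
        hsym.restrict_invariant inv
      -- The restriction to the orthogonal complement is compact and self-adjoint, so its norm is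
      -- its spectral radius, and the nonzero spectral values are eigenvalues.
      have hbig : 1 / 2 < ‖S.restrict inv‖ := by
        by_contra hle
        push Not at hle
        have := (S.restrict inv).le_of_opNorm_le hle ⟨v, (hF v).2 hv⟩
        exact absurd this (not_le.2 hv2)
      have hsp := (S.restrict inv).spectralRadius_eq_nnnorm
        (ContinuousLinearMap.isSelfAdjoint_iff_isSymmetric.2 hRs)
      have hlt : ENNReal.ofReal (1 / 2) < spectralRadius ℝ (S.restrict inv) := by
        rw [hsp, ← enorm_eq_nnnorm, ← ofReal_norm, ENNReal.ofReal_lt_ofReal_iff (by linarith)]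
        exact hbig
      rw [spectralRadius, lt_iSup_iff] at hlt
      obtain ⟨k, hlt⟩ := hlt
      rw [lt_iSup_iff] at hlt
      obtain ⟨hk, hlt⟩ := hlt
      have hk2 : 1 / 2 < |k| := by
        rw [← Real.norm_eq_abs]
        rw [← enorm_eq_nnnorm, ← ofReal_norm, ENNReal.ofReal_lt_ofReal_iff'] at hlt
        exact hlt.1
      have hk0 : k ≠ 0 := by rintro rfl; norm_num at hk2
      obtain ⟨w, hw1, hw2⟩ := ((hRc.hasEigenvalue_iff_mem_spectrum hk0).2 hk).exists_hasEigenvector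
      rw [Module.End.mem_eigenspace_iff] at hw1
      have hw3 : S (w : H) = k • (w : H) := congrArg Subtype.val hw1
      have hwn : ‖(w : H)‖ ≠ 0 := by simpa using hw2
      refine ⟨Matrix.vecCons (‖(w : H)‖⁻¹ • (w : H)) e, Matrix.vecCons k l, ?_, ?_, ?_⟩
      · rw [orthonormal_vecCons_iff]
        refine ⟨by simp only [norm_smul, norm_inv, norm_norm]; field_simp, fun i => ?_, he⟩
        rw [real_inner_smul_left, real_inner_comm, (hF w).1 w.2 i, mul_zero]
      · intro i
        refine Fin.cases ?_ (fun j => ?_) i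
        · simp only [Matrix.cons_val_zero, map_smul, hw3]; rw [smul_comm]
        · simpa using hl j
      · intro i
        refine Fin.cases ?_ (fun j => ?_) i
        · simpa using hk2
        · simpa using hl2 j
  -- Each eigenvector contributes at least `1/4` to the Hilbert-Schmidt sum, which `B` bounds.
  obtain ⟨n, hn⟩ := exists_nat_gt (4 * B)
  obtain ⟨e, l, he, hl, hl2⟩ := step n
  have h1 := hB n e he
  have h2 : ∀ i, (1 / 4 : ℝ) ≤ ‖S (e i)‖ ^ 2 := fun i => by
    rw [hl, norm_smul, he.1 i, mul_one, Real.norm_eq_abs]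
    have := hl2 i
    nlinarith
  have h3 : ∑ _i : Fin n, (1 / 4 : ℝ) ≤ ∑ i, ‖S (e i)‖ ^ 2 := Finset.sum_le_sum fun i _ => h2 i
  simp at h3
  linarith

/-- The component of `v` orthogonal to an orthonormal family. -/
noncomputable def orthRest {n : ℕ} (e : Fin n → H) (v : H) : H := v - ∑ i, inner ℝ (e i) v • e i

theorem inner_orthRest {n : ℕ} {e : Fin n → H} (he : Orthonormal ℝ e) (v : H) (i : Fin n) :
    inner ℝ (e i) (orthRest e v) = 0 := by
  rw [orthRest, inner_sub_right, inner_sum]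
  simp only [real_inner_smul_right]
  rw [Finset.sum_eq_single i]
  · rw [real_inner_self_eq_norm_sq, he.1 i]; simp
  · intro j _ hj; rw [he.2 hj.symm, mul_zero]
  · simp

theorem norm_orthRest_le {n : ℕ} {e : Fin n → H} (he : Orthonormal ℝ e) (v : H) :
    ‖orthRest e v‖ ≤ ‖v‖ := by
  have h : inner ℝ (orthRest e v) (∑ i, inner ℝ (e i) v • e i) = 0 := by
    rw [inner_sum]
    refine Finset.sum_eq_zero fun i _ => ?_
    rw [real_inner_smul_right, real_inner_comm (e i) (orthRest e v), inner_orthRest he, mul_zero]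
  have h2 : v = orthRest e v + ∑ i, inner ℝ (e i) v • e i := by rw [orthRest]; abel
  have h3 := norm_add_sq_real (orthRest e v) (∑ i, inner ℝ (e i) v • e i)
  rw [← h2, h] at h3
  refine abs_le_of_sq_le_sq' ?_ (norm_nonneg _) |>.2
  nlinarith [sq_nonneg ‖∑ i, inner ℝ (e i) v • e i‖]

end HilbertSchmidt

/-! ### Regularised determinant of a negative Hilbert-Schmidt operator -/

section Fredholm

variable {H : Type*} [NormedAddCommGroup H] [InnerProductSpace ℝ H]

theorem pow_apply_eigenvector {S : H →L[ℝ] H} {e : H} {l : ℝ} (h : S e = l • e) (m : ℕ) :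
    (S ^ m) e = l ^ m • e := by
  induction m with
  | zero => simp
  | succ m ih => rw [pow_succ', mul_apply_eq_comp, ih, map_smul, h, smul_smul, pow_succ]

theorem pow_apply_of_orthogonal {S : H →L[ℝ] H} (hsym : (S : H →ₗ[ℝ] H).IsSymmetric) {n : ℕ}
    {e : Fin n → H} {l : Fin n → ℝ} (hl : ∀ i, S (e i) = l i • e i)
    (hS : ∀ v, (∀ i, inner ℝ (e i) v = 0) → ‖S v‖ ≤ 1 / 2 * ‖v‖) {w : H}
    (hw : ∀ i, inner ℝ (e i) w = 0) (m : ℕ) :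
    (∀ i, inner ℝ (e i) ((S ^ m) w) = 0) ∧ ‖(S ^ m) w‖ ≤ (1 / 2) ^ m * ‖w‖ := by
  induction m with
  | zero => simpa using hw
  | succ m ih =>
    rw [pow_succ', mul_apply_eq_comp]
    refine ⟨fun i => ?_, (hS _ ih.1).trans ?_⟩
    · have : inner ℝ (e i) (S ((S ^ m) w)) = inner ℝ (S (e i)) ((S ^ m) w) := (hsym _ _).symm
      rw [this, hl, real_inner_smul_left, ih.1, mul_zero]
    · rw [pow_succ']; linarith [ih.2]

theorem pow_apply_eq_sum_add {S : H →L[ℝ] H} {n : ℕ} {e : Fin n → H} {l : Fin n → ℝ}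
    (hl : ∀ i, S (e i) = l i • e i) (v : H) (m : ℕ) :
    (S ^ m) v = ∑ i, (l i ^ m * inner ℝ (e i) v) • e i + (S ^ m) (orthRest e v) := by
  conv_lhs => rw [show v = ∑ i, inner ℝ (e i) v • e i + orthRest e v by rw [orthRest]; abel]
  rw [map_add, map_sum]
  congr 1
  refine Finset.sum_congr rfl fun i _ => ?_
  rw [map_smul, pow_apply_eigenvector (hl i), smul_smul, mul_comm]

/-- Applied to the rows of the kernel and integrated, this compares `tr S^(m+2)` with the power sum
of the eigenvalues that have been split off. Only the component of `v` orthogonal to these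
eigenvectors enters the error, and there `S` contracts by `1/2`. -/
theorem abs_inner_pow_sub_sum_le {S : H →L[ℝ] H} (hsym : (S : H →ₗ[ℝ] H).IsSymmetric) {n : ℕ}
    {e : Fin n → H} (he : Orthonormal ℝ e) {l : Fin n → ℝ} (hl : ∀ i, S (e i) = l i • e i)
    (hS : ∀ v, (∀ i, inner ℝ (e i) v = 0) → ‖S v‖ ≤ 1 / 2 * ‖v‖) (v : H) (m : ℕ) :
    |inner ℝ v ((S ^ m) v) - ∑ i, l i ^ m * (inner ℝ v (e i)) ^ 2| ≤ (1 / 2) ^ m * ‖v‖ ^ 2 := by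
  have h := pow_apply_of_orthogonal hsym hl hS (inner_orthRest he v) m
  have e1 : inner ℝ v ((S ^ m) v) - ∑ i, l i ^ m * (inner ℝ v (e i)) ^ 2
      = inner ℝ v ((S ^ m) (orthRest e v)) := by
    conv_lhs => rw [pow_apply_eq_sum_add hl, inner_add_right, inner_sum]
    simp only [real_inner_smul_right]
    have : ∀ i, l i ^ m * inner ℝ (e i) v * inner ℝ v (e i) = l i ^ m * (inner ℝ v (e i)) ^ 2 :=
      fun i => by rw [real_inner_comm]; ring
    simp only [this]; ring
  rw [e1]
  calc _ ≤ ‖v‖ * ‖(S ^ m) (orthRest e v)‖ := abs_real_inner_le_norm _ _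
    _ ≤ ‖v‖ * ((1 / 2) ^ m * ‖v‖) := by
      gcongr
      refine h.2.trans ?_
      gcongr
      exact norm_orthRest_le he v
    _ = _ := by ring

open PowerSeries in
/-- Let `S ≤ 0` be a Hilbert-Schmidt operator `S v = ⟨s(·), v⟩` and let `δ` be the coefficients of
its regularised determinant. Then `∑ δ` converges to a nonzero number and the coefficients of
`δ(z) (1 - z S)⁻¹` are absolutely summable. -/
theorem fredholm_summable [CompleteSpace H] {Ω : Type*} [MeasurableSpace Ω] {ν : Measure Ω}
    {S : H →L[ℝ] H}
    (hsym : (S : H →ₗ[ℝ] H).IsSymmetric) (hneg : ∀ v, inner ℝ (S v) v ≤ 0) {s : Ω → H}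
    (hs : ∀ v, Integrable (fun x => (inner ℝ (s x) v) ^ 2) ν ∧
      ∫ x, (inner ℝ (s x) v) ^ 2 ∂ν = ‖S v‖ ^ 2)
    (hs2 : Integrable (fun x => ‖s x‖ ^ 2) ν)
    (hsm : ∀ m : ℕ, Integrable (fun x => inner ℝ (s x) ((S ^ m) (s x))) ν)
    {p δ : ℕ → ℝ} (hp0 : p 0 = 0) (hp1 : p 1 = 0)
    (hp : ∀ m, p (m + 2) = ∫ x, inner ℝ (s x) ((S ^ m) (s x)) ∂ν) (hδ0 : δ 0 = 1)
    (hδ : ∀ n : ℕ, n * δ n = -∑ q ∈ Finset.HasAntidiagonal.antidiagonal n, p q.1 * δ q.2) :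
    (Summable fun n => |δ n|) ∧ ∑' n, δ n ≠ 0 ∧
      ∃ b : ℕ → ℝ, Summable b ∧ ∀ n v,
        ‖∑ q ∈ Finset.HasAntidiagonal.antidiagonal n, δ q.1 • (S ^ q.2) v‖ ≤ b n * ‖v‖ := by
  set B := ∫ x, ‖s x‖ ^ 2 ∂ν with hB
  -- The Hilbert-Schmidt bound is Bessel's inequality for each row `s x`, integrated over `x`.
  obtain ⟨N, e, l, he, hl, hS⟩ := exists_orthonormal_eigenvectors S hsym B (by
    intro n v hv
    calc ∑ i, ‖S (v i)‖ ^ 2 = ∫ x, ∑ i, (inner ℝ (s x) (v i)) ^ 2 ∂ν := by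
          rw [integral_finsetSum _ fun i _ => (hs (v i)).1]
          exact Finset.sum_congr rfl fun i _ => (hs (v i)).2.symm
      _ ≤ B := by
          refine integral_mono (integrable_finsetSum _ fun i _ => (hs (v i)).1) hs2 fun x => ?_
          have := hv.sum_inner_products_le (s := Finset.univ) (s x)
          simpa [real_inner_comm] using this)
  have hl0 : ∀ i, l i ≤ 0 := fun i => by
    have := hneg (e i)
    rw [hl, real_inner_smul_left, real_inner_self_eq_norm_sq, he.1 i] at this
    simpa using this
  have hl2 : ∀ i, ∫ x, (inner ℝ (s x) (e i)) ^ 2 ∂ν = l i ^ 2 := fun i => by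
    rw [(hs _).2, hl, norm_smul, he.1 i]; simp
  have hpl : ∀ m, |p (m + 2) - ∑ i, l i ^ (m + 2)| ≤ (1 / 2) ^ m * B := by
    intro m
    have hI : Integrable (fun x => ∑ i, l i ^ m * (inner ℝ (s x) (e i)) ^ 2) ν :=
      integrable_finsetSum _ fun i _ => (hs (e i)).1.const_mul _
    have : p (m + 2) - ∑ i, l i ^ (m + 2) = ∫ x, (inner ℝ (s x) ((S ^ m) (s x))
        - ∑ i, l i ^ m * (inner ℝ (s x) (e i)) ^ 2) ∂ν := by
      rw [integral_sub (hsm m) hI, hp, integral_finsetSum _ fun i _ => (hs (e i)).1.const_mul _]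
      congr 1
      refine Finset.sum_congr rfl fun i _ => ?_
      rw [integral_const_mul, hl2, pow_add]
    rw [this]
    refine (abs_integral_le_integral_abs).trans ?_
    rw [hB, ← integral_const_mul]
    exact integral_mono ((hsm m).sub hI).abs (hs2.const_mul _) fun x =>
      abs_inner_pow_sub_sum_le hsym he hl hS (s x) m
  -- The recursion for `δ` is the differential equation `z D' = -(∑ p_m z^m) D` of the regularised
  -- determinant.
  set D : PowerSeries ℝ := mk δ with hD
  have hDe : D.euler = -(mk p) * D := by
    ext n
    rw [coeff_euler, hD, coeff_mk, hδ, neg_mul, map_neg, coeff_mul]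
    simp
  set f : Fin N → PowerSeries ℝ := fun i => 1 - C (l i) * X with hf
  have hgeo : ∀ i, f i * mk (fun n => l i ^ n) = 1 := fun i => one_sub_mul_geom (l i)
  have hfe : ∀ i, (mk (fun n => l i ^ n)).euler
      = (X * C (l i) * mk (fun n => l i ^ n)) * mk (fun n => l i ^ n) := by
    intro i
    set g := mk (fun n => l i ^ n)
    have h1 := congrArg euler (hgeo i)
    have h2 : (f i).euler = - (X * C (l i)) := by
      ext n
      rw [coeff_euler, hf]
      simp only [coeff_one_sub_C_mul_X, map_neg, mul_comm X, coeff_C_mul, coeff_X]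
      rcases n with _ | _ | n <;> simp
    rw [euler_mul, euler_one, h2] at h1
    have h3 := hgeo i
    calc g.euler = g * (-(X * C (l i)) * g + f i * g.euler) + X * C (l i) * g * g
          + (1 - f i * g) * g.euler := by ring
      _ = _ := by rw [h1, h3]; ring
  -- Dividing `D` by `∏ (1 - l_i z)` removes the large eigenvalues: the logarithmic derivative
  -- becomes `∑ (∑ l_i^n - p_n) z^n`, with geometrically small coefficients by `hpl`.
  set G : PowerSeries ℝ := D * ∏ i, mk (fun n => l i ^ n) with hG
  set c : PowerSeries ℝ := -(mk p) + ∑ i, X * C (l i) * mk (fun n => l i ^ n) with hc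
  have hGe : G.euler = c * G := by
    rw [hG, euler_mul, hDe, euler_prod _ _ _ fun i _ => hfe i, hc]; ring
  have hG1 : constantCoeff G = 1 := by
    rw [hG, map_mul, map_prod, hD]
    simp [← coeff_zero_eq_constantCoeff_apply, hδ0]
  have hcc : ∀ n, coeff n (∑ i, X * C (l i) * mk (fun n => l i ^ n))
      = if n = 0 then 0 else ∑ i, l i ^ n := by
    intro n
    rw [map_sum]
    rcases n with _ | n
    · simp
    · simp only [mul_assoc, coeff_succ_X_mul, coeff_C_mul, coeff_mk, Nat.succ_ne_zero, if_false]
      exact Finset.sum_congr rfl fun i _ => by ring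
  have hc0 : coeff 0 c = 0 := by
    rw [hc, map_add, hcc, map_neg, coeff_mk, hp0]; simp
  -- The factor `4` converts `(1/2)^m` into `(1/2)^(m+2)`. The coefficient of index `1` is bounded
  -- apart, because the regularisation sets `p 1 = 0` and leaves `∑ l_i` uncompensated.
  have hcb : ∀ n, |coeff n c| ≤ max (4 * B) (2 * |∑ i, l i|) * (1 / 2) ^ n := by
    intro n
    have hc' : coeff n c = -p n + if n = 0 then 0 else ∑ i, l i ^ n := by
      rw [hc, map_add, hcc, map_neg, coeff_mk]
    rcases n with _ | _ | m
    · rw [hc0]; simp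
    · rw [hc', zero_add, hp1]
      have := le_max_right (4 * B) (2 * |∑ i, l i|)
      simp; linarith
    · rw [hc', if_neg (by omega), ← abs_neg]
      have h1 := hpl m
      have h2 := mul_le_mul_of_nonneg_right (le_max_left (4 * B) (2 * |∑ i, l i|))
        (by positivity : (0 : ℝ) ≤ (1 / 2) ^ (m + 2))
      have h3 : 4 * B * (1 / 2) ^ (m + 2) = (1 / 2) ^ m * B := by ring
      rw [h3] at h2
      refine le_trans (le_of_eq ?_) (h1.trans h2)
      congr 1; ring
  have hGs : G.AbsSummable := absSummable_of_euler_eq hGe hc0 hcb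
  have hG0 : G.coeffSum ≠ 0 := coeffSum_ne_zero_of_euler_eq hGe hG1 hc0 hcb
  have hfs : ∀ i ∈ Finset.univ, (f i).AbsSummable := fun i _ => absSummable_one_sub (l i)
  have hDG : D = (∏ i, f i) * G := by
    rw [hG, mul_left_comm, ← Finset.prod_mul_distrib]
    simp [hgeo]
  have hDs : D.AbsSummable := hDG ▸ (absSummable_prod _ _ hfs).mul hGs
  have hDsum : ∑' n, δ n = D.coeffSum := by simp [coeffSum, hD]
  have hδs : Summable fun n => |δ n| := by simpa [AbsSummable, hD] using hDs
  refine ⟨hδs, ?_, ?_⟩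
  -- At `z = 1` the determinant is `∏ (1 - l_i)` times a nonzero number; negativity of `S` gives `1
  -- - l_i ≥ 1`.
  · rw [hDsum, hDG, coeffSum_mul (absSummable_prod _ _ hfs) hGs, coeffSum_prod _ _ hfs]
    refine mul_ne_zero (Finset.prod_ne_zero_iff.2 fun i _ => ?_) hG0
    rw [hf, coeffSum_one_sub]
    have := hl0 i
    linarith
  -- On the eigenvector `e i` the resolvent is multiplication by `(1 - l_i z)⁻¹`. This pole cancels
  -- against the factor `1 - l_i z` of `D`, so the coefficients stay summable even for large `l_i`.
  · set τ : Fin N → PowerSeries ℝ := fun i => D * mk (fun n => l i ^ n) with hτ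
    have hτs : ∀ i, (τ i).AbsSummable := by
      classical
      intro i
      have : τ i = (∏ j ∈ Finset.univ.erase i, f j) * G := by
        rw [hτ]
        simp only
        rw [hDG, ← Finset.mul_prod_erase Finset.univ f (Finset.mem_univ i)]
        calc _ = (f i * mk (fun n => l i ^ n)) * ((∏ j ∈ Finset.univ.erase i, f j) * G) := by ring
          _ = _ := by rw [hgeo, one_mul]
      rw [this]
      exact (absSummable_prod _ _ fun i _ => absSummable_one_sub (l i)).mul hGs
    have hhalf : Summable fun n : ℕ => ‖((1 : ℝ) / 2) ^ n‖ := by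
      simpa using summable_geometric_of_lt_one (by norm_num) (by norm_num : (1 / 2 : ℝ) < 1)
    have hconv := summable_norm_sum_mul_antidiagonal_of_summable_norm (f := fun n => |δ n|)
      (g := fun n : ℕ => ((1 : ℝ) / 2) ^ n) (by simpa using hδs) hhalf
    refine ⟨fun n => ∑ i, ‖coeff n (τ i)‖ + ‖∑ q ∈ Finset.HasAntidiagonal.antidiagonal n,
      |δ q.1| * (1 / 2) ^ q.2‖, (summable_sum fun i _ => hτs i).add hconv, fun n v => ?_⟩
    -- On the orthogonal rest the powers of `S` decay like `(1/2)^n`, and the coefficients are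
    -- bounded by a convolution of two summable sequences.
    have e1 : ∑ q ∈ Finset.HasAntidiagonal.antidiagonal n, δ q.1 • (S ^ q.2) v
        = ∑ i, (coeff n (τ i) * inner ℝ (e i) v) • e i
          + ∑ q ∈ Finset.HasAntidiagonal.antidiagonal n, δ q.1 • (S ^ q.2) (orthRest e v) := by
      have : ∀ q : ℕ × ℕ, δ q.1 • (S ^ q.2) v
          = ∑ i, (δ q.1 * l i ^ q.2 * inner ℝ (e i) v) • e i
            + δ q.1 • (S ^ q.2) (orthRest e v) := by
        intro q
        rw [pow_apply_eq_sum_add hl, smul_add, Finset.smul_sum]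
        simp only [smul_smul, mul_assoc]
      simp only [this]
      rw [Finset.sum_add_distrib, Finset.sum_comm]
      congr 1
      refine Finset.sum_congr rfl fun i _ => ?_
      rw [hτ]
      simp only [coeff_mul, hD, coeff_mk]
      rw [Finset.sum_mul, Finset.sum_smul]
    rw [e1, add_mul]
    refine (norm_add_le _ _).trans (add_le_add ?_ ?_)
    · rw [Finset.sum_mul]
      refine (norm_sum_le _ _).trans (Finset.sum_le_sum fun i _ => ?_)
      rw [norm_smul, he.1 i, mul_one, norm_mul]
      gcongr
      have := norm_inner_le_norm (𝕜 := ℝ) (e i) v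
      rwa [he.1 i, one_mul] at this
    · refine (norm_sum_le _ _).trans ?_
      rw [Real.norm_of_nonneg (Finset.sum_nonneg fun q _ => by positivity), Finset.sum_mul]
      refine Finset.sum_le_sum fun q _ => ?_
      rw [norm_smul, Real.norm_eq_abs, mul_assoc]
      gcongr
      refine (pow_apply_of_orthogonal hsym hl hS (inner_orthRest he v) q.2).2.trans ?_
      gcongr
      exact norm_orthRest_le he v

end Fredholm

/-! ### Functions with finite moments -/

/-- `f` is measurable and has finite moments of all orders. -/
def AllMoments {Ω : Type*} [MeasurableSpace Ω] (f : Ω → ℝ) (μ : Measure Ω) : Prop :=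
  AEStronglyMeasurable f μ ∧ ∀ n : ℕ, Integrable (fun x => |f x| ^ n) μ

namespace AllMoments

variable {Ω : Type*} [MeasurableSpace Ω] {μ : Measure Ω} {f g : Ω → ℝ}

theorem integrable (hf : AllMoments f μ) : Integrable f μ := by
  have := hf.2 1
  simp only [pow_one] at this
  exact (integrable_norm_iff hf.1).1 this

theorem memLp_two (hf : AllMoments f μ) : MemLp f 2 μ := by
  rw [memLp_two_iff_integrable_sq hf.1]
  simpa using hf.2 2

theorem const [IsFiniteMeasure μ] (c : ℝ) : AllMoments (fun _ => c) μ :=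
  ⟨aestronglyMeasurable_const, fun _ => integrable_const _⟩

theorem mul (hf : AllMoments f μ) (hg : AllMoments g μ) : AllMoments (fun x => f x * g x) μ := by
  refine ⟨hf.1.mul hg.1, fun n => ?_⟩
  refine ((hf.2 (2 * n)).add (hg.2 (2 * n))).mono'
    (continuous_abs.comp_aestronglyMeasurable (hf.1.mul hg.1) |>.pow n) (ae_of_all _ fun x => ?_)
  have h1 : 0 ≤ |f x| ^ n := by positivity
  have h2 : 0 ≤ |g x| ^ n := by positivity
  rw [Real.norm_of_nonneg (by positivity)]
  simp only [Pi.add_apply, pow_mul', abs_mul, mul_pow]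
  nlinarith [sq_nonneg (|f x| ^ n - |g x| ^ n)]

theorem add (hf : AllMoments f μ) (hg : AllMoments g μ) : AllMoments (fun x => f x + g x) μ := by
  refine ⟨hf.1.add hg.1, fun n => ?_⟩
  refine (((hf.2 n).add (hg.2 n)).const_mul (2 ^ n)).mono'
    (continuous_abs.comp_aestronglyMeasurable (hf.1.add hg.1) |>.pow n) (ae_of_all _ fun x => ?_)
  rw [Real.norm_of_nonneg (by positivity)]
  simp only [Pi.add_apply]
  calc |f x + g x| ^ n ≤ (2 * max |f x| |g x|) ^ n := by
        gcongr
        have := abs_add_le (f x) (g x)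
        linarith [le_max_left |f x| |g x|, le_max_right |f x| |g x|]
    _ = 2 ^ n * (max |f x| |g x|) ^ n := mul_pow _ _ _
    _ ≤ _ := by
        gcongr
        rcases max_cases |f x| |g x| with h | h <;> rw [h.1]
        · exact le_add_of_nonneg_right (by positivity)
        · exact le_add_of_nonneg_left (by positivity)

theorem const_mul [IsFiniteMeasure μ] (c : ℝ) (hf : AllMoments f μ) :
    AllMoments (fun x => c * f x) μ := (const c).mul hf

theorem sum [IsFiniteMeasure μ] {ι : Type*} (s : Finset ι) {F : ι → Ω → ℝ}
    (hF : ∀ i ∈ s, AllMoments (F i) μ) : AllMoments (fun x => ∑ i ∈ s, F i x) μ := by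
  classical
  induction s using Finset.induction_on with
  | empty => simpa using const 0
  | insert a s ha ih =>
    simp only [Finset.sum_insert ha]
    exact (hF a (by simp)).add (ih fun i hi => hF i (by simp [hi]))

theorem prod [IsFiniteMeasure μ] {ι : Type*} (s : Finset ι) {F : ι → Ω → ℝ}
    (hF : ∀ i ∈ s, AllMoments (F i) μ) : AllMoments (fun x => ∏ i ∈ s, F i x) μ := by
  classical
  induction s using Finset.induction_on with
  | empty => simpa using const 1
  | insert a s ha ih =>
    simp only [Finset.prod_insert ha]
    exact (hF a (by simp)).mul (ih fun i hi => hF i (by simp [hi]))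

theorem det [IsFiniteMeasure μ] {ι : Type*} [Fintype ι] [DecidableEq ι] {M : Ω → Matrix ι ι ℝ}
    (hM : ∀ i j, AllMoments (fun x => M x i j) μ) : AllMoments (fun x => (M x).det) μ := by
  simp only [Matrix.det_apply']
  exact sum _ fun σ _ => (prod _ fun i _ => hM _ _).const_mul _

theorem comp {Ω' : Type*} [MeasurableSpace Ω'] {ν : Measure Ω'} {φ : Ω' → Ω}
    (hf : AllMoments f μ) (hφ : MeasurePreserving φ ν μ) : AllMoments (fun x => f (φ x)) ν :=
  ⟨hf.1.comp_measurePreserving hφ, fun n => hφ.integrable_comp_of_integrable (hf.2 n)⟩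

end AllMoments

/-- Distinct coordinates of a product measure are independent. It transfers the joint moments of the
kernel to every off-diagonal matrix entry. -/
theorem measurePreserving_eval_pair {n : ℕ} (μ : Measure ℝ) [IsProbabilityMeasure μ] {i j : Fin n}
    (hij : i ≠ j) :
    MeasurePreserving (fun t : Fin n → ℝ => (t i, t j)) (Measure.pi fun _ => μ) (μ.prod μ) := by
  refine ⟨by fun_prop, ?_⟩
  have h := (ProbabilityTheory.iIndepFun_pi (μ := fun _ : Fin n => μ) (X := fun _ => id)
    fun _ => aemeasurable_id).indepFun hij
  simp only [id] at h
  rw [ProbabilityTheory.indepFun_iff_map_prod_eq_prod_map_map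
    (measurable_pi_apply i).aemeasurable (measurable_pi_apply j).aemeasurable] at h
  rw [h, (measurePreserving_eval (fun _ : Fin n => μ) i).map_eq,
    (measurePreserving_eval (fun _ : Fin n => μ) j).map_eq]

/-! ### The Fredholm recursions -/

/-- Like `borderedMatrix`, indexed by `Fin (n + 1)` and with an arbitrary corner. -/
def corneredMatrix (k : ℝ → ℝ → ℝ) (c x y : ℝ) {n : ℕ} (t : Fin n → ℝ) :
    Matrix (Fin (n + 1)) (Fin (n + 1)) ℝ :=
  Matrix.of fun i j => Fin.cases (Fin.cases c (fun j => k x (t j)) j)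
    (fun i => Fin.cases (k (t i) y) (fun j => offDiagMatrix k t i j) j) i

theorem det_borderedMatrix (k : ℝ → ℝ → ℝ) (x y : ℝ) {n : ℕ} (t : Fin n → ℝ) :
    (borderedMatrix k x y t).det = (corneredMatrix k (k x y) x y t).det := by
  let e : Unit ⊕ Fin n ≃ Fin (n + 1) :=
    { toFun := Sum.elim (fun _ => 0) Fin.succ
      invFun := Fin.cases (Sum.inl ()) Sum.inr
      left_inv := by rintro (_ | i) <;> simp
      right_inv := fun i => by refine Fin.cases ?_ (fun j => ?_) i <;> simp }
  rw [← Matrix.det_submatrix_equiv_self e]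
  congr 1
  ext (i | i) (j | j) <;> simp [borderedMatrix, corneredMatrix, e]

theorem offDiagMatrix_eq_corneredMatrix (k : ℝ → ℝ → ℝ) {n : ℕ} (t : Fin (n + 1) → ℝ) :
    offDiagMatrix k t = corneredMatrix k 0 (t 0) (t 0) (fun i => t i.succ) := by
  ext i j
  refine Fin.cases ?_ (fun i => ?_) i <;> refine Fin.cases ?_ (fun j => ?_) j <;>
    simp [offDiagMatrix, corneredMatrix, Fin.succ_ne_zero, (Fin.succ_ne_zero _).symm]

theorem det_corneredMatrix_zero (k : ℝ → ℝ → ℝ) (c x y : ℝ) (t : Fin 0 → ℝ) :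
    (corneredMatrix k c x y t).det = c := by
  simp [corneredMatrix]

/-- Laplace expansion along the first row. Deleting the column of `t j` removes the zero diagonal
entry of the row of `t j`, so that row, moved to the top by a cycle, borders the matrix of the
remaining variables. The sign `(-1)^j` of the cycle cancels the cofactor sign `(-1)^(j+1)` up to
`-1`. -/
theorem det_corneredMatrix_succ (k : ℝ → ℝ → ℝ) (c x y : ℝ) {n : ℕ} (t : Fin (n + 1) → ℝ) :
    (corneredMatrix k c x y t).det = c * (offDiagMatrix k t).det -
      ∑ j, k x (t j) * (borderedMatrix k (t j) y fun i => t (j.succAbove i)).det := by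
  rw [Matrix.det_succ_row_zero, Fin.sum_univ_succ, sub_eq_add_neg, ← Finset.sum_neg_distrib]
  congr 1
  · have : (corneredMatrix k c x y t).submatrix Fin.succ (Fin.succAbove 0) = offDiagMatrix k t := by
      ext i j; simp [corneredMatrix]
    rw [this]; simp [corneredMatrix]
  · refine Finset.sum_congr rfl fun j _ => ?_
    have h : (corneredMatrix k c x y t).submatrix Fin.succ (Fin.succAbove j.succ)
        = (corneredMatrix k (k (t j) y) (t j) y fun i => t (j.succAbove i)).submatrix
            j.cycleRange id := by
      ext i l
      obtain ⟨a, rfl⟩ := j.cycleRange.symm.surjective i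
      simp only [Matrix.submatrix_apply, Equiv.apply_symm_apply, id]
      refine Fin.cases ?_ (fun a => ?_) a <;> refine Fin.cases ?_ (fun l => ?_) l
      · simp [corneredMatrix]
      · simp [corneredMatrix, offDiagMatrix, (Fin.succAbove_ne j l).symm]
      · simp [corneredMatrix]
      · simp [corneredMatrix, offDiagMatrix]
    rw [h, Matrix.det_permute, Fin.sign_cycleRange, ← det_borderedMatrix]
    simp only [corneredMatrix, Matrix.of_apply, Fin.cases_zero, Fin.cases_succ]
    have : ((-1 : ℝ)) ^ (j : ℕ) * (-1) ^ (j : ℕ) = 1 := by rw [← mul_pow]; norm_num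
    simp only [Fin.val_succ, pow_succ]
    push_cast
    linear_combination (-(k x (t j) * (borderedMatrix k (t j) y fun i => t (j.succAbove i)).det))
      * this

/-- A measurable kernel with finite moments, jointly and in each variable. -/
structure MomentKernel (μ : Measure ℝ) (k : ℝ → ℝ → ℝ) : Prop where
  meas : Measurable fun p : ℝ × ℝ => k p.1 p.2
  joint : AllMoments (fun p : ℝ × ℝ => k p.1 p.2) (μ.prod μ)
  left : ∀ x, AllMoments (k x) μ
  right : ∀ y, AllMoments (fun x => k x y) μ

section Recursion

variable {μ : Measure ℝ} [IsProbabilityMeasure μ] {k : ℝ → ℝ → ℝ}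

namespace MomentKernel

theorem allMoments_pair (hk : MomentKernel μ k) {n : ℕ} {i j : Fin n} (hij : i ≠ j) :
    AllMoments (fun t : Fin n → ℝ => k (t i) (t j)) (Measure.pi fun _ => μ) :=
  hk.joint.comp (measurePreserving_eval_pair μ hij)

theorem allMoments_offDiag (hk : MomentKernel μ k) (n : ℕ) :
    AllMoments (fun t : Fin n → ℝ => (offDiagMatrix k t).det) (Measure.pi fun _ => μ) := by
  refine AllMoments.det fun i j => ?_
  simp only [offDiagMatrix, Matrix.of_apply]
  split_ifs with h
  · exact AllMoments.const 0
  · exact hk.allMoments_pair h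

theorem allMoments_bordered (hk : MomentKernel μ k) (x y : ℝ) (n : ℕ) :
    AllMoments (fun t : Fin n → ℝ => (borderedMatrix k x y t).det) (Measure.pi fun _ => μ) := by
  refine AllMoments.det fun i j => ?_
  have hev := fun i : Fin n => measurePreserving_eval (fun _ : Fin n => μ) i
  rcases i with i | i <;> rcases j with j | j <;> simp only [borderedMatrix,
    Matrix.fromBlocks_apply₁₁, Matrix.fromBlocks_apply₁₂, Matrix.fromBlocks_apply₂₁,
    Matrix.fromBlocks_apply₂₂, Matrix.of_apply, offDiagMatrix]
  · exact AllMoments.const _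
  · exact (hk.left x).comp (hev j)
  · exact (hk.right y).comp (hev i)
  · split_ifs with h
    · exact AllMoments.const 0
    · exact hk.allMoments_pair h

/-- The border variable is one of the integrated ones here. Since `succAbove` skips `j`, no kernel
entry has both arguments at the same coordinate, and no value of `k` on the diagonal appears. -/
theorem allMoments_bordered_eval (hk : MomentKernel μ k) (y : ℝ) {n : ℕ} (j : Fin (n + 1)) :
    AllMoments (fun t : Fin (n + 1) → ℝ =>
      (borderedMatrix k (t j) y fun i => t (j.succAbove i)).det) (Measure.pi fun _ => μ) := by
  refine AllMoments.det fun a b => ?_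
  have hev := fun i : Fin (n + 1) => measurePreserving_eval (fun _ : Fin (n + 1) => μ) i
  rcases a with a | a <;> rcases b with b | b <;> simp only [borderedMatrix,
    Matrix.fromBlocks_apply₁₁, Matrix.fromBlocks_apply₁₂, Matrix.fromBlocks_apply₂₁,
    Matrix.fromBlocks_apply₂₂, Matrix.of_apply, offDiagMatrix]
  · exact (hk.right y).comp (hev j)
  · exact hk.allMoments_pair (Fin.succAbove_ne j b).symm
  · exact (hk.right y).comp (hev _)
  · split_ifs with h
    · exact AllMoments.const 0
    · exact hk.allMoments_pair fun h' => h (Fin.succAbove_right_injective h')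

theorem allMoments_bordered_eval₂ (hk : MomentKernel μ k) {n : ℕ} (j : Fin (n + 1)) :
    AllMoments (fun t : Fin (n + 1 + 1) → ℝ =>
      (borderedMatrix k (t j.succ) (t 0) fun i => t (j.succAbove i).succ).det)
      (Measure.pi fun _ => μ) := by
  refine AllMoments.det fun a b => ?_
  rcases a with a | a <;> rcases b with b | b <;> simp only [borderedMatrix,
    Matrix.fromBlocks_apply₁₁, Matrix.fromBlocks_apply₁₂, Matrix.fromBlocks_apply₂₁,
    Matrix.fromBlocks_apply₂₂, Matrix.of_apply, offDiagMatrix]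
  · exact hk.allMoments_pair (Fin.succ_ne_zero _)
  · exact hk.allMoments_pair fun h => Fin.succAbove_ne j b (Fin.succ_injective _ h).symm
  · exact hk.allMoments_pair (Fin.succ_ne_zero _)
  · split_ifs with h
    · exact AllMoments.const 0
    · exact hk.allMoments_pair fun h' =>
        h (Fin.succAbove_right_injective (Fin.succ_injective _ h'))

end MomentKernel

/-- `(-1)ⁿ / n! ∫ det (k(t_i,t_j) 1_{i≠j})`. -/
noncomputable def detCoeff (μ : Measure ℝ) [SigmaFinite μ] (k : ℝ → ℝ → ℝ) (n : ℕ) : ℝ :=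
  (-1) ^ n / (n.factorial : ℝ) *
    ∫ t : Fin n → ℝ, (offDiagMatrix k t).det ∂(Measure.pi fun _ => μ)

/-- `(-1)ⁿ / n! ∫ det` of the bordered matrices. -/
noncomputable def minorCoeff (μ : Measure ℝ) [SigmaFinite μ] (k : ℝ → ℝ → ℝ) (x y : ℝ) (n : ℕ) :
    ℝ :=
  (-1) ^ n / (n.factorial : ℝ) *
    ∫ t : Fin n → ℝ, (borderedMatrix k x y t).det ∂(Measure.pi fun _ => μ)

theorem resolventTerm_eq (x y : ℝ) (n : ℕ) :
    resolventTerm μ k x y n = -minorCoeff μ k x y n := by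
  rw [resolventTerm, minorCoeff, pow_succ]; ring

theorem offDiagMatrix_neg {n : ℕ} (t : Fin n → ℝ) :
    offDiagMatrix (fun a b => -k a b) t = -offDiagMatrix k t := by
  ext i j
  simp only [offDiagMatrix, Matrix.of_apply, Matrix.neg_apply]
  split_ifs <;> simp

theorem det2Term_neg (n : ℕ) : det2Term μ (fun a b => -k a b) n = detCoeff μ k n := by
  simp only [det2Term, detCoeff, offDiagMatrix_neg, Matrix.det_neg, Fintype.card_fin]
  rw [integral_const_mul]; ring

theorem detCoeff_zero : detCoeff μ k 0 = 1 := by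
  simp [detCoeff]

theorem detCoeff_one : detCoeff μ k 1 = 0 := by
  simp [detCoeff, offDiagMatrix]

theorem minorCoeff_zero (x y : ℝ) : minorCoeff μ k x y 0 = k x y := by
  simp only [minorCoeff, det_borderedMatrix, det_corneredMatrix_zero]
  simp

/-- Pulling the coordinate `j` out by Fubini shows that all terms of the cofactor expansion have the
same integral. -/
theorem integral_mul_bordered (hk : MomentKernel μ k) (x y : ℝ) {n : ℕ} (j : Fin (n + 1)) :
    Integrable (fun t : Fin (n + 1) → ℝ =>
      k x (t j) * (borderedMatrix k (t j) y fun i => t (j.succAbove i)).det)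
      (Measure.pi fun _ => μ) ∧
    ∫ t : Fin (n + 1) → ℝ, k x (t j) * (borderedMatrix k (t j) y fun i => t (j.succAbove i)).det
      ∂(Measure.pi fun _ => μ) =
    ∫ s, k x s * ∫ t : Fin n → ℝ, (borderedMatrix k s y t).det ∂(Measure.pi fun _ => μ) ∂μ := by
  have hI : Integrable (fun t : Fin (n + 1) → ℝ =>
      k x (t j) * (borderedMatrix k (t j) y fun i => t (j.succAbove i)).det)
      (Measure.pi fun _ => μ) :=
    (((hk.left x).comp (measurePreserving_eval (fun _ : Fin (n + 1) => μ) j)).mul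
      (hk.allMoments_bordered_eval y j)).integrable
  refine ⟨hI, ?_⟩
  have mp := measurePreserving_piFinSuccAbove (fun _ : Fin (n + 1) => μ) j
  set φ : ℝ × (Fin n → ℝ) → ℝ := fun p => k x p.1 * (borderedMatrix k p.1 y p.2).det
  have e : (fun t : Fin (n + 1) → ℝ =>
      k x (t j) * (borderedMatrix k (t j) y fun i => t (j.succAbove i)).det)
      = φ ∘ (MeasurableEquiv.piFinSuccAbove (fun _ : Fin (n + 1) => ℝ) j) := rfl
  rw [e] at hI ⊢
  rw [mp.integrable_comp_emb (MeasurableEquiv.measurableEmbedding _)] at hI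
  change ∫ t, φ (MeasurableEquiv.piFinSuccAbove (fun _ : Fin (n + 1) => ℝ) j t) ∂_ = _
  rw [mp.integral_comp' φ, integral_prod _ hI]
  simp only [φ, integral_const_mul]

/-- Fredholm's recursion: the `n + 1` equal terms of the cofactor expansion turn `1/(n+1)!` into
`1/n!`, and their minus sign is absorbed by the alternating sign. -/
theorem minorCoeff_succ (hk : MomentKernel μ k) (x y : ℝ) (n : ℕ) :
    minorCoeff μ k x y (n + 1) = k x y * detCoeff μ k (n + 1) +
      ∫ s, k x s * minorCoeff μ k s y n ∂μ := by
  have h : ∫ t : Fin (n + 1) → ℝ, (borderedMatrix k x y t).det ∂(Measure.pi fun _ => μ) =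
      k x y * ∫ t : Fin (n + 1) → ℝ, (offDiagMatrix k t).det ∂(Measure.pi fun _ => μ) -
      (n + 1) * ∫ s, k x s * ∫ t : Fin n → ℝ, (borderedMatrix k s y t).det
        ∂(Measure.pi fun _ => μ) ∂μ := by
    simp only [det_borderedMatrix _ x y, det_corneredMatrix_succ]
    rw [integral_sub ((hk.allMoments_offDiag _).integrable.const_mul _)
      (integrable_finsetSum _ fun j _ => (integral_mul_bordered hk x y j).1),
      integral_finsetSum _ fun j _ => (integral_mul_bordered hk x y j).1, integral_const_mul]
    simp only [(integral_mul_bordered hk x y _).2]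
    simp
  rw [minorCoeff, h, detCoeff]
  simp only [minorCoeff]
  have : ∀ s, k x s * ((-1) ^ n / (n.factorial : ℝ) *
      ∫ t : Fin n → ℝ, (borderedMatrix k s y t).det ∂(Measure.pi fun _ => μ)) =
      (-1) ^ n / (n.factorial : ℝ) * (k x s *
      ∫ t : Fin n → ℝ, (borderedMatrix k s y t).det ∂(Measure.pi fun _ => μ)) := fun s => by ring
  simp only [this]
  rw [integral_const_mul, Nat.factorial_succ]
  push_cast
  have h1 : (n.factorial : ℝ) ≠ 0 := by positivity
  have h2 : (n : ℝ) + 1 ≠ 0 := by positivity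
  field_simp
  ring

/-- With the diagonal set to zero the corner term of the expansion disappears, and what remains is
the trace of `k` composed with the `n`-th minor. The index starts at `2` because that composition
already uses two variables. -/
theorem detCoeff_add_two (hk : MomentKernel μ k) (n : ℕ) :
    (n + 2 : ℝ) * detCoeff μ k (n + 2) = -∫ x, ∫ s, k x s * minorCoeff μ k s x n ∂μ ∂μ := by
  have hI : ∀ j : Fin (n + 1), Integrable (fun t : Fin (n + 1 + 1) → ℝ =>
      k (t 0) (t j.succ) * (borderedMatrix k (t j.succ) (t 0) fun i => t (j.succAbove i).succ).det)
      (Measure.pi fun _ => μ) := fun j =>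
    ((hk.allMoments_pair (Fin.succ_ne_zero j).symm).mul (hk.allMoments_bordered_eval₂ j)).integrable
  have mp := measurePreserving_piFinSuccAbove (fun _ : Fin (n + 1 + 1) => μ) 0
  have hj : ∀ j : Fin (n + 1), ∫ t : Fin (n + 1 + 1) → ℝ,
      k (t 0) (t j.succ) * (borderedMatrix k (t j.succ) (t 0) fun i => t (j.succAbove i).succ).det
      ∂(Measure.pi fun _ => μ) = ∫ x, ∫ s, k x s *
        ∫ t : Fin n → ℝ, (borderedMatrix k s x t).det ∂(Measure.pi fun _ => μ) ∂μ ∂μ := by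
    intro j
    have hI := hI j
    set φ : ℝ × (Fin (n + 1) → ℝ) → ℝ := fun p => k p.1 (p.2 j) *
      (borderedMatrix k (p.2 j) p.1 fun i => p.2 (j.succAbove i)).det
    have e : (fun t : Fin (n + 1 + 1) → ℝ => k (t 0) (t j.succ) *
        (borderedMatrix k (t j.succ) (t 0) fun i => t (j.succAbove i).succ).det)
        = φ ∘ (MeasurableEquiv.piFinSuccAbove (fun _ : Fin (n + 1 + 1) => ℝ) 0) := rfl
    rw [e] at hI ⊢
    rw [mp.integrable_comp_emb (MeasurableEquiv.measurableEmbedding _)] at hI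
    change ∫ t, φ (MeasurableEquiv.piFinSuccAbove (fun _ : Fin (n + 1 + 1) => ℝ) 0 t) ∂_ = _
    rw [mp.integral_comp' φ, integral_prod _ hI]
    exact integral_congr_ae (ae_of_all _ fun x => (integral_mul_bordered hk x x j).2)
  have h : ∫ t : Fin (n + 2) → ℝ, (offDiagMatrix k t).det ∂(Measure.pi fun _ => μ) =
      -((n + 1) * ∫ x, ∫ s, k x s *
        ∫ t : Fin n → ℝ, (borderedMatrix k s x t).det ∂(Measure.pi fun _ => μ) ∂μ ∂μ) := by
    simp only [offDiagMatrix_eq_corneredMatrix, det_corneredMatrix_succ, zero_mul, zero_sub]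
    rw [integral_neg, integral_finsetSum _ fun j _ => hI j]
    simp only [hj]
    simp
  rw [detCoeff, h]
  simp only [minorCoeff]
  have : ∀ x s, k x s * ((-1) ^ n / (n.factorial : ℝ) *
      ∫ t : Fin n → ℝ, (borderedMatrix k s x t).det ∂(Measure.pi fun _ => μ)) =
      (-1) ^ n / (n.factorial : ℝ) * (k x s *
      ∫ t : Fin n → ℝ, (borderedMatrix k s x t).det ∂(Measure.pi fun _ => μ)) :=
    fun x s => by ring
  simp only [this, integral_const_mul]
  rw [Nat.factorial_succ, Nat.factorial_succ]
  push_cast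
  have h1 : (n.factorial : ℝ) ≠ 0 := by positivity
  have h2 : (n : ℝ) + 1 ≠ 0 := by positivity
  have h3 : (n : ℝ) + 1 + 1 ≠ 0 := by positivity
  field_simp
  ring

theorem measurable_integral_bordered (hk : MomentKernel μ k) (n : ℕ) :
    Measurable fun p : ℝ × ℝ => minorCoeff μ k p.1 p.2 n := by
  have hm : ∀ i j : Unit ⊕ Fin n, Measurable fun q : (ℝ × ℝ) × (Fin n → ℝ) =>
      borderedMatrix k q.1.1 q.1.2 q.2 i j := by
    intro i j
    rcases i with i | i <;> rcases j with j | j <;> simp only [borderedMatrix,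
      Matrix.fromBlocks_apply₁₁, Matrix.fromBlocks_apply₁₂, Matrix.fromBlocks_apply₂₁,
      Matrix.fromBlocks_apply₂₂, Matrix.of_apply, offDiagMatrix]
    · exact hk.meas.comp measurable_fst
    · exact hk.meas.comp (f := fun q : (ℝ × ℝ) × (Fin n → ℝ) => (q.1.1, q.2 j)) (by fun_prop)
    · exact hk.meas.comp (f := fun q : (ℝ × ℝ) × (Fin n → ℝ) => (q.2 i, q.1.2)) (by fun_prop)
    · split_ifs
      · exact measurable_const
      · exact hk.meas.comp (f := fun q : (ℝ × ℝ) × (Fin n → ℝ) => (q.2 i, q.2 j)) (by fun_prop)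
  have : Measurable fun q : (ℝ × ℝ) × (Fin n → ℝ) => (borderedMatrix k q.1.1 q.1.2 q.2).det := by
    simp only [Matrix.det_apply']
    exact Finset.measurable_fun_sum _ fun σ _ =>
      (Finset.measurable_fun_prod _ fun i _ => hm _ _).const_mul _
  exact (this.stronglyMeasurable.integral_prod_right.measurable).const_mul _

end Recursion

/-! ### Scalar products of square integrable functions -/

section L2

variable {μ : Measure ℝ}

/-- The scalar product of `L²` functions. -/
theorem inner_toLp_eq {u v : ℝ → ℝ} (hu : MemLp u 2 μ) (hv : MemLp v 2 μ) :
    inner ℝ (hu.toLp u) (hv.toLp v) = ∫ x, u x * v x ∂μ := by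
  rw [L2.inner_def]
  refine integral_congr_ae ?_
  filter_upwards [hu.coeFn_toLp, hv.coeFn_toLp] with x h1 h2
  rw [h1, h2]; simp [mul_comm]

theorem abs_integral_mul_le {u v : ℝ → ℝ} (hu : MemLp u 2 μ) (hv : MemLp v 2 μ) :
    |∫ x, u x * v x ∂μ| ≤ ‖hu.toLp u‖ * ‖hv.toLp v‖ := by
  rw [← inner_toLp_eq]; exact abs_real_inner_le_norm _ _

theorem norm_toLp_sq {u : ℝ → ℝ} (hu : MemLp u 2 μ) : ‖hu.toLp u‖ ^ 2 = ∫ x, u x ^ 2 ∂μ := by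
  rw [← real_inner_self_eq_norm_sq, inner_toLp_eq]; simp only [sq]

end L2

/-! ### Integral operators with square integrable kernels -/

section KernelOperators

variable {μ : Measure ℝ} [IsProbabilityMeasure μ] {k : ℝ → ℝ → ℝ}

theorem stronglyMeasurable_kernelOp (hk : Measurable fun p : ℝ × ℝ => k p.1 p.2) {v : ℝ → ℝ}
    (hv : StronglyMeasurable v) : StronglyMeasurable (kernelOp μ k v) := by
  have : StronglyMeasurable fun p : ℝ × ℝ => k p.1 p.2 * v p.2 :=
    hk.stronglyMeasurable.mul (hv.comp_measurable measurable_snd)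
  exact this.integral_prod_right

theorem kernelOp_congr {v w : ℝ → ℝ} (h : v =ᵐ[μ] w) (x : ℝ) : kernelOp μ k v x = kernelOp μ k w x :=
  integral_congr_ae (h.mono fun y hy => by simp only [hy])

theorem memLp_two_prod_mul {u v : ℝ → ℝ} (hu : MemLp u 2 μ) (hv : MemLp v 2 μ) :
    MemLp (fun p : ℝ × ℝ => u p.1 * v p.2) 2 (μ.prod μ) := by
  have hm : AEStronglyMeasurable (fun p : ℝ × ℝ => u p.1 * v p.2) (μ.prod μ) :=
    hu.1.comp_fst.mul hv.1.comp_snd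
  rw [memLp_two_iff_integrable_sq hm]
  simp only [mul_pow]
  exact Integrable.mul_prod ((memLp_two_iff_integrable_sq hu.1).1 hu)
    ((memLp_two_iff_integrable_sq hv.1).1 hv)

/-- A jointly square integrable kernel with square integrable rows. -/
structure L2Kernel (μ : Measure ℝ) (k : ℝ → ℝ → ℝ) : Prop where
  meas : Measurable fun p : ℝ × ℝ => k p.1 p.2
  joint : MemLp (fun p : ℝ × ℝ => k p.1 p.2) 2 (μ.prod μ)
  left : ∀ x, MemLp (k x) 2 μ

theorem MomentKernel.l2 (hk : MomentKernel μ k) : L2Kernel μ k :=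
  ⟨hk.meas, hk.joint.memLp_two, fun x => (hk.left x).memLp_two⟩

namespace L2Kernel

/-- The rows of the kernel. -/
noncomputable def row (hk : L2Kernel μ k) (x : ℝ) : Lp ℝ 2 μ := (hk.left x).toLp (k x)

theorem inner_row (hk : L2Kernel μ k) {v : ℝ → ℝ} (hv : MemLp v 2 μ) (x : ℝ) :
    inner ℝ (hk.row x) (hv.toLp v) = kernelOp μ k v x := inner_toLp_eq (hk.left x) hv

theorem inner_row' (hk : L2Kernel μ k) (v : Lp ℝ 2 μ) (x : ℝ) :
    inner ℝ (hk.row x) v = kernelOp μ k v x := by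
  conv_lhs => rw [← Lp.toLp_coeFn v (Lp.memLp v)]
  exact hk.inner_row (Lp.memLp v) x

theorem integrable_norm_row_sq (hk : L2Kernel μ k) : Integrable (fun x => ‖hk.row x‖ ^ 2) μ := by
  simp only [row, norm_toLp_sq]
  exact ((memLp_two_iff_integrable_sq hk.joint.1).1 hk.joint).integral_prod_left

theorem measurable_norm_row (hk : L2Kernel μ k) : Measurable fun x => ‖hk.row x‖ := by
  have h : ∀ x, ‖hk.row x‖ = Real.sqrt (∫ y, k x y ^ 2 ∂μ) := fun x => by
    rw [← norm_toLp_sq (hk.left x), Real.sqrt_sq (norm_nonneg _)]; rfl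
  simp only [h]
  exact ((hk.meas.pow_const 2).stronglyMeasurable.integral_prod_right).measurable.sqrt

theorem memLp_norm_row (hk : L2Kernel μ k) : MemLp (fun x => ‖hk.row x‖) 2 μ := by
  rw [memLp_two_iff_integrable_sq hk.measurable_norm_row.aestronglyMeasurable]
  exact hk.integrable_norm_row_sq

theorem abs_kernelOp_le (hk : L2Kernel μ k) {v : ℝ → ℝ} (hv : MemLp v 2 μ) (x : ℝ) :
    |kernelOp μ k v x| ≤ ‖hk.row x‖ * ‖hv.toLp v‖ := abs_integral_mul_le _ hv

theorem memLp_kernelOp (hk : L2Kernel μ k) {v : ℝ → ℝ} (hv : MemLp v 2 μ) :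
    MemLp (kernelOp μ k v) 2 μ := by
  obtain ⟨v', hv', e⟩ := hv.1
  have hm : kernelOp μ k v = kernelOp μ k v' := funext fun x => kernelOp_congr e x
  refine (hk.memLp_norm_row.mul_const ‖hv.toLp v‖).mono ?_ (ae_of_all _ fun x => ?_)
  · rw [hm]; exact (stronglyMeasurable_kernelOp hk.meas hv').aestronglyMeasurable
  · rw [Real.norm_eq_abs]
    exact (hk.abs_kernelOp_le hv x).trans (le_abs_self _)

/-- The operator on `L²` with kernel `k`. -/
noncomputable def toCLM (hk : L2Kernel μ k) : Lp ℝ 2 μ →L[ℝ] Lp ℝ 2 μ :=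
  LinearMap.mkContinuous
    { toFun := fun v => (hk.memLp_kernelOp (Lp.memLp v)).toLp _
      map_add' := fun u v => by
        rw [← MemLp.toLp_add]
        refine MemLp.toLp_congr _ _ (ae_of_all _ fun x => ?_)
        simp only [Pi.add_apply, ← hk.inner_row', inner_add_right]
      map_smul' := fun c v => by
        rw [RingHom.id_apply, ← MemLp.toLp_const_smul]
        refine MemLp.toLp_congr _ _ (ae_of_all _ fun x => ?_)
        simp only [Pi.smul_apply, ← hk.inner_row', real_inner_smul_right, smul_eq_mul] }
    ‖hk.memLp_norm_row.toLp _‖ fun v => by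
      refine abs_le_of_sq_le_sq' ?_ (by positivity) |>.2
      simp only [LinearMap.coe_mk, AddHom.coe_mk, mul_pow, norm_toLp_sq]
      rw [← integral_mul_const]
      refine integral_mono ((memLp_two_iff_integrable_sq (hk.memLp_kernelOp (Lp.memLp v)).1).1
        (hk.memLp_kernelOp (Lp.memLp v))) (hk.integrable_norm_row_sq.mul_const _) fun x => ?_
      simp only [← hk.inner_row', ← mul_pow]
      exact sq_le_sq.2 ((abs_real_inner_le_norm _ _).trans (le_abs_self _))

theorem toCLM_apply (hk : L2Kernel μ k) (v : Lp ℝ 2 μ) :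
    hk.toCLM v = (hk.memLp_kernelOp (Lp.memLp v)).toLp _ := rfl

theorem coeFn_toCLM (hk : L2Kernel μ k) (v : Lp ℝ 2 μ) : hk.toCLM v =ᵐ[μ] kernelOp μ k v :=
  (hk.memLp_kernelOp (Lp.memLp v)).coeFn_toLp

theorem toCLM_toLp (hk : L2Kernel μ k) {v : ℝ → ℝ} (hv : MemLp v 2 μ) :
    hk.toCLM (hv.toLp v) = (hk.memLp_kernelOp hv).toLp _ := by
  rw [toCLM_apply]
  exact MemLp.toLp_congr _ _ (ae_of_all _ fun x => kernelOp_congr hv.coeFn_toLp x)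

theorem integrable_mul_mul (hk : L2Kernel μ k) {u v : ℝ → ℝ} (hu : MemLp u 2 μ)
    (hv : MemLp v 2 μ) : Integrable (fun p : ℝ × ℝ => k p.1 p.2 * (u p.1 * v p.2)) (μ.prod μ) :=
  hk.joint.integrable_mul (memLp_two_prod_mul hu hv)

theorem isSymmetric (hk : L2Kernel μ k) (hs : ∀ x y, k x y = k y x) :
    (hk.toCLM : Lp ℝ 2 μ →ₗ[ℝ] Lp ℝ 2 μ).IsSymmetric := by
  intro u v
  have hu := Lp.memLp u
  have hv := Lp.memLp v
  have h1 : inner ℝ (hk.toCLM u) v = ∫ x, kernelOp μ k u x * v x ∂μ := by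
    conv_lhs => rw [← Lp.toLp_coeFn v hv]
    exact inner_toLp_eq (hk.memLp_kernelOp hu) hv
  have h2 : inner ℝ u (hk.toCLM v) = ∫ x, u x * kernelOp μ k v x ∂μ := by
    conv_lhs => rw [← Lp.toLp_coeFn u hu]
    exact inner_toLp_eq hu (hk.memLp_kernelOp hv)
  have e1 : ∀ x, kernelOp μ k u x * v x = ∫ y, k x y * (v x * u y) ∂μ := fun x => by
    rw [kernelOp, ← integral_mul_const]
    exact integral_congr_ae (ae_of_all _ fun y => by ring)
  have e2 : ∀ x, u x * kernelOp μ k v x = ∫ y, k y x * (v y * u x) ∂μ := fun x => by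
    rw [kernelOp, ← integral_const_mul]
    exact integral_congr_ae (ae_of_all _ fun y => by simp only [hs y x]; ring)
  change inner ℝ (hk.toCLM u) v = inner ℝ u (hk.toCLM v)
  rw [h1, h2]
  simp only [e1, e2]
  exact integral_integral_swap (hk.integrable_mul_mul hv hu)

end L2Kernel

end KernelOperators

/-- A kernel `k(x,y) = s(x,y) + g(x)` where `s` is symmetric, centered and negative on functions of
mean zero, and `g` has mean zero. -/
structure CenteredKernel (μ : Measure ℝ) (k s : ℝ → ℝ → ℝ) (g : ℝ → ℝ) : Prop where
  kern : MomentKernel μ k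
  symm_kern : MomentKernel μ s
  symm : ∀ x y, s x y = s y x
  mean : ∀ x, ∫ y, s x y ∂μ = 0
  moments : AllMoments g μ
  mean_g : ∫ x, g x ∂μ = 0
  decomp : ∀ x y, k x y = s x y + g x
  neg : ∀ v, MemLp v 2 μ → ∫ x, v x ∂μ = 0 → ∫ x, kernelOp μ s v x * v x ∂μ ≤ 0

/-! ### The 2-determinant of a centered kernel -/

namespace CenteredKernel

variable {μ : Measure ℝ} [IsProbabilityMeasure μ] {k s : ℝ → ℝ → ℝ} {g : ℝ → ℝ}

/-- The constant function `1` in `L²(μ)`. -/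
noncomputable def oneLp (μ : Measure ℝ) [IsProbabilityMeasure μ] : Lp ℝ 2 μ :=
  (memLp_const (1 : ℝ)).toLp (fun _ => (1 : ℝ))

theorem inner_oneLp_toLp {v : ℝ → ℝ} (hv : MemLp v 2 μ) :
    inner ℝ (oneLp μ) (hv.toLp v) = ∫ x, v x ∂μ := by
  rw [oneLp, inner_toLp_eq]; simp

theorem inner_oneLp (v : Lp ℝ 2 μ) : inner ℝ (oneLp μ) v = ∫ x, v x ∂μ := by
  conv_lhs => rw [← Lp.toLp_coeFn v (Lp.memLp v)]
  exact inner_oneLp_toLp _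

theorem norm_oneLp : inner ℝ (oneLp μ) (oneLp μ) = (1 : ℝ) := by
  conv_lhs => rw [oneLp]
  rw [inner_toLp_eq]; simp

/-- `g` as an element of `L²`. -/
noncomputable def gLp (h : CenteredKernel μ k s g) : Lp ℝ 2 μ := h.moments.memLp_two.toLp g

theorem toCLM_one (h : CenteredKernel μ k s g) : h.symm_kern.l2.toCLM (oneLp μ) = 0 := by
  rw [oneLp, L2Kernel.toCLM_toLp]
  have : kernelOp μ s (fun _ => 1) = fun _ => 0 := funext fun x => by simp [kernelOp, h.mean]
  rw [← MemLp.toLp_zero MemLp.zero']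
  exact MemLp.toLp_congr _ _ (by rw [this]; rfl)

theorem inner_one_toCLM (h : CenteredKernel μ k s g) (v : Lp ℝ 2 μ) :
    inner ℝ (oneLp μ) (h.symm_kern.l2.toCLM v) = 0 := by
  have : inner ℝ (oneLp μ) (h.symm_kern.l2.toCLM v) = inner ℝ (h.symm_kern.l2.toCLM (oneLp μ)) v :=
    ((h.symm_kern.l2.isSymmetric h.symm) (oneLp μ) v).symm
  rw [this, h.toCLM_one, inner_zero_left]

theorem inner_one_gLp (h : CenteredKernel μ k s g) : inner ℝ (oneLp μ) h.gLp = 0 := by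
  rw [gLp, inner_oneLp_toLp, h.mean_g]

theorem inner_one_row (h : CenteredKernel μ k s g) (x : ℝ) :
    inner ℝ (oneLp μ) (h.symm_kern.l2.row x) = 0 := by
  rw [L2Kernel.row, inner_oneLp_toLp, h.mean]

theorem inner_one_pow (h : CenteredKernel μ k s g) {w : Lp ℝ 2 μ} (hw : inner ℝ (oneLp μ) w = 0)
    (m : ℕ) : inner ℝ (oneLp μ) ((h.symm_kern.l2.toCLM ^ m) w) = 0 := by
  rcases m with _ | m
  · simpa using hw
  · rw [pow_succ', mul_apply_eq_comp, h.inner_one_toCLM]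

/-- Negativity is assumed on mean zero functions only. Constants lie in the kernel of `S` and are
orthogonal to its range, so removing the mean does not change the quadratic form. -/
theorem inner_toCLM_nonpos (h : CenteredKernel μ k s g) (v : Lp ℝ 2 μ) :
    inner ℝ (h.symm_kern.l2.toCLM v) v ≤ 0 := by
  set S := h.symm_kern.l2.toCLM
  set c : ℝ := inner ℝ (oneLp μ) v
  set w := v - c • oneLp μ
  have hw : inner ℝ (oneLp μ) w = 0 := by
    rw [inner_sub_right, real_inner_smul_right, norm_oneLp, mul_one, sub_self]
  have e : inner ℝ (S v) v = inner ℝ (S w) w := by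
    have h1 : S w = S v := by
      simp only [w, map_sub, map_smul]
      rw [show S (oneLp μ) = 0 from h.toCLM_one]; simp
    rw [h1, inner_sub_right, real_inner_smul_right, real_inner_comm (oneLp μ) (S v),
      h.inner_one_toCLM]
    ring
  rw [e]
  have hwm := Lp.memLp w
  have : inner ℝ (S w) w = ∫ x, kernelOp μ s w x * w x ∂μ := by
    conv_lhs => rw [← Lp.toLp_coeFn w hwm]
    rw [show S (hwm.toLp w) = (h.symm_kern.l2.memLp_kernelOp hwm).toLp _ from
      L2Kernel.toCLM_toLp _ hwm]
    exact inner_toLp_eq _ hwm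
  rw [this]
  exact h.neg w hwm (by rw [← inner_oneLp, hw])

/-- The rows of `k`. -/
theorem row_eq (h : CenteredKernel μ k s g) (x : ℝ) :
    h.kern.l2.row x = h.symm_kern.l2.row x + g x • oneLp μ := by
  rw [L2Kernel.row, L2Kernel.row, oneLp, ← MemLp.toLp_const_smul, ← MemLp.toLp_add]
  exact MemLp.toLp_congr _ _ (ae_of_all _ fun y => by simp [h.decomp])

/-- The columns of `k`. -/
noncomputable def col (h : CenteredKernel μ k s g) (y : ℝ) : Lp ℝ 2 μ :=
  h.symm_kern.l2.row y + h.gLp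

theorem coeFn_col (h : CenteredKernel μ k s g) (y : ℝ) : h.col y =ᵐ[μ] fun x => k x y := by
  rw [col, gLp]
  filter_upwards [Lp.coeFn_add (h.symm_kern.l2.row y) h.gLp, h.moments.memLp_two.coeFn_toLp,
    (h.symm_kern.l2.left y).coeFn_toLp] with x h1 h2 h3
  change (h.symm_kern.l2.row y) x = s y x at h3
  rw [gLp] at h1
  rw [h1, Pi.add_apply, h2, h3, h.decomp, h.symm]

theorem inner_one_col (h : CenteredKernel μ k s g) (y : ℝ) : inner ℝ (oneLp μ) (h.col y) = 0 := by
  rw [col, inner_add_right, h.inner_one_row, h.inner_one_gLp, add_zero]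

/-- The coefficients of `δ(z) (1 - z S)⁻¹`. -/
noncomputable def resCoeff (h : CenteredKernel μ k s g) (n : ℕ) (w : Lp ℝ 2 μ) : Lp ℝ 2 μ :=
  ∑ q ∈ Finset.HasAntidiagonal.antidiagonal n,
    detCoeff μ k q.1 • (h.symm_kern.l2.toCLM ^ q.2) w

theorem resCoeff_zero (h : CenteredKernel μ k s g) (w : Lp ℝ 2 μ) : h.resCoeff 0 w = w := by
  simp [resCoeff, detCoeff_zero]

theorem resCoeff_succ (h : CenteredKernel μ k s g) (n : ℕ) (w : Lp ℝ 2 μ) :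
    h.resCoeff (n + 1) w = detCoeff μ k (n + 1) • w + h.symm_kern.l2.toCLM (h.resCoeff n w) := by
  rw [resCoeff, Finset.Nat.sum_antidiagonal_succ', resCoeff, map_sum]
  congr 1
  refine Finset.sum_congr rfl fun q _ => ?_
  rw [map_smul, pow_succ', mul_apply_eq_comp]

theorem inner_one_resCoeff (h : CenteredKernel μ k s g) (n : ℕ) (y : ℝ) :
    inner ℝ (oneLp μ) (h.resCoeff n (h.col y)) = 0 := by
  rw [resCoeff, inner_sum]
  refine Finset.sum_eq_zero fun q _ => ?_
  rw [real_inner_smul_right, h.inner_one_pow (h.inner_one_col y), mul_zero]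

/-- The columns of the minors are obtained by applying `resCoeff`. -/
theorem coeFn_resCoeff (h : CenteredKernel μ k s g) (n : ℕ) (y : ℝ) :
    h.resCoeff n (h.col y) =ᵐ[μ] fun x => minorCoeff μ k x y n := by
  induction n with
  | zero => simp only [resCoeff_zero, minorCoeff_zero]; exact h.coeFn_col y
  | succ n ih =>
    rw [resCoeff_succ]
    filter_upwards [Lp.coeFn_add (detCoeff μ k (n + 1) • h.col y)
      (h.symm_kern.l2.toCLM (h.resCoeff n (h.col y))),
      Lp.coeFn_smul (detCoeff μ k (n + 1)) (h.col y),
      h.symm_kern.l2.coeFn_toCLM (h.resCoeff n (h.col y)), h.coeFn_col y] with x h1 h2 h3 h4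
    rw [h1, Pi.add_apply, h2, Pi.smul_apply, h3, h4, minorCoeff_succ h.kern, smul_eq_mul, mul_comm]
    congr 1
    have e : ∫ z, k x z * minorCoeff μ k z y n ∂μ = inner ℝ (h.kern.l2.row x)
        (h.resCoeff n (h.col y)) := by
      rw [h.kern.l2.inner_row', kernelOp_congr ih]; rfl
    -- The rows of `k` and `s` differ by a constant function, which does not see the mean zero
    -- columns: on these `K` acts as `S`.
    rw [e, h.row_eq, inner_add_left, real_inner_smul_left, h.inner_one_resCoeff, mul_zero, add_zero,
      h.symm_kern.l2.inner_row']

theorem integral_mul_minorCoeff (h : CenteredKernel μ k s g) (n : ℕ) (x y : ℝ) :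
    ∫ z, k x z * minorCoeff μ k z y n ∂μ
      = inner ℝ (h.kern.l2.row x) (h.resCoeff n (h.col y)) := by
  rw [h.kern.l2.inner_row', kernelOp_congr (h.coeFn_resCoeff n y)]; rfl

/-- The powers of `S` are applied to an element of `L²` that varies with `x`, so measurability in
`x` is not automatic. It comes from jointly measurable representatives, obtained by iterated
integration against `s`. -/
theorem measurable_inner_row_pow (h : CenteredKernel μ k s g) (m : ℕ) :
    Measurable fun x => inner ℝ (h.symm_kern.l2.row x)
      ((h.symm_kern.l2.toCLM ^ m) (h.symm_kern.l2.row x)) := by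
  have key : ∃ q : ℝ → ℝ → ℝ, (StronglyMeasurable fun p : ℝ × ℝ => q p.1 p.2) ∧
      ∀ y, (h.symm_kern.l2.toCLM ^ m) (h.symm_kern.l2.row y) =ᵐ[μ] fun x => q x y := by
    induction m with
    | zero =>
      refine ⟨s, h.symm_kern.meas.stronglyMeasurable, fun y => ?_⟩
      have := (h.symm_kern.l2.left y).coeFn_toLp
      filter_upwards [this] with x hx
      rw [h.symm x y, ← hx]; rfl
    | succ m ih =>
      obtain ⟨q, hq, hq2⟩ := ih
      refine ⟨fun x y => ∫ z, s x z * q z y ∂μ, ?_, fun y => ?_⟩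
      · have : StronglyMeasurable fun p : (ℝ × ℝ) × ℝ => s p.1.1 p.2 * q p.2 p.1.2 :=
          (h.symm_kern.meas.comp (f := fun p : (ℝ × ℝ) × ℝ => (p.1.1, p.2))
            (by fun_prop)).stronglyMeasurable.mul
            (hq.comp_measurable (show Measurable fun p : (ℝ × ℝ) × ℝ => (p.2, p.1.2) by fun_prop))
        exact this.integral_prod_right
      · rw [pow_succ', mul_apply_eq_comp]
        filter_upwards [h.symm_kern.l2.coeFn_toCLM
          ((h.symm_kern.l2.toCLM ^ m) (h.symm_kern.l2.row y))] with x hx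
        rw [hx, kernelOp_congr (hq2 y)]; rfl
  obtain ⟨q, hq, hq2⟩ := key
  have e : ∀ x, inner ℝ (h.symm_kern.l2.row x)
      ((h.symm_kern.l2.toCLM ^ m) (h.symm_kern.l2.row x)) = ∫ z, s x z * q z x ∂μ := fun x => by
    rw [h.symm_kern.l2.inner_row', kernelOp_congr (hq2 x)]; rfl
  simp only [e]
  have : StronglyMeasurable fun p : ℝ × ℝ => s p.1 p.2 * q p.2 p.1 :=
    h.symm_kern.meas.stronglyMeasurable.mul (hq.comp_measurable measurable_swap)
  exact this.integral_prod_right.measurable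

theorem integrable_inner_row_pow (h : CenteredKernel μ k s g) (m : ℕ) :
    Integrable (fun x => inner ℝ (h.symm_kern.l2.row x)
      ((h.symm_kern.l2.toCLM ^ m) (h.symm_kern.l2.row x))) μ := by
  refine (h.symm_kern.l2.integrable_norm_row_sq.const_mul ‖h.symm_kern.l2.toCLM ^ m‖).mono'
    (h.measurable_inner_row_pow m).aestronglyMeasurable (ae_of_all _ fun x => ?_)
  refine (norm_inner_le_norm _ _).trans ?_
  calc _ ≤ ‖h.symm_kern.l2.row x‖ * (‖h.symm_kern.l2.toCLM ^ m‖ * ‖h.symm_kern.l2.row x‖) := by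
        gcongr; exact ContinuousLinearMap.le_opNorm _ _
    _ = _ := by ring

theorem inner_row_sq (h : CenteredKernel μ k s g) (v : Lp ℝ 2 μ) :
    Integrable (fun x => (inner ℝ (h.symm_kern.l2.row x) v) ^ 2) μ ∧
      ∫ x, (inner ℝ (h.symm_kern.l2.row x) v) ^ 2 ∂μ = ‖h.symm_kern.l2.toCLM v‖ ^ 2 := by
  have hm := h.symm_kern.l2.memLp_kernelOp (Lp.memLp v)
  simp only [h.symm_kern.l2.inner_row']
  exact ⟨(memLp_two_iff_integrable_sq hm.1).1 hm, by rw [L2Kernel.toCLM_apply, norm_toLp_sq]⟩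

theorem integral_inner_row (h : CenteredKernel μ k s g) (v : Lp ℝ 2 μ) :
    Integrable (fun x => inner ℝ (h.symm_kern.l2.row x) v) μ ∧
      ∫ x, inner ℝ (h.symm_kern.l2.row x) v ∂μ = 0 := by
  have hm := h.symm_kern.l2.memLp_kernelOp (Lp.memLp v)
  simp only [h.symm_kern.l2.inner_row']
  exact ⟨hm.integrable (by norm_num), by
    rw [← inner_oneLp_toLp hm, ← h.symm_kern.l2.toCLM_apply, h.inner_one_toCLM]⟩

/-- The traces of the powers of the operator with kernel `s`. -/
noncomputable def trace (h : CenteredKernel μ k s g) : ℕ → ℝ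
  -- The index `0` carries no trace, and the value `0` at index `1` is the regularisation: `tr S` is
  -- dropped from the determinant.
  | 0 => 0
  | 1 => 0
  | m + 2 => ∫ x, inner ℝ (h.symm_kern.l2.row x)
      ((h.symm_kern.l2.toCLM ^ m) (h.symm_kern.l2.row x)) ∂μ

/-- The Plemelj-Smithies recursion, obtained by expanding the trace in `detCoeff_add_two` with the
formula for the minors. The contribution of `g` integrates to zero because the range of `S` is
orthogonal to `1`, so the determinant of `K` only involves the traces of `S`. -/
theorem detCoeff_recursion (h : CenteredKernel μ k s g) (n : ℕ) :
    n * detCoeff μ k n =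
      -∑ q ∈ Finset.HasAntidiagonal.antidiagonal n, h.trace q.1 * detCoeff μ k q.2 := by
  rcases n with _ | _ | n
  · simp [trace]
  · rw [zero_add, detCoeff_one, Finset.Nat.sum_antidiagonal_succ]; simp [trace]
  · rw [Finset.Nat.sum_antidiagonal_succ, Finset.Nat.sum_antidiagonal_succ]
    have := detCoeff_add_two h.kern n
    push_cast
    rw [show ((n : ℝ) + 1 + 1) = n + 2 by ring, this]
    simp only [trace, zero_mul, zero_add]
    congr 1
    simp only [h.integral_mul_minorCoeff]
    have e : ∀ x, inner ℝ (h.kern.l2.row x) (h.resCoeff n (h.col x)) =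
        ∑ q ∈ Finset.HasAntidiagonal.antidiagonal n, detCoeff μ k q.1 *
          (inner ℝ (h.symm_kern.l2.row x)
            ((h.symm_kern.l2.toCLM ^ q.2) (h.symm_kern.l2.row x)) +
          inner ℝ (h.symm_kern.l2.row x) ((h.symm_kern.l2.toCLM ^ q.2) h.gLp)) := by
      intro x
      rw [h.row_eq, inner_add_left, real_inner_smul_left, h.inner_one_resCoeff, mul_zero, add_zero,
        resCoeff, inner_sum]
      refine Finset.sum_congr rfl fun q _ => ?_
      rw [real_inner_smul_right, col, map_add, inner_add_right]
    simp only [e]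
    have hI : ∀ q : ℕ × ℕ, Integrable (fun x => inner ℝ (h.symm_kern.l2.row x)
            ((h.symm_kern.l2.toCLM ^ q.2) (h.symm_kern.l2.row x)) +
          inner ℝ (h.symm_kern.l2.row x) ((h.symm_kern.l2.toCLM ^ q.2) h.gLp)) μ := fun q =>
      (h.integrable_inner_row_pow q.2).add (h.integral_inner_row _).1
    rw [integral_finsetSum _ fun q _ => (hI q).const_mul _, ← Finset.Nat.sum_antidiagonal_swap]
    refine Finset.sum_congr rfl fun q _ => ?_
    simp only [Prod.fst_swap, Prod.snd_swap]
    rw [integral_const_mul, integral_add (h.integrable_inner_row_pow _)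
      (h.integral_inner_row _).1, (h.integral_inner_row _).2, add_zero, mul_comm]

theorem summable_coeffs (h : CenteredKernel μ k s g) :
    (Summable fun n => |detCoeff μ k n|) ∧ ∑' n, detCoeff μ k n ≠ 0 ∧
      ∃ b : ℕ → ℝ, Summable b ∧ ∀ n v, ‖h.resCoeff n v‖ ≤ b n * ‖v‖ :=
  fredholm_summable (h.symm_kern.l2.isSymmetric h.symm) h.inner_toCLM_nonpos h.inner_row_sq
    h.symm_kern.l2.integrable_norm_row_sq h.integrable_inner_row_pow rfl rfl (fun _ => rfl)
    detCoeff_zero h.detCoeff_recursion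

theorem summable_det2Term (h : CenteredKernel μ k s g) :
    Summable fun n => det2Term μ (fun a b => -k a b) (n + 1) := by
  simp only [det2Term_neg]
  exact (summable_nat_add_iff 1).2 h.summable_coeffs.1.of_abs

theorem fredholmDet2_eq (h : CenteredKernel μ k s g) :
    fredholmDet2 μ (fun a b => -k a b) = ∑' n, detCoeff μ k n := by
  rw [fredholmDet2, h.summable_coeffs.1.of_abs.tsum_eq_zero_add, detCoeff_zero]
  simp only [det2Term_neg]

theorem fredholmDet2_ne_zero (h : CenteredKernel μ k s g) :
    fredholmDet2 μ (fun a b => -k a b) ≠ 0 := by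
  rw [h.fredholmDet2_eq]; exact h.summable_coeffs.2.1

end CenteredKernel

/-! ### Convergence of the resolvent kernel and inversion of `id - K` -/

namespace CenteredKernel

variable {μ : Measure ℝ} [IsProbabilityMeasure μ] {k s : ℝ → ℝ → ℝ} {g : ℝ → ℝ}

theorem memLp_minorCoeff (h : CenteredKernel μ k s g) (n : ℕ) (y : ℝ) :
    MemLp (fun x => minorCoeff μ k x y n) 2 μ :=
  (memLp_congr_ae (h.coeFn_resCoeff n y)).1 (Lp.memLp _)

/-- The minors are dominated by a summable sequence. -/
theorem minorCoeff_bound (h : CenteredKernel μ k s g) :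
    ∃ b : ℕ → ℝ, Summable b ∧ (∀ n x y, |minorCoeff μ k x y n| ≤
      b n * (|k x y| + ‖h.kern.l2.row x‖ * ‖h.col y‖)) ∧
      ∀ n x y, ∫ z, |k x z * minorCoeff μ k z y n| ∂μ ≤
        b n * (‖h.kern.l2.row x‖ * ‖h.col y‖) := by
  obtain ⟨hs, -, b, hb, hbn⟩ := h.summable_coeffs
  have hb0 : ∀ n, 0 ≤ |b n| := fun n => abs_nonneg _
  have hbn' : ∀ n v, ‖h.resCoeff n v‖ ≤ |b n| * ‖v‖ := fun n v =>
    (hbn n v).trans (by gcongr; exact le_abs_self _)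
  -- By Fredholm's recursion the `n`-th minor is bounded through the `n`-th determinant coefficient
  -- and the resolvent coefficient of index `n - 1`; the last term serves the second estimate. At `n
  -- = 0` the truncated index `0 - 1 = 0` only adds a nonnegative term.
  refine ⟨fun n => |detCoeff μ k n| + |b (n - 1)| + |b n|, (hs.add ?_).add hb.abs, ?_, ?_⟩
  · rw [← summable_nat_add_iff 1]; simpa using hb.abs
  · intro n x y
    rcases n with _ | n
    · simp only [minorCoeff_zero, detCoeff_zero]
      have h1 := hb0 0
      have h2 : 0 ≤ ‖h.kern.l2.row x‖ * ‖h.col y‖ := by positivity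
      have h3 := abs_nonneg (k x y)
      simp only [abs_one]
      nlinarith [mul_nonneg h1 h2, mul_nonneg h1 h3, hb0 (0 - 1), mul_nonneg (hb0 (0 - 1)) h2,
        mul_nonneg (hb0 (0 - 1)) h3]
    · rw [minorCoeff_succ h.kern, h.integral_mul_minorCoeff]
      have h1 : |k x y * detCoeff μ k (n + 1)| = |detCoeff μ k (n + 1)| * |k x y| := by
        rw [abs_mul, mul_comm]
      have h2 : |inner ℝ (h.kern.l2.row x) (h.resCoeff n (h.col y))| ≤
          |b n| * (‖h.kern.l2.row x‖ * ‖h.col y‖) := by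
        refine (abs_real_inner_le_norm _ _).trans ?_
        calc _ ≤ ‖h.kern.l2.row x‖ * (|b n| * ‖h.col y‖) := by gcongr; exact hbn' _ _
          _ = _ := by ring
      have h3 : 0 ≤ ‖h.kern.l2.row x‖ * ‖h.col y‖ := by positivity
      have h4 := abs_nonneg (k x y)
      have h5 := abs_nonneg (detCoeff μ k (n + 1))
      refine (abs_add_le _ _).trans ?_
      simp only [h1, Nat.add_sub_cancel]
      nlinarith [mul_nonneg h5 h3, mul_nonneg (hb0 n) h4, mul_nonneg (hb0 (n + 1)) h3,
        mul_nonneg (hb0 (n + 1)) h4]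
  · intro n x y
    have h1 := abs_integral_mul_le (h.kern.l2.left x).abs (h.memLp_minorCoeff n y).abs
    have e1 : ‖(h.kern.l2.left x).abs.toLp _‖ = ‖h.kern.l2.row x‖ := by
      rw [L2Kernel.row, Lp.norm_toLp, Lp.norm_toLp]
      congr 1
      exact eLpNorm_congr_norm_ae (ae_of_all _ fun y => by simp)
    have e2 : ‖(h.memLp_minorCoeff n y).abs.toLp _‖ = ‖h.resCoeff n (h.col y)‖ := by
      rw [Lp.norm_def, Lp.norm_def, eLpNorm_congr_ae (h.coeFn_resCoeff n y),
        eLpNorm_congr_ae (h.memLp_minorCoeff n y).abs.coeFn_toLp]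
      congr 1
      exact eLpNorm_congr_norm_ae (ae_of_all _ fun y => by simp)
    rw [e1, e2] at h1
    simp only [abs_mul]
    refine (le_abs_self _).trans (h1.trans ?_)
    calc _ ≤ ‖h.kern.l2.row x‖ * (|b n| * ‖h.col y‖) := by gcongr; exact hbn' _ _
      _ = |b n| * (‖h.kern.l2.row x‖ * ‖h.col y‖) := by ring
      _ ≤ _ := by
        gcongr
        have := abs_nonneg (detCoeff μ k n)
        have := hb0 (n - 1)
        linarith

theorem summable_minorCoeff (h : CenteredKernel μ k s g) (x y : ℝ) :
    Summable fun n => minorCoeff μ k x y n := by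
  obtain ⟨b, hb, hb1, -⟩ := h.minorCoeff_bound
  exact (Summable.of_nonneg_of_le (fun n => abs_nonneg _) (fun n => hb1 n x y)
    (hb.mul_right _)).of_abs

theorem summable_resolventTerm (h : CenteredKernel μ k s g) (x y : ℝ) :
    Summable fun n => resolventTerm μ k x y n := by
  simp only [resolventTerm_eq]; exact (h.summable_minorCoeff x y).neg

theorem resolventKernel_eq (x y : ℝ) :
    resolventKernel μ k x y =
      -(fredholmDet2 μ fun a b => -k a b)⁻¹ * ∑' n, minorCoeff μ k x y n := by
  rw [resolventKernel]
  simp only [resolventTerm_eq, tsum_neg]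
  ring

/-- The resolvent equation `r = -k + k ∘ r`. -/
theorem resolventKernel_equation (h : CenteredKernel μ k s g) (x y : ℝ) :
    resolventKernel μ k x y = -k x y + ∫ z, k x z * resolventKernel μ k z y ∂μ := by
  obtain ⟨b, hb, -, hb2⟩ := h.minorCoeff_bound
  have hD := h.fredholmDet2_ne_zero
  have hI : ∀ n, Integrable (fun z => k x z * minorCoeff μ k z y n) μ := fun n =>
    (h.kern.l2.left x).integrable_mul (h.memLp_minorCoeff n y)
  -- The second estimate of `minorCoeff_bound` is the `L¹` bound that allows exchanging series and
  -- integral.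
  have hsw : ∫ z, k x z * ∑' n, minorCoeff μ k z y n ∂μ
      = ∑' n, ∫ z, k x z * minorCoeff μ k z y n ∂μ := by
    simp only [← tsum_mul_left]
    refine (integral_tsum_of_summable_integral_norm hI ?_).symm
    exact Summable.of_nonneg_of_le (fun n => integral_nonneg fun z => norm_nonneg _)
      (fun n => hb2 n x y) (hb.mul_right _)
  have hS : ∑' n, minorCoeff μ k x y n = k x y * (fredholmDet2 μ fun a b => -k a b) +
      ∫ z, k x z * ∑' n, minorCoeff μ k z y n ∂μ := by
    have s1 : Summable fun n => k x y * detCoeff μ k (n + 1) :=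
      ((summable_nat_add_iff 1).2 h.summable_coeffs.1.of_abs).mul_left _
    have s2 : Summable fun n => ∫ z, k x z * minorCoeff μ k z y n ∂μ := by
      have := ((summable_nat_add_iff 1).2 (h.summable_minorCoeff x y)).sub s1
      refine this.congr fun n => ?_
      rw [minorCoeff_succ h.kern]; ring
    rw [(h.summable_minorCoeff x y).tsum_eq_zero_add, minorCoeff_zero, hsw, h.fredholmDet2_eq,
      h.summable_coeffs.1.of_abs.tsum_eq_zero_add, detCoeff_zero]
    simp only [minorCoeff_succ h.kern]
    rw [s1.tsum_add s2, tsum_mul_left]; ring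
  have e : ∀ z, k x z * resolventKernel μ k z y = -(fredholmDet2 μ fun a b => -k a b)⁻¹ *
      (k x z * ∑' n, minorCoeff μ k z y n) := fun z => by rw [resolventKernel_eq]; ring
  simp only [e]
  rw [integral_const_mul, resolventKernel_eq, hS]
  field_simp
  ring

/-- Summing the bounds on the minors dominates the resolvent kernel by `|k(x,y)|` plus a product of
row and column norms, which is square integrable jointly and along every row. -/
theorem resolventKernel_l2 (h : CenteredKernel μ k s g) : L2Kernel μ (resolventKernel μ k) := by
  obtain ⟨b, hb, hb1, -⟩ := h.minorCoeff_bound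
  have hm : Measurable fun p : ℝ × ℝ => resolventKernel μ k p.1 p.2 := by
    simp only [resolventKernel_eq]
    refine Measurable.const_mul ?_ _
    exact measurable_of_tendsto_metrizable
      (fun N => Finset.measurable_fun_sum (Finset.range N) fun n _ =>
        measurable_integral_bordered h.kern n)
      (tendsto_pi_nhds.2 fun p => (h.summable_minorCoeff p.1 p.2).hasSum.tendsto_sum_nat)
  set C := |-(fredholmDet2 μ fun a b => -k a b)⁻¹| * ∑' n, b n
  have bd : ∀ x y, |resolventKernel μ k x y| ≤
      C * (|k x y| + ‖h.kern.l2.row x‖ * ‖h.col y‖) := by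
    intro x y
    have s1 : Summable fun n => ‖minorCoeff μ k x y n‖ :=
      Summable.of_nonneg_of_le (fun n => norm_nonneg _) (fun n => hb1 n x y) (hb.mul_right _)
    rw [resolventKernel_eq, abs_mul, mul_assoc, ← tsum_mul_right]
    gcongr
    exact (norm_tsum_le_tsum_norm s1).trans (s1.tsum_le_tsum (fun n => hb1 n x y) (hb.mul_right _))
  -- The columns of `k` are the rows of the transposed kernel.
  have hcolm : MemLp (fun y => ‖h.col y‖) 2 μ := by
    have hk' : Measurable fun p : ℝ × ℝ => k p.2 p.1 := h.kern.meas.comp measurable_swap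
    have h' : L2Kernel μ fun y x => k x y := ⟨hk', h.kern.joint.memLp_two.comp_measurePreserving
      Measure.measurePreserving_swap, fun y => (h.kern.right y).memLp_two⟩
    have e : ∀ y, ‖h'.row y‖ = ‖h.col y‖ := fun y => by
      rw [Lp.norm_def, Lp.norm_def, eLpNorm_congr_ae (h.coeFn_col y), L2Kernel.row,
        eLpNorm_congr_ae (h'.left y).coeFn_toLp]
    simpa only [e] using h'.memLp_norm_row
  refine ⟨hm, ?_, fun x => ?_⟩
  · refine MemLp.mono ((h.kern.l2.joint.abs.add (memLp_two_prod_mul h.kern.l2.memLp_norm_row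
      hcolm)).const_mul C) hm.aestronglyMeasurable (ae_of_all _ fun p => ?_)
    exact (bd p.1 p.2).trans (le_abs_self _)
  · refine MemLp.mono (((h.kern.l2.left x).abs.add (hcolm.const_mul ‖h.kern.l2.row x‖)).const_mul C)
      (hm.comp measurable_prodMk_left).aestronglyMeasurable (ae_of_all _ fun y => ?_)
    exact (bd x y).trans (le_abs_self _)

/-- `(id - K)(id - R) = id`. -/
theorem right_inverse (h : CenteredKernel μ k s g) {v : ℝ → ℝ} (hv : MemLp v 2 μ) (x : ℝ) :
    (v x - kernelOp μ (resolventKernel μ k) v x) -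
      kernelOp μ k (fun y => v y - kernelOp μ (resolventKernel μ k) v y) x = v x := by
  set r := resolventKernel μ k
  have hr : L2Kernel μ r := h.resolventKernel_l2
  have hRv := hr.memLp_kernelOp hv
  have h1 : kernelOp μ k (fun y => v y - kernelOp μ r v y) x =
      kernelOp μ k v x - kernelOp μ k (kernelOp μ r v) x := by
    simp only [kernelOp, mul_sub]
    exact integral_sub ((h.kern.l2.left x).integrable_mul hv)
      ((h.kern.l2.left x).integrable_mul hRv)
  have h2 : kernelOp μ r v x = -kernelOp μ k v x + kernelOp μ k (kernelOp μ r v) x := by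
    have hI : Integrable (fun p : ℝ × ℝ => r p.1 p.2 * (k x p.1 * v p.2)) (μ.prod μ) :=
      hr.integrable_mul_mul (h.kern.l2.left x) hv
    have e1 : kernelOp μ k (kernelOp μ r v) x
        = ∫ y, (∫ z, k x z * r z y ∂μ) * v y ∂μ := by
      have a1 : ∀ z, k x z * kernelOp μ r v z = ∫ y, r z y * (k x z * v y) ∂μ := fun z => by
        rw [kernelOp, ← integral_const_mul]
        exact integral_congr_ae (ae_of_all _ fun y => by ring)
      have a2 : ∀ y, (∫ z, k x z * r z y ∂μ) * v y = ∫ z, r z y * (k x z * v y) ∂μ := fun y => by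
        rw [← integral_mul_const]
        exact integral_congr_ae (ae_of_all _ fun y => by ring)
      conv_lhs => rw [kernelOp]
      simp only [a1, a2]
      exact integral_integral_swap hI
    have e2 : ∀ y, (∫ z, k x z * r z y ∂μ) * v y = r x y * v y + k x y * v y := fun y => by
      rw [show r x y = -k x y + ∫ z, k x z * r z y ∂μ from h.resolventKernel_equation x y]; ring
    rw [e1]
    simp only [e2]
    rw [integral_add (f := fun y => r x y * v y) (g := fun y => k x y * v y)
      ((hr.left x).integrable_mul hv) ((h.kern.l2.left x).integrable_mul hv)]
    simp only [kernelOp]; ring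
  rw [h1, h2]; ring

/-- `id - K` is injective. -/
theorem eq_zero_of_eq_kernelOp (h : CenteredKernel μ k s g) {e : ℝ → ℝ} (he : MemLp e 2 μ)
    (hK : e =ᵐ[μ] kernelOp μ k e) : e =ᵐ[μ] 0 := by
  set E := he.toLp e
  set c : ℝ := inner ℝ (oneLp μ) E
  have h1 : E = h.symm_kern.l2.toCLM E + c • h.gLp := by
    rw [gLp, ← MemLp.toLp_const_smul, h.symm_kern.l2.toCLM_toLp he, ← MemLp.toLp_add]
    refine MemLp.toLp_congr _ _ (hK.trans (ae_of_all _ fun x => ?_))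
    simp only [Pi.add_apply, Pi.smul_apply, smul_eq_mul]
    rw [← h.kern.l2.inner_row he, h.row_eq, inner_add_left, real_inner_smul_left,
      h.symm_kern.l2.inner_row he, mul_comm]
  -- Both `S E` and `g` are orthogonal to `1`, hence `E` has mean zero and `E = S E`. Then `‖E‖² =
  -- ⟨S E, E⟩ ≤ 0`.
  have hc : c = 0 := by
    change inner ℝ (oneLp μ) E = 0
    rw [h1, inner_add_right, h.inner_one_toCLM, real_inner_smul_right, h.inner_one_gLp]; simp
  rw [hc, zero_smul, add_zero] at h1
  have h2 := h.inner_toCLM_nonpos E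
  rw [← h1, real_inner_self_eq_norm_sq] at h2
  have h3 : E = 0 := by
    rw [← norm_eq_zero]; exact pow_eq_zero_iff (two_ne_zero) |>.1 (le_antisymm h2 (sq_nonneg _))
  have h4 := he.coeFn_toLp
  rw [show he.toLp e = 0 from h3] at h4
  exact h4.symm.trans (Lp.coeFn_zero _ _ _)

/-- `(id - R)(id - K) = id`. -/
theorem left_inverse (h : CenteredKernel μ k s g) {v : ℝ → ℝ} (hv : MemLp v 2 μ) :
    (fun x => (v x - kernelOp μ k v x) -
      kernelOp μ (resolventKernel μ k) (fun y => v y - kernelOp μ k v y) x) =ᵐ[μ] v := by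
  set r := resolventKernel μ k
  have hr : L2Kernel μ r := h.resolventKernel_l2
  set u := fun y => v y - kernelOp μ k v y
  have hu : MemLp u 2 μ := hv.sub (h.kern.l2.memLp_kernelOp hv)
  -- The right inverse gives `(id - K) z = (id - K) v` for `z = (id - R)(id - K) v`, and injectivity
  -- of `id - K` yields `z = v`.
  set z := fun y => u y - kernelOp μ r u y
  have hz : MemLp z 2 μ := hu.sub (hr.memLp_kernelOp hu)
  have h1 : ∀ x, z x - kernelOp μ k z x = u x := fun x => h.right_inverse hu x
  have h2 := h.eq_zero_of_eq_kernelOp (hz.sub hv) (ae_of_all _ fun x => by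
    have : kernelOp μ k (z - v) x = kernelOp μ k z x - kernelOp μ k v x := by
      simp only [kernelOp, Pi.sub_apply, mul_sub]
      exact integral_sub ((h.kern.l2.left x).integrable_mul hz)
        ((h.kern.l2.left x).integrable_mul hv)
    rw [this, Pi.sub_apply]
    have := h1 x
    simp only [u] at this
    linarith)
  filter_upwards [h2] with x hx
  simpa [sub_eq_zero] using hx

end CenteredKernel

/-! ### The logarithmic singularity -/

/-- The negative part of `ln |t|`. -/
noncomputable def logNeg (t : ℝ) : ℝ := max 0 (-Real.log |t|)

theorem logNeg_nonneg (t : ℝ) : 0 ≤ logNeg t := le_max_left _ _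

theorem measurable_logNeg : Measurable logNeg := by
  unfold logNeg; fun_prop

theorem integrable_logNeg : Integrable logNeg := by
  have h : logNeg = indicator (Ioc (-1) 1) fun t => -Real.log t := by
    funext t
    rw [logNeg, Real.log_abs]
    by_cases ht : t ∈ Ioc (-1 : ℝ) 1
    · rw [indicator_of_mem ht, max_eq_right]
      rw [← Real.log_abs]
      exact neg_nonneg.2 (Real.log_nonpos (abs_nonneg _) (abs_le.2 ⟨ht.1.le, ht.2⟩))
    · rw [indicator_of_notMem ht, max_eq_left]
      rw [← Real.log_abs, neg_nonpos]
      apply Real.log_nonneg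
      by_contra h1
      push Not at h1
      exact ht ⟨(abs_lt.1 h1).1, (abs_lt.1 h1).2.le⟩
  rw [h, integrable_indicator_iff measurableSet_Ioc]
  have := (intervalIntegral.intervalIntegrable_log' (a := -1) (b := 1)).1
  exact this.neg

theorem log_abs_sub_le (x y : ℝ) :
    Real.log |x - y| ≤ Real.log (1 + |x|) + Real.log (1 + |y|) := by
  rw [← Real.log_mul (by positivity) (by positivity)]
  rcases eq_or_ne (x - y) 0 with h | h
  · rw [h]; simp only [abs_zero, Real.log_zero]
    exact Real.log_nonneg (by nlinarith [abs_nonneg x, abs_nonneg y])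
  · apply Real.log_le_log (abs_pos.2 h)
    have := abs_sub x y
    nlinarith [abs_nonneg x, abs_nonneg y, mul_nonneg (abs_nonneg x) (abs_nonneg y)]

theorem log_one_add_abs_nonneg (x : ℝ) : 0 ≤ Real.log (1 + |x|) :=
  Real.log_nonneg (by linarith [abs_nonneg x])

theorem abs_log_abs_sub_le (x y : ℝ) :
    |Real.log (|x - y|)| ≤ Real.log (1 + |x|) + Real.log (1 + |y|) + logNeg (x - y) := by
  have h1 := log_abs_sub_le x y
  have h2 := logNeg_nonneg (x - y)
  have h3 : -Real.log |x - y| ≤ logNeg (x - y) := le_max_right _ _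
  have h4 := log_one_add_abs_nonneg x
  have h5 := log_one_add_abs_nonneg y
  exact abs_le.2 ⟨by linarith, by linarith⟩

theorem measurable_log_abs_sub : Measurable fun p : ℝ × ℝ => Real.log |p.1 - p.2| := by
  fun_prop

theorem integrable_comp_sub {f g : ℝ → ℝ} (hf : Integrable f) (hg : Integrable g) :
    Integrable fun p : ℝ × ℝ => f p.1 * g (p.1 - p.2) := by
  have h := (Integrable.mul_prod hf hg)
  have mp : MeasurePreserving (fun p : ℝ × ℝ => (p.1, p.1 - p.2)) (volume.prod volume)
      (volume.prod volume) := by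
    have := (MeasurePreserving.id (volume : Measure ℝ)).skew_product
      (g := fun x y => x - y) (by fun_prop) (ae_of_all _ fun x => by
        exact (Measure.measurePreserving_sub_left volume x).map_eq)
    exact this
  exact mp.integrable_comp_of_integrable h

/-- Integrability of the logarithmic kernel against densities with finite logarithmic moments. -/
theorem integrable_log_mul {σ τ : ℝ → ℝ} {M : ℝ} (hσ : Integrable σ) (hτ : Integrable τ)
    (hσl : Integrable fun x => σ x * Real.log (1 + |x|))
    (hτl : Integrable fun x => τ x * Real.log (1 + |x|)) (hM : ∀ᵐ x, |τ x| ≤ M) :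
    Integrable fun p : ℝ × ℝ => σ p.1 * τ p.2 * Real.log |p.1 - p.2| := by
  have h1 := (Integrable.mul_prod hσl hτ).abs
  have h2 := (Integrable.mul_prod hσ hτl).abs
  have h3 := ((integrable_comp_sub hσ integrable_logNeg).const_mul M).abs
  refine ((h1.add h2).add h3).mono' ?_ ?_
  · exact (hσ.1.comp_fst.mul hτ.1.comp_snd).mul measurable_log_abs_sub.aestronglyMeasurable
  · have hM' : ∀ᵐ p : ℝ × ℝ ∂(volume.prod volume), |τ p.2| ≤ M :=
      Measure.quasiMeasurePreserving_snd.ae hM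
    filter_upwards [hM'] with p hp
    have h4 := abs_log_abs_sub_le p.1 p.2
    have hM0 : 0 ≤ M := (abs_nonneg _).trans hp
    simp only [Pi.add_apply, norm_mul, Real.norm_eq_abs, abs_mul, abs_of_nonneg hM0,
      abs_of_nonneg (log_one_add_abs_nonneg _), abs_of_nonneg (logNeg_nonneg _)]
    calc |σ p.1| * |τ p.2| * |Real.log (|p.1 - p.2|)|
        ≤ |σ p.1| * |τ p.2| * (Real.log (1 + |p.1|) + Real.log (1 + |p.2|)
          + logNeg (p.1 - p.2)) := by gcongr
      _ = |σ p.1| * Real.log (1 + |p.1|) * |τ p.2| + |σ p.1| * (|τ p.2| * Real.log (1 + |p.2|))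
          + |σ p.1| * logNeg (p.1 - p.2) * |τ p.2| := by ring
      _ ≤ |σ p.1| * Real.log (1 + |p.1|) * |τ p.2| + |σ p.1| * (|τ p.2| * Real.log (1 + |p.2|))
          + |σ p.1| * logNeg (p.1 - p.2) * M := by
          gcongr
          exact mul_nonneg (abs_nonneg _) (logNeg_nonneg _)
      _ = _ := by ring

/-! ### The energy of a density -/

/-- The measure with density `σ`. -/
noncomputable def densMeasure (σ : ℝ → ℝ) : Measure ℝ :=
  volume.withDensity fun x => ENNReal.ofReal (σ x)

/-- Probability densities of finite energy. -/
structure FiniteEnergyDensity (V σ : ℝ → ℝ) : Prop where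
  meas : Measurable σ
  nonneg : ∀ x, 0 ≤ σ x
  integrable : Integrable σ
  mass : ∫ x, σ x = 1
  potential : Integrable fun x => σ x * V x
  entropy : Integrable fun x => σ x * Real.log (σ x)
  interaction : Integrable fun p : ℝ × ℝ => σ p.1 * σ p.2 * Real.log |p.1 - p.2|

/-- The energy of a density. -/
noncomputable def densEnergy (V : ℝ → ℝ) (P : ℝ) (σ : ℝ → ℝ) : ℝ :=
  (∫ x, σ x * V x) + (∫ x, σ x * Real.log (σ x)) -
    P * ∫ p : ℝ × ℝ, σ p.1 * σ p.2 * Real.log |p.1 - p.2|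

section densMeasure

variable {σ : ℝ → ℝ}

theorem integrable_densMeasure_iff (hm : Measurable σ) (h0 : ∀ x, 0 ≤ σ x) (f : ℝ → ℝ) :
    Integrable f (densMeasure σ) ↔ Integrable fun x => σ x * f x := by
  rw [densMeasure, integrable_withDensity_iff_integrable_smul' (by fun_prop) (by simp)]
  simp only [ENNReal.toReal_ofReal (h0 _), smul_eq_mul]

theorem integral_densMeasure (hm : Measurable σ) (h0 : ∀ x, 0 ≤ σ x) (f : ℝ → ℝ) :
    ∫ x, f x ∂(densMeasure σ) = ∫ x, σ x * f x := by
  rw [densMeasure, integral_withDensity_eq_integral_toReal_smul (by fun_prop) (by simp)]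
  simp only [ENNReal.toReal_ofReal (h0 _), smul_eq_mul]

theorem isProbabilityMeasure_densMeasure (h0 : ∀ x, 0 ≤ σ x) (hi : Integrable σ)
    (h1 : ∫ x, σ x = 1) : IsProbabilityMeasure (densMeasure σ) := by
  refine ⟨?_⟩
  rw [densMeasure, withDensity_apply _ MeasurableSet.univ, Measure.restrict_univ,
    ← ofReal_integral_eq_lintegral_ofReal hi (ae_of_all _ h0), h1, ENNReal.ofReal_one]

theorem lebDensity_densMeasure (hm : Measurable σ) (h0 : ∀ x, 0 ≤ σ x) :
    lebDensity (densMeasure σ) =ᵐ[volume] σ := by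
  have := Measure.rnDeriv_withDensity volume (f := fun x => ENNReal.ofReal (σ x)) (by fun_prop)
  filter_upwards [this] with x hx
  rw [lebDensity, densMeasure, hx, ENNReal.toReal_ofReal (h0 x)]

theorem densMeasure_prod (hm : Measurable σ) : (densMeasure σ).prod (densMeasure σ) =
    (volume.prod volume).withDensity
      fun p : ℝ × ℝ => ENNReal.ofReal (σ p.1) * ENNReal.ofReal (σ p.2) := by
  rw [densMeasure, prod_withDensity (by fun_prop) (by fun_prop)]

theorem integrable_densMeasure_prod_iff (hm : Measurable σ) (h0 : ∀ x, 0 ≤ σ x) (f : ℝ × ℝ → ℝ) :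
    Integrable f ((densMeasure σ).prod (densMeasure σ)) ↔
      Integrable (fun p => σ p.1 * σ p.2 * f p) (volume.prod volume) := by
  rw [densMeasure_prod hm, integrable_withDensity_iff_integrable_smul' (by fun_prop)
    (ae_of_all _ fun p => ENNReal.mul_lt_top (by simp) (by simp))]
  simp only [ENNReal.toReal_mul, ENNReal.toReal_ofReal (h0 _), smul_eq_mul]

theorem integral_densMeasure_prod (hm : Measurable σ) (h0 : ∀ x, 0 ≤ σ x) (f : ℝ × ℝ → ℝ) :
    ∫ p, f p ∂((densMeasure σ).prod (densMeasure σ)) =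
      ∫ p : ℝ × ℝ, σ p.1 * σ p.2 * f p ∂(volume.prod volume) := by
  rw [densMeasure_prod hm, integral_withDensity_eq_integral_toReal_smul (by fun_prop)
    (ae_of_all _ fun p => ENNReal.mul_lt_top (by simp) (by simp))]
  simp only [ENNReal.toReal_mul, ENNReal.toReal_ofReal (h0 _), smul_eq_mul]

theorem FiniteEnergyDensity.freeEnergy_eq {V : ℝ → ℝ} (h : FiniteEnergyDensity V σ) (P : ℝ) :
    freeEnergy V P (densMeasure σ) = (densEnergy V P σ : ℝ) := by
  have hd := lebDensity_densMeasure h.meas h.nonneg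
  have hac : densMeasure σ ≪ volume := withDensity_absolutelyContinuous _ _
  have hl : (fun x => Real.log (lebDensity (densMeasure σ) x)) =ᵐ[densMeasure σ]
      fun x => Real.log (σ x) := hac.ae_le (hd.mono fun x hx => by simp only [hx])
  have i1 : Integrable V (densMeasure σ) :=
    (integrable_densMeasure_iff h.meas h.nonneg _).2 h.potential
  have i2 : Integrable (fun x => Real.log (lebDensity (densMeasure σ) x)) (densMeasure σ) :=
    ((integrable_densMeasure_iff h.meas h.nonneg _).2 h.entropy).congr hl.symm
  rw [freeEnergy, if_pos]
  · rw [densEnergy, integral_add i1 i2, integral_congr_ae hl,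
      integral_densMeasure h.meas h.nonneg, integral_densMeasure h.meas h.nonneg,
      integral_densMeasure_prod h.meas h.nonneg]
    rfl
  · exact ⟨hac, i1, i2, (integrable_densMeasure_prod_iff h.meas h.nonneg _).2 h.interaction⟩

end densMeasure

theorem measurable_lebDensity (μ : Measure ℝ) : Measurable (lebDensity μ) :=
  (Measure.measurable_rnDeriv μ volume).ennreal_toReal

theorem densMeasure_lebDensity {μ : Measure ℝ} [IsProbabilityMeasure μ] (h : μ ≪ volume) :
    densMeasure (lebDensity μ) = μ := by
  have h1 : (fun x => ENNReal.ofReal (lebDensity μ x)) =ᵐ[volume] μ.rnDeriv volume := by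
    filter_upwards [Measure.rnDeriv_lt_top μ volume] with x hx
    rw [lebDensity, ENNReal.ofReal_toReal hx.ne]
  rw [densMeasure, withDensity_congr_ae h1, Measure.withDensity_rnDeriv_eq _ _ h]

/-- A competitor of finite energy, which forces the minimal energy to be different from `⊤`. -/
theorem finiteEnergyDensity_uniform {V : ℝ → ℝ} (hV : Continuous V) :
    FiniteEnergyDensity V (indicator (Icc 0 1) fun _ => 1) := by
  have hi : ∀ f : ℝ → ℝ, Continuous f →
      Integrable fun x => (indicator (Icc (0 : ℝ) 1) (fun _ => (1 : ℝ)) x) * f x := by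
    intro f hf
    have : (fun x => (indicator (Icc (0 : ℝ) 1) (fun _ => (1 : ℝ)) x) * f x)
        = indicator (Icc 0 1) f := by
      funext x
      by_cases hx : x ∈ Icc (0 : ℝ) 1 <;> simp [hx]
    rw [this, integrable_indicator_iff measurableSet_Icc]
    exact hf.continuousOn.integrableOn_Icc
  have h1 : Integrable (indicator (Icc (0 : ℝ) 1) fun _ => (1 : ℝ)) := by
    simpa using hi (fun _ => 1) continuous_const
  have hl := hi (fun x => Real.log (1 + |x|))
    ((continuous_const.add continuous_abs).log fun x => (by positivity : (1 + |x| : ℝ) ≠ 0))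
  refine ⟨measurable_const.indicator measurableSet_Icc,
    fun x => indicator_nonneg (fun _ _ => zero_le_one) x, h1, ?_, hi V hV, ?_,
    integrable_log_mul (M := 1) h1 h1 hl hl (ae_of_all _ fun x => ?_)⟩
  · rw [integral_indicator measurableSet_Icc]; simp
  · have : (fun x => (indicator (Icc (0 : ℝ) 1) (fun _ => (1 : ℝ)) x) *
        Real.log (indicator (Icc (0 : ℝ) 1) (fun _ => (1 : ℝ)) x)) = fun _ => 0 := by
      funext x
      by_cases hx : x ∈ Icc (0 : ℝ) 1 <;> simp [hx]
    rw [this]; exact integrable_zero _ _ _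
  · by_cases hx : x ∈ Icc (0 : ℝ) 1 <;> simp [hx]

/-- The density of the equilibrium measure has finite energy and minimises the energy. -/
theorem IsEquilibriumMeasure.density {V : ℝ → ℝ} {P : ℝ} {μ : Measure ℝ} [IsProbabilityMeasure μ]
    (hμ : IsEquilibriumMeasure V P μ) (hV : Continuous V) :
    μ ≪ volume ∧ FiniteEnergyDensity V (lebDensity μ) ∧
      ∀ σ, FiniteEnergyDensity V σ → densEnergy V P (lebDensity μ) ≤ densEnergy V P σ := by
  have hle : ∀ σ, FiniteEnergyDensity V σ → freeEnergy V P μ ≤ (densEnergy V P σ : ℝ) :=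
    fun σ hσ => by
      rw [← hσ.freeEnergy_eq]
      exact hμ.2 _ (isProbabilityMeasure_densMeasure hσ.nonneg hσ.integrable hσ.mass)
  have hfin : HasFiniteEnergy V μ := by
    by_contra h
    have := hle _ (finiteEnergyDensity_uniform hV)
    rw [freeEnergy, if_neg h, top_le_iff] at this
    exact EReal.coe_ne_top _ this
  obtain ⟨hac, i1, i2, i3⟩ := hfin
  have hm := measurable_lebDensity μ
  have h0 : ∀ x, 0 ≤ lebDensity μ x := fun x => ENNReal.toReal_nonneg
  have hd := densMeasure_lebDensity hac
  have hρ : FiniteEnergyDensity V (lebDensity μ) := by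
    have hint : Integrable (lebDensity μ) := Measure.integrable_toReal_rnDeriv
    refine ⟨hm, h0, hint, ?_, ?_, ?_, ?_⟩
    · have := integral_densMeasure hm h0 fun _ => 1
      rw [hd] at this
      simpa using this.symm
    · rw [← integrable_densMeasure_iff hm h0, hd]; exact i1
    · rw [← integrable_densMeasure_iff hm h0, hd]; exact i2
    · have := (integrable_densMeasure_prod_iff hm h0 fun p => Real.log |p.1 - p.2|).1
      rw [hd] at this
      exact this i3
  refine ⟨hac, hρ, fun σ hσ => ?_⟩
  have h1 := hρ.freeEnergy_eq P
  rw [hd] at h1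
  have h2 := hle σ hσ
  rw [h1] at h2
  exact EReal.coe_le_coe_iff.1 h2

theorem exists_forall_le_of_cocompact {h : ℝ → ℝ} (hc : Continuous h) {C : ℝ}
    (hC : ∀ᶠ x in cocompact ℝ, h x ≤ C) : ∃ D, ∀ x, h x ≤ D := by
  obtain ⟨K, hK, hKs⟩ := mem_cocompact.1 hC
  obtain ⟨D, hD⟩ := hK.bddAbove_image hc.continuousOn
  refine ⟨max C D, fun x => ?_⟩
  by_cases hx : x ∈ K
  · exact (hD (mem_image_of_mem h hx)).trans (le_max_right _ _)
  · exact (hKs hx : h x ≤ C).trans (le_max_left _ _)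

/-- The decay assumption with `Q = 1` bounds `exp (-V x)` by a power of `|x|` near infinity. The
exponent `k + 1` keeps `α` positive also when `k = 0`. -/
theorem PotentialAssumptions.log_le {V : ℝ → ℝ} {μ : Measure ℝ} (hV : PotentialAssumptions V μ)
    (k : ℕ) : ∃ C, ∀ x, k * Real.log (1 + |x|) ≤ V x + C := by
  have hc : Continuous fun x => k * Real.log (1 + |x|) - V x :=
    (continuous_const.mul ((continuous_const.add continuous_abs).log
      fun x => (by positivity : (1 + |x| : ℝ) ≠ 0))).sub hV.contDiff.continuous
  have hd := hV.decay 1 (k + 1) (by positivity)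
  have h1 := hd.def (c := 1) one_pos
  have h2 : ∀ᶠ x : ℝ in cocompact ℝ, 1 ≤ |x| := by
    have := tendsto_norm_cocompact_atTop (E := ℝ)
    exact this.eventually_ge_atTop 1
  obtain ⟨D, hD⟩ := exists_forall_le_of_cocompact hc (C := k * Real.log 2) <| by
    filter_upwards [h1, h2] with x hx hx1
    have hx0 : 0 < |x| := by linarith
    simp only [Polynomial.eval_one, one_mul, Real.norm_eq_abs, Real.abs_exp,
      abs_of_nonneg (Real.rpow_nonneg (abs_nonneg x) _)] at hx
    have h3 : -V x ≤ -(k + 1) * Real.log (|x|) := by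
      rw [← Real.log_exp (-V x), ← Real.log_rpow hx0]
      exact Real.log_le_log (Real.exp_pos _) hx
    have h4 : Real.log (1 + |x|) ≤ Real.log 2 + Real.log (|x|) := by
      rw [← Real.log_mul (by norm_num) hx0.ne']
      exact Real.log_le_log (by linarith) (by linarith)
    have h5 := Real.log_nonneg hx1
    have : (k : ℝ) * Real.log (1 + |x|) ≤ k * (Real.log 2 + Real.log (|x|)) := by gcongr
    nlinarith
  exact ⟨D, fun x => by linarith [hD x]⟩

/-! ### The Euler-Lagrange equation -/

section EulerLagrange

variable {V : ℝ → ℝ} {P : ℝ} {μ : Measure ℝ} [IsProbabilityMeasure μ]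

theorem FiniteEnergyDensity.of_lebDensity (hac : μ ≪ volume)
    (h : FiniteEnergyDensity V (lebDensity μ)) :
    Integrable V μ ∧ Integrable (fun x => Real.log (lebDensity μ x)) μ ∧
      Integrable (fun p : ℝ × ℝ => Real.log |p.1 - p.2|) (μ.prod μ) := by
  have hm := measurable_lebDensity μ
  have h0 : ∀ x, 0 ≤ lebDensity μ x := fun x => ENNReal.toReal_nonneg
  have hd := densMeasure_lebDensity hac
  refine ⟨?_, ?_, ?_⟩
  · rw [← hd, integrable_densMeasure_iff hm h0]; exact h.potential
  · have := (integrable_densMeasure_iff hm h0 fun x => Real.log (lebDensity μ x)).2 h.entropy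
    rwa [hd] at this
  · have := (integrable_densMeasure_prod_iff hm h0 fun p => Real.log |p.1 - p.2|).2 h.interaction
    rwa [hd] at this

theorem integrable_lebDensity_mul_iff (hac : μ ≪ volume) (f : ℝ → ℝ) :
    Integrable (fun x => lebDensity μ x * f x) ↔ Integrable f μ := by
  have := integrable_densMeasure_iff (measurable_lebDensity μ)
    (fun x => ENNReal.toReal_nonneg) f
  rw [densMeasure_lebDensity hac] at this
  exact this.symm

theorem integral_lebDensity_mul (hac : μ ≪ volume) (f : ℝ → ℝ) :
    ∫ x, lebDensity μ x * f x = ∫ x, f x ∂μ := by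
  have := integral_densMeasure (measurable_lebDensity μ)
    (fun x => ENNReal.toReal_nonneg) f
  rw [densMeasure_lebDensity hac] at this
  exact this.symm

theorem integrable_lebDensity_prod_mul_iff (hac : μ ≪ volume) (f : ℝ × ℝ → ℝ) :
    Integrable (fun p : ℝ × ℝ => lebDensity μ p.1 * lebDensity μ p.2 * f p)
      (volume.prod volume) ↔ Integrable f (μ.prod μ) := by
  have := integrable_densMeasure_prod_iff (measurable_lebDensity μ)
    (fun x => ENNReal.toReal_nonneg) f
  rw [densMeasure_lebDensity hac] at this
  exact this.symm

theorem integral_lebDensity_prod_mul (hac : μ ≪ volume) (f : ℝ × ℝ → ℝ) :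
    ∫ p : ℝ × ℝ, lebDensity μ p.1 * lebDensity μ p.2 * f p ∂(volume.prod volume)
      = ∫ p, f p ∂(μ.prod μ) := by
  have := integral_densMeasure_prod (measurable_lebDensity μ)
    (fun x => ENNReal.toReal_nonneg) f
  rw [densMeasure_lebDensity hac] at this
  exact this.symm

theorem MeasureTheory.Integrable.mul_of_abs_le {α : Type*} [MeasurableSpace α] {ν : Measure α}
    {f w : α → ℝ} (hf : Integrable f ν) (hw : Measurable w) {C : ℝ} (hC : ∀ x, |w x| ≤ C) :
    Integrable (fun x => w x * f x) ν :=
  hf.bdd_mul hw.aestronglyMeasurable (ae_of_all _ hC)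

/-- For a multiplicative perturbation of the density the entropy splits through `ln (ρ w) = ln ρ +
ln w`. The bounds on `w` keep all integrals convergent. -/
theorem densEnergy_mul (hac : μ ≪ volume) (h : FiniteEnergyDensity V (lebDensity μ)) (P : ℝ)
    {w : ℝ → ℝ} (hw : Measurable w) (h1 : ∀ x, 1 / 2 ≤ w x) (h2 : ∀ x, w x ≤ 2)
    (hmass : ∫ x, w x ∂μ = 1) :
    FiniteEnergyDensity V (fun x => lebDensity μ x * w x) ∧
    densEnergy V P (fun x => lebDensity μ x * w x) =
      (∫ x, w x * V x ∂μ) + ((∫ x, w x * Real.log (lebDensity μ x) ∂μ)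
        + ∫ x, w x * Real.log (w x) ∂μ)
      - P * ∫ p : ℝ × ℝ, w p.1 * w p.2 * Real.log |p.1 - p.2| ∂(μ.prod μ) := by
  obtain ⟨i1, i2, i3⟩ := h.of_lebDensity hac
  have hwb : ∀ x, |w x| ≤ 2 := fun x => abs_le.2 ⟨by linarith [h1 x], h2 x⟩
  have hlb : ∀ x, |w x * Real.log (w x)| ≤ 4 := fun x => by
    have hp : 0 < w x := by linarith [h1 x]
    have a1 := Real.log_le_sub_one_of_pos hp
    have a2 := Real.one_sub_inv_le_log_of_pos hp
    have a3 : (w x)⁻¹ ≤ 2 := by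
      rw [inv_le_comm₀ hp (by norm_num)]; linarith [h1 x]
    rw [abs_mul]
    have a4 : |Real.log (w x)| ≤ 1 := abs_le.2 ⟨by linarith, by linarith [h2 x]⟩
    calc |w x| * |Real.log (w x)| ≤ 2 * 1 := by gcongr; exact hwb x
      _ ≤ 4 := by norm_num
  have j1 := i1.mul_of_abs_le hw hwb
  have j2 := i2.mul_of_abs_le hw hwb
  have j4 : Integrable (fun x => w x * Real.log (w x)) μ :=
    Integrable.of_bound (by fun_prop) 4 (ae_of_all _ hlb)
  have j3 : Integrable (fun p : ℝ × ℝ => w p.1 * w p.2 * Real.log |p.1 - p.2|) (μ.prod μ) :=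
    i3.mul_of_abs_le (w := fun p : ℝ × ℝ => w p.1 * w p.2) (by fun_prop) (C := 2 * 2)
      fun p => by rw [abs_mul]; exact mul_le_mul (hwb _) (hwb _) (abs_nonneg _) (by norm_num)
  have j5 : Integrable w μ := Integrable.of_bound (by fun_prop) 2 (ae_of_all _ hwb)
  have e2 : (fun x => lebDensity μ x * w x * Real.log (lebDensity μ x * w x)) =
      fun x => lebDensity μ x * (w x * Real.log (lebDensity μ x) + w x * Real.log (w x)) := by
    funext x
    -- Where the density vanishes, `Real.log 0 = 0` breaks the splitting of the logarithm, but the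
    -- prefactor is zero.
    rcases eq_or_ne (lebDensity μ x) 0 with hx | hx
    · rw [hx]; ring
    · rw [Real.log_mul hx (by linarith [h1 x])]; ring
  have e1 : (fun x => lebDensity μ x * w x * V x) = fun x => lebDensity μ x * (w x * V x) := by
    funext x; ring
  have e3 : (fun p : ℝ × ℝ => lebDensity μ p.1 * w p.1 * (lebDensity μ p.2 * w p.2)
      * Real.log |p.1 - p.2|) = fun p : ℝ × ℝ => lebDensity μ p.1 * lebDensity μ p.2 *
        (w p.1 * w p.2 * Real.log |p.1 - p.2|) := by
    funext p; ring
  constructor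
  · refine ⟨(measurable_lebDensity μ).mul hw,
      fun x => mul_nonneg ENNReal.toReal_nonneg (by linarith [h1 x]),
      (integrable_lebDensity_mul_iff hac _).2 j5, ?_, ?_, ?_, ?_⟩
    · rw [integral_lebDensity_mul hac, hmass]
    · rw [e1]; exact (integrable_lebDensity_mul_iff hac _).2 j1
    · rw [e2]; exact (integrable_lebDensity_mul_iff hac _).2 (j2.add j4)
    · rw [e3]; exact (integrable_lebDensity_prod_mul_iff hac _).2 j3
  · have e4 := integral_lebDensity_prod_mul hac
      (fun p : ℝ × ℝ => w p.1 * w p.2 * Real.log |p.1 - p.2|)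
    rw [densEnergy, e1, e2, e3, integral_lebDensity_mul hac, integral_lebDensity_mul hac,
      ← integral_add j2 j4, ← e4]
    rfl

/-- The competitor is `ρ (1 + εφ)`. Potential and interaction are polynomials in `ε`, and `t ln t ≤
t (t - 1)` bounds the extra entropy by `ε²` because `φ` has mean zero. -/
theorem energy_first_variation (hac : μ ≪ volume) (h : FiniteEnergyDensity V (lebDensity μ))
    (hmin : ∀ σ, FiniteEnergyDensity V σ → densEnergy V P (lebDensity μ) ≤ densEnergy V P σ)
    {φ : ℝ → ℝ} (hφ : Measurable φ) (hφ1 : ∀ x, |φ x| ≤ 1) (hφ0 : ∫ x, φ x ∂μ = 0) :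
    ∃ B, ∀ ε : ℝ, |ε| ≤ 1 / 2 → 0 ≤ ε * (∫ x, φ x * (V x + Real.log (lebDensity μ x)
      - 2 * P * ∫ y, Real.log |x - y| ∂μ) ∂μ) + ε ^ 2 * B := by
  obtain ⟨i1, i2, i3⟩ := h.of_lebDensity hac
  have iφ : Integrable φ μ := Integrable.of_bound (by fun_prop) 1 (ae_of_all _ hφ1)
  have j1 := i1.mul_of_abs_le hφ hφ1
  have j2 := i2.mul_of_abs_le hφ hφ1
  have j3 : Integrable (fun p : ℝ × ℝ => φ p.1 * Real.log |p.1 - p.2|) (μ.prod μ) :=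
    i3.mul_of_abs_le (w := fun p : ℝ × ℝ => φ p.1) (by fun_prop) fun p => hφ1 p.1
  have j4 : Integrable (fun p : ℝ × ℝ => φ p.2 * Real.log |p.1 - p.2|) (μ.prod μ) :=
    i3.mul_of_abs_le (w := fun p : ℝ × ℝ => φ p.2) (by fun_prop) fun p => hφ1 p.2
  have j5 : Integrable (fun p : ℝ × ℝ => φ p.1 * φ p.2 * Real.log |p.1 - p.2|) (μ.prod μ) :=
    i3.mul_of_abs_le (w := fun p : ℝ × ℝ => φ p.1 * φ p.2) (by fun_prop) (C := 1 * 1) fun p => by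
      rw [abs_mul]; exact mul_le_mul (hφ1 _) (hφ1 _) (abs_nonneg _) (by norm_num)
  have e34 : ∫ p : ℝ × ℝ, φ p.2 * Real.log |p.1 - p.2| ∂(μ.prod μ)
      = ∫ p : ℝ × ℝ, φ p.1 * Real.log |p.1 - p.2| ∂(μ.prod μ) := by
    rw [← integral_prod_swap]
    simp only [Prod.fst_swap, Prod.snd_swap, abs_sub_comm]
  have j6 : Integrable (fun x => φ x * ∫ y, Real.log |x - y| ∂μ) μ := by
    have := j3.integral_prod_left
    simpa only [integral_const_mul] using this
  have e3 : ∫ p : ℝ × ℝ, φ p.1 * Real.log |p.1 - p.2| ∂(μ.prod μ)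
      = ∫ x, φ x * ∫ y, Real.log |x - y| ∂μ ∂μ := by
    rw [integral_prod _ j3]
    simp only [integral_const_mul]
  have eA : ∫ x, φ x * (V x + Real.log (lebDensity μ x)
      - 2 * P * ∫ y, Real.log |x - y| ∂μ) ∂μ = (∫ x, φ x * V x ∂μ)
      + (∫ x, φ x * Real.log (lebDensity μ x) ∂μ)
      - 2 * P * ∫ p : ℝ × ℝ, φ p.1 * Real.log |p.1 - p.2| ∂(μ.prod μ) := by
    have j12 : Integrable (fun x => φ x * V x + φ x * Real.log (lebDensity μ x)) μ := j1.add j2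
    rw [e3, ← integral_const_mul, ← integral_add j1 j2, ← integral_sub j12 (j6.const_mul _)]
    congr 1; funext x; ring
  set A := ∫ x, φ x * (V x + Real.log (lebDensity μ x)
      - 2 * P * ∫ y, Real.log |x - y| ∂μ) ∂μ with hA
  refine ⟨1 - P * ∫ p : ℝ × ℝ, φ p.1 * φ p.2 * Real.log |p.1 - p.2| ∂(μ.prod μ), fun ε hε => ?_⟩
  have hεφ : ∀ x, |ε * φ x| ≤ 1 / 2 := fun x => by
    rw [abs_mul]
    calc |ε| * |φ x| ≤ 1 / 2 * 1 := mul_le_mul hε (hφ1 x) (abs_nonneg _) (by norm_num)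
      _ = _ := by norm_num
  set w : ℝ → ℝ := fun x => 1 + ε * φ x with hw
  have hwm : Measurable w := by fun_prop
  have w1 : ∀ x, 1 / 2 ≤ w x := fun x => by have := (abs_le.1 (hεφ x)).1; simp only [hw]; linarith
  have w2 : ∀ x, w x ≤ 2 := fun x => by have := (abs_le.1 (hεφ x)).2; simp only [hw]; linarith
  have hmass : ∫ x, w x ∂μ = 1 := by
    simp only [hw]
    rw [integral_add (integrable_const _) (iφ.const_mul _), integral_const_mul, hφ0]; simp
  obtain ⟨f1, f2⟩ := densEnergy_mul hac h P hwm w1 w2 hmass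
  have f0 := (densEnergy_mul hac h P (w := fun _ => 1) measurable_const (by norm_num)
    (by norm_num) (by simp)).2
  have hle := hmin _ f1
  simp only [mul_one, one_mul, Real.log_one, mul_zero, integral_zero, add_zero] at f0
  rw [f0, f2] at hle
  have g1 : ∫ x, w x * V x ∂μ = (∫ x, V x ∂μ) + ε * ∫ x, φ x * V x ∂μ := by
    rw [← integral_const_mul, ← integral_add i1 (j1.const_mul _)]
    congr 1; funext x; simp only [hw]; ring
  have g2 : ∫ x, w x * Real.log (lebDensity μ x) ∂μ = (∫ x, Real.log (lebDensity μ x) ∂μ)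
      + ε * ∫ x, φ x * Real.log (lebDensity μ x) ∂μ := by
    rw [← integral_const_mul, ← integral_add i2 (j2.const_mul _)]
    congr 1; funext x; simp only [hw]; ring
  have g3 : ∫ p : ℝ × ℝ, w p.1 * w p.2 * Real.log |p.1 - p.2| ∂(μ.prod μ)
      = (∫ p : ℝ × ℝ, Real.log |p.1 - p.2| ∂(μ.prod μ))
        + ε * (2 * ∫ p : ℝ × ℝ, φ p.1 * Real.log |p.1 - p.2| ∂(μ.prod μ))
        + ε ^ 2 * ∫ p : ℝ × ℝ, φ p.1 * φ p.2 * Real.log |p.1 - p.2| ∂(μ.prod μ) := by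
    rw [two_mul]
    nth_rewrite 2 [← e34]
    have j34 : Integrable (fun p : ℝ × ℝ => ε * (φ p.1 * Real.log |p.1 - p.2|
      + φ p.2 * Real.log |p.1 - p.2|)) (μ.prod μ) := (j3.add j4).const_mul _
    have j345 : Integrable (fun p : ℝ × ℝ => Real.log |p.1 - p.2| + ε * (φ p.1 *
      Real.log |p.1 - p.2| + φ p.2 * Real.log |p.1 - p.2|)) (μ.prod μ) := i3.add j34
    rw [← integral_add j3 j4, ← integral_const_mul, ← integral_const_mul, ← integral_add i3 j34,
      ← integral_add j345 (j5.const_mul _)]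
    congr 1; funext p; simp only [hw]; ring
  have g4 : ∫ x, w x * Real.log (w x) ∂μ ≤ ε ^ 2 := by
    have hb : ∀ x, w x * Real.log (w x) ≤ ε * φ x + ε ^ 2 := fun x => by
      have hp : 0 < w x := by linarith [w1 x]
      have a1 := mul_le_mul_of_nonneg_left (Real.log_le_sub_one_of_pos hp) hp.le
      have a2 : φ x ^ 2 ≤ 1 := (sq_le_one_iff_abs_le_one _).2 (hφ1 x)
      have a3 : ε ^ 2 * φ x ^ 2 ≤ ε ^ 2 * 1 := by gcongr
      calc _ ≤ _ := a1
        _ = ε * φ x + ε ^ 2 * φ x ^ 2 := by simp only [hw]; ring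
        _ ≤ _ := by linarith
    by_cases hi : Integrable (fun x => w x * Real.log (w x)) μ
    · calc _ ≤ ∫ x, (ε * φ x + ε ^ 2) ∂μ :=
            integral_mono hi ((iφ.const_mul _).add (integrable_const _)) hb
        _ = ε ^ 2 := by
            rw [integral_add (iφ.const_mul _) (integrable_const _), integral_const_mul, hφ0]
            simp
    · rw [integral_undef hi]; positivity
  rw [g1, g2, g3] at hle
  rw [eA]
  linarith

/-- Both signs of `ε` force the first variation to vanish. Testing with `1_s - μ(s)` shows that `ψ`
and its mean have the same integral over every measurable set `s`. -/
theorem euler_lagrange (hac : μ ≪ volume) (h : FiniteEnergyDensity V (lebDensity μ))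
    (hmin : ∀ σ, FiniteEnergyDensity V σ → densEnergy V P (lebDensity μ) ≤ densEnergy V P σ) :
    ∃ c, ∀ᵐ x ∂μ, V x + Real.log (lebDensity μ x) - 2 * P * ∫ y, Real.log |x - y| ∂μ = c := by
  obtain ⟨i1, i2, i3⟩ := h.of_lebDensity hac
  set ψ : ℝ → ℝ := fun x => V x + Real.log (lebDensity μ x) - 2 * P * ∫ y, Real.log |x - y| ∂μ
    with hψ
  have iψ : Integrable ψ μ := (i1.add i2).sub (i3.integral_prod_left.const_mul _)
  have key : ∀ s, MeasurableSet s → ∫ x in s, ψ x ∂μ = ∫ x in s, (∫ y, ψ y ∂μ) ∂μ := by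
    intro s hs
    have hb0 : 0 ≤ μ.real s := measureReal_nonneg
    have hb1 : μ.real s ≤ 1 := measureReal_le_one
    set φ : ℝ → ℝ := fun x => s.indicator 1 x - μ.real s with hφ
    have hφm : Measurable φ := (measurable_one.indicator hs).sub_const _
    have hφ1 : ∀ x, |φ x| ≤ 1 := fun x => by
      by_cases hx : x ∈ s <;> simp only [hφ, hx, indicator_of_mem, indicator_of_notMem,
        not_false_eq_true, Pi.one_apply] <;> exact abs_le.2 ⟨by linarith, by linarith⟩
    have is : Integrable (s.indicator (1 : ℝ → ℝ)) μ := (integrable_const 1).indicator hs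
    have hφ0 : ∫ x, φ x ∂μ = 0 := by
      simp only [hφ]
      rw [integral_sub is (integrable_const _), integral_indicator_one hs]; simp
    obtain ⟨B, hB⟩ := energy_first_variation (P := P) hac h hmin hφm hφ1 hφ0
    have hA : ∫ x, φ x * ψ x ∂μ = 0 := by
      set A := ∫ x, φ x * ψ x ∂μ with hA'
      have hB' : ∀ ε : ℝ, |ε| ≤ 1 / 2 → 0 ≤ ε * A + ε ^ 2 * B := hB
      by_contra hne
      -- So small that the quadratic term cannot compensate `δ |A|`; the `+ 1` avoids division by
      -- zero.
      set δ := min (1 / 2) (|A| / (2 * (|B| + 1))) with hδ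
      have hA0 : 0 < |A| := abs_pos.2 hne
      have hδ0 : 0 < δ := lt_min (by norm_num) (by positivity)
      have hδ1 : δ ≤ 1 / 2 := min_le_left _ _
      have hδ2 : δ * (2 * (|B| + 1)) ≤ |A| :=
        (le_div_iff₀ (by positivity)).1 (min_le_right _ _)
      have b1 := hB' δ (by rw [abs_of_pos hδ0]; exact hδ1)
      have b2 := hB' (-δ) (by rw [abs_neg, abs_of_pos hδ0]; exact hδ1)
      have hBa := le_abs_self B
      have b3 : δ * |A| ≤ δ ^ 2 * |B| := by
        rcases abs_cases A with ⟨ha, -⟩ | ⟨ha, -⟩ <;> rw [ha] <;> nlinarith [sq_nonneg δ]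
      have b4 : δ * |A| ≤ δ * (δ * |B|) := by linarith [b3]
      have b5 := le_of_mul_le_mul_left b4 hδ0
      nlinarith [abs_nonneg B]
    have e1 : ∫ x, φ x * ψ x ∂μ = (∫ x in s, ψ x ∂μ) - μ.real s * ∫ y, ψ y ∂μ := by
      rw [← integral_indicator hs, ← integral_const_mul,
        ← integral_sub (iψ.indicator hs) (iψ.const_mul _)]
      congr 1; funext x
      by_cases hx : x ∈ s <;> simp [hφ, hx, sub_mul]
    rw [hA] at e1
    rw [setIntegral_const, smul_eq_mul]
    linarith
  refine ⟨∫ y, ψ y ∂μ, ?_⟩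
  exact iψ.ae_eq_of_forall_setIntegral_eq ψ (fun _ => ∫ y, ψ y ∂μ) (integrable_const _)
    fun s hs _ => key s hs

end EulerLagrange

/-! ### Positivity of the density -/

theorem integrable_indicator_mul_continuous {B : Set ℝ} (hB : MeasurableSet B) {n : ℝ}
    (hBn : B ⊆ Icc (-n) n) (c : ℝ) {f : ℝ → ℝ} (hf : Continuous f) :
    Integrable fun x => B.indicator (fun _ => c) x * f x := by
  have : (fun x => B.indicator (fun _ => c) x * f x) = B.indicator fun x => c * f x := by
    funext x
    by_cases hx : x ∈ B <;> simp [hx]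
  rw [this, integrable_indicator_iff hB]
  exact ((continuous_const.mul hf).continuousOn.integrableOn_Icc).mono_set hBn

theorem finiteEnergyDensity_indicator {V : ℝ → ℝ} (hV : Continuous V) {B : Set ℝ}
    (hB : MeasurableSet B) {n : ℝ} (hBn : B ⊆ Icc (-n) n) (hm : 0 < volume.real B) :
    FiniteEnergyDensity V (B.indicator fun _ => 1 / volume.real B) := by
  have h1 : Integrable (B.indicator fun _ => 1 / volume.real B) := by
    simpa using integrable_indicator_mul_continuous hB hBn (1 / volume.real B)
      (f := fun _ => 1) continuous_const
  have hl := integrable_indicator_mul_continuous hB hBn (1 / volume.real B)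
    (f := fun x => Real.log (1 + |x|))
    ((continuous_const.add continuous_abs).log fun x => (by positivity : (1 + |x| : ℝ) ≠ 0))
  refine ⟨measurable_const.indicator hB,
    fun x => indicator_nonneg (fun _ _ => by positivity) x, h1, ?_,
    integrable_indicator_mul_continuous hB hBn _ hV, ?_,
    integrable_log_mul (M := 1 / volume.real B) h1 h1 hl hl (ae_of_all _ fun x => ?_)⟩
  · rw [integral_indicator hB, setIntegral_const, smul_eq_mul, mul_one_div_cancel hm.ne']
  · have h2 := integrable_indicator_mul_continuous hB hBn (1 / volume.real B)
      (f := fun _ => Real.log (1 / volume.real B)) continuous_const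
    refine h2.congr (ae_of_all _ fun x => ?_)
    by_cases hx : x ∈ B <;> simp [hx]
  · by_cases hx : x ∈ B
    · simp only [hx, indicator_of_mem]
      rw [abs_of_nonneg (by positivity)]
    · simp only [hx, not_false_eq_true, indicator_of_notMem, abs_zero]; positivity

/-- Since `ρ` and `τ` are nowhere both nonzero, the entropy of the mixture is the sum of the two
entropies and contains `ε ln ε`; every other change is at most a constant times `ε`. -/
theorem densEnergy_mixture {V : ℝ → ℝ} {ρ τ : ℝ → ℝ} {M : ℝ} (P : ℝ)
    (hρ : FiniteEnergyDensity V ρ) (hτ : FiniteEnergyDensity V τ)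
    (hρl : Integrable fun x => ρ x * Real.log (1 + |x|))
    (hτl : Integrable fun x => τ x * Real.log (1 + |x|)) (hM : ∀ x, |τ x| ≤ M)
    (hdisj : ∀ x, ρ x = 0 ∨ τ x = 0) :
    ∃ C, ∀ ε : ℝ, 0 < ε → ε < 1 →
      FiniteEnergyDensity V (fun x => (1 - ε) * ρ x + ε * τ x) ∧
      densEnergy V P (fun x => (1 - ε) * ρ x + ε * τ x) ≤
        densEnergy V P ρ + ε * (Real.log ε + C) := by
  have hx1 := integrable_log_mul hρ.integrable hτ.integrable hρl hτl (ae_of_all _ hM)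
  have hx2 : Integrable fun p : ℝ × ℝ => τ p.1 * ρ p.2 * Real.log |p.1 - p.2| := by
    refine (hx1.swap).congr (ae_of_all _ fun p => ?_)
    simp only [Function.comp, Prod.fst_swap, Prod.snd_swap, abs_sub_comm]; ring
  set a1 := ∫ x, ρ x * V x
  set a2 := ∫ x, τ x * V x
  set b1 := ∫ x, ρ x * Real.log (ρ x)
  set b2 := ∫ x, τ x * Real.log (τ x)
  set c1 := ∫ p : ℝ × ℝ, ρ p.1 * ρ p.2 * Real.log |p.1 - p.2|
  set c2 := ∫ p : ℝ × ℝ, ρ p.1 * τ p.2 * Real.log |p.1 - p.2|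
  set c3 := ∫ p : ℝ × ℝ, τ p.1 * ρ p.2 * Real.log |p.1 - p.2|
  set c4 := ∫ p : ℝ × ℝ, τ p.1 * τ p.2 * Real.log |p.1 - p.2|
  refine ⟨|a1| + |a2| + |b1| + |b2| + |P * c1| * 2 + |P * c2| + |P * c3| + |P * c4|,
    fun ε h0 h1 => ?_⟩
  have e1 : (fun x => ((1 - ε) * ρ x + ε * τ x) * V x) =
      fun x => (1 - ε) * (ρ x * V x) + ε * (τ x * V x) := by funext x; ring
  have e2 : (fun x => ((1 - ε) * ρ x + ε * τ x) * Real.log ((1 - ε) * ρ x + ε * τ x)) =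
      fun x => ((1 - ε) * (ρ x * Real.log (ρ x)) + (1 - ε) * Real.log (1 - ε) * ρ x) +
        (ε * (τ x * Real.log (τ x)) + ε * Real.log ε * τ x) := by
    funext x
    rcases hdisj x with h | h
    · rw [h]
      rcases eq_or_ne (τ x) 0 with h' | h'
      · rw [h']; simp
      · rw [mul_zero, zero_add, Real.log_mul h0.ne' h']; simp; ring
    · rw [h]
      rcases eq_or_ne (ρ x) 0 with h' | h'
      · rw [h']; simp
      · rw [mul_zero, add_zero, Real.log_mul (by linarith) h']; simp; ring
  have e3 : (fun p : ℝ × ℝ => ((1 - ε) * ρ p.1 + ε * τ p.1) * ((1 - ε) * ρ p.2 + ε * τ p.2)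
      * Real.log |p.1 - p.2|) = fun p : ℝ × ℝ =>
      ((1 - ε) ^ 2 * (ρ p.1 * ρ p.2 * Real.log |p.1 - p.2|) +
        (1 - ε) * ε * (ρ p.1 * τ p.2 * Real.log |p.1 - p.2|)) +
      ((1 - ε) * ε * (τ p.1 * ρ p.2 * Real.log |p.1 - p.2|) +
        ε ^ 2 * (τ p.1 * τ p.2 * Real.log |p.1 - p.2|)) := by funext p; ring
  have v1 := hρ.potential.const_mul (1 - ε)
  have v2 := hτ.potential.const_mul ε
  have s1 := hρ.entropy.const_mul (1 - ε)
  have s2 := hρ.integrable.const_mul ((1 - ε) * Real.log (1 - ε))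
  have s3 := hτ.entropy.const_mul ε
  have s4 := hτ.integrable.const_mul (ε * Real.log ε)
  have s12 : Integrable fun x => (1 - ε) * (ρ x * Real.log (ρ x))
    + (1 - ε) * Real.log (1 - ε) * ρ x := s1.add s2
  have s34 : Integrable fun x => ε * (τ x * Real.log (τ x)) + ε * Real.log ε * τ x := s3.add s4
  have w1 := hρ.interaction.const_mul ((1 - ε) ^ 2)
  have w2 := hx1.const_mul ((1 - ε) * ε)
  have w3 := hx2.const_mul ((1 - ε) * ε)
  have w4 := hτ.interaction.const_mul (ε ^ 2)
  have w12 : Integrable fun p : ℝ × ℝ => (1 - ε) ^ 2 * (ρ p.1 * ρ p.2 * Real.log |p.1 - p.2|) +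
        (1 - ε) * ε * (ρ p.1 * τ p.2 * Real.log |p.1 - p.2|) := w1.add w2
  have w34 : Integrable fun p : ℝ × ℝ => (1 - ε) * ε * (τ p.1 * ρ p.2 * Real.log |p.1 - p.2|) +
        ε ^ 2 * (τ p.1 * τ p.2 * Real.log |p.1 - p.2|) := w3.add w4
  constructor
  · refine ⟨(hρ.meas.const_mul _).add (hτ.meas.const_mul _), fun x => ?_,
      (hρ.integrable.const_mul _).add (hτ.integrable.const_mul _), ?_, ?_, ?_, ?_⟩
    · have := hρ.nonneg x
      have := hτ.nonneg x
      have : 0 ≤ 1 - ε := by linarith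
      positivity
    · rw [integral_add (hρ.integrable.const_mul _) (hτ.integrable.const_mul _),
        integral_const_mul, integral_const_mul, hρ.mass, hτ.mass]; ring
    · rw [e1]; exact v1.add v2
    · rw [e2]; exact s12.add s34
    · rw [e3]; exact w12.add w34
  · rw [densEnergy, densEnergy, e1, e2, e3, integral_add v1 v2, integral_add s12 s34,
      integral_add s1 s2, integral_add s3 s4, integral_add w12 w34, integral_add w1 w2,
      integral_add w3 w4]
    simp only [integral_const_mul]
    rw [hρ.mass, hτ.mass]
    change (1 - ε) * a1 + ε * a2 + ((1 - ε) * b1 + (1 - ε) * Real.log (1 - ε) * 1 +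
      (ε * b2 + ε * Real.log ε * 1)) - P * ((1 - ε) ^ 2 * c1 + (1 - ε) * ε * c2 +
      ((1 - ε) * ε * c3 + ε ^ 2 * c4)) ≤ a1 + b1 - P * c1 + _
    have l1 : (1 - ε) * Real.log (1 - ε) ≤ 0 :=
      mul_nonpos_of_nonneg_of_nonpos (by linarith) (Real.log_nonpos (by linarith) (by linarith))
    have k : ∀ t q : ℝ, 0 ≤ t → t ≤ ε * 1 → t * q ≤ ε * |q| := fun t q ht0 ht =>
      (mul_le_mul_of_nonneg_left (le_abs_self q) ht0).trans
        (mul_le_mul_of_nonneg_right (by linarith) (abs_nonneg q))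
    have k1 := k ε (-a1) h0.le (by linarith)
    have k2 := k ε a2 h0.le (by linarith)
    have k3 := k ε (-b1) h0.le (by linarith)
    have k4 := k ε b2 h0.le (by linarith)
    have k5 := k (ε * (1 - ε)) (-(P * c2)) (by nlinarith) (by nlinarith)
    have k6 := k (ε * (1 - ε)) (-(P * c3)) (by nlinarith) (by nlinarith)
    have k7 := k (ε ^ 2) (-(P * c4)) (by positivity) (by nlinarith)
    have k8 := k ε (P * c1) h0.le (by linarith)
    have k9 := k (ε - ε ^ 2) (P * c1) (by nlinarith) (by nlinarith)
    rw [abs_neg] at k1 k3 k5 k6 k7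
    nlinarith

section Positivity

variable {V : ℝ → ℝ} {P : ℝ} {μ : Measure ℝ} [IsProbabilityMeasure μ]

/-- If the density vanished on a bounded set of positive measure, a little mass spread uniformly
there would lower the energy, since the entropy has slope `-∞` at zero. -/
theorem ae_lebDensity_ne_zero (hV : Continuous V)
    (hlog : Integrable fun x => lebDensity μ x * Real.log (1 + |x|))
    (h : FiniteEnergyDensity V (lebDensity μ))
    (hmin : ∀ σ, FiniteEnergyDensity V σ → densEnergy V P (lebDensity μ) ≤ densEnergy V P σ) :
    ∀ᵐ x, lebDensity μ x ≠ 0 := by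
  set Z : Set ℝ := {x | lebDensity μ x = 0}
  have hZ : MeasurableSet Z := measurable_lebDensity μ (measurableSet_singleton 0)
  have key : ∀ n : ℕ, volume (Z ∩ Icc (-(n : ℝ)) n) = 0 := by
    intro n
    by_contra hne
    set B := Z ∩ Icc (-(n : ℝ)) n with hBdef
    have hB : MeasurableSet B := hZ.inter measurableSet_Icc
    have hfin : volume B ≠ ⊤ :=
      ((measure_mono inter_subset_right).trans_lt measure_Icc_lt_top).ne
    have hm : 0 < volume.real B := ENNReal.toReal_pos hne hfin
    have hBn : B ⊆ Icc (-(n : ℝ)) n := inter_subset_right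
    have hτ := finiteEnergyDensity_indicator hV hB hBn hm
    have hl := integrable_indicator_mul_continuous hB hBn (1 / volume.real B)
      (f := fun x => Real.log (1 + |x|))
      ((continuous_const.add continuous_abs).log fun x => (by positivity : (1 + |x| : ℝ) ≠ 0))
    obtain ⟨C, hC⟩ := densEnergy_mixture (M := 1 / volume.real B) P h hτ hlog hl (fun x => by
      by_cases hx : x ∈ B
      · simp only [hx, indicator_of_mem]
        rw [abs_of_nonneg (by positivity)]
      · simp only [hx, not_false_eq_true, indicator_of_notMem, abs_zero]; positivity) (fun x => by
      by_cases hx : x ∈ B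
      · exact Or.inl hx.1
      · exact Or.inr (indicator_of_notMem hx _))
    -- This `ε` makes `ln ε + C ≤ -1`.
    obtain ⟨f1, f2⟩ := hC (Real.exp (-(|C| + 1))) (Real.exp_pos _) (by
      rw [Real.exp_lt_one_iff]; linarith [abs_nonneg C])
    have f3 := hmin _ f1
    rw [Real.log_exp] at f2
    have := le_abs_self C
    nlinarith [Real.exp_pos (-(|C| + 1))]
  rw [ae_iff]
  simp only [not_not]
  have hU : Z = ⋃ n : ℕ, Z ∩ Icc (-(n : ℝ)) n := by
    ext x
    simp only [mem_iUnion, mem_inter_iff, exists_and_left]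
    refine ⟨fun hx => ⟨hx, ?_⟩, fun hx => hx.1⟩
    obtain ⟨n, hn⟩ := exists_nat_ge |x|
    exact ⟨n, abs_le.1 hn⟩
  change volume Z = 0
  rw [hU, measure_iUnion_null_iff]
  exact key

end Positivity

/-! ### Regularity of the density -/

/-- `μ` has the continuous positive density `ρ`, which decays faster than any power. -/
structure RegularDensity (μ : Measure ℝ) (ρ : ℝ → ℝ) : Prop where
  cont : Continuous ρ
  pos : ∀ x, 0 < ρ x
  bound : ∀ k : ℕ, ∃ C, ∀ x, (1 + |x|) ^ k * ρ x ≤ C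
  ae_eq : lebDensity μ =ᵐ[volume] ρ
  ac : μ ≪ volume

/-- The logarithmic potential. -/
noncomputable def logPotential (μ : Measure ℝ) (x : ℝ) : ℝ := ∫ y, Real.log |x - y| ∂μ

/-- The logarithm truncated near the origin. -/
noncomputable def truncLog (N : ℕ) (t : ℝ) : ℝ := Real.log (max |t| (Real.exp (-N)))

theorem continuous_truncLog (N : ℕ) : Continuous (truncLog N) :=
  (continuous_abs.max continuous_const).log fun _ =>
    ((Real.exp_pos _).trans_le (le_max_right _ _)).ne'

theorem abs_truncLog_le (N : ℕ) (x y : ℝ) :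
    |truncLog N (x - y)| ≤ N + (Real.log (1 + |x|) + Real.log (1 + |y|)) := by
  have h0 : 0 < max |x - y| (Real.exp (-N)) := (Real.exp_pos _).trans_le (le_max_right _ _)
  have h1 : -(N : ℝ) ≤ truncLog N (x - y) := by
    rw [← Real.log_exp (-(N : ℝ)), truncLog]
    exact Real.log_le_log (Real.exp_pos _) (le_max_right _ _)
  have h4 := log_one_add_abs_nonneg x
  have h5 := log_one_add_abs_nonneg y
  have h6 : (0 : ℝ) ≤ N := N.cast_nonneg
  have h2 : truncLog N (x - y) ≤ Real.log (1 + |x|) + Real.log (1 + |y|) := by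
    rcases max_choice |x - y| (Real.exp (-N)) with h | h
    · rw [truncLog, h]; exact log_abs_sub_le x y
    · rw [truncLog, h, Real.log_exp]; linarith
  exact abs_le.2 ⟨by linarith, by linarith⟩

theorem abs_truncLog_sub_log_le (N : ℕ) {t : ℝ} (ht : t ≠ 0) :
    |truncLog N t - Real.log (|t|)| ≤ max 0 (logNeg t - N) := by
  rcases le_total (Real.exp (-N)) |t| with h | h
  · rw [truncLog, max_eq_left h, sub_self, abs_zero]; exact le_max_left _ _
  · rw [truncLog, max_eq_right h, Real.log_exp]
    have h1 : Real.log (|t|) ≤ -N := by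
      rw [← Real.log_exp (-(N : ℝ))]; exact Real.log_le_log (abs_pos.2 ht) h
    rw [abs_of_nonneg (by linarith)]
    refine le_trans ?_ (le_max_right _ _)
    have : -Real.log (|t|) ≤ logNeg t := le_max_right _ _
    linarith

theorem tendsto_integral_logNeg_tail :
    Tendsto (fun N : ℕ => ∫ t, max 0 (logNeg t - N)) atTop (𝓝 0) := by
  suffices hlim : Tendsto (fun N : ℕ => ∫ t, max 0 (logNeg t - N)) atTop
      (𝓝 (∫ _ : ℝ, (0 : ℝ))) by
    rwa [integral_zero] at hlim
  refine tendsto_integral_of_dominated_convergence logNeg (fun N => ?_) integrable_logNeg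
    (fun N => ae_of_all _ fun t => ?_) (ae_of_all _ fun t => ?_)
  · exact (measurable_const.max (measurable_logNeg.sub_const _)).aestronglyMeasurable
  · rw [Real.norm_of_nonneg (le_max_left _ _)]
    exact max_le (logNeg_nonneg t) (by linarith [N.cast_nonneg (α := ℝ)])
  · obtain ⟨n, hn⟩ := exists_nat_ge (logNeg t)
    refine tendsto_const_nhds.congr' ?_
    filter_upwards [eventually_ge_atTop n] with N hN
    have : (n : ℝ) ≤ N := by exact_mod_cast hN
    rw [max_eq_left (by linarith)]

section Potential

variable {μ : Measure ℝ} [IsProbabilityMeasure μ]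

/-- Integrability against a measure with bounded density. -/
theorem integrable_of_bounded_density (hac : μ ≪ volume) {M : ℝ}
    (hM : ∀ᵐ x, lebDensity μ x ≤ M) {f : ℝ → ℝ} (hf : Integrable f) : Integrable f μ := by
  rw [← integrable_lebDensity_mul_iff hac]
  exact hf.bdd_mul (measurable_lebDensity μ).aestronglyMeasurable
    (hM.mono fun x hx => by
      rwa [Real.norm_of_nonneg (show (0 : ℝ) ≤ lebDensity μ x from ENNReal.toReal_nonneg)])

theorem integral_le_of_bounded_density (hac : μ ≪ volume) {M : ℝ}
    (hM : ∀ᵐ x, lebDensity μ x ≤ M) {f : ℝ → ℝ} (hf : Integrable f) (h0 : ∀ x, 0 ≤ f x) :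
    ∫ x, f x ∂μ ≤ M * ∫ x, f x := by
  rw [← integral_lebDensity_mul hac, ← integral_const_mul]
  refine integral_mono_ae ((integrable_lebDensity_mul_iff hac _).2
    (integrable_of_bounded_density hac hM hf)) (hf.const_mul M) ?_
  filter_upwards [hM] with x hx
  exact mul_le_mul_of_nonneg_right hx (h0 x)

theorem integrable_log_abs_sub (hac : μ ≪ volume) {M : ℝ} (hM : ∀ᵐ x, lebDensity μ x ≤ M)
    (hlog : Integrable (fun x => Real.log (1 + |x|)) μ) (x : ℝ) :
    Integrable (fun y => Real.log |x - y|) μ := by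
  have h1 := integrable_of_bounded_density hac hM (integrable_logNeg.comp_sub_left x)
  refine (((integrable_const (Real.log (1 + |x|))).add hlog).add h1).mono'
    (Measurable.aestronglyMeasurable (by fun_prop))
    (ae_of_all _ fun y => abs_log_abs_sub_le x y)

theorem logPotential_le (hlog : Integrable (fun x => Real.log (1 + |x|)) μ) (x : ℝ) :
    logPotential μ x ≤ Real.log (1 + |x|) + ∫ y, Real.log (1 + |y|) ∂μ := by
  have h0 : 0 ≤ ∫ y, Real.log (1 + |y|) ∂μ := integral_nonneg log_one_add_abs_nonneg
  by_cases hi : Integrable (fun y => Real.log |x - y|) μ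
  · calc logPotential μ x ≤ ∫ y, (Real.log (1 + |x|) + Real.log (1 + |y|)) ∂μ :=
          integral_mono hi ((integrable_const _).add hlog) fun y => log_abs_sub_le x y
      _ = _ := by rw [integral_add (integrable_const _) hlog]; simp
  -- A divergent integral has the value `0`, which the nonnegative right-hand side still dominates.
  · rw [logPotential, integral_undef hi]
    exact add_nonneg (log_one_add_abs_nonneg x) h0

/-- The potential is a uniform limit of potentials of truncated logarithms. A bounded density makes
the truncation error at most `M ∫ max 0 (logNeg t - N) dt`, independently of `x`. -/
theorem continuous_logPotential (hac : μ ≪ volume) {M : ℝ} (hM : ∀ᵐ x, lebDensity μ x ≤ M)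
    (hlog : Integrable (fun x => Real.log (1 + |x|)) μ) : Continuous (logPotential μ) := by
  have hT : ∀ N x, Integrable (fun y => truncLog N (x - y)) μ := fun N x =>
    ((integrable_const _).add ((integrable_const _).add hlog)).mono'
      (((continuous_truncLog N).comp (by fun_prop)).aestronglyMeasurable)
      (ae_of_all _ fun y => abs_truncLog_le N x y)
  have hcont : ∀ N : ℕ, Continuous fun x => ∫ y, truncLog N (x - y) ∂μ := by
    intro N
    rw [continuous_iff_continuousAt]
    intro x₀
    refine continuousAt_of_dominated (bound := fun y => N + (Real.log (2 + |x₀|)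
      + Real.log (1 + |y|))) ?_ ?_ ((integrable_const _).add ((integrable_const _).add hlog)) ?_
    · exact Eventually.of_forall fun x =>
        ((continuous_truncLog N).comp (by fun_prop)).aestronglyMeasurable
    · filter_upwards [Metric.ball_mem_nhds x₀ one_pos] with x hx
      refine ae_of_all _ fun y => (abs_truncLog_le N x y).trans ?_
      have : |x| ≤ 1 + |x₀| := by
        have h1 := abs_sub_abs_le_abs_sub x x₀
        rw [Metric.mem_ball, Real.dist_eq] at hx
        linarith
      have h2 : Real.log (1 + |x|) ≤ Real.log (2 + |x₀|) :=
        Real.log_le_log (by positivity) (by linarith)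
      linarith
    · exact ae_of_all _ fun y => ((continuous_truncLog N).comp (by fun_prop)).continuousAt
  refine TendstoUniformly.continuous (F := fun (N : ℕ) x => ∫ y, truncLog N (x - y) ∂μ)
    (p := atTop) ?_ (Eventually.of_forall hcont).frequently
  rw [Metric.tendstoUniformly_iff]
  intro ε hε
  have ht := tendsto_integral_logNeg_tail.const_mul M
  rw [mul_zero] at ht
  filter_upwards [ht.eventually (gt_mem_nhds hε)] with N hN x
  refine lt_of_le_of_lt ?_ hN
  have hint : Integrable fun t => max 0 (logNeg t - N) :=
    integrable_logNeg.mono'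
      (measurable_const.max (measurable_logNeg.sub_const _)).aestronglyMeasurable
      (ae_of_all _ fun t => by
        rw [Real.norm_of_nonneg (le_max_left _ _)]
        exact max_le (logNeg_nonneg t) (by linarith [N.cast_nonneg (α := ℝ)]))
  have hi2 := hint.comp_sub_left x
  rw [dist_comm, Real.dist_eq, logPotential,
    ← integral_sub (hT N x) (integrable_log_abs_sub hac hM hlog x)]
  calc |∫ y, (truncLog N (x - y) - Real.log |x - y|) ∂μ|
      ≤ ∫ y, max 0 (logNeg (x - y) - N) ∂μ := by
        rw [← Real.norm_eq_abs]
        refine norm_integral_le_of_norm_le (integrable_of_bounded_density hac hM hi2) ?_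
        have : ∀ᵐ y, y ≠ x := by simp [ae_iff]
        filter_upwards [hac.ae_le this] with y hy
        exact abs_truncLog_sub_log_le N (sub_ne_zero.2 (Ne.symm hy))
    _ ≤ M * ∫ y, max 0 (logNeg (x - y) - N) :=
        integral_le_of_bounded_density hac hM hi2 fun y => le_max_left _ _
    _ = M * ∫ t, max 0 (logNeg t - N) := by
        rw [integral_sub_left_eq_self (fun t => max 0 (logNeg t - N))]

end Potential

/-- The equilibrium measure has a continuous, positive and rapidly decaying density. -/
theorem IsEquilibriumMeasure.regularDensity {V : ℝ → ℝ} {P : ℝ} {μ : Measure ℝ}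
    [IsProbabilityMeasure μ] (hP : 0 < P) (hμ : IsEquilibriumMeasure V P μ)
    (hV : PotentialAssumptions V μ) : ∃ ρ, RegularDensity μ ρ := by
  have hVc := hV.contDiff.continuous
  obtain ⟨hac, hF, hmin⟩ := hμ.density hVc
  obtain ⟨i1, i2, i3⟩ := hF.of_lebDensity hac
  have hlog : Integrable (fun x => Real.log (1 + |x|)) μ := by
    obtain ⟨C, hC⟩ := hV.log_le 1
    refine (i1.add (integrable_const C)).mono' (Measurable.aestronglyMeasurable (by fun_prop))
      (ae_of_all _ fun x => ?_)
    rw [Real.norm_of_nonneg (log_one_add_abs_nonneg x)]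
    simpa using hC x
  have hne := ae_lebDensity_ne_zero hVc ((integrable_lebDensity_mul_iff hac _).2 hlog) hF hmin
  obtain ⟨c, hc⟩ := euler_lagrange hac hF hmin
  -- Positivity of the density turns the Euler-Lagrange equation, known for `μ`, into one that holds
  -- for Lebesgue measure.
  have hvol : volume ≪ μ := by
    have := withDensity_absolutelyContinuous' (μ := volume)
      (f := fun x => ENNReal.ofReal (lebDensity μ x))
      (measurable_lebDensity μ).ennreal_ofReal.aemeasurable (hne.mono fun x hx => by
        simp only [ne_eq, ENNReal.ofReal_eq_zero, not_le]
        exact lt_of_le_of_ne ENNReal.toReal_nonneg (Ne.symm hx))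
    rwa [show volume.withDensity (fun x => ENNReal.ofReal (lebDensity μ x)) = μ from
      densMeasure_lebDensity hac] at this
  set ρ : ℝ → ℝ := fun x => Real.exp (c - V x + 2 * P * logPotential μ x) with hρ
  have hae : lebDensity μ =ᵐ[volume] ρ := by
    filter_upwards [hvol.ae_le hc, hne] with x hx hx0
    have hx1 : 0 < lebDensity μ x := lt_of_le_of_ne ENNReal.toReal_nonneg (Ne.symm hx0)
    rw [hρ, ← Real.exp_log hx1]
    simp only [logPotential]
    congr 1; linarith
  have hbound : ∀ k : ℕ, ∃ C, ∀ x, (1 + |x|) ^ k * ρ x ≤ C := by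
    intro k
    -- The factor `exp (2P U)` grows at most like `(1 + |x|)^m` up to a constant, so domination of
    -- `(k + m) ln (1 + |x|)` by `V` is what is needed.
    obtain ⟨m, hm⟩ := exists_nat_ge (2 * P)
    obtain ⟨C, hC⟩ := hV.log_le (k + m)
    set D := ∫ y, Real.log (1 + |y|) ∂μ
    refine ⟨Real.exp (c + C + 2 * P * D), fun x => ?_⟩
    have h0 : (0 : ℝ) < 1 + |x| := by positivity
    rw [← Real.exp_log (pow_pos h0 k), Real.log_pow, hρ, ← Real.exp_add]
    apply Real.exp_le_exp.2
    have h1 := logPotential_le hlog x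
    have h2 := hC x
    push_cast at h2
    have h3 := mul_le_mul_of_nonneg_left h1 (by positivity : 0 ≤ 2 * P)
    have h4 := mul_le_mul_of_nonneg_right hm (log_one_add_abs_nonneg x)
    nlinarith
  obtain ⟨M, hM⟩ := hbound 0
  have hM' : ∀ᵐ x, lebDensity μ x ≤ M := hae.mono fun x hx => by
    rw [hx]; simpa using hM x
  have hU := continuous_logPotential hac hM' hlog
  exact ⟨ρ, by fun_prop, fun x => Real.exp_pos _, hbound, hae, hac⟩

/-! ### Moments of the logarithmic kernel -/

/-- From `ln s ≤ s^ε / ε` with `ε = 1/(2(n+1))`: after raising to the power `n + 1` the singularity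
is `|t|^(-1/2)`, which is integrable. -/
theorem logNeg_pow_le (n : ℕ) {t : ℝ} (ht : t ≠ 0) : logNeg t ^ (n + 1) ≤
    (2 * (n + 1 : ℝ)) ^ (n + 1) * (Ioc (-1) 1).indicator (fun t => |t| ^ (-(1 / 2) : ℝ)) t := by
  have h0 : 0 < |t| := abs_pos.2 ht
  by_cases h1 : |t| < 1
  · have hlog : Real.log (|t|) < 0 := Real.log_neg h0 h1
    have hmem : t ∈ Ioc (-1 : ℝ) 1 := ⟨(abs_lt.1 h1).1, (abs_lt.1 h1).2.le⟩
    rw [indicator_of_mem hmem, logNeg,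
      max_eq_right (by linarith)]
    have hε : (0 : ℝ) < 1 / (2 * (n + 1)) := by positivity
    have h2 := Real.log_le_rpow_div (inv_nonneg.2 h0.le) hε
    rw [Real.log_inv] at h2
    have h3 : (|t|⁻¹ ^ (1 / (2 * (n + 1 : ℝ)))) ^ (n + 1) = |t| ^ (-(1 / 2) : ℝ) := by
      rw [← Real.rpow_natCast, ← Real.rpow_mul (inv_nonneg.2 h0.le), Real.inv_rpow h0.le,
        ← Real.rpow_neg h0.le]
      congr 1
      push_cast
      field_simp
    calc (-Real.log (|t|)) ^ (n + 1)
        ≤ (|t|⁻¹ ^ (1 / (2 * (n + 1 : ℝ))) / (1 / (2 * (n + 1)))) ^ (n + 1) := by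
          gcongr; linarith
      _ = _ := by rw [div_pow, h3, one_div_pow, div_div_eq_mul_div, div_one, mul_comm]
  · have : logNeg t = 0 := max_eq_left (neg_nonpos.2 (Real.log_nonneg (not_lt.1 h1)))
    rw [this, zero_pow (by omega)]
    exact mul_nonneg (by positivity) (indicator_nonneg (fun _ _ => by positivity) _)

theorem integrable_logNeg_pow (n : ℕ) : Integrable fun t => logNeg t ^ (n + 1) := by
  have h1 : IntervalIntegrable (fun t : ℝ => |t| ^ (-(1 / 2) : ℝ)) volume 0 1 := by
    refine (intervalIntegral.intervalIntegrable_rpow' (r := -(1 / 2)) (by norm_num)).congr_ae ?_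
    refine (ae_restrict_mem measurableSet_uIoc).mono fun t ht => ?_
    rw [uIoc_of_le zero_le_one] at ht
    simp only [abs_of_pos ht.1]
  have h2 : IntervalIntegrable (fun t : ℝ => |t| ^ (-(1 / 2) : ℝ)) volume (-1) 0 := by
    have := h1.comp_mul_left (c := -1)
    simp only [neg_mul, one_mul, abs_neg, zero_div, one_div, inv_neg, inv_one] at this
    simpa only [one_div] using this.symm
  have h3 := ((h2.trans h1).1.integrable_indicator measurableSet_Ioc).const_mul
    ((2 * (n + 1 : ℝ)) ^ (n + 1))
  refine h3.mono' (measurable_logNeg.pow_const _).aestronglyMeasurable ?_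
  have : ∀ᵐ t : ℝ, t ≠ 0 := by simp [ae_iff]
  filter_upwards [this] with t ht
  rw [Real.norm_of_nonneg (pow_nonneg (logNeg_nonneg t) _)]
  exact logNeg_pow_le n ht

theorem AllMoments.mono {Ω : Type*} [MeasurableSpace Ω] {ν : Measure Ω} {f g : Ω → ℝ}
    (hg : AllMoments g ν) (hf : AEStronglyMeasurable f ν) (h : ∀ x, |f x| ≤ |g x|) :
    AllMoments f ν :=
  ⟨hf, fun n => (hg.2 n).mono' (continuous_abs.comp_aestronglyMeasurable hf |>.pow n)
    (ae_of_all _ fun x => by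
      rw [Real.norm_of_nonneg (by positivity)]
      exact pow_le_pow_left₀ (abs_nonneg _) (h x) n)⟩

theorem AllMoments.comp_fst {μ : Measure ℝ} [IsProbabilityMeasure μ] {f : ℝ → ℝ}
    (hf : AllMoments f μ) : AllMoments (fun p : ℝ × ℝ => f p.1) (μ.prod μ) :=
  hf.comp measurePreserving_fst

theorem AllMoments.comp_snd {μ : Measure ℝ} [IsProbabilityMeasure μ] {f : ℝ → ℝ}
    (hf : AllMoments f μ) : AllMoments (fun p : ℝ × ℝ => f p.2) (μ.prod μ) :=
  hf.comp measurePreserving_snd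

namespace RegularDensity

variable {μ : Measure ℝ} [IsProbabilityMeasure μ] {ρ : ℝ → ℝ}

theorem exists_bound (h : RegularDensity μ ρ) : ∃ M, 0 < M ∧ ∀ x, ρ x ≤ M := by
  obtain ⟨M, hM⟩ := h.bound 0
  simp only [pow_zero, one_mul] at hM
  exact ⟨M, (h.pos 0).trans_le (hM 0), hM⟩

theorem exists_ae_bound (h : RegularDensity μ ρ) : ∃ M, 0 < M ∧ ∀ᵐ x, lebDensity μ x ≤ M := by
  obtain ⟨M, h0, hM⟩ := h.exists_bound
  exact ⟨M, h0, h.ae_eq.mono fun x hx => hx ▸ hM x⟩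

theorem integrable_iff (h : RegularDensity μ ρ) (f : ℝ → ℝ) :
    Integrable f μ ↔ Integrable fun x => ρ x * f x := by
  rw [← integrable_lebDensity_mul_iff h.ac]
  exact integrable_congr (h.ae_eq.mono fun x hx => by simp only [hx])

theorem integral_eq (h : RegularDensity μ ρ) (f : ℝ → ℝ) :
    ∫ x, f x ∂μ = ∫ x, ρ x * f x := by
  rw [← integral_lebDensity_mul h.ac]
  exact integral_congr_ae (h.ae_eq.mono fun x hx => by simp only [hx])

theorem volume_ac (h : RegularDensity μ ρ) : volume ≪ μ := by
  have := withDensity_absolutelyContinuous' (μ := volume)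
    (f := fun x => ENNReal.ofReal (lebDensity μ x))
    (measurable_lebDensity μ).ennreal_ofReal.aemeasurable (h.ae_eq.mono fun x hx => by
      simp only [ne_eq, ENNReal.ofReal_eq_zero, not_le, hx, h.pos x])
  rwa [show volume.withDensity (fun x => ENNReal.ofReal (lebDensity μ x)) = μ from
    densMeasure_lebDensity h.ac] at this

/-- Powers of `1 + |x|` are integrable against the density. -/
theorem integrable_pow_mul (h : RegularDensity μ ρ) (n : ℕ) :
    Integrable fun x => (1 + |x|) ^ n * ρ x := by
  obtain ⟨C, hC⟩ := h.bound (n + 2)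
  have h1 : Integrable fun x : ℝ => (1 + ‖x‖) ^ (-(2 : ℝ)) :=
    integrable_one_add_norm (by simp)
  refine (h1.const_mul C).mono' ?_ (ae_of_all _ fun x => ?_)
  · have := h.cont
    exact Continuous.aestronglyMeasurable (by fun_prop)
  · have h0 : (0 : ℝ) < 1 + |x| := by positivity
    have := (h.pos x).le
    rw [Real.norm_of_nonneg (by positivity), Real.norm_eq_abs, Real.rpow_neg h0.le,
      ← div_eq_mul_inv, le_div_iff₀ (by positivity)]
    calc (1 + |x|) ^ n * ρ x * (1 + |x|) ^ (2 : ℝ) = (1 + |x|) ^ (n + 2) * ρ x := by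
          rw [show (2 : ℝ) = (2 : ℕ) by norm_num, Real.rpow_natCast]; ring
      _ ≤ C := hC x

theorem allMoments_one_add_abs (h : RegularDensity μ ρ) : AllMoments (fun x => 1 + |x|) μ := by
  refine ⟨Continuous.aestronglyMeasurable (by fun_prop), fun n => ?_⟩
  rw [h.integrable_iff]
  refine (h.integrable_pow_mul n).congr (ae_of_all _ fun x => ?_)
  simp only
  rw [abs_of_pos (show (0 : ℝ) < 1 + |x| by positivity), mul_comm]

theorem measurable_log_one_add_abs : Measurable fun x : ℝ => Real.log (1 + |x|) := by fun_prop

theorem allMoments_log_one_add_abs (h : RegularDensity μ ρ) :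
    AllMoments (fun x => Real.log (1 + |x|)) μ :=
  h.allMoments_one_add_abs.mono measurable_log_one_add_abs.aestronglyMeasurable fun x => by
    rw [abs_of_nonneg (log_one_add_abs_nonneg x),
      abs_of_pos (show (0 : ℝ) < 1 + |x| by positivity)]
    exact (Real.log_le_sub_one_of_pos (by positivity)).trans (by linarith)

theorem allMoments_logNeg (h : RegularDensity μ ρ) (x : ℝ) :
    AllMoments (fun y => logNeg (x - y)) μ := by
  obtain ⟨M, -, hM⟩ := h.exists_ae_bound
  have hm : Measurable fun y => logNeg (x - y) := measurable_logNeg.comp (by fun_prop)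
  refine ⟨hm.aestronglyMeasurable, fun n => ?_⟩
  simp only [abs_of_nonneg (logNeg_nonneg _)]
  rcases n with _ | n
  · simp
  · exact integrable_of_bounded_density h.ac hM ((integrable_logNeg_pow n).comp_sub_left x)

theorem allMoments_logNeg_prod (h : RegularDensity μ ρ) :
    AllMoments (fun p : ℝ × ℝ => logNeg (p.1 - p.2)) (μ.prod μ) := by
  obtain ⟨M, -, hM⟩ := h.exists_ae_bound
  have hm : Measurable fun p : ℝ × ℝ => logNeg (p.1 - p.2) := measurable_logNeg.comp (by fun_prop)
  refine ⟨hm.aestronglyMeasurable, fun n => ?_⟩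
  simp only [abs_of_nonneg (logNeg_nonneg _)]
  rcases n with _ | n
  · simp
  · have hp := fun x => ((integrable_logNeg_pow n).comp_sub_left x)
    rw [integrable_prod_iff (hm.pow_const _).aestronglyMeasurable]
    refine ⟨ae_of_all _ fun x => integrable_of_bounded_density h.ac hM (hp x), ?_⟩
    refine Integrable.of_bound
      ((hm.pow_const (n + 1)).norm.stronglyMeasurable.integral_prod_right).aestronglyMeasurable
      (M * ∫ t, logNeg t ^ (n + 1)) (ae_of_all _ fun x => ?_)
    simp only [Real.norm_eq_abs, abs_pow, abs_of_nonneg (logNeg_nonneg _)]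
    rw [abs_of_nonneg (integral_nonneg fun y => pow_nonneg (logNeg_nonneg _) _)]
    refine (integral_le_of_bounded_density h.ac hM (hp x)
      fun y => pow_nonneg (logNeg_nonneg _) _).trans_eq ?_
    rw [integral_sub_left_eq_self (fun t => logNeg t ^ (n + 1))]

theorem momentKernel_log (h : RegularDensity μ ρ) :
    MomentKernel μ fun x y => Real.log |x - y| := by
  have hl := h.allMoments_log_one_add_abs
  have key : ∀ x, AllMoments (fun y => Real.log |x - y|) μ := fun x =>
    (((AllMoments.const (Real.log (1 + |x|))).add hl).add (h.allMoments_logNeg x)).mono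
      (Measurable.aestronglyMeasurable (by fun_prop))
      fun y => (abs_log_abs_sub_le x y).trans (le_abs_self _)
  refine ⟨measurable_log_abs_sub, ?_, key, fun y => ?_⟩
  · exact ((hl.comp_fst.add hl.comp_snd).add h.allMoments_logNeg_prod).mono
      measurable_log_abs_sub.aestronglyMeasurable
      fun p => (abs_log_abs_sub_le p.1 p.2).trans (le_abs_self _)
  · simpa only [abs_sub_comm] using key y

theorem measurable_logPotential (μ : Measure ℝ) [IsProbabilityMeasure μ] :
    Measurable (logPotential μ) :=
  (measurable_log_abs_sub.stronglyMeasurable.integral_prod_right (ν := μ)).measurable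

theorem allMoments_logPotential (h : RegularDensity μ ρ) : AllMoments (logPotential μ) μ := by
  obtain ⟨M, -, hM⟩ := h.exists_ae_bound
  have hl := h.allMoments_log_one_add_abs
  refine ((hl.add (AllMoments.const (∫ y, Real.log (1 + |y|) ∂μ))).add
    (AllMoments.const (M * ∫ t, logNeg t))).mono
    (measurable_logPotential μ).aestronglyMeasurable fun x => ?_
  refine le_trans ?_ (le_abs_self _)
  have hn := integrable_logNeg.comp_sub_left x
  have i1 : Integrable (fun y => Real.log (1 + |x|) + Real.log (1 + |y|)) μ :=
    (integrable_const _).add hl.integrable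
  have i2 : Integrable (fun y => logNeg (x - y)) μ := integrable_of_bounded_density h.ac hM hn
  calc |logPotential μ x|
      ≤ ∫ y, (Real.log (1 + |x|) + Real.log (1 + |y|) + logNeg (x - y)) ∂μ :=
        norm_integral_le_of_norm_le (f := fun y => Real.log |x - y|) (i1.add i2)
          (ae_of_all _ fun y => abs_log_abs_sub_le x y)
    _ = Real.log (1 + |x|) + (∫ y, Real.log (1 + |y|) ∂μ) + ∫ y, logNeg (x - y) ∂μ := by
        rw [integral_add i1 i2, integral_add (integrable_const _) hl.integrable]; simp
    _ ≤ _ := by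
        gcongr
        refine (integral_le_of_bounded_density h.ac hM hn fun y => logNeg_nonneg _).trans_eq ?_
        rw [integral_sub_left_eq_self logNeg]

end RegularDensity

/-- The centered symmetric part of the logarithmic kernel. -/
noncomputable def centeredLog (P : ℝ) (μ : Measure ℝ) (x y : ℝ) : ℝ :=
  2 * P * (Real.log |x - y| - logPotential μ x - logPotential μ y + ∫ z, logPotential μ z ∂μ)

theorem logKernel_eq (P : ℝ) (μ : Measure ℝ) (x y : ℝ) :
    logKernel P μ x y = 2 * P * (Real.log |x - y| - logPotential μ y) := by
  simp only [logKernel, logPotential, abs_sub_comm _ y]; ring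

section

variable {μ : Measure ℝ} [IsProbabilityMeasure μ] {ρ : ℝ → ℝ}

theorem MomentKernel.add {k l : ℝ → ℝ → ℝ} (hk : MomentKernel μ k) (hl : MomentKernel μ l) :
    MomentKernel μ fun x y => k x y + l x y :=
  ⟨hk.meas.add hl.meas, hk.joint.add hl.joint, fun x => (hk.left x).add (hl.left x),
    fun y => (hk.right y).add (hl.right y)⟩

theorem MomentKernel.const_mul {k : ℝ → ℝ → ℝ} (c : ℝ) (hk : MomentKernel μ k) :
    MomentKernel μ fun x y => c * k x y :=
  ⟨hk.meas.const_mul c, hk.joint.const_mul c, fun x => (hk.left x).const_mul c,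
    fun y => (hk.right y).const_mul c⟩

theorem MomentKernel.of_fst {g : ℝ → ℝ} (hm : Measurable g) (hg : AllMoments g μ) :
    MomentKernel μ fun x _ => g x :=
  ⟨hm.comp measurable_fst, hg.comp_fst, fun _ => AllMoments.const _, fun _ => hg⟩

theorem MomentKernel.of_snd {g : ℝ → ℝ} (hm : Measurable g) (hg : AllMoments g μ) :
    MomentKernel μ fun _ y => g y :=
  ⟨hm.comp measurable_snd, hg.comp_snd, fun _ => hg, fun _ => AllMoments.const _⟩

/-- Only negativity is left as a hypothesis. The difference between `k` and its double centering
depends on `x` alone, because the second variable of `k` is already centered by the potential. -/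
theorem RegularDensity.centeredKernel (h : RegularDensity μ ρ) (P : ℝ)
    (hneg : ∀ v, MemLp v 2 μ → ∫ x, v x ∂μ = 0 →
      ∫ x, kernelOp μ (centeredLog P μ) v x * v x ∂μ ≤ 0) :
    CenteredKernel μ (logKernel P μ) (centeredLog P μ)
      fun x => 2 * P * (logPotential μ x - ∫ z, logPotential μ z ∂μ) := by
  have hU := h.allMoments_logPotential
  have hUm := RegularDensity.measurable_logPotential μ
  have hL := h.momentKernel_log
  have e1 : logKernel P μ = fun x y => 2 * P * (Real.log |x - y| + -1 * logPotential μ y) := by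
    funext x y; rw [logKernel_eq]; ring
  have e2 : centeredLog P μ = fun x y => 2 * P * (Real.log |x - y| + -1 * logPotential μ x
      + -1 * logPotential μ y + ∫ z, logPotential μ z ∂μ) := by
    funext x y; rw [centeredLog]; ring
  refine ⟨?_, ?_, fun x y => ?_, fun x => ?_, ?_, ?_, fun x y => ?_, hneg⟩
  · rw [e1]
    exact (hL.add ((MomentKernel.of_snd hUm hU).const_mul (-1))).const_mul (2 * P)
  · rw [e2]
    exact (((hL.add ((MomentKernel.of_fst hUm hU).const_mul (-1))).add
      ((MomentKernel.of_snd hUm hU).const_mul (-1))).add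
      (MomentKernel.of_fst measurable_const (AllMoments.const _))).const_mul (2 * P)
  · simp only [centeredLog, abs_sub_comm x y]; ring
  · simp only [centeredLog]
    have i1 := (hL.left x).integrable
    have i2 : Integrable (fun y => Real.log |x - y| - logPotential μ x) μ :=
      i1.sub (integrable_const _)
    have i3 : Integrable (fun y => Real.log |x - y| - logPotential μ x - logPotential μ y) μ :=
      i2.sub hU.integrable
    rw [integral_const_mul, integral_add i3 (integrable_const _), integral_sub i2 hU.integrable,
      integral_sub i1 (integrable_const _)]
    simp [logPotential]
  · simpa only [sub_eq_add_neg] using (hU.add (AllMoments.const _)).const_mul (2 * P)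
  · rw [integral_const_mul, integral_sub hU.integrable (integrable_const _)]; simp
  · rw [logKernel_eq, centeredLog]; ring

end

/-! ### The logarithm as a superposition of Cauchy kernels -/

/-- The derivative in `r` of `½ ln((t² + r²)/(1 + r²))`. -/
noncomputable def cauchyDiff (t r : ℝ) : ℝ := r / (t ^ 2 + r ^ 2) - r / (1 + r ^ 2)

theorem hasDerivAt_log_quotient {t : ℝ} (ht : t ≠ 0) (r : ℝ) :
    HasDerivAt (fun r => (Real.log (t ^ 2 + r ^ 2) - Real.log (1 + r ^ 2)) / 2)
      (cauchyDiff t r) r := by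
  have h1 : t ^ 2 + r ^ 2 ≠ 0 := by positivity
  have h2 : 1 + r ^ 2 ≠ 0 := by positivity
  have a := (((hasDerivAt_pow 2 r).const_add (t ^ 2)).log h1)
  have b := (((hasDerivAt_pow 2 r).const_add 1).log h2)
  refine ((a.sub b).div_const 2).congr_deriv ?_
  rw [cauchyDiff]
  field_simp
  norm_num
  ring

theorem tendsto_log_quotient (t : ℝ) :
    Tendsto (fun r : ℝ => (Real.log (t ^ 2 + r ^ 2) - Real.log (1 + r ^ 2)) / 2) atTop (𝓝 0) := by
  have h : Tendsto (fun r : ℝ => (t ^ 2 - 1) / (1 + r ^ 2) + 1) atTop (𝓝 (0 + 1)) := by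
    refine Tendsto.add_const 1 (tendsto_const_nhds.div_atTop ?_)
    exact tendsto_atTop_add_const_left _ _ (tendsto_pow_atTop two_ne_zero)
  rw [zero_add] at h
  have h2 := (h.log one_ne_zero).div_const 2
  rw [Real.log_one, zero_div] at h2
  refine h2.congr' ?_
  filter_upwards [eventually_gt_atTop 0] with r hr
  have h3 : t ^ 2 + r ^ 2 ≠ 0 := by positivity
  have h4 : 1 + r ^ 2 ≠ 0 := by positivity
  rw [← Real.log_div h3 h4]
  congr 2
  field_simp
  ring

theorem cauchyDiff_eq {t : ℝ} (ht : t ≠ 0) (r : ℝ) :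
    cauchyDiff t r = r * (1 - t ^ 2) / ((t ^ 2 + r ^ 2) * (1 + r ^ 2)) := by
  have h3 : t ^ 2 + r ^ 2 ≠ 0 := by positivity
  have h4 : 1 + r ^ 2 ≠ 0 := by positivity
  rw [cauchyDiff]; field_simp; ring

/-- The primitive equals `ln |t|` at `r = 0` and tends to `0` at infinity. The integrand has the
constant sign of `1 - t²`, so convergence is absolute and the integral of the absolute value comes
for free. -/
theorem cauchyDiff_integral {t : ℝ} (ht : t ≠ 0) :
    IntegrableOn (cauchyDiff t) (Ioi 0) ∧ ∫ r in Ioi 0, cauchyDiff t r = -Real.log (|t|) ∧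
      ∫ r in Ioi 0, |cauchyDiff t r| = |Real.log (|t|)| := by
  have h0 : (Real.log (t ^ 2 + 0 ^ 2) - Real.log (1 + 0 ^ 2)) / 2 = Real.log (|t|) := by
    simp [Real.log_pow]
  have hc : ContinuousWithinAt (fun r : ℝ => (Real.log (t ^ 2 + r ^ 2) - Real.log (1 + r ^ 2)) / 2)
      (Ici 0) 0 := (hasDerivAt_log_quotient ht 0).continuousAt.continuousWithinAt
  have hd := fun r (_ : r ∈ Ioi (0 : ℝ)) => hasDerivAt_log_quotient ht r
  have hT := tendsto_log_quotient t
  rcases le_total (|t|) 1 with h1 | h1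
  · have hp : ∀ r ∈ Ioi (0 : ℝ), 0 ≤ cauchyDiff t r := fun r (hr : 0 < r) => by
      rw [cauchyDiff_eq ht]
      have : 0 ≤ 1 - t ^ 2 := by nlinarith [abs_nonneg t, sq_abs t]
      positivity
    have hi := integral_Ioi_of_hasDerivAt_of_nonneg hc hd hp hT
    have hl : Real.log (|t|) ≤ 0 := Real.log_nonpos (abs_nonneg t) h1
    simp only [h0, zero_sub] at hi
    refine ⟨integrableOn_Ioi_deriv_of_nonneg hc hd hp hT, hi, ?_⟩
    rw [setIntegral_congr_fun measurableSet_Ioi fun r hr => abs_of_nonneg (hp r hr), hi,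
      abs_of_nonpos hl]
  · have hp : ∀ r ∈ Ioi (0 : ℝ), cauchyDiff t r ≤ 0 := fun r (hr : 0 < r) => by
      rw [cauchyDiff_eq ht]
      have : 1 - t ^ 2 ≤ 0 := by nlinarith [abs_nonneg t, sq_abs t]
      exact div_nonpos_of_nonpos_of_nonneg (mul_nonpos_of_nonneg_of_nonpos hr.le this)
        (by positivity)
    have hi := integral_Ioi_of_hasDerivAt_of_nonpos hc hd hp hT
    have hl : 0 ≤ Real.log (|t|) := Real.log_nonneg h1
    simp only [h0, zero_sub] at hi
    refine ⟨integrableOn_Ioi_deriv_of_nonpos hc hd hp hT, hi, ?_⟩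
    rw [setIntegral_congr_fun measurableSet_Ioi fun r hr => abs_of_nonpos (hp r hr),
      integral_neg, hi, neg_neg, abs_of_nonneg hl]

theorem ae_fst_ne_snd : ∀ᵐ p : ℝ × ℝ, p.1 ≠ p.2 := by
  have : MeasurableSet {p : ℝ × ℝ | ¬ p.1 ≠ p.2} := by
    simp only [not_not]; exact measurableSet_eq_fun measurable_fst measurable_snd
  rw [ae_iff]
  refine (Measure.measure_prod_null this).2 (ae_of_all _ fun x => ?_)
  have : Prod.mk x ⁻¹' {p : ℝ × ℝ | ¬ p.1 ≠ p.2} = {x} := by ext y; simp [eq_comm]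
  change volume (Prod.mk x ⁻¹' {p : ℝ × ℝ | ¬ p.1 ≠ p.2}) = 0
  rw [this]; simp

theorem continuous_cauchy {r : ℝ} (hr : 0 < r) : Continuous fun t : ℝ => r / (t ^ 2 + r ^ 2) :=
  continuous_const.div (by fun_prop) fun t => by positivity

theorem abs_cauchy_le {r : ℝ} (hr : 0 < r) (t : ℝ) : |r / (t ^ 2 + r ^ 2)| ≤ 1 / r := by
  rw [abs_of_nonneg (by positivity), div_le_div_iff₀ (by positivity) hr]
  nlinarith [sq_nonneg t]

theorem integrable_cauchy_mul {F G : ℝ → ℝ} (hF : Integrable F) (hG : Integrable G) {r : ℝ}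
    (hr : 0 < r) :
    Integrable fun p : ℝ × ℝ => F p.1 * G p.2 * (r / ((p.1 - p.2) ^ 2 + r ^ 2)) := by
  have := (hF.mul_prod hG).bdd_mul (c := 1 / r)
    (((continuous_cauchy hr).comp (continuous_fst.sub continuous_snd)).aestronglyMeasurable)
    (ae_of_all _ fun p => abs_cauchy_le hr (p.1 - p.2))
  refine this.congr (ae_of_all _ fun p => ?_)
  simp only [Function.comp, Pi.sub_apply]
  ring

/-- The Cauchy energy of two charges. -/
noncomputable def cauchyEnergy (F G : ℝ → ℝ) (r : ℝ) : ℝ :=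
  ∫ p : ℝ × ℝ, F p.1 * G p.2 * (r / ((p.1 - p.2) ^ 2 + r ^ 2))

/-- Fubini for the representation of `-ln |t|` by `cauchyDiff`. The counterterm `r/(1+r²)` makes the
`r`-integral converge and is not seen by the neutral charge `F`. -/
theorem cauchyEnergy_integral {F G : ℝ → ℝ} (hF : Integrable F) (hG : Integrable G)
    (h0 : ∫ x, F x = 0)
    (hlog : Integrable fun p : ℝ × ℝ => F p.1 * G p.2 * Real.log |p.1 - p.2|) :
    IntegrableOn (cauchyEnergy F G) (Ioi 0) ∧ ∫ r in Ioi 0, cauchyEnergy F G r =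
      -∫ p : ℝ × ℝ, F p.1 * G p.2 * Real.log |p.1 - p.2| := by
  have hFG := hF.mul_prod hG
  set Φ : (ℝ × ℝ) × ℝ → ℝ := fun q => F q.1.1 * G q.1.2 * cauchyDiff (q.1.1 - q.1.2) q.2
  have hm : Measurable fun q : (ℝ × ℝ) × ℝ => cauchyDiff (q.1.1 - q.1.2) q.2 := by
    unfold cauchyDiff; fun_prop
  have hΦm : AEStronglyMeasurable Φ (volume.prod (volume.restrict (Ioi 0))) :=
    (hFG.1.comp_fst).mul hm.aestronglyMeasurable
  have hne := ae_fst_ne_snd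
  have hΦ : Integrable Φ (volume.prod (volume.restrict (Ioi 0))) := by
    rw [integrable_prod_iff hΦm]
    constructor
    · filter_upwards [hne] with p hp
      exact (cauchyDiff_integral (sub_ne_zero.2 hp)).1.const_mul (F p.1 * G p.2)
    · refine hlog.abs.congr ?_
      filter_upwards [hne] with p hp
      simp only [Φ, norm_mul, Real.norm_eq_abs, abs_mul]
      rw [integral_const_mul, (cauchyDiff_integral (sub_ne_zero.2 hp)).2.2]
  have e1 : ∫ q, Φ q ∂(volume.prod (volume.restrict (Ioi 0))) =
      -∫ p : ℝ × ℝ, F p.1 * G p.2 * Real.log |p.1 - p.2| := by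
    rw [integral_prod _ hΦ, ← integral_neg]
    refine integral_congr_ae ?_
    filter_upwards [hne] with p hp
    simp only [Φ]
    rw [integral_const_mul, (cauchyDiff_integral (sub_ne_zero.2 hp)).2.1, mul_neg]
  have hJ : ∀ r ∈ Ioi (0 : ℝ), ∫ p, Φ (p, r) = cauchyEnergy F G r := fun r hr => by
    have h1 := integrable_cauchy_mul hF hG hr
    have h2 := hFG.mul_const (r / (1 + r ^ 2))
    have h3 : ∫ p : ℝ × ℝ, F p.1 * G p.2 * (r / (1 + r ^ 2)) = 0 := by
      rw [integral_mul_const]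
      have := integral_prod_mul (μ := volume) (ν := volume) F G
      rw [h0, zero_mul] at this
      rw [show ∫ p : ℝ × ℝ, F p.1 * G p.2 = 0 from this, zero_mul]
    have h4 : ∫ p, Φ (p, r) = ∫ p : ℝ × ℝ, (F p.1 * G p.2 * (r / ((p.1 - p.2) ^ 2 + r ^ 2))
        - F p.1 * G p.2 * (r / (1 + r ^ 2))) := by
      congr 1; funext p; simp only [Φ, cauchyDiff]; ring
    rw [h4, integral_sub h1 h2, h3, sub_zero, cauchyEnergy]
  have hint : IntegrableOn (fun r => ∫ p, Φ (p, r)) (Ioi 0) := hΦ.integral_prod_right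
  refine ⟨hint.congr_fun hJ measurableSet_Ioi, ?_⟩
  rw [← e1, integral_prod_symm _ hΦ]
  exact (setIntegral_congr_fun measurableSet_Ioi hJ).symm

/-! ### Fourier representation of the Cauchy energy -/

theorem integrable_exp_neg_abs {r : ℝ} (hr : 0 < r) : Integrable fun ξ : ℝ => Real.exp (-r * |ξ|) := by
  rw [← integrableOn_univ, ← Iic_union_Ioi (a := (0 : ℝ)), integrableOn_union]
  constructor
  · refine (integrableOn_exp_mul_Iic hr 0).congr_fun (fun ξ (hξ : ξ ≤ 0) => ?_) measurableSet_Iic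
    simp only [abs_of_nonpos hξ]; congr 1; ring
  · refine (integrableOn_exp_mul_Ioi (neg_lt_zero.2 hr) 0).congr_fun (fun ξ (hξ : 0 < ξ) => ?_)
      measurableSet_Ioi
    simp only [abs_of_pos hξ]

theorem integral_exp_neg_abs_mul_exp {r : ℝ} (hr : 0 < r) (t : ℝ) :
    ∫ ξ : ℝ, (Real.exp (-r * |ξ|) : ℂ) * Complex.exp (-(Complex.I * t * ξ)) =
      (2 * (r / (t ^ 2 + r ^ 2)) : ℝ) := by
  have hi1 : IntegrableOn (fun ξ : ℝ => Complex.exp ((r - Complex.I * t) * ξ)) (Iic 0) :=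
    integrableOn_exp_mul_complex_Iic (by simpa using hr) 0
  have hi2 : IntegrableOn (fun ξ : ℝ => Complex.exp ((-r - Complex.I * t) * ξ)) (Ioi 0) :=
    integrableOn_exp_mul_complex_Ioi (by simpa using hr) 0
  have e1 : EqOn (fun ξ : ℝ => Complex.exp ((r - Complex.I * t) * ξ))
      (fun ξ : ℝ => (Real.exp (-r * |ξ|) : ℂ) * Complex.exp (-(Complex.I * t * ξ))) (Iic 0) :=
    fun ξ (hξ : ξ ≤ 0) => by
      simp only [abs_of_nonpos hξ, Complex.ofReal_exp, ← Complex.exp_add]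
      congr 1; push_cast; ring
  have e2 : EqOn (fun ξ : ℝ => Complex.exp ((-r - Complex.I * t) * ξ))
      (fun ξ : ℝ => (Real.exp (-r * |ξ|) : ℂ) * Complex.exp (-(Complex.I * t * ξ))) (Ioi 0) :=
    fun ξ (hξ : 0 < ξ) => by
      simp only [abs_of_pos hξ, Complex.ofReal_exp, ← Complex.exp_add]
      congr 1; push_cast; ring
  rw [← intervalIntegral.integral_Iic_add_Ioi (b := 0) (hi1.congr_fun e1 measurableSet_Iic)
    (hi2.congr_fun e2 measurableSet_Ioi), ← setIntegral_congr_fun measurableSet_Iic e1,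
    ← setIntegral_congr_fun measurableSet_Ioi e2,
    integral_exp_mul_complex_Iic (by simpa using hr),
    integral_exp_mul_complex_Ioi (by simpa using hr)]
  have h1 : (r - Complex.I * t : ℂ) ≠ 0 := fun h => hr.ne' (by simpa using congrArg Complex.re h)
  have h2 : (-r - Complex.I * t : ℂ) ≠ 0 := fun h => hr.ne' (by simpa using congrArg Complex.re h)
  have h3 : (t ^ 2 + r ^ 2 : ℂ) ≠ 0 := by
    have : t ^ 2 + r ^ 2 ≠ 0 := by positivity
    exact_mod_cast this
  push_cast
  simp only [mul_zero, Complex.exp_zero]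
  field_simp
  ring_nf
  simp only [Complex.I_sq]
  ring

theorem norm_exp_neg_I_mul (t x : ℝ) : ‖Complex.exp (-(Complex.I * t * x))‖ = 1 := by
  rw [show -(Complex.I * t * x) = ((-(t * x) : ℝ) : ℂ) * Complex.I by push_cast; ring,
    Complex.norm_exp_ofReal_mul_I]

theorem integrable_mul_exp {F : ℝ → ℝ} (hF : Integrable F) (x : ℝ) :
    Integrable fun t => (F t : ℂ) * Complex.exp (-(Complex.I * t * x)) :=
  hF.ofReal.mul_bdd (c := 1) (Continuous.aestronglyMeasurable (by fun_prop))
    (ae_of_all _ fun t => (norm_exp_neg_I_mul t x).le)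

theorem norm_fourierT_le {F : ℝ → ℝ} (hF : Integrable F) (x : ℝ) :
    ‖fourierT F x‖ ≤ ∫ t, |F t| :=
  norm_integral_le_of_norm_le hF.abs (ae_of_all _ fun t => by
    rw [norm_mul, norm_exp_neg_I_mul, mul_one, Complex.norm_real, Real.norm_eq_abs])

theorem continuous_fourierT {F : ℝ → ℝ} (hF : Integrable F) : Continuous (fourierT F) :=
  continuous_of_dominated (fun x => (integrable_mul_exp hF x).1)
    (fun x => ae_of_all _ fun t => by
      rw [norm_mul, norm_exp_neg_I_mul, mul_one, Complex.norm_real, Real.norm_eq_abs]) hF.abs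
    (ae_of_all _ fun t => by fun_prop)

theorem fourierT_mul_conj {F G : ℝ → ℝ} (ξ : ℝ) :
    fourierT F ξ * (starRingEnd ℂ) (fourierT G ξ) =
      ∫ p : ℝ × ℝ, (F p.1 * G p.2 : ℂ) * Complex.exp (-(Complex.I * (p.1 - p.2 : ℝ) * ξ)) := by
  rw [fourierT, fourierT, ← integral_conj]
  refine (integral_prod_mul (μ := volume) (ν := volume) _ _).symm.trans ?_
  refine integral_congr_ae (ae_of_all _ fun p => ?_)
  simp only [map_mul, Complex.conj_ofReal, ← Complex.exp_conj, map_neg, Complex.conj_I]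
  have h : Complex.exp (-(Complex.I * (p.1 - p.2 : ℝ) * ξ)) =
      Complex.exp (-(Complex.I * p.1 * ξ)) * Complex.exp (-(-Complex.I * p.2 * ξ)) := by
    rw [← Complex.exp_add]; congr 1; push_cast; ring
  rw [h]; ring

/-- The Cauchy kernel is half the Fourier transform of `exp (-r|ξ|)`, so the double integral becomes
a positive weight against the product of the two transforms. -/
theorem cauchyEnergy_eq_fourier {F G : ℝ → ℝ} (hF : Integrable F) (hG : Integrable G) {r : ℝ}
    (hr : 0 < r) : cauchyEnergy F G r = 1 / 2 * ∫ ξ : ℝ, Real.exp (-r * |ξ|) *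
      (fourierT F ξ * (starRingEnd ℂ) (fourierT G ξ)).re := by
  have hFG : Integrable fun p : ℝ × ℝ => ((F p.1 * G p.2 : ℝ) : ℂ) := (hF.mul_prod hG).ofReal
  have hE := (integrable_exp_neg_abs hr).ofReal (𝕜 := ℂ)
  have hΦ : Integrable (fun q : ℝ × (ℝ × ℝ) => ((Real.exp (-r * |q.1|) : ℂ) *
      ((F q.2.1 * G q.2.2 : ℝ) : ℂ)) * Complex.exp (-(Complex.I * (q.2.1 - q.2.2 : ℝ) * q.1)))
      (volume.prod volume) :=
    (hE.mul_prod hFG).mul_bdd (c := 1) (Continuous.aestronglyMeasurable (by fun_prop))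
      (ae_of_all _ fun q => (norm_exp_neg_I_mul _ _).le)
  have key : ∫ ξ : ℝ, (Real.exp (-r * |ξ|) : ℂ) *
      (fourierT F ξ * (starRingEnd ℂ) (fourierT G ξ)) = ((2 * cauchyEnergy F G r : ℝ) : ℂ) := by
    have h1 : ∀ ξ : ℝ, (Real.exp (-r * |ξ|) : ℂ) *
        (fourierT F ξ * (starRingEnd ℂ) (fourierT G ξ)) =
        ∫ p : ℝ × ℝ, ((Real.exp (-r * |ξ|) : ℂ) * ((F p.1 * G p.2 : ℝ) : ℂ)) *
          Complex.exp (-(Complex.I * (p.1 - p.2 : ℝ) * ξ)) := fun ξ => by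
      rw [fourierT_mul_conj, ← integral_const_mul]
      congr 1; funext p; push_cast; ring
    simp only [h1]
    rw [integral_integral_swap hΦ, cauchyEnergy, ← integral_const_mul, ← integral_complex_ofReal]
    congr 1; funext p
    have h2 := integral_exp_neg_abs_mul_exp hr (p.1 - p.2)
    calc _ = ∫ ξ : ℝ, ((F p.1 * G p.2 : ℝ) : ℂ) * ((Real.exp (-r * |ξ|) : ℂ) *
          Complex.exp (-(Complex.I * (p.1 - p.2 : ℝ) * ξ))) := by
          congr 1; funext ξ; ring
      _ = _ := by rw [integral_const_mul, h2]; push_cast; ring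
  have hint : Integrable fun ξ : ℝ => (Real.exp (-r * |ξ|) : ℂ) *
      (fourierT F ξ * (starRingEnd ℂ) (fourierT G ξ)) :=
    hE.mul_bdd (c := (∫ t, |F t|) * ∫ t, |G t|)
      ((continuous_fourierT hF).mul (Complex.continuous_conj.comp
        (continuous_fourierT hG))).aestronglyMeasurable
      (ae_of_all _ fun ξ => by
        rw [norm_mul, RCLike.norm_conj]
        exact mul_le_mul (norm_fourierT_le hF ξ) (norm_fourierT_le hG ξ) (norm_nonneg _)
          (integral_nonneg fun t => abs_nonneg _))
  have h3 := congrArg Complex.re key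
  rw [Complex.ofReal_re] at h3
  have h4 : (∫ ξ : ℝ, (Real.exp (-r * |ξ|) : ℂ) *
      (fourierT F ξ * (starRingEnd ℂ) (fourierT G ξ))).re = ∫ ξ : ℝ, Real.exp (-r * |ξ|) *
      (fourierT F ξ * (starRingEnd ℂ) (fourierT G ξ)).re := by
    have := integral_re hint
    simp only [RCLike.re_to_complex, Complex.re_ofReal_mul] at this
    exact this.symm
  rw [← h4, h3]; ring

/-- Fatou's lemma for nonnegative real functions with bounded integrals. -/
theorem integrable_of_tendsto_of_integral_le {α : Type*} [MeasurableSpace α] {ν : Measure α}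
    {F : ℕ → α → ℝ} {f : α → ℝ} {C : ℝ} (hi : ∀ n, Integrable (F n) ν)
    (h0 : ∀ n x, 0 ≤ F n x) (hC : ∀ n, ∫ x, F n x ∂ν ≤ C)
    (hlim : ∀ᵐ x ∂ν, Tendsto (fun n => F n x) atTop (𝓝 (f x))) :
    Integrable f ν ∧ ∫ x, f x ∂ν ≤ C := by
  have hm : AEStronglyMeasurable f ν := aestronglyMeasurable_of_tendsto_ae atTop
    (fun n => (hi n).1) hlim
  have hf0 : 0 ≤ᵐ[ν] f := hlim.mono fun x hx => ge_of_tendsto' hx fun n => h0 n x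
  have hC0 : 0 ≤ C := (integral_nonneg (h0 0)).trans (hC 0)
  have hle : ∫⁻ x, ENNReal.ofReal (f x) ∂ν ≤ ENNReal.ofReal C := by
    calc ∫⁻ x, ENNReal.ofReal (f x) ∂ν
        = ∫⁻ x, liminf (fun n => ENNReal.ofReal (F n x)) atTop ∂ν :=
          lintegral_congr_ae (hlim.mono fun x hx =>
            ((ENNReal.continuous_ofReal.tendsto _).comp hx).liminf_eq.symm)
      _ ≤ liminf (fun n => ∫⁻ x, ENNReal.ofReal (F n x) ∂ν) atTop :=
          lintegral_liminf_le' fun n => (hi n).1.aemeasurable.ennreal_ofReal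
      _ ≤ ENNReal.ofReal C := by
          refine liminf_le_of_le (by isBoundedDefault) fun b hb => ?_
          obtain ⟨n, hn⟩ := hb.exists
          refine hn.trans ?_
          rw [← ofReal_integral_eq_lintegral_ofReal (hi n) (ae_of_all _ (h0 n))]
          exact ENNReal.ofReal_le_ofReal (hC n)
  have hint : Integrable f ν := ⟨hm, by
    rw [hasFiniteIntegral_iff_ofReal hf0]
    exact hle.trans_lt ENNReal.ofReal_lt_top⟩
  refine ⟨hint, ?_⟩
  rw [integral_eq_lintegral_of_nonneg_ae hf0 hm]
  exact ENNReal.toReal_le_of_le_ofReal hC0 hle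

theorem integral_comp_sub {f g : ℝ → ℝ} (hf : Integrable f) (hg : Integrable g) :
    ∫ p : ℝ × ℝ, f p.1 * g (p.1 - p.2) = (∫ x, f x) * ∫ x, g x := by
  rw [show (volume : Measure (ℝ × ℝ)) = volume.prod volume from rfl,
    integral_prod _ (integrable_comp_sub hf hg), ← integral_mul_const]
  congr 1; funext x
  simp only
  rw [integral_const_mul, integral_sub_left_eq_self g]

/-! ### Bessel's inequality -/

theorem integrable_cauchy {r : ℝ} (hr : 0 < r) : Integrable fun t : ℝ => r / (t ^ 2 + r ^ 2) := by
  have := (integrable_inv_one_add_sq.comp_div hr.ne').const_mul (1 / r)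
  refine this.congr (ae_of_all _ fun t => ?_)
  simp only
  field_simp
  ring

theorem integral_cauchy {r : ℝ} (hr : 0 < r) : ∫ t : ℝ, r / (t ^ 2 + r ^ 2) = Real.pi := by
  have h : (fun t : ℝ => r / (t ^ 2 + r ^ 2)) = fun t => 1 / r * (1 + (t / r) ^ 2)⁻¹ := by
    funext t; field_simp; ring
  rw [h, integral_const_mul, Measure.integral_comp_div (fun t : ℝ => (1 + t ^ 2)⁻¹),
    integral_univ_inv_one_add_sq, abs_of_pos hr, smul_eq_mul]
  field_simp

/-- Use `F(x)F(y) ≤ (F(x)² + F(y)²)/2` and the total mass `π` of the Cauchy kernel. -/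
theorem cauchyEnergy_self_le {F : ℝ → ℝ} (hF : Integrable F) (hF2 : Integrable fun x => F x ^ 2)
    {r : ℝ} (hr : 0 < r) : cauchyEnergy F F r ≤ Real.pi * ∫ x, F x ^ 2 := by
  have i1 := integrable_comp_sub hF2 (integrable_cauchy hr)
  have i2 : Integrable fun p : ℝ × ℝ => F p.2 ^ 2 * (r / ((p.1 - p.2) ^ 2 + r ^ 2)) := by
    refine i1.swap.congr (ae_of_all _ fun p => ?_)
    simp only [Function.comp, Prod.fst_swap, Prod.snd_swap, sub_sq_comm p.2 p.1]
  have e1 := integral_comp_sub hF2 (integrable_cauchy hr)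
  have e2 : ∫ p : ℝ × ℝ, F p.2 ^ 2 * (r / ((p.1 - p.2) ^ 2 + r ^ 2)) =
      ∫ p : ℝ × ℝ, F p.1 ^ 2 * (r / ((p.1 - p.2) ^ 2 + r ^ 2)) := by
    rw [show (volume : Measure (ℝ × ℝ)) = volume.prod volume from rfl, ← integral_prod_swap]
    simp only [Prod.fst_swap, Prod.snd_swap]
    congr 1; funext p; rw [sub_sq_comm]
  rw [integral_cauchy hr] at e1
  calc cauchyEnergy F F r ≤ ∫ p : ℝ × ℝ, 1 / 2 * (F p.1 ^ 2 * (r / ((p.1 - p.2) ^ 2 + r ^ 2)) +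
        F p.2 ^ 2 * (r / ((p.1 - p.2) ^ 2 + r ^ 2))) := by
        refine integral_mono (integrable_cauchy_mul hF hF hr) ((i1.add i2).const_mul _)
          fun p => ?_
        have h1 : 0 ≤ r / ((p.1 - p.2) ^ 2 + r ^ 2) := by positivity
        have h2 : F p.1 * F p.2 ≤ 1 / 2 * (F p.1 ^ 2 + F p.2 ^ 2) := by
          nlinarith [sq_nonneg (F p.1 - F p.2)]
        calc _ ≤ 1 / 2 * (F p.1 ^ 2 + F p.2 ^ 2) * (r / ((p.1 - p.2) ^ 2 + r ^ 2)) :=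
              mul_le_mul_of_nonneg_right h2 h1
          _ = _ := by ring
    _ = Real.pi * ∫ x, F x ^ 2 := by
        rw [integral_const_mul, integral_add i1 i2, e2, e1]; ring

theorem mul_conj_self_re (z : ℂ) : (z * (starRingEnd ℂ) z).re = ‖z‖ ^ 2 := by
  rw [Complex.mul_conj, Complex.ofReal_re, Complex.normSq_eq_norm_sq]

theorem integrable_exp_mul_fourierT_sq {F : ℝ → ℝ} (hF : Integrable F) {r : ℝ} (hr : 0 < r) :
    Integrable fun ξ : ℝ => Real.exp (-r * |ξ|) * ‖fourierT F ξ‖ ^ 2 :=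
  (integrable_exp_neg_abs hr).mul_bdd (c := (∫ t, |F t|) ^ 2)
    ((continuous_fourierT hF).norm.pow 2).aestronglyMeasurable (ae_of_all _ fun ξ => by
      rw [norm_pow, norm_norm]
      exact pow_le_pow_left₀ (norm_nonneg _) (norm_fourierT_le hF ξ) 2)

theorem cauchyEnergy_self {F : ℝ → ℝ} (hF : Integrable F) {r : ℝ} (hr : 0 < r) :
    cauchyEnergy F F r = 1 / 2 * ∫ ξ : ℝ, Real.exp (-r * |ξ|) * ‖fourierT F ξ‖ ^ 2 := by
  rw [cauchyEnergy_eq_fourier hF hF hr]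
  simp only [mul_conj_self_re]

/-- Bessel's inequality for the Fourier transform of integrable functions. -/
theorem fourierT_bessel {F : ℝ → ℝ} (hF : Integrable F) (hF2 : Integrable fun x => F x ^ 2) :
    Integrable (fun ξ => ‖fourierT F ξ‖ ^ 2) ∧
      ∫ ξ, ‖fourierT F ξ‖ ^ 2 ≤ 2 * Real.pi * ∫ x, F x ^ 2 := by
  have hr : ∀ n : ℕ, (0 : ℝ) < 1 / (n + 1) := fun n => by positivity
  -- Abel regularisation by `exp (-r|ξ|)` with `r = 1/(n+1)`, removed by Fatou's lemma.
  refine integrable_of_tendsto_of_integral_le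
    (F := fun n ξ => Real.exp (-(1 / ((n : ℝ) + 1)) * |ξ|) * ‖fourierT F ξ‖ ^ 2)
    (fun n => integrable_exp_mul_fourierT_sq hF (hr n)) (fun n ξ => by positivity) (fun n => ?_)
    (ae_of_all _ fun ξ => ?_)
  · have h1 := cauchyEnergy_self hF (hr n)
    have h2 := cauchyEnergy_self_le hF hF2 (hr n)
    linarith
  · have h1 := tendsto_one_div_add_atTop_nhds_zero_nat (𝕜 := ℝ)
    have h2 := ((h1.neg.mul_const |ξ|).rexp).mul_const (‖fourierT F ξ‖ ^ 2)
    simpa using h2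

/-! ### The logarithmic energy -/

/-- Pairs of charges with finite mutual logarithmic energy. -/
def LogIntegrable (F G : ℝ → ℝ) : Prop :=
  Integrable fun p : ℝ × ℝ => F p.1 * G p.2 * Real.log |p.1 - p.2|

theorem integral_exp_neg_mul_abs {ξ : ℝ} (hξ : ξ ≠ 0) :
    ∫ r in Ioi (0 : ℝ), Real.exp (-r * |ξ|) = 1 / |ξ| := by
  have h := integral_exp_mul_Ioi (a := -|ξ|) (by simpa using hξ) 0
  simp only [mul_zero, Real.exp_zero] at h
  rw [show (fun r : ℝ => Real.exp (-r * |ξ|)) = fun r => Real.exp (-|ξ| * r) by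
    funext r; congr 1; ring, h]
  rw [neg_div_neg_eq]

/-- The diagonal case is nonnegative, so finiteness of the energy gives joint integrability by
Tonelli. It supplies the majorant for the energy of two different charges. -/
theorem integrable_exp_mul_fourierT_prod {F : ℝ → ℝ} (hF : Integrable F) (h0 : ∫ x, F x = 0)
    (hlog : LogIntegrable F F) : Integrable (fun q : ℝ × ℝ =>
      Real.exp (-q.1 * |q.2|) * ‖fourierT F q.2‖ ^ 2)
      ((volume.restrict (Ioi 0)).prod volume) := by
  have hm : Continuous fun q : ℝ × ℝ => Real.exp (-q.1 * |q.2|) * ‖fourierT F q.2‖ ^ 2 := by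
    have := continuous_fourierT hF
    fun_prop
  rw [integrable_prod_iff hm.aestronglyMeasurable]
  have h1 := (cauchyEnergy_integral hF hF h0 hlog).1
  constructor
  · filter_upwards [ae_restrict_mem measurableSet_Ioi] with r hr
    exact integrable_exp_mul_fourierT_sq hF hr
  · refine (h1.const_mul 2).congr ?_
    filter_upwards [ae_restrict_mem measurableSet_Ioi] with r hr
    simp only [norm_mul, norm_pow, norm_norm]
    simp only [Real.norm_eq_abs, Real.abs_exp]
    rw [cauchyEnergy_self hF hr]; ring

theorem integrable_fourierT_sq_div {F : ℝ → ℝ} (hF : Integrable F) (h0 : ∫ x, F x = 0)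
    (hlog : LogIntegrable F F) : Integrable fun ξ => ‖fourierT F ξ‖ ^ 2 / |ξ| := by
  have h := (integrable_exp_mul_fourierT_prod hF h0 hlog).integral_prod_right
  refine h.congr ?_
  have : ∀ᵐ ξ : ℝ, ξ ≠ 0 := by simp [ae_iff]
  filter_upwards [this] with ξ hξ
  rw [integral_mul_const, integral_exp_neg_mul_abs hξ]; ring

theorem abs_mul_conj_re_le (z w : ℂ) :
    |(z * (starRingEnd ℂ) w).re| ≤ (‖z‖ ^ 2 + ‖w‖ ^ 2) / 2 := by
  refine (Complex.abs_re_le_norm _).trans ?_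
  rw [norm_mul, RCLike.norm_conj]
  nlinarith [sq_nonneg (‖z‖ - ‖w‖)]

/-- The logarithmic energy of neutral charges in Fourier space. -/
theorem logEnergy_eq_fourier {F G : ℝ → ℝ} (hF : Integrable F) (hG : Integrable G)
    (hF0 : ∫ x, F x = 0) (hG0 : ∫ x, G x = 0) (hFF : LogIntegrable F F) (hGG : LogIntegrable G G)
    (hFG : LogIntegrable F G) :
    -∫ p : ℝ × ℝ, F p.1 * G p.2 * Real.log |p.1 - p.2| =
      1 / 2 * ∫ ξ, (fourierT F ξ * (starRingEnd ℂ) (fourierT G ξ)).re / |ξ| := by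
  have hc : Continuous fun ξ => (fourierT F ξ * (starRingEnd ℂ) (fourierT G ξ)).re :=
    Complex.continuous_re.comp ((continuous_fourierT hF).mul (Complex.continuous_conj.comp
        (continuous_fourierT hG)))
  have hint : Integrable (fun q : ℝ × ℝ => Real.exp (-q.1 * |q.2|) *
      (fourierT F q.2 * (starRingEnd ℂ) (fourierT G q.2)).re)
      ((volume.restrict (Ioi 0)).prod volume) := by
    refine ((integrable_exp_mul_fourierT_prod hF hF0 hFF).add
      (integrable_exp_mul_fourierT_prod hG hG0 hGG)).mono'
      (((by fun_prop : Continuous fun q : ℝ × ℝ => Real.exp (-q.1 * |q.2|)).mul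
        (hc.comp continuous_snd)).aestronglyMeasurable) (ae_of_all _ fun q => ?_)
    rw [norm_mul, Real.norm_eq_abs, Real.norm_eq_abs, Real.abs_exp, Pi.add_apply, ← mul_add]
    refine mul_le_mul_of_nonneg_left ((abs_mul_conj_re_le _ _).trans ?_) (Real.exp_pos _).le
    have := sq_nonneg ‖fourierT F q.2‖
    have := sq_nonneg ‖fourierT G q.2‖
    linarith
  rw [← (cauchyEnergy_integral hF hG hF0 hFG).2,
    setIntegral_congr_fun measurableSet_Ioi fun r hr => cauchyEnergy_eq_fourier hF hG hr,
    integral_const_mul]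
  congr 1
  -- The `r`-integral of `exp (-r|ξ|)` produces the weight `1/|ξ|`.
  refine (integral_integral_swap (f := fun r ξ => Real.exp (-r * |ξ|) *
      (fourierT F ξ * (starRingEnd ℂ) (fourierT G ξ)).re) hint).trans ?_
  refine integral_congr_ae ?_
  have : ∀ᵐ ξ : ℝ, ξ ≠ 0 := by simp [ae_iff]
  filter_upwards [this] with ξ hξ
  rw [integral_mul_const, integral_exp_neg_mul_abs hξ]; ring

theorem logEnergy_nonpos {F : ℝ → ℝ} (hF : Integrable F) (h0 : ∫ x, F x = 0)
    (hlog : LogIntegrable F F) : ∫ p : ℝ × ℝ, F p.1 * F p.2 * Real.log |p.1 - p.2| ≤ 0 := by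
  have h := logEnergy_eq_fourier hF hF h0 h0 hlog hlog hlog
  have h1 : 0 ≤ ∫ ξ, (fourierT F ξ * (starRingEnd ℂ) (fourierT F ξ)).re / |ξ| :=
    integral_nonneg fun ξ => by
      simp only [mul_conj_self_re]
      positivity
  linarith

/-! ### Neutral charges and their potentials -/

/-- Neutral charge densities with enough integrability and decay. -/
structure LogCharge (F : ℝ → ℝ) : Prop where
  meas : AEStronglyMeasurable F
  moment : Integrable fun x => (1 + |x|) ^ 2 * |F x|
  sq : Integrable fun x => ((1 + |x|) * F x) ^ 2
  neutral : ∫ x, F x = 0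

/-- The logarithmic potential of a charge density. -/
noncomputable def chargePotential (F : ℝ → ℝ) (x : ℝ) : ℝ := ∫ t, F t * Real.log |x - t|

theorem integrable_logNeg_sq_sub (x : ℝ) : Integrable fun t => logNeg (x - t) ^ 2 :=
  (integrable_logNeg_pow 1).comp_sub_left x

namespace LogCharge

variable {F G : ℝ → ℝ}

theorem integrable_pow_mul (h : LogCharge F) {n : ℕ} (hn : n ≤ 2) :
    Integrable fun x => (1 + |x|) ^ n * |F x| := by
  refine h.moment.mono' ?_ (ae_of_all _ fun x => ?_)
  · exact (Continuous.aestronglyMeasurable (by fun_prop)).mul h.meas.norm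
  · rw [Real.norm_of_nonneg (by positivity)]
    gcongr
    linarith [abs_nonneg x]

theorem integrable (h : LogCharge F) : Integrable F := by
  have := h.integrable_pow_mul (n := 0) (by norm_num)
  simp only [pow_zero, one_mul] at this
  exact (integrable_norm_iff h.meas).1 this

theorem integrable_sq (h : LogCharge F) : Integrable fun x => F x ^ 2 := by
  refine h.sq.mono' (h.meas.pow 2) (ae_of_all _ fun x => ?_)
  rw [Real.norm_of_nonneg (by positivity), mul_pow]
  have h1 : 1 ≤ (1 + |x|) ^ 2 := by nlinarith [abs_nonneg x]
  nlinarith [sq_nonneg (F x)]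

theorem integrable_log_mul (h : LogCharge F) : Integrable fun x => F x * Real.log (1 + |x|) := by
  refine (h.integrable_pow_mul (n := 1) (by norm_num)).mono'
    (h.meas.mul (RegularDensity.measurable_log_one_add_abs.aestronglyMeasurable))
    (ae_of_all _ fun x => ?_)
  rw [norm_mul, Real.norm_eq_abs, Real.norm_of_nonneg (log_one_add_abs_nonneg x), pow_one,
    mul_comm]
  refine mul_le_mul_of_nonneg_right ?_ (abs_nonneg _)
  exact (Real.log_le_sub_one_of_pos (by positivity)).trans (by linarith)

/-- Away from the diagonal logarithmic moments suffice. Near it `|F G| ≤ F² + G²` leaves one square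
against the integrable singularity `logNeg`. -/
theorem logIntegrable (hF : LogCharge F) (hG : LogCharge G) : LogIntegrable F G := by
  have h1 := (hF.integrable_log_mul.mul_prod hG.integrable).abs
  have h2 := (hF.integrable.mul_prod hG.integrable_log_mul).abs
  have h3 := integrable_comp_sub hF.integrable_sq integrable_logNeg
  have h4 : Integrable fun p : ℝ × ℝ => G p.2 ^ 2 * logNeg (p.1 - p.2) := by
    refine (integrable_comp_sub hG.integrable_sq integrable_logNeg).swap.congr
      (ae_of_all _ fun p => ?_)
    simp only [Function.comp, Prod.fst_swap, Prod.snd_swap, logNeg, abs_sub_comm]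
  refine ((h1.add h2).add (h3.add h4)).mono' ?_ (ae_of_all _ fun p => ?_)
  · exact (hF.meas.comp_fst.mul hG.meas.comp_snd).mul measurable_log_abs_sub.aestronglyMeasurable
  · have h5 := abs_log_abs_sub_le p.1 p.2
    have h6 := logNeg_nonneg (p.1 - p.2)
    simp only [Pi.add_apply, norm_mul, Real.norm_eq_abs, abs_mul,
      abs_of_nonneg (log_one_add_abs_nonneg _)]
    have h7 : |F p.1| * |G p.2| ≤ F p.1 ^ 2 + G p.2 ^ 2 := by
      nlinarith [sq_nonneg (|F p.1| - |G p.2|), sq_abs (F p.1), sq_abs (G p.2),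
        sq_nonneg (F p.1), sq_nonneg (G p.2)]
    calc |F p.1| * |G p.2| * |Real.log (|p.1 - p.2|)|
        ≤ |F p.1| * |G p.2| * (Real.log (1 + |p.1|) + Real.log (1 + |p.2|)
          + logNeg (p.1 - p.2)) := by gcongr
      _ = |F p.1| * Real.log (1 + |p.1|) * |G p.2| + |F p.1| * (|G p.2| * Real.log (1 + |p.2|))
          + |F p.1| * |G p.2| * logNeg (p.1 - p.2) := by ring
      _ ≤ |F p.1| * Real.log (1 + |p.1|) * |G p.2| + |F p.1| * (|G p.2| * Real.log (1 + |p.2|))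
          + (F p.1 ^ 2 + G p.2 ^ 2) * logNeg (p.1 - p.2) := by gcongr
      _ = _ := by ring

theorem integrable_logNeg_mul (h : LogCharge F) (x : ℝ) :
    Integrable fun t => ((1 + |t|) * |F t|) * logNeg (x - t) := by
  refine (h.sq.add (integrable_logNeg_sq_sub x)).mono' ?_ (ae_of_all _ fun t => ?_)
  · exact ((Continuous.aestronglyMeasurable (by fun_prop)).mul h.meas.norm).mul
      (measurable_logNeg.comp (by fun_prop)).aestronglyMeasurable
  · have := logNeg_nonneg (x - t)
    rw [Real.norm_of_nonneg (by positivity), Pi.add_apply, mul_pow, ← sq_abs (F t), ← mul_pow]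
    nlinarith [sq_nonneg ((1 + |t|) * |F t| - logNeg (x - t)),
      sq_nonneg ((1 + |t|) * |F t|), sq_nonneg (logNeg (x - t))]

theorem exists_logNeg_bound (h : LogCharge F) :
    ∃ B, 0 ≤ B ∧ ∀ x, ∫ t, ((1 + |t|) * |F t|) * logNeg (x - t) ≤ B := by
  refine ⟨(∫ t, ((1 + |t|) * F t) ^ 2) + ∫ t, logNeg t ^ 2,
    add_nonneg (integral_nonneg fun t => sq_nonneg _) (integral_nonneg fun t => sq_nonneg _),
    fun x => ?_⟩
  have e : ∫ t, logNeg t ^ 2 = ∫ t, logNeg (x - t) ^ 2 :=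
    (integral_sub_left_eq_self (fun t => logNeg t ^ 2) volume x).symm
  rw [e, ← integral_add h.sq (integrable_logNeg_sq_sub x)]
  refine integral_mono (h.integrable_logNeg_mul x) (h.sq.add (integrable_logNeg_sq_sub x))
    fun t => ?_
  simp only
  rw [mul_pow, ← sq_abs (F t), ← mul_pow]
  nlinarith [sq_nonneg ((1 + |t|) * |F t| - logNeg (x - t)),
      sq_nonneg ((1 + |t|) * |F t|), sq_nonneg (logNeg (x - t))]

theorem integrable_mul_log (h : LogCharge F) (x : ℝ) :
    Integrable fun t => F t * Real.log |x - t| := by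
  have h1 := (h.integrable.mul_const (Real.log (1 + |x|))).abs
  have h2 := h.integrable_log_mul.abs
  refine ((h1.add h2).add (h.integrable_logNeg_mul x)).mono'
    (h.meas.mul (Measurable.aestronglyMeasurable (by fun_prop))) (ae_of_all _ fun t => ?_)
  have h5 := abs_log_abs_sub_le x t
  have h6 := logNeg_nonneg (x - t)
  simp only [Pi.add_apply, norm_mul, Real.norm_eq_abs, abs_mul,
      abs_of_nonneg (log_one_add_abs_nonneg _)]
  calc |F t| * |Real.log (|x - t|)|
      ≤ |F t| * (Real.log (1 + |x|) + Real.log (1 + |t|) + logNeg (x - t)) := by gcongr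
    _ = |F t| * Real.log (1 + |x|) + |F t| * Real.log (1 + |t|) + 1 * |F t| * logNeg (x - t) := by
        ring
    _ ≤ _ := by gcongr; linarith [abs_nonneg t]

theorem aestronglyMeasurable_chargePotential (h : LogCharge F) :
    AEStronglyMeasurable (chargePotential F) := by
  have : AEStronglyMeasurable (fun p : ℝ × ℝ => F p.2 * Real.log |p.1 - p.2|)
      (volume.prod volume) := h.meas.comp_snd.mul measurable_log_abs_sub.aestronglyMeasurable
  exact this.integral_prod_right'

end LogCharge

/-- Used with `a = t/x`: it makes `ln |x-t| - ln |x|` of order `|t/x|` for large `x`, at the price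
of the logarithmic singularity at `t = x`. -/
theorem abs_log_abs_one_sub_le {a : ℝ} (ha : 1 - a ≠ 0) :
    |Real.log (|1 - a|)| ≤ 2 * |a| * (1 + logNeg (1 - a)) := by
  have hn := logNeg_nonneg (1 - a)
  have hp := abs_pos.2 ha
  have h1 : |1 - a| ≤ 1 + |a| := (abs_sub _ _).trans (by simp)
  have h2 : Real.log |1 - a| ≤ |a| := (Real.log_le_sub_one_of_pos hp).trans (by linarith)
  have h3 : -Real.log |1 - a| ≤ logNeg (1 - a) := le_max_right _ _
  have ha0 := abs_nonneg a
  refine abs_le.2 ⟨?_, by nlinarith⟩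
  rcases le_total (|a|) (1 / 2) with h | h
  · have h4 : 1 / 2 ≤ |1 - a| := by
      have := abs_sub_abs_le_abs_sub 1 a
      rw [abs_one] at this; linarith
    have h5 : 1 - |a| ≤ |1 - a| := by
      have := abs_sub_abs_le_abs_sub 1 a
      rwa [abs_one] at this
    have h6 := Real.one_sub_inv_le_log_of_pos hp
    have h7 : |1 - a|⁻¹ ≤ 1 + 2 * |a| := by
      rw [inv_le_iff_one_le_mul₀ hp]; nlinarith
    nlinarith
  · nlinarith

theorem abs_log_sub_log_le {x t : ℝ} (hx : 1 ≤ |x|) (ht : t ≠ x) :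
    |Real.log (|x - t|) - Real.log (|x|)| ≤
      2 / |x| * ((1 + |t|) * (1 + Real.log (1 + |x|) + logNeg (x - t))) := by
  have hx0 : x ≠ 0 := fun h => by rw [h] at hx; simp at hx; linarith
  have hxp := abs_pos.2 hx0
  have hxt : x - t ≠ 0 := sub_ne_zero.2 (Ne.symm ht)
  have e : 1 - t / x = (x - t) / x := by field_simp
  have e2 : Real.log |x - t| - Real.log |x| = Real.log |1 - t / x| := by
    rw [e, abs_div, Real.log_div (abs_ne_zero.2 hxt) hxp.ne']
  have h1 := abs_log_abs_one_sub_le (a := t / x) (by rw [e]; exact div_ne_zero hxt hx0)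
  have h2 : logNeg (1 - t / x) ≤ Real.log (1 + |x|) + logNeg (x - t) := by
    have h3 : Real.log |x| ≤ Real.log (1 + |x|) := Real.log_le_log hxp (by linarith)
    have h4 : -Real.log |x - t| ≤ logNeg (x - t) := le_max_right _ _
    have h5 := log_one_add_abs_nonneg x
    have h6 := logNeg_nonneg (x - t)
    refine max_le (by linarith) ?_
    rw [← e2]; linarith
  rw [e2]
  have h6 := logNeg_nonneg (x - t)
  have h5 := log_one_add_abs_nonneg x
  calc _ ≤ _ := h1
    _ = 2 / |x| * (|t| * (1 + logNeg (1 - t / x))) := by rw [abs_div]; ring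
    _ ≤ _ := by
        have : 0 ≤ logNeg (1 - t / x) := logNeg_nonneg _
        gcongr ?_ * (?_ * ?_)
        · linarith
        · linarith

namespace LogCharge

variable {F G : ℝ → ℝ}

/-- The potential of a neutral charge decays at infinity. -/
theorem exists_chargePotential_bound (h : LogCharge F) :
    ∃ D, 0 ≤ D ∧ ∀ x, |chargePotential F x| * (1 + |x|) ≤ D * (1 + Real.log (1 + |x|)) := by
  obtain ⟨B, hB0, hB⟩ := h.exists_logNeg_bound
  have i1 := h.integrable_pow_mul (n := 1) (by norm_num)
  simp only [pow_one] at i1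
  set A := ∫ t, (1 + |t|) * |F t| with hA
  have hA0 : 0 ≤ A := integral_nonneg fun t => by positivity
  have hint : ∀ x c : ℝ, Integrable fun t =>
      c * ((1 + |t|) * |F t|) + ((1 + |t|) * |F t|) * logNeg (x - t) := fun x c =>
    (i1.const_mul c).add (h.integrable_logNeg_mul x)
  have hval : ∀ x c : ℝ, ∫ t, (c * ((1 + |t|) * |F t|) + ((1 + |t|) * |F t|) * logNeg (x - t))
      ≤ c * A + B := fun x c => by
    rw [integral_add (i1.const_mul c) (h.integrable_logNeg_mul x), integral_const_mul]
    linarith [hB x]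
  refine ⟨4 * (2 * A + B), by positivity, fun x => ?_⟩
  have hl := log_one_add_abs_nonneg x
  rcases le_total (|x|) 1 with hx | hx
  · have hb : |chargePotential F x| ≤ (1 + Real.log (1 + |x|)) * A + B := by
      refine le_trans ?_ (hval x (1 + Real.log (1 + |x|)))
      refine norm_integral_le_of_norm_le (f := fun t => F t * Real.log |x - t|)
        (hint x _) (ae_of_all _ fun t => ?_)
      have h5 := abs_log_abs_sub_le x t
      have h6 := logNeg_nonneg (x - t)
      have h7 : Real.log (1 + |t|) ≤ |t| :=
        (Real.log_le_sub_one_of_pos (by positivity)).trans (by linarith)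
      have h8 := abs_nonneg t
      rw [norm_mul, Real.norm_eq_abs, Real.norm_eq_abs]
      calc |F t| * |Real.log (|x - t|)| ≤ |F t| * ((1 + |t|) * (1 + Real.log (1 + |x|)) +
            (1 + |t|) * logNeg (x - t)) := by
            refine mul_le_mul_of_nonneg_left (h5.trans ?_) (abs_nonneg _)
            nlinarith [mul_nonneg h8 hl, mul_nonneg h8 h6]
        _ = _ := by ring
    have : |chargePotential F x| * (1 + |x|) ≤ ((1 + Real.log (1 + |x|)) * A + B) * 2 := by
      gcongr; linarith
    nlinarith [mul_nonneg hA0 hl, mul_nonneg hB0 hl]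
  · have hx0 : 0 < |x| := by linarith
    have hb : |chargePotential F x| ≤ 2 / |x| * ((1 + Real.log (1 + |x|)) * A + B) := by
      -- Neutrality allows subtracting `ln |x|`, which gains a factor `1/|x|`.
      have e : chargePotential F x = ∫ t, F t * (Real.log |x - t| - Real.log |x|) := by
        simp only [mul_sub]
        rw [integral_sub (h.integrable_mul_log x) (h.integrable.mul_const _), integral_mul_const,
          h.neutral]
        simp [chargePotential]
      rw [e]
      refine le_trans ?_ (mul_le_mul_of_nonneg_left (hval x (1 + Real.log (1 + |x|)))
        (by positivity))
      rw [← integral_const_mul]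
      refine norm_integral_le_of_norm_le (f := fun t => F t * (Real.log |x - t| - Real.log |x|))
        ((hint x _).const_mul _) ?_
      have : ∀ᵐ t : ℝ, t ≠ x := by simp [ae_iff]
      filter_upwards [this] with t ht
      rw [norm_mul, Real.norm_eq_abs, Real.norm_eq_abs]
      calc |F t| * |Real.log (|x - t|) - Real.log (|x|)| ≤ |F t| * (2 / |x| * ((1 + |t|) *
            (1 + Real.log (1 + |x|) + logNeg (x - t)))) := mul_le_mul_of_nonneg_left (abs_log_sub_log_le hx ht) (abs_nonneg _)
        _ = _ := by ring
    have h9 : 1 + |x| ≤ 2 * |x| := by linarith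
    have hn : 0 ≤ (1 + Real.log (1 + |x|)) * A + B := by positivity
    calc |chargePotential F x| * (1 + |x|)
        ≤ 2 / |x| * ((1 + Real.log (1 + |x|)) * A + B) * (2 * |x|) := by gcongr
      _ = 4 * ((1 + Real.log (1 + |x|)) * A + B) := by field_simp; ring
      _ ≤ _ := by nlinarith [mul_nonneg hA0 hl, mul_nonneg hB0 hl]

/-- The potential is `O(ln|x| / |x|)`. With `u = 1 + |x|`, the bound `1 + ln u ≤ 5 u^(1/4)` leaves
the square below `25 D² u^(-3/2)`, which is integrable. -/
theorem memLp_chargePotential (h : LogCharge F) : MemLp (chargePotential F) 2 := by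
  obtain ⟨D, hD0, hD⟩ := h.exists_chargePotential_bound
  rw [memLp_two_iff_integrable_sq h.aestronglyMeasurable_chargePotential]
  have h1 : Integrable fun x : ℝ => (1 + ‖x‖) ^ (-(3 / 2 : ℝ)) :=
    integrable_one_add_norm (by norm_num)
  refine (h1.const_mul (25 * D ^ 2)).mono' (h.aestronglyMeasurable_chargePotential.pow 2)
    (ae_of_all _ fun x => ?_)
  have hu : (0 : ℝ) < 1 + |x| := by positivity
  have hlog := Real.log_le_rpow_div hu.le (ε := 1 / 4) (by norm_num)
  have h1u : 1 ≤ (1 + |x|) ^ (1 / 4 : ℝ) :=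
    Real.one_le_rpow (by linarith [abs_nonneg x]) (by norm_num)
  have hb : |chargePotential F x| * (1 + |x|) ≤ D * (5 * (1 + |x|) ^ (1 / 4 : ℝ)) :=
    (hD x).trans (mul_le_mul_of_nonneg_left (by linarith) hD0)
  rw [Real.norm_of_nonneg (sq_nonneg _), Real.norm_eq_abs, ← sq_abs]
  have e : (1 + |x|) ^ (-(3 / 2 : ℝ)) = ((1 + |x|) ^ (1 / 4 : ℝ)) ^ 2 / (1 + |x|) ^ 2 := by
    rw [← Real.rpow_natCast, ← Real.rpow_mul hu.le, ← Real.rpow_natCast, ← Real.rpow_sub hu]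
    congr 1; norm_num
  rw [e, ← mul_div_assoc, le_div_iff₀ (by positivity), ← mul_pow]
  calc _ ≤ (D * (5 * (1 + |x|) ^ (1 / 4 : ℝ))) ^ 2 := by gcongr
    _ = _ := by ring

end LogCharge

/-! ### The charges `vρ` and negativity of the centered logarithm -/

namespace RegularDensity

variable {μ : Measure ℝ} [IsProbabilityMeasure μ] {ρ : ℝ → ℝ}

theorem logCharge (h : RegularDensity μ ρ) {v : ℝ → ℝ} (hv : MemLp v 2 μ)
    (h0 : ∫ x, v x ∂μ = 0) : LogCharge fun x => ρ x * v x := by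
  have hvm : AEStronglyMeasurable v volume := hv.1.mono_ac h.volume_ac
  have hm := h.cont.aestronglyMeasurable.mul hvm (μ := volume)
  have hsq : Integrable fun x => ρ x * v x ^ 2 :=
    (h.integrable_iff _).1 ((memLp_two_iff_integrable_sq hv.1).1 hv)
  refine ⟨hm, ?_, ?_, ?_⟩
  · refine (hsq.add (h.integrable_pow_mul 4)).mono'
      ((Continuous.aestronglyMeasurable (by fun_prop)).mul hm.norm) (ae_of_all _ fun x => ?_)
    have hp := h.pos x
    rw [Real.norm_of_nonneg (by positivity), abs_mul, abs_of_pos hp, Pi.add_apply,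
      ← sq_abs (v x)]
    have : (1 + |x|) ^ 2 * |v x| ≤ |v x| ^ 2 + (1 + |x|) ^ 4 := by
      nlinarith [sq_nonneg ((1 + |x|) ^ 2 - |v x|), sq_nonneg (|v x|),
        sq_nonneg ((1 + |x|) ^ 2)]
    nlinarith
  · obtain ⟨C, hC⟩ := h.bound 2
    refine (hsq.const_mul C).mono'
      (((Continuous.aestronglyMeasurable (by fun_prop)).mul hm).pow 2) (ae_of_all _ fun x => ?_)
    have hp := h.pos x
    rw [Real.norm_of_nonneg (by positivity)]
    calc ((1 + |x|) * (ρ x * v x)) ^ 2 = (1 + |x|) ^ 2 * ρ x * (ρ x * v x ^ 2) := by ring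
      _ ≤ C * (ρ x * v x ^ 2) := mul_le_mul_of_nonneg_right (hC x) (by positivity)
  · rw [← h.integral_eq, h0]

theorem chargePotential_eq (h : RegularDensity μ ρ) (v : ℝ → ℝ) (x : ℝ) :
    chargePotential (fun x => ρ x * v x) x = ∫ y, Real.log |x - y| * v y ∂μ := by
  rw [h.integral_eq, chargePotential]
  congr 1; funext t; ring

theorem memLp_of_volume (h : RegularDensity μ ρ) {f : ℝ → ℝ} (hf : MemLp f 2) : MemLp f 2 μ := by
  obtain ⟨M, -, hM⟩ := h.exists_ae_bound
  rw [memLp_two_iff_integrable_sq (hf.1.mono_ac h.ac)]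
  exact integrable_of_bounded_density h.ac hM ((memLp_two_iff_integrable_sq hf.1).1 hf)

theorem kernelOp_logKernel (h : RegularDensity μ ρ) (P : ℝ) {v : ℝ → ℝ} (hv : MemLp v 2 μ)
    (x : ℝ) : kernelOp μ (logKernel P μ) v x =
      2 * P * (chargePotential (fun x => ρ x * v x) x - ∫ y, logPotential μ y * v y ∂μ) := by
  rw [h.chargePotential_eq, ← integral_sub, ← integral_const_mul, kernelOp]
  · congr 1; funext y; rw [logKernel_eq]; ring
  · exact ((h.momentKernel_log.left x).memLp_two).integrable_mul hv
  · exact h.allMoments_logPotential.memLp_two.integrable_mul hv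

theorem kernelOp_centeredLog (h : RegularDensity μ ρ) (P : ℝ) {v : ℝ → ℝ} (hv : MemLp v 2 μ)
    (h0 : ∫ x, v x ∂μ = 0) (x : ℝ) : kernelOp μ (centeredLog P μ) v x =
      2 * P * (chargePotential (fun x => ρ x * v x) x - ∫ y, logPotential μ y * v y ∂μ) := by
  rw [← h.kernelOp_logKernel P hv, kernelOp, kernelOp]
  have e : (fun y => centeredLog P μ x y * v y) = fun y => logKernel P μ x y * v y
      - 2 * P * (logPotential μ x - ∫ z, logPotential μ z ∂μ) * v y := by
    funext y; rw [logKernel_eq, centeredLog]; ring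
  rw [e, integral_sub, integral_const_mul, h0]
  · ring
  · have h1 : Integrable (fun y => Real.log |x - y| * v y) μ :=
      ((h.momentKernel_log.left x).memLp_two).integrable_mul hv
    have h2 : Integrable (fun y => logPotential μ y * v y) μ :=
      h.allMoments_logPotential.memLp_two.integrable_mul hv
    refine ((h1.sub h2).const_mul (2 * P)).congr (ae_of_all _ fun y => ?_)
    simp only [Pi.sub_apply]
    rw [logKernel_eq]; ring
  · exact (hv.integrable one_le_two).const_mul _

/-- On mean zero functions the quadratic form is `2P` times the logarithmic energy of the neutral
charge `vρ`. -/
theorem centeredLog_neg (h : RegularDensity μ ρ) {P : ℝ} (hP : 0 < P) (v : ℝ → ℝ)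
    (hv : MemLp v 2 μ) (h0 : ∫ x, v x ∂μ = 0) :
    ∫ x, kernelOp μ (centeredLog P μ) v x * v x ∂μ ≤ 0 := by
  have hF := h.logCharge hv h0
  have hn := logEnergy_nonpos hF.integrable hF.neutral (hF.logIntegrable hF)
  have e : ∫ x, chargePotential (fun x => ρ x * v x) x * v x ∂μ =
      ∫ p : ℝ × ℝ, (ρ p.1 * v p.1) * (ρ p.2 * v p.2) * Real.log |p.1 - p.2| := by
    rw [h.integral_eq, show (volume : Measure (ℝ × ℝ)) = volume.prod volume from rfl,
      integral_prod _ (hF.logIntegrable hF)]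
    congr 1; funext x
    simp only [chargePotential]
    rw [← mul_assoc, mul_comm, mul_comm (ρ x), ← mul_assoc, mul_comm, ← integral_const_mul]
    rw [← integral_const_mul]
    congr 1; funext y; ring
  simp only [h.kernelOp_centeredLog P hv h0]
  have i1 : Integrable (fun x => chargePotential (fun x => ρ x * v x) x * v x) μ :=
    (h.memLp_of_volume hF.memLp_chargePotential).integrable_mul hv
  set c := ∫ y, logPotential μ y * v y ∂μ
  have : (fun x => 2 * P * (chargePotential (fun x => ρ x * v x) x - c) * v x) = fun x =>
      2 * P * (chargePotential (fun x => ρ x * v x) x * v x) - 2 * P * c * v x := by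
    funext x; ring
  rw [this, integral_sub (i1.const_mul _) ((hv.integrable one_le_two).const_mul _),
    integral_const_mul, integral_const_mul, h0, e]
  nlinarith

end RegularDensity

/-! ### The tail of a charge and its Hilbert transform -/

/-- The tail `∫_x^∞ F`. -/
noncomputable def tail (F : ℝ → ℝ) (x : ℝ) : ℝ := ∫ t in Ioi x, F t

theorem tail_eq_neg {F : ℝ → ℝ} (hF : Integrable F) (h0 : ∫ t, F t = 0) (x : ℝ) :
    tail F x = -∫ t in Iic x, F t := by
  have := intervalIntegral.integral_Iic_add_Ioi (b := x) hF.integrableOn hF.integrableOn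
  rw [h0] at this
  rw [tail]; linarith

theorem tail_eq_sub {F : ℝ → ℝ} (hF : Integrable F) (x : ℝ) :
    tail F x = tail F 0 - ∫ t in (0 : ℝ)..x, F t := by
  rw [tail, tail, intervalIntegral.integral_Ioi_sub_Ioi' hF.integrableOn hF.integrableOn |>.symm]
  ring

theorem continuous_tail {F : ℝ → ℝ} (hF : Integrable F) : Continuous (tail F) := by
  have : tail F = fun x => tail F 0 - ∫ t in (0 : ℝ)..x, F t := funext (tail_eq_sub hF)
  rw [this]
  exact continuous_const.sub (intervalIntegral.continuous_primitive
    (fun a b => hF.intervalIntegrable) 0)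

namespace LogCharge

variable {F : ℝ → ℝ}

/-- By neutrality the tail is an integral over either half-line. On the side where `|t| ≥ |x|`, it
is controlled by the second moment as in Chebyshev's inequality. -/
theorem abs_tail_mul_le (h : LogCharge F) (x : ℝ) :
    |tail F x| * (1 + |x|) ^ 2 ≤ ∫ t, (1 + |t|) ^ 2 * |F t| := by
  have key : ∀ s : Set ℝ, MeasurableSet s → (∀ t ∈ s, |x| ≤ |t|) →
      |∫ t in s, F t| * (1 + |x|) ^ 2 ≤ ∫ t, (1 + |t|) ^ 2 * |F t| := fun s hs hst => by
    have h1 : |∫ t in s, F t| ≤ ∫ t in s, |F t| := by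
      simpa only [Real.norm_eq_abs] using norm_integral_le_integral_norm (μ := volume.restrict s) F
    calc |∫ t in s, F t| * (1 + |x|) ^ 2 ≤ (∫ t in s, |F t|) * (1 + |x|) ^ 2 := by gcongr
      _ = ∫ t in s, |F t| * (1 + |x|) ^ 2 := (integral_mul_const _ _).symm
      _ ≤ ∫ t in s, (1 + |t|) ^ 2 * |F t| := by
          refine setIntegral_mono_on (h.integrable.abs.mul_const _).integrableOn
            h.moment.integrableOn hs fun t ht => ?_
          rw [mul_comm]
          have := hst t ht
          gcongr
      _ ≤ _ := setIntegral_le_integral h.moment (ae_of_all _ fun t => by positivity)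
  rcases le_total 0 x with hx | hx
  · exact key _ measurableSet_Ioi fun t (ht : x < t) => by
      rw [abs_of_nonneg hx, abs_of_nonneg (by linarith)]; exact ht.le
  · rw [tail_eq_neg h.integrable h.neutral, abs_neg]
    exact key _ measurableSet_Iic fun t (ht : t ≤ x) => by
      rw [abs_of_nonpos hx, abs_of_nonpos (by linarith)]; linarith

theorem exists_tail_bound (h : LogCharge F) : ∃ C, 0 ≤ C ∧ ∀ x, |tail F x| ≤ C := by
  refine ⟨_, integral_nonneg fun t => ?_, fun x => le_trans ?_ (h.abs_tail_mul_le x)⟩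
  · positivity
  · exact le_mul_of_one_le_right (abs_nonneg _) (by nlinarith [abs_nonneg x])

theorem integrable_tail (h : LogCharge F) : Integrable (tail F) := by
  have h1 : Integrable fun x : ℝ => (1 + ‖x‖) ^ (-(2 : ℝ)) := integrable_one_add_norm (by simp)
  refine (h1.const_mul (∫ t, (1 + |t|) ^ 2 * |F t|)).mono'
    (continuous_tail h.integrable).aestronglyMeasurable (ae_of_all _ fun x => ?_)
  rw [Real.norm_eq_abs, Real.norm_eq_abs, Real.rpow_neg (by positivity), ← div_eq_mul_inv,
    le_div_iff₀ (by positivity), show (2 : ℝ) = (2 : ℕ) by norm_num, Real.rpow_natCast]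
  exact h.abs_tail_mul_le x

theorem memLp_tail (h : LogCharge F) : MemLp (tail F) 2 := by
  obtain ⟨C, -, hC⟩ := h.exists_tail_bound
  have hc := continuous_tail h.integrable
  rw [memLp_two_iff_integrable_sq hc.aestronglyMeasurable]
  refine (h.integrable_tail.bdd_mul (c := C) hc.aestronglyMeasurable
    (ae_of_all _ hC)).congr (ae_of_all _ fun x => ?_)
  simp only
  ring

end LogCharge

theorem integral_indicator_inv {ε r : ℝ} (hε : 0 < ε) (hr : ε < r) :
    IntervalIntegrable (fun t : ℝ => 1 / t) volume ε r ∧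
      ∫ t in ε..r, 1 / t = Real.log r - Real.log ε := by
  have h0 : (0 : ℝ) ∉ uIcc ε r := by
    rw [uIcc_of_le hr.le]; exact fun h => absurd h.1 (not_le.2 hε)
  refine ⟨?_, ?_⟩
  · refine ContinuousOn.intervalIntegrable (continuousOn_const.div continuousOn_id fun t ht h => ?_)
    exact h0 (h ▸ ht)
  · rw [integral_one_div h0, Real.log_div (by linarith) hε.ne']

/-- Fubini for `G(r)/t` over the region `ε < t < r`. -/
theorem integral_tail_div {G : ℝ → ℝ} (hG : Integrable G)
    (hGl : Integrable fun r => G r * Real.log |r|) {ε : ℝ} (hε : 0 < ε) :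
    IntegrableOn (fun t => 1 / t * tail G t) (Ioi ε) ∧
      ∫ t in Ioi ε, 1 / t * tail G t = ∫ r in Ioi ε, G r * (Real.log r - Real.log ε) := by
  set ν := (volume : Measure ℝ).restrict (Ioi ε)
  set Φ : ℝ × ℝ → ℝ := fun q => {q : ℝ × ℝ | q.1 < q.2}.indicator (fun q => 1 / q.1 * G q.2) q
  have hS : MeasurableSet {q : ℝ × ℝ | q.1 < q.2} := measurableSet_lt measurable_fst measurable_snd
  have hm : AEStronglyMeasurable Φ (ν.prod ν) := by
    refine AEStronglyMeasurable.indicator ?_ hS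
    exact (Measurable.aestronglyMeasurable (by fun_prop)).mul
      (hG.1.mono_measure Measure.restrict_le_self).comp_snd
  have hsec : ∀ r, (fun t => Φ (t, r)) = fun t => (Iio r).indicator (fun t => 1 / t) t * G r := by
    intro r; funext t
    by_cases ht : t < r <;> simp [Φ, indicator, ht]
  have hsecL : ∀ r ∈ Ioi ε, IntegrableOn (fun t => (Iio r).indicator (fun t => 1 / t) t) (Ioi ε) ∧
      ∫ t in Ioi ε, (Iio r).indicator (fun t => 1 / t) t = Real.log r - Real.log ε := by
    intro r hr
    obtain ⟨a, b⟩ := integral_indicator_inv hε hr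
    constructor
    · rw [IntegrableOn, integrable_indicator_iff measurableSet_Iio, IntegrableOn,
        Measure.restrict_restrict measurableSet_Iio, inter_comm, Ioi_inter_Iio]
      exact a.1.mono_set Ioo_subset_Ioc_self
    · rw [integral_indicator measurableSet_Iio, Measure.restrict_restrict measurableSet_Iio,
        inter_comm, Ioi_inter_Iio, ← integral_Ioc_eq_integral_Ioo,
        ← intervalIntegral.integral_of_le (le_of_lt hr), b]
  have hΦ : Integrable Φ (ν.prod ν) := by
    rw [integrable_prod_iff' hm]
    constructor
    · filter_upwards [ae_restrict_mem measurableSet_Ioi] with r hr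
      rw [hsec]
      exact (hsecL r hr).1.mul_const _
    · have : IntegrableOn (fun r => |G r * Real.log |r| - G r * Real.log ε|) (Ioi ε) :=
        (hGl.sub (hG.mul_const _)).abs.integrableOn
      refine this.congr ?_
      filter_upwards [ae_restrict_mem measurableSet_Ioi] with r hr
      have hr' : ε < r := hr
      have e : ∀ t ∈ Ioi ε, ‖Φ (t, r)‖ = (Iio r).indicator (fun t => 1 / t) t * |G r| :=
        fun t (ht : ε < t) => by
          rw [congrFun (hsec r) t, norm_mul, Real.norm_eq_abs, Real.norm_eq_abs, abs_of_nonneg]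
          exact indicator_apply_nonneg fun _ => by
            have : 0 < t := hε.trans ht
            positivity
      rw [setIntegral_congr_fun measurableSet_Ioi e, integral_mul_const, (hsecL r hr).2,
        ← mul_sub, abs_mul, abs_of_pos (hε.trans hr'), mul_comm, abs_of_nonneg]
      have := Real.log_le_log hε hr'.le
      linarith
  have e1 : ∀ t ∈ Ioi ε, ∫ r, Φ (t, r) ∂ν = 1 / t * tail G t := by
    intro t ht
    have : (fun r => Φ (t, r)) = (Ioi t).indicator fun r => 1 / t * G r := by
      funext r
      by_cases hr : t < r <;> simp [Φ, indicator, hr]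
    rw [this, integral_indicator measurableSet_Ioi, Measure.restrict_restrict measurableSet_Ioi,
      inter_eq_left.2 (Ioi_subset_Ioi (le_of_lt ht)), integral_const_mul, tail]
  have e2 : ∀ r ∈ Ioi ε, ∫ t, Φ (t, r) ∂ν = G r * (Real.log r - Real.log ε) := by
    intro r hr
    rw [hsec, integral_mul_const, (hsecL r hr).2, mul_comm]
  have hi : IntegrableOn (fun t => ∫ r, Φ (t, r) ∂ν) (Ioi ε) := hΦ.integral_prod_left
  refine ⟨hi.congr_fun e1 measurableSet_Ioi, ?_⟩
  rw [← setIntegral_congr_fun measurableSet_Ioi e1, ← setIntegral_congr_fun measurableSet_Ioi e2]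
  exact integral_integral_swap hΦ

theorem integral_eq_integral_Ioi_add {k : ℝ → ℝ} (hk : Integrable k) :
    ∫ s, k s = (∫ s in Ioi 0, k s) + ∫ s in Ioi 0, k (-s) := by
  have h := intervalIntegral.integral_Iic_add_Ioi (b := (0 : ℝ)) hk.integrableOn hk.integrableOn
  have h2 := integral_comp_neg_Ioi (0 : ℝ) k
  rw [neg_zero] at h2
  rw [h2]; linarith

theorem tail_comp_add (F : ℝ → ℝ) (x s : ℝ) : tail (fun r => F (x + r)) s = tail F (x + s) := by
  rw [tail, tail, ← integral_indicator measurableSet_Ioi, ← integral_indicator measurableSet_Ioi,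
    ← integral_add_left_eq_self ((Ioi (x + s)).indicator F) x]
  congr 1; funext r
  simp [indicator]

theorem tail_comp_sub {F : ℝ → ℝ} (hF : Integrable F) (h0 : ∫ t, F t = 0) (x s : ℝ) :
    tail (fun r => F (x - r)) s = -tail F (x - s) := by
  rw [tail_eq_neg hF h0, neg_neg, tail, integral_Iic_eq_integral_Iio,
    ← integral_indicator measurableSet_Ioi, ← integral_indicator measurableSet_Iio,
    ← integral_sub_left_eq_self ((Iio (x - s)).indicator F) volume x]
  congr 1; funext r
  simp only [indicator, mem_Iio, mem_Ioi, sub_lt_sub_iff_left]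

namespace LogCharge

variable {F : ℝ → ℝ}

/-- The truncated principal value integral of the tail. -/
theorem integral_tail_div_sub (h : LogCharge F) (x : ℝ) {ε : ℝ} (hε : 0 < ε) :
    ∫ t in {t : ℝ | ε < |t - x|}, tail F t / (t - x) =
      ∫ q, F q * (Real.log (max |x - q| ε) - Real.log ε) := by
  have hS : MeasurableSet {t : ℝ | ε < |t - x|} := measurableSet_lt (by fun_prop) (by fun_prop)
  set m : ℝ → ℝ := fun s => {s : ℝ | ε < |s|}.indicator (fun s => tail F (x + s) / s) s with hm
  set k : ℝ → ℝ := fun s => F (x + s) * (Real.log (max |s| ε) - Real.log ε) with hk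
  have hS0 : MeasurableSet {s : ℝ | ε < |s|} := measurableSet_lt (by fun_prop) (by fun_prop)
  have e1 : ∫ t in {t : ℝ | ε < |t - x|}, tail F t / (t - x) = ∫ s, m s := by
    rw [← integral_indicator hS, ← integral_add_left_eq_self _ x]
    congr 1; funext s
    simp [hm, indicator]
  have e2 : ∫ q, F q * (Real.log (max |x - q| ε) - Real.log ε) = ∫ s, k s := by
    rw [← integral_add_left_eq_self _ x]
    congr 1; funext s
    simp [hk]
  have hlogx := h.integrable_mul_log x
  have hmi : Integrable m := by
    rw [hm, integrable_indicator_iff hS0]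
    have h1 : Integrable fun s => tail F (x + s) := h.integrable_tail.comp_add_left x
    refine (h1.integrableOn (s := {s : ℝ | ε < |s|})).norm.mul_const (1 / ε) |>.mono' ?_ ?_
    · exact (h1.1.restrict).div₀ (aestronglyMeasurable_id)
    · filter_upwards [ae_restrict_mem hS0] with s hs
      rw [norm_div, div_eq_mul_one_div]
      refine mul_le_mul_of_nonneg_left ?_ (norm_nonneg _)
      exact one_div_le_one_div_of_le hε (le_of_lt hs)
  have hG1 : Integrable fun r => F (x + r) := h.integrable.comp_add_left x
  have hG2 : Integrable fun r => F (x - r) := h.integrable.comp_sub_left x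
  have hl1 : Integrable fun r => F (x + r) * Real.log |r| := by
    refine (hlogx.comp_add_left x).congr (ae_of_all _ fun r => ?_)
    simp only [sub_add_cancel_left, abs_neg]
  have hl2 : Integrable fun r => F (x - r) * Real.log |r| := by
    refine (hlogx.comp_sub_left x).congr (ae_of_all _ fun r => ?_)
    simp only [sub_sub_cancel]
  have hki : Integrable k := by
    refine (hl1.abs.add (hG1.abs.mul_const (2 * |Real.log ε|))).mono' ?_ (ae_of_all _ fun s => ?_)
    · exact hG1.1.mul (Measurable.aestronglyMeasurable (by fun_prop))
    · simp only [hk, norm_mul, Real.norm_eq_abs, Pi.add_apply, abs_mul]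
      rw [← mul_add]
      refine mul_le_mul_of_nonneg_left ?_ (abs_nonneg _)
      have h2 : |Real.log (max |s| ε)| ≤ |Real.log (|s|)| + |Real.log ε| := by
        rcases max_choice |s| ε with h3 | h3 <;> rw [h3]
        · linarith [abs_nonneg (Real.log ε)]
        · linarith [abs_nonneg (Real.log (|s|))]
      linarith [abs_sub (Real.log (max |s| ε)) (Real.log ε)]
  -- Both integrands vanish for arguments at most `ε`, so integrals over `(0, ∞)` reduce to `(ε,
  -- ∞)`.
  have aux : ∀ {u v : ℝ → ℝ}, (∀ s, 0 < s → s ≤ ε → u s = 0) → (∀ s, ε < s → u s = v s) →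
      ∫ s in Ioi 0, u s = ∫ s in Ioi ε, v s := fun {u v} h1 h2 => by
    rw [← setIntegral_congr_fun measurableSet_Ioi (fun s hs => h2 s hs)]
    refine setIntegral_eq_of_subset_of_forall_sdiff_eq_zero measurableSet_Ioi
      (Ioi_subset_Ioi hε.le) fun s hs => h1 s hs.1 (not_lt.1 hs.2)
  -- On the left half-line, reflection turns the tail of `F` into minus the tail of the reflected
  -- charge, by neutrality. The sign of `1/s` compensates.
  rw [e1, e2, integral_eq_integral_Ioi_add hmi, integral_eq_integral_Ioi_add hki]
  congr 1
  · rw [aux (v := fun t => 1 / t * tail (fun r => F (x + r)) t),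
      aux (v := fun r => F (x + r) * (Real.log r - Real.log ε)), (integral_tail_div hG1 hl1 hε).2]
    · intro s hs hs'
      simp [hk, abs_of_pos hs, max_eq_right hs']
    · intro s hs
      simp [hk, abs_of_pos (hε.trans hs), max_eq_left hs.le]
    · intro s hs hs'
      simp [hm, indicator, abs_of_pos hs, not_lt.2 hs']
    · intro s hs
      rw [tail_comp_add]
      simp [hm, indicator, abs_of_pos (hε.trans hs), hs]
      ring
  · rw [aux (v := fun t => 1 / t * tail (fun r => F (x - r)) t),
      aux (v := fun r => F (x - r) * (Real.log r - Real.log ε)), (integral_tail_div hG2 hl2 hε).2]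
    · intro s hs hs'
      simp [hk, abs_of_pos hs, max_eq_right hs']
    · intro s hs
      simp [hk, abs_of_pos (hε.trans hs), max_eq_left hs.le, sub_eq_add_neg]
    · intro s hs hs'
      simp [hm, indicator, abs_of_pos hs, not_lt.2 hs']
    · intro s hs
      rw [tail_comp_sub h.integrable h.neutral]
      simp [hm, indicator, abs_of_pos (hε.trans hs), hs, sub_eq_add_neg]
      ring

/-- The logarithmic potential is the Hilbert transform of the tail. -/
theorem isHilbertTransform (h : LogCharge F) : IsHilbertTransform (tail F) (chargePotential F) := by
  refine ⟨h.memLp_tail, h.memLp_chargePotential, ae_of_all _ fun x => ?_⟩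
  have hlogx := h.integrable_mul_log x
  have hne : ∀ᵐ q : ℝ, q ≠ x := by simp [ae_iff]
  have key : Tendsto (fun ε : ℝ => ∫ q, F q * Real.log (max |x - q| ε)) (𝓝[>] 0)
      (𝓝 (chargePotential F x)) := by
    refine tendsto_integral_filter_of_dominated_convergence (fun q => |F q * Real.log (|x - q|)|)
      ?_ ?_ hlogx.abs ?_
    · exact Eventually.of_forall fun ε =>
        h.meas.mul (Measurable.aestronglyMeasurable (by fun_prop))
    · filter_upwards [Ioo_mem_nhdsGT one_pos] with ε hε
      filter_upwards [hne] with q hq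
      have hp : 0 < |x - q| := abs_pos.2 (sub_ne_zero.2 (Ne.symm hq))
      rw [norm_mul, abs_mul, Real.norm_eq_abs, Real.norm_eq_abs]
      refine mul_le_mul_of_nonneg_left ?_ (abs_nonneg _)
      rcases le_total |x - q| ε with h1 | h1
      · have h2 := Real.log_le_log hp h1
        have h3 := Real.log_nonpos hε.1.le hε.2.le
        rw [max_eq_right h1, abs_of_nonpos h3, abs_of_nonpos (h2.trans h3)]
        linarith
      · rw [max_eq_left h1]
    · filter_upwards [hne] with q hq
      have hp : 0 < |x - q| := abs_pos.2 (sub_ne_zero.2 (Ne.symm hq))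
      refine tendsto_const_nhds.congr' ?_
      filter_upwards [Ioo_mem_nhdsGT hp] with ε hε
      rw [max_eq_left hε.2.le]
  refine key.congr' ?_
  filter_upwards [self_mem_nhdsWithin] with ε hε
  have hε' : 0 < ε := hε
  rw [h.integral_tail_div_sub x hε']
  simp only [mul_sub]
  have hi : Integrable fun q => F q * Real.log (max |x - q| ε) := by
    refine (hlogx.abs.add (h.integrable.abs.mul_const |Real.log ε|)).mono'
      (h.meas.mul (Measurable.aestronglyMeasurable (by fun_prop))) (ae_of_all _ fun q => ?_)
    simp only [norm_mul, Real.norm_eq_abs, Pi.add_apply, abs_mul]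
    rw [← mul_add]
    refine mul_le_mul_of_nonneg_left ?_ (abs_nonneg _)
    rcases max_choice |x - q| ε with h3 | h3 <;> rw [h3]
    · linarith [abs_nonneg (Real.log ε)]
    · linarith [abs_nonneg (Real.log (|x - q|))]
  -- Neutrality removes the divergent constant `ln ε`.
  rw [integral_sub hi (h.integrable.mul_const _), integral_mul_const, h.neutral]
  simp

end LogCharge

/-! ### Weak derivatives on the line -/

theorem integrable_mul_test {u φ : ℝ → ℝ} (hu : LocallyIntegrable u) (hφ : Continuous φ)
    (hc : HasCompactSupport φ) : Integrable fun x => u x * φ x := by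
  simpa only [smul_eq_mul, mul_comm] using hu.integrable_smul_left_of_hasCompactSupport hφ hc

theorem continuous_deriv_test {φ : ℝ → ℝ} (hφ : ContDiff ℝ (⊤ : ℕ∞) φ) : Continuous (deriv φ) :=
  hφ.continuous_deriv (by simp)

namespace HasWeakDeriv

variable {u u' v v' : ℝ → ℝ}

theorem ae_unique (h : HasWeakDeriv u v) (h' : HasWeakDeriv u v') : v =ᵐ[volume] v' := by
  refine ae_eq_of_integral_contDiff_smul_eq h.2.1 h'.2.1 fun φ hφ hc => ?_
  have h1 := h.2.2 φ hφ hc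
  have h2 := h'.2.2 φ hφ hc
  simp only [smul_eq_mul, mul_comm (φ _)]
  linarith

theorem weakDeriv_ae (h : HasWeakDeriv u v) : weakDeriv u =ᵐ[volume] v := by
  have hex : ∃ v, HasWeakDeriv u v := ⟨v, h⟩
  rw [weakDeriv, dif_pos hex]
  exact hex.choose_spec.ae_unique h

theorem congr (h : HasWeakDeriv u v) (hu : u =ᵐ[volume] u') (hv : v =ᵐ[volume] v') :
    HasWeakDeriv u' v' := by
  refine ⟨h.1.congr hu, h.2.1.congr hv, fun φ hφ hc => ?_⟩
  have e1 : ∫ x, u x * deriv φ x = ∫ x, u' x * deriv φ x :=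
    integral_congr_ae (hu.mono fun x hx => by simp only [hx])
  have e2 : ∫ x, v x * φ x = ∫ x, v' x * φ x :=
    integral_congr_ae (hv.mono fun x hx => by simp only [hx])
  rw [← e1, ← e2, h.2.2 φ hφ hc]

theorem add {u₁ u₂ v₁ v₂ : ℝ → ℝ} (h₁ : HasWeakDeriv u₁ v₁) (h₂ : HasWeakDeriv u₂ v₂) :
    HasWeakDeriv (fun x => u₁ x + u₂ x) fun x => v₁ x + v₂ x := by
  refine ⟨h₁.1.add h₂.1, h₁.2.1.add h₂.2.1, fun φ hφ hc => ?_⟩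
  have hd := continuous_deriv_test hφ
  simp only [add_mul]
  rw [integral_add (integrable_mul_test h₁.1 hd hc.deriv) (integrable_mul_test h₂.1 hd hc.deriv),
    integral_add (integrable_mul_test h₁.2.1 hφ.continuous hc)
      (integrable_mul_test h₂.2.1 hφ.continuous hc), h₁.2.2 φ hφ hc, h₂.2.2 φ hφ hc]
  ring

theorem const_mul (c : ℝ) (h : HasWeakDeriv u v) :
    HasWeakDeriv (fun x => c * u x) fun x => c * v x := by
  refine ⟨h.1.smul c, h.2.1.smul c, fun φ hφ hc => ?_⟩
  simp only [mul_assoc]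
  rw [integral_const_mul, integral_const_mul, h.2.2 φ hφ hc]
  ring

theorem sub {u₁ u₂ v₁ v₂ : ℝ → ℝ} (h₁ : HasWeakDeriv u₁ v₁) (h₂ : HasWeakDeriv u₂ v₂) :
    HasWeakDeriv (fun x => u₁ x - u₂ x) fun x => v₁ x - v₂ x := by
  simpa only [neg_one_mul, ← sub_eq_add_neg] using h₁.add (h₂.const_mul (-1))

end HasWeakDeriv

/-! ### Primitives -/

theorem intervalIntegrable_of_locallyIntegrable {g : ℝ → ℝ} (hg : LocallyIntegrable g) (a b : ℝ) :
    IntervalIntegrable g volume a b :=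
  (hg.integrableOn_isCompact isCompact_uIcc).intervalIntegrable

/-- `u` is a primitive of the locally integrable function `g`. -/
def IsPrimitive (u g : ℝ → ℝ) : Prop :=
  LocallyIntegrable g ∧ ∀ x, u x = u 0 + ∫ t in (0 : ℝ)..x, g t

namespace IsPrimitive

variable {u g v k : ℝ → ℝ}

theorem sub_eq (h : IsPrimitive u g) (a b : ℝ) : u b - u a = ∫ t in a..b, g t := by
  rw [h.2 b, h.2 a, ← intervalIntegral.integral_add_adjacent_intervals
    (intervalIntegrable_of_locallyIntegrable h.1 0 a)
    (intervalIntegrable_of_locallyIntegrable h.1 a b)]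
  ring

theorem continuous (h : IsPrimitive u g) : Continuous u := by
  rw [funext h.2]
  exact continuous_const.add (intervalIntegral.continuous_primitive
    (intervalIntegrable_of_locallyIntegrable h.1) 0)

theorem of_deriv (hu : ContDiff ℝ 1 u) : IsPrimitive u (deriv u) := by
  have hc := hu.continuous_deriv le_rfl
  refine ⟨hc.locallyIntegrable, fun x => ?_⟩
  rw [intervalIntegral.integral_deriv_eq_sub
    (fun t _ => (hu.differentiable one_ne_zero).differentiableAt) (hc.intervalIntegrable _ _)]
  ring

theorem absolutelyContinuous (h : IsPrimitive u g) (a b : ℝ) :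
    AbsolutelyContinuousOnInterval u a b := by
  have h1 := (intervalIntegrable_of_locallyIntegrable h.1 a b
    ).absolutelyContinuousOnInterval_intervalIntegral left_mem_uIcc
  have h2 : AbsolutelyContinuousOnInterval (fun _ : ℝ => u a) a b :=
    (LipschitzWith.const (u a)).lipschitzOnWith.absolutelyContinuousOnInterval
  have e : u = (fun _ : ℝ => u a) + fun x => ∫ t in a..x, g t := by
    funext x
    rw [Pi.add_apply, ← h.sub_eq a x]; ring
  rw [e]
  exact h2.add h1

theorem deriv_ae (h : IsPrimitive u g) : deriv u =ᵐ[volume] g := by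
  filter_upwards [LocallyIntegrable.ae_hasDerivAt_integral h.1] with x hx
  have : HasDerivAt (fun x => u 0 + ∫ t in (0 : ℝ)..x, g t) (g x) x := (hx 0).const_add _
  rw [← funext h.2] at this
  exact this.deriv

theorem locallyIntegrable_mul (h : IsPrimitive u g) (hk : LocallyIntegrable k) :
    LocallyIntegrable fun x => u x * k x := by
  rw [locallyIntegrable_iff]
  intro K hK
  exact (hk.integrableOn_isCompact hK).continuousOn_mul h.continuous.continuousOn hK

/-- Primitives of locally integrable functions are absolutely continuous, so integration by parts
applies on every bounded interval. -/
theorem mul (h : IsPrimitive u g) (h' : IsPrimitive v k) :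
    IsPrimitive (fun x => u x * v x) fun x => u x * k x + g x * v x := by
  have l1 := h.locallyIntegrable_mul h'.1
  have l2 := h'.locallyIntegrable_mul h.1
  simp only [mul_comm (v _)] at l2
  refine ⟨l1.add l2, fun x => ?_⟩
  rw [intervalIntegral.integral_add (intervalIntegrable_of_locallyIntegrable l1 0 x)
    (intervalIntegrable_of_locallyIntegrable l2 0 x)]
  have h1 := (h.absolutelyContinuous 0 x).integral_mul_deriv_eq_deriv_mul
    (h'.absolutelyContinuous 0 x)
  have e1 : ∫ t in (0 : ℝ)..x, u t * deriv v t = ∫ t in (0 : ℝ)..x, u t * k t :=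
    intervalIntegral.integral_congr_ae (h'.deriv_ae.mono fun t ht _ => by rw [ht])
  have e2 : ∫ t in (0 : ℝ)..x, deriv u t * v t = ∫ t in (0 : ℝ)..x, g t * v t :=
    intervalIntegral.integral_congr_ae (h.deriv_ae.mono fun t ht _ => by rw [ht])
  rw [e1, e2] at h1
  linarith

/-- The derivative of an integrable function with integrable derivative has integral zero. -/
theorem integral_eq_zero (h : IsPrimitive u g) (hu : Integrable u) (hg : Integrable g) :
    ∫ x, g x = 0 := by
  -- Integrability of `g` gives limits of `u` at `±∞`; integrability of `u` forces both to be zero.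
  have t1 : Tendsto u atTop (𝓝 (u 0 + ∫ t in Ioi 0, g t)) := by
    rw [funext h.2]
    have := (intervalIntegral_tendsto_integral_Ioi 0 hg.integrableOn tendsto_id).const_add (u 0)
    simpa using this
  have t2 : Tendsto u atBot (𝓝 (u 0 - ∫ t in Iic 0, g t)) := by
    have := (intervalIntegral_tendsto_integral_Iic 0 hg.integrableOn tendsto_id).const_sub (u 0)
    refine this.congr fun x => ?_
    rw [id, ← h.sub_eq x 0]; ring
  have z1 := (hu.integrableAtFilter atTop).eq_zero_of_tendsto (fun s hs => by
    obtain ⟨a, ha⟩ := mem_atTop_sets.1 hs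
    exact measure_mono_top (show Ici a ⊆ s from ha) Real.volume_Ici) t1
  have z2 := (hu.integrableAtFilter atBot).eq_zero_of_tendsto (fun s hs => by
    obtain ⟨a, ha⟩ := mem_atBot_sets.1 hs
    exact measure_mono_top (show Iic a ⊆ s from ha) Real.volume_Iic) t2
  have := intervalIntegral.integral_Iic_add_Ioi (b := (0 : ℝ)) hg.integrableOn hg.integrableOn
  linarith

theorem hasWeakDeriv (h : IsPrimitive u g) : HasWeakDeriv u g := by
  refine ⟨h.continuous.locallyIntegrable, h.1, fun φ hφ hc => ?_⟩
  have hφ1 : ContDiff ℝ 1 φ := hφ.of_le (by simp)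
  have hd := continuous_deriv_test hφ
  have l1 := integrable_mul_test h.continuous.locallyIntegrable hd hc.deriv
  have l2 := integrable_mul_test h.1 hφ.continuous hc
  have h1 := (h.mul (of_deriv hφ1)).integral_eq_zero
    (integrable_mul_test h.continuous.locallyIntegrable hφ.continuous hc) (l1.add l2)
  rw [integral_add l1 l2] at h1
  linarith

end IsPrimitive

theorem LocallyIntegrable.isPrimitive {g : ℝ → ℝ} (hg : LocallyIntegrable g) (c : ℝ) :
    IsPrimitive (fun x => c + ∫ t in (0 : ℝ)..x, g t) g :=
  ⟨hg, fun x => by simp⟩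

theorem isPrimitive_tail {F : ℝ → ℝ} (hF : Integrable F) :
    IsPrimitive (tail F) fun x => -F x :=
  ⟨hF.neg.locallyIntegrable, fun x => by rw [tail_eq_sub hF, intervalIntegral.integral_neg]; ring⟩

/-- Test functions of mean zero are derivatives of test functions. -/
theorem exists_primitive_test {k : ℝ → ℝ} (hk : ContDiff ℝ (⊤ : ℕ∞) k) (hc : HasCompactSupport k)
    (h0 : ∫ x, k x = 0) :
    ∃ ψ : ℝ → ℝ, ContDiff ℝ (⊤ : ℕ∞) ψ ∧ HasCompactSupport ψ ∧ deriv ψ = k := by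
  have hi : Integrable k := hk.continuous.integrable_of_hasCompactSupport hc
  have hd : ∀ x, HasDerivAt (fun x => ∫ t in (0 : ℝ)..x, k t) (k x) x := fun x =>
    intervalIntegral.integral_hasDerivAt_right (hk.continuous.intervalIntegrable _ _)
      (hk.continuous.stronglyMeasurableAtFilter _ _) hk.continuous.continuousAt
  have hd' : ∀ x, HasDerivAt (fun x => -tail k x) (k x) x := fun x => by
    have e : (fun x => -tail k x) = fun x => (∫ t in (0 : ℝ)..x, k t) - tail k 0 := by
      funext x; rw [tail_eq_sub hi]; ring
    rw [e]; exact (hd x).sub_const _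
  have hder : deriv (fun x => -tail k x) = k := funext fun x => (hd' x).deriv
  obtain ⟨R, hR⟩ := hc.isCompact.isBounded.subset_closedBall 0
  have hz : ∀ t, R < |t| → k t = 0 := fun t ht => by
    by_contra hne
    have := hR (subset_tsupport k (Function.mem_support.2 hne))
    rw [mem_closedBall_zero_iff, Real.norm_eq_abs] at this
    linarith
  -- This primitive vanishes to the right of the support of `k`, and to the left of it because `k`
  -- has mean zero.
  refine ⟨fun x => -tail k x, ?_, ?_, hder⟩
  · rw [contDiff_infty_iff_deriv, hder]
    exact ⟨fun x => (hd' x).differentiableAt, hk⟩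
  · refine HasCompactSupport.intro (isCompact_closedBall (0 : ℝ) |R|) fun x hx => ?_
    rw [mem_closedBall_zero_iff, Real.norm_eq_abs, not_le] at hx
    have hRx : R < |x| := (le_abs_self R).trans_lt hx
    rcases le_total 0 x with h | h
    · rw [tail, setIntegral_eq_zero_of_forall_eq_zero, neg_zero]
      intro t (ht : x < t)
      refine hz t ?_
      rw [abs_of_nonneg h] at hRx
      rw [abs_of_nonneg (by linarith)]; linarith
    · rw [tail_eq_neg hi h0, setIntegral_eq_zero_of_forall_eq_zero, neg_zero, neg_zero]
      intro t (ht : t ≤ x)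
      refine hz t ?_
      rw [abs_of_nonpos h] at hRx
      rw [abs_of_nonpos (by linarith)]; linarith

/-- A function with vanishing weak derivative is constant. -/
theorem HasWeakDeriv.ae_const {u : ℝ → ℝ} (h : HasWeakDeriv u fun _ => 0) :
    ∃ c, u =ᵐ[volume] fun _ => c := by
  set b : ContDiffBump (0 : ℝ) := ⟨1, 2, one_pos, one_lt_two⟩
  set η := b.normed volume with hη
  have hη1 : ContDiff ℝ (⊤ : ℕ∞) η := b.contDiff_normed
  have hηc : HasCompactSupport η := b.hasCompactSupport_normed
  have hηi : ∫ x, η x = 1 := b.integral_normed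
  have hηint := hη1.continuous.integrable_of_hasCompactSupport hηc (μ := volume)
  refine ⟨∫ x, u x * η x, ?_⟩
  refine ae_eq_of_integral_contDiff_smul_eq h.1 (continuous_const.locallyIntegrable)
    fun φ hφ hc => ?_
  have hφint := hφ.continuous.integrable_of_hasCompactSupport hc (μ := volume)
  set m := ∫ x, φ x
  -- Subtracting the multiple `m * η` of a fixed bump gives mean zero, so that the difference is an
  -- admissible derivative.
  obtain ⟨ψ, hψ1, hψc, hψd⟩ := exists_primitive_test (k := fun x => φ x - m * η x)
    (hφ.sub (contDiff_const.mul hη1)) (hc.sub (hηc.mul_left)) (by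
      rw [integral_sub hφint (hηint.const_mul m), integral_const_mul, hηi]; ring)
  have h1 := h.2.2 ψ hψ1 hψc
  rw [hψd] at h1
  simp only [zero_mul, integral_zero, neg_zero, mul_sub] at h1
  have i2 : Integrable fun x => u x * (m * η x) := by
    have := (integrable_mul_test h.1 hη1.continuous hηc).const_mul m
    refine this.congr (ae_of_all _ fun x => ?_)
    simp only; ring
  rw [integral_sub (integrable_mul_test h.1 hφ.continuous hc) i2] at h1
  have e : ∫ x, u x * (m * η x) = m * ∫ x, u x * η x := by
    rw [← integral_const_mul]; congr 1; funext x; ring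
  simp only [smul_eq_mul]
  rw [integral_mul_const]
  simp only [mul_comm (φ _)]
  linarith

/-- A weakly differentiable function agrees almost everywhere with a primitive. -/
theorem HasWeakDeriv.exists_primitive {u v : ℝ → ℝ} (h : HasWeakDeriv u v) :
    ∃ w, IsPrimitive w v ∧ u =ᵐ[volume] w := by
  have hp := LocallyIntegrable.isPrimitive h.2.1 0
  have h0 := h.sub hp.hasWeakDeriv
  simp only [sub_self] at h0
  obtain ⟨c, hc⟩ := h0.ae_const
  refine ⟨_, LocallyIntegrable.isPrimitive h.2.1 c, hc.mono fun x hx => ?_⟩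
  simp only [zero_add] at hx
  linarith

/-! ### Fourier transforms of tails -/

theorem fourierT_eq_cos_sin {G : ℝ → ℝ} (hG : Integrable G) (ξ : ℝ) :
    fourierT G ξ = (∫ t, G t * Real.cos (t * ξ) : ℝ) -
      Complex.I * (∫ t, G t * Real.sin (t * ξ) : ℝ) := by
  have i1 : Integrable fun t => G t * Real.cos (t * ξ) :=
    hG.mul_bdd (c := 1) (Continuous.aestronglyMeasurable (by fun_prop))
      (ae_of_all _ fun t => Real.abs_cos_le_one _)
  have i2 : Integrable fun t => G t * Real.sin (t * ξ) :=
    hG.mul_bdd (c := 1) (Continuous.aestronglyMeasurable (by fun_prop))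
      (ae_of_all _ fun t => Real.abs_sin_le_one _)
  have j1 : Integrable fun t => ((G t * Real.cos (t * ξ) : ℝ) : ℂ) := i1.ofReal
  have j2 : Integrable fun t => ((G t * Real.sin (t * ξ) : ℝ) : ℂ) := i2.ofReal
  rw [← integral_complex_ofReal, ← integral_complex_ofReal, ← integral_const_mul,
    ← integral_sub j1 (j2.const_mul Complex.I), fourierT]
  congr 1; funext t
  have : -(Complex.I * t * ξ) = ((-(t * ξ) : ℝ) : ℂ) * Complex.I := by push_cast; ring
  rw [this, Complex.exp_mul_I, ← Complex.ofReal_cos, ← Complex.ofReal_sin, Real.cos_neg,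
    Real.sin_neg]
  push_cast
  ring

namespace LogCharge

variable {F G : ℝ → ℝ}

theorem integral_tail_mul_deriv (h : LogCharge F) {φ : ℝ → ℝ} (hφ : ContDiff ℝ 1 φ) {B : ℝ}
    (hB : ∀ x, |φ x| ≤ B) (hi : Integrable fun x => tail F x * deriv φ x) :
    ∫ x, tail F x * deriv φ x = ∫ x, F x * φ x := by
  have hb := hφ.continuous.aestronglyMeasurable (μ := volume)
  have i1 : Integrable fun x => tail F x * φ x :=
    h.integrable_tail.mul_bdd hb (ae_of_all _ hB)
  have i2 : Integrable fun x => -F x * φ x := h.integrable.neg.mul_bdd hb (ae_of_all _ hB)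
  have h1 := ((isPrimitive_tail h.integrable).mul (IsPrimitive.of_deriv hφ)).integral_eq_zero i1
    (hi.add i2)
  rw [integral_add hi i2] at h1
  simp only [neg_mul, integral_neg] at h1
  linarith

/-- The charge is minus the derivative of its tail; the integration by parts is done against cosine
and sine, which are real. -/
theorem fourierT_eq (h : LogCharge F) (ξ : ℝ) :
    fourierT F ξ = -(Complex.I * ξ) * fourierT (tail F) ξ := by
  have hc : ∀ x : ℝ, HasDerivAt (fun t => Real.cos (t * ξ)) (-Real.sin (x * ξ) * ξ) x := fun x => by
    simpa using ((hasDerivAt_id x).mul_const ξ).cos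
  have hs : ∀ x : ℝ, HasDerivAt (fun t => Real.sin (t * ξ)) (Real.cos (x * ξ) * ξ) x := fun x => by
    simpa using ((hasDerivAt_id x).mul_const ξ).sin
  have hc' : deriv (fun t => Real.cos (t * ξ)) = fun x => -Real.sin (x * ξ) * ξ :=
    funext fun x => (hc x).deriv
  have hs' : deriv (fun t => Real.sin (t * ξ)) = fun x => Real.cos (x * ξ) * ξ :=
    funext fun x => (hs x).deriv
  have i1 : Integrable fun t => tail F t * (-Real.sin (t * ξ) * ξ) :=
    h.integrable_tail.mul_bdd (c := |ξ|) (Continuous.aestronglyMeasurable (by fun_prop))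
      (ae_of_all _ fun t => by
        rw [norm_mul, norm_neg, Real.norm_eq_abs, Real.norm_eq_abs]
        exact mul_le_of_le_one_left (abs_nonneg _) (Real.abs_sin_le_one _))
  have i2 : Integrable fun t => tail F t * (Real.cos (t * ξ) * ξ) :=
    h.integrable_tail.mul_bdd (c := |ξ|) (Continuous.aestronglyMeasurable (by fun_prop))
      (ae_of_all _ fun t => by
        rw [norm_mul, Real.norm_eq_abs, Real.norm_eq_abs]
        exact mul_le_of_le_one_left (abs_nonneg _) (Real.abs_cos_le_one _))
  have e1 := h.integral_tail_mul_deriv (φ := fun t => Real.cos (t * ξ)) (by fun_prop)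
    (fun t => Real.abs_cos_le_one _) (by rw [hc']; exact i1)
  have e2 := h.integral_tail_mul_deriv (φ := fun t => Real.sin (t * ξ)) (by fun_prop)
    (fun t => Real.abs_sin_le_one _) (by rw [hs']; exact i2)
  rw [hc'] at e1
  rw [hs'] at e2
  have e3 : ∫ t, tail F t * (-Real.sin (t * ξ) * ξ) = -ξ * ∫ t, tail F t * Real.sin (t * ξ) := by
    rw [← integral_const_mul]; congr 1; funext t; ring
  have e4 : ∫ t, tail F t * (Real.cos (t * ξ) * ξ) = ξ * ∫ t, tail F t * Real.cos (t * ξ) := by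
    rw [← integral_const_mul]; congr 1; funext t; ring
  rw [fourierT_eq_cos_sin h.integrable, fourierT_eq_cos_sin h.integrable_tail, ← e1, ← e2, e3, e4]
  generalize ∫ t, tail F t * Real.sin (t * ξ) = a
  generalize ∫ t, tail F t * Real.cos (t * ξ) = b
  push_cast
  ring_nf
  rw [Complex.I_sq]
  ring

theorem norm_fourierT_eq (h : LogCharge F) (ξ : ℝ) :
    ‖fourierT F ξ‖ = |ξ| * ‖fourierT (tail F) ξ‖ := by
  rw [h.fourierT_eq, norm_mul, norm_neg, norm_mul, Complex.norm_I, one_mul, Complex.norm_real,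
    Real.norm_eq_abs]

/-- The weighted square `|ξ|` times that of the transform of the tail equals `|ℱF(ξ)|²/|ξ|`, whose
integrability is the finiteness of the logarithmic energy. -/
theorem memLp_fourierT_tail (h : LogCharge F) : MemLp (fourierT (tail F)) 2
    (volume.withDensity fun x => ENNReal.ofReal |x|) := by
  have hc := continuous_fourierT h.integrable_tail
  rw [memLp_two_iff_integrable_sq_norm hc.aestronglyMeasurable,
    integrable_withDensity_iff_integrable_smul' (by fun_prop) (by simp)]
  refine (integrable_fourierT_sq_div h.integrable h.neutral (h.logIntegrable h)).congr
    (ae_of_all _ fun ξ => ?_)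
  simp only [ENNReal.toReal_ofReal (abs_nonneg _), smul_eq_mul, h.norm_fourierT_eq]
  rcases eq_or_ne ξ 0 with rfl | hξ
  · simp
  · have := abs_pos.2 hξ
    field_simp

theorem integral_mul_chargePotential (hF : LogCharge F) (hG : LogCharge G) :
    ∫ x, F x * chargePotential G x =
      ∫ p : ℝ × ℝ, F p.1 * G p.2 * Real.log |p.1 - p.2| := by
  rw [show (volume : Measure (ℝ × ℝ)) = volume.prod volume from rfl,
    integral_prod _ (hF.logIntegrable hG)]
  congr 1; funext x
  simp only [chargePotential]
  rw [← integral_const_mul]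
  congr 1; funext t; ring

/-- This identifies the second term of the form of `-L` with a logarithmic energy; two derivatives
account for the change of weight from `1/|ξ|` to `|ξ|`. -/
theorem integral_abs_mul_fourierT (hF : LogCharge F) (hG : LogCharge G) :
    ∫ ξ, |ξ| * (fourierT (tail F) ξ * (starRingEnd ℂ) (fourierT (tail G) ξ)).re =
      -2 * ∫ x, F x * chargePotential G x := by
  have h := logEnergy_eq_fourier hF.integrable hG.integrable hF.neutral hG.neutral
    (hF.logIntegrable hF) (hG.logIntegrable hG) (hF.logIntegrable hG)
  rw [← hF.integral_mul_chargePotential hG] at h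
  have e : (fun ξ => (fourierT F ξ * (starRingEnd ℂ) (fourierT G ξ)).re / |ξ|) = fun ξ =>
      |ξ| * (fourierT (tail F) ξ * (starRingEnd ℂ) (fourierT (tail G) ξ)).re := by
    funext ξ
    rw [hF.fourierT_eq, hG.fourierT_eq]
    have : -(Complex.I * ξ) * fourierT (tail F) ξ *
        (starRingEnd ℂ) (-(Complex.I * ξ) * fourierT (tail G) ξ) =
        ((ξ ^ 2 : ℝ) : ℂ) * (fourierT (tail F) ξ * (starRingEnd ℂ) (fourierT (tail G) ξ)) := by
      simp only [map_mul, map_neg, Complex.conj_I, Complex.conj_ofReal]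
      push_cast
      ring_nf
      rw [Complex.I_sq]; ring
    rw [this, Complex.re_ofReal_mul, ← sq_abs]
    rcases eq_or_ne ξ 0 with rfl | hξ
    · simp
    · have := abs_pos.2 hξ
      field_simp
  rw [e] at h
  linarith

end LogCharge

/-! ### The weak derivative of the potential -/

theorem LogCharge.of_continuous {G : ℝ → ℝ} (hG : Continuous G) (hc : HasCompactSupport G)
    (h0 : ∫ x, G x = 0) : LogCharge G := by
  refine ⟨hG.aestronglyMeasurable, ?_, ?_, h0⟩
  · exact Continuous.integrable_of_hasCompactSupport (by fun_prop) hc.abs.mul_left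
  · have h1 : HasCompactSupport fun x => (1 + |x|) * G x := hc.mul_left
    exact Continuous.integrable_of_hasCompactSupport (by fun_prop)
      (h1.comp_left (g := fun y => y ^ 2) (by simp))

theorem tail_deriv_test {φ : ℝ → ℝ} (hφ : ContDiff ℝ (⊤ : ℕ∞) φ) (hc : HasCompactSupport φ) :
    LogCharge (deriv φ) ∧ tail (deriv φ) = fun x => -φ x := by
  have hd := continuous_deriv_test hφ
  have hφ1 : ContDiff ℝ 1 φ := hφ.of_le (by simp)
  have hi := hd.integrable_of_hasCompactSupport hc.deriv (μ := volume)
  have h0 : ∫ x, deriv φ x = 0 := (IsPrimitive.of_deriv hφ1).integral_eq_zero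
    (hφ.continuous.integrable_of_hasCompactSupport hc) hi
  refine ⟨LogCharge.of_continuous hd hc.deriv h0, funext fun x => ?_⟩
  have hdx : ∀ y ∈ Ici x, HasDerivAt φ (deriv φ y) y := fun y _ =>
    (hφ1.differentiable one_ne_zero y).hasDerivAt
  rw [tail, integral_Ioi_of_hasDerivAt_of_tendsto' hdx hi.integrableOn (m := 0), zero_sub]
  have := hc.is_zero_at_infty
  exact this.mono_left (by rw [cocompact_eq_atBot_atTop]; exact le_sup_right)

/-- The pairing is the logarithmic energy of `F` and the neutral charge `φ'`. In Fourier space the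
weight `1/|ξ|` cancels the derivative, and Cauchy-Schwarz with Bessel's inequality for `F` and `φ`
concludes. -/
theorem LogCharge.exists_bound_test {F : ℝ → ℝ} (h : LogCharge F) :
    ∃ C, ∀ φ : ℝ → ℝ, ContDiff ℝ (⊤ : ℕ∞) φ → HasCompactSupport φ → ∀ hφ2 : MemLp φ 2 volume,
      |∫ x, chargePotential F x * deriv φ x| ≤ C * ‖hφ2.toLp φ‖ := by
  have hFb := fourierT_bessel h.integrable h.integrable_sq
  have hF2 : MemLp (fun ξ => ‖fourierT F ξ‖) 2 := by
    rw [memLp_two_iff_integrable_sq (continuous_fourierT h.integrable).norm.aestronglyMeasurable]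
    exact hFb.1
  refine ⟨1 / 2 * (Real.sqrt (2 * Real.pi) * ‖hF2.toLp _‖), fun φ hφ hc hφ2 => ?_⟩
  obtain ⟨hG, ht⟩ := tail_deriv_test hφ hc
  set G := deriv φ
  have hGt2 : Integrable fun x => tail G x ^ 2 :=
    (memLp_two_iff_integrable_sq hG.memLp_tail.1).1 hG.memLp_tail
  have hGb := fourierT_bessel hG.integrable_tail hGt2
  have hG2 : MemLp (fun ξ => ‖fourierT (tail G) ξ‖) 2 := by
    rw [memLp_two_iff_integrable_sq
      (continuous_fourierT hG.integrable_tail).norm.aestronglyMeasurable]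
    exact hGb.1
  have h1 := logEnergy_eq_fourier hG.integrable h.integrable hG.neutral h.neutral
    (hG.logIntegrable hG) (h.logIntegrable h) (hG.logIntegrable h)
  rw [← hG.integral_mul_chargePotential h] at h1
  have h2 : |∫ ξ, (fourierT G ξ * (starRingEnd ℂ) (fourierT F ξ)).re / (|ξ|)| ≤
      ‖hG2.toLp _‖ * ‖hF2.toLp _‖ := by
    refine le_trans ?_ ((le_abs_self _).trans (abs_integral_mul_le hG2 hF2))
    refine norm_integral_le_of_norm_le
      (f := fun ξ => (fourierT G ξ * (starRingEnd ℂ) (fourierT F ξ)).re / |ξ|)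
      (hG2.integrable_mul hF2) (ae_of_all _ fun ξ => ?_)
    rw [norm_div, Real.norm_eq_abs, Real.norm_eq_abs, abs_abs]
    refine div_le_of_le_mul₀ (abs_nonneg _) (by positivity) ?_
    refine (Complex.abs_re_le_norm _).trans_eq ?_
    rw [norm_mul, RCLike.norm_conj, hG.norm_fourierT_eq]
    ring
  have h3 : ‖hG2.toLp _‖ ≤ Real.sqrt (2 * Real.pi) * ‖hφ2.toLp φ‖ := by
    refine abs_le_of_sq_le_sq' ?_ (by positivity) |>.2
    rw [norm_toLp_sq, mul_pow, Real.sq_sqrt (by positivity), norm_toLp_sq]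
    refine hGb.2.trans_eq ?_
    simp only [ht, neg_sq]
  have e : ∫ x, chargePotential F x * G x = ∫ x, G x * chargePotential F x := by
    simp only [mul_comm]
  rw [e]
  have h4 : |∫ x, G x * chargePotential F x| =
      1 / 2 * |∫ ξ, (fourierT G ξ * (starRingEnd ℂ) (fourierT F ξ)).re / (|ξ|)| := by
    rw [← abs_neg, h1, abs_mul, abs_of_pos (by norm_num : (0 : ℝ) < 1 / 2)]
  rw [h4]
  have h5 := mul_le_mul_of_nonneg_right h3 (norm_nonneg (hF2.toLp _))
  calc _ ≤ 1 / 2 * (‖hG2.toLp _‖ * ‖hF2.toLp _‖) := by gcongr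
    _ ≤ _ := by linarith

/-- Smooth compactly supported functions. -/
def testFunctions : Submodule ℝ (ℝ → ℝ) where
  carrier := {φ | ContDiff ℝ (⊤ : ℕ∞) φ ∧ HasCompactSupport φ}
  add_mem' h1 h2 := ⟨h1.1.add h2.1, h1.2.add h2.2⟩
  zero_mem' := ⟨contDiff_const, HasCompactSupport.zero⟩
  smul_mem' c _ h := ⟨contDiff_const.smul h.1, h.2.smul_left (f := fun _ => c)⟩

theorem memLp_test (φ : testFunctions) : MemLp (φ : ℝ → ℝ) 2 volume :=
  φ.2.1.continuous.memLp_of_hasCompactSupport φ.2.2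

/-- A function whose distributional derivative is bounded in `L²` has a weak derivative in `L²`. -/
theorem exists_hasWeakDeriv_of_bound {u : ℝ → ℝ} (hu : LocallyIntegrable u) {C : ℝ}
    (hC : ∀ φ : ℝ → ℝ, ContDiff ℝ (⊤ : ℕ∞) φ → HasCompactSupport φ → ∀ hφ2 : MemLp φ 2 volume,
      |∫ x, u x * deriv φ x| ≤ C * ‖hφ2.toLp φ‖) :
    ∃ g, MemLp g 2 ∧ HasWeakDeriv u g := by
  have hint : ∀ φ : testFunctions, Integrable fun x => u x * deriv (φ : ℝ → ℝ) x := fun φ =>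
    integrable_mul_test hu (continuous_deriv_test φ.2.1) φ.2.2.deriv
  have hdiff : ∀ φ : testFunctions, Differentiable ℝ (φ : ℝ → ℝ) := fun φ =>
    φ.2.1.differentiable (by simp)
  let e : testFunctions →ₗ[ℝ] Lp ℝ 2 (volume : Measure ℝ) :=
    { toFun := fun φ => (memLp_test φ).toLp _
      map_add' := fun φ ψ => MemLp.toLp_add (memLp_test φ) (memLp_test ψ)
      map_smul' := fun c φ => MemLp.toLp_const_smul c (memLp_test φ) }
  let l : testFunctions →ₗ[ℝ] ℝ :=
    { toFun := fun φ => ∫ x, u x * deriv (φ : ℝ → ℝ) x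
      map_add' := fun φ ψ => by
        rw [← integral_add (hint φ) (hint ψ)]
        congr 1; funext x
        rw [Submodule.coe_add, deriv_add (hdiff φ x) (hdiff ψ x)]; ring
      map_smul' := fun c φ => by
        rw [RingHom.id_apply, smul_eq_mul, ← integral_const_mul]
        congr 1; funext x
        rw [Submodule.coe_smul, deriv_const_smul c (hdiff φ x), smul_eq_mul]; ring }
  have hb : ∃ C, ∀ φ, ‖l φ‖ ≤ C * ‖e φ‖ := ⟨C, fun φ => hC φ φ.2.1 φ.2.2 (memLp_test φ)⟩
  -- The bound makes `φ ↦ ∫ u φ'` a continuous functional on the image of the test functions in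
  -- `L²`. Hahn-Banach extends it and Riesz represents it by minus the weak derivative.
  obtain ⟨L, hL, -⟩ := exists_extension_norm_eq (𝕜 := ℝ) (LinearMap.range e) (l.compLeftInverse e)
  set g := (InnerProductSpace.toDual ℝ (Lp ℝ 2 (volume : Measure ℝ))).symm L
  have hg : MemLp (fun x => -(g x)) 2 := (Lp.memLp g).neg
  refine ⟨_, hg, hu, hg.locallyIntegrable one_le_two, fun φ hφ hc => ?_⟩
  set φ' : testFunctions := ⟨φ, hφ, hc⟩
  have h1 : L (e φ') = l φ' := by
    have := hL ⟨e φ', LinearMap.mem_range_self e φ'⟩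
    rw [LinearMap.compLeftInverse_apply_of_bdd _ _ hb φ' (e φ') rfl] at this
    exact this
  have h2 : inner ℝ g (e φ') = L (e φ') := InnerProductSpace.toDual_symm_apply
  have h3 : inner ℝ g (e φ') = ∫ x, g x * φ x := by
    conv_lhs => rw [← Lp.toLp_coeFn g (Lp.memLp g)]
    exact inner_toLp_eq (Lp.memLp g) (memLp_test φ')
  have h4 : l φ' = ∫ x, u x * deriv φ x := rfl
  rw [← h4, ← h1, ← h2, h3, ← integral_neg]
  congr 1; funext x; ring

/-- The potential of a neutral charge has a square integrable weak derivative. -/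
theorem LogCharge.exists_hasWeakDeriv {F : ℝ → ℝ} (h : LogCharge F) :
    ∃ g, MemLp g 2 ∧ HasWeakDeriv (chargePotential F) g := by
  obtain ⟨C, hC⟩ := h.exists_bound_test
  exact exists_hasWeakDeriv_of_bound (h.memLp_chargePotential.locallyIntegrable one_le_two) hC

/-! ### The Poincaré inequality -/

/-- Smooth cutoffs converging to `1`. -/
noncomputable def cutoff (n : ℕ) (x : ℝ) : ℝ :=
  (⟨1, 2, one_pos, one_lt_two⟩ : ContDiffBump (0 : ℝ)) (x / (n + 1))

theorem contDiff_cutoff (n : ℕ) : ContDiff ℝ 1 (cutoff n) := by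
  unfold cutoff
  exact (ContDiffBump.contDiff _).comp (contDiff_id.div_const _)

theorem cutoff_nonneg (n : ℕ) (x : ℝ) : 0 ≤ cutoff n x := ContDiffBump.nonneg _

theorem cutoff_le_one (n : ℕ) (x : ℝ) : cutoff n x ≤ 1 := ContDiffBump.le_one _

theorem hasCompactSupport_cutoff (n : ℕ) : HasCompactSupport (cutoff n) := by
  have hn : (0 : ℝ) < n + 1 := by positivity
  refine HasCompactSupport.intro (isCompact_closedBall (0 : ℝ) (2 * (n + 1))) fun x hx => ?_
  rw [mem_closedBall_zero_iff, Real.norm_eq_abs, not_le] at hx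
  refine ContDiffBump.zero_of_le_dist _ ?_
  rw [dist_zero_right, Real.norm_eq_abs, abs_div, abs_of_pos hn, le_div_iff₀ hn]
  exact hx.le

theorem tendsto_cutoff (x : ℝ) : Tendsto (fun n => cutoff n x) atTop (𝓝 1) := by
  obtain ⟨N, hN⟩ := exists_nat_ge |x|
  refine tendsto_const_nhds.congr' ?_
  filter_upwards [eventually_ge_atTop N] with n hn
  have hn0 : (0 : ℝ) < n + 1 := by positivity
  refine (ContDiffBump.one_of_mem_closedBall _ ?_).symm
  rw [mem_closedBall_zero_iff, Real.norm_eq_abs, abs_div, abs_of_pos hn0, div_le_iff₀ hn0]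
  have : (N : ℝ) ≤ n := by exact_mod_cast hn
  simp only [one_mul]; linarith

theorem exists_deriv_cutoff_bound : ∃ D, 0 ≤ D ∧ ∀ n x, |deriv (cutoff n) x| ≤ D / (n + 1) := by
  set b : ContDiffBump (0 : ℝ) := ⟨1, 2, one_pos, one_lt_two⟩
  have hb : ContDiff ℝ 1 b := b.contDiff
  obtain ⟨D, hD⟩ := (hb.continuous_deriv le_rfl).bounded_above_of_compact_support
    b.hasCompactSupport.deriv
  refine ⟨D, (norm_nonneg _).trans (hD 0), fun n x => ?_⟩
  have hn0 : (0 : ℝ) < n + 1 := by positivity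
  have h1 : HasDerivAt (b : ℝ → ℝ) (deriv b (x / (n + 1))) (x / (n + 1)) :=
    (hb.differentiable one_ne_zero _).hasDerivAt
  have h2 : HasDerivAt (fun x : ℝ => x / (n + 1)) (1 / (n + 1)) x := (hasDerivAt_id x).div_const _
  have : HasDerivAt (cutoff n) (deriv b (x / (n + 1)) * (1 / (n + 1))) x := h1.comp x h2
  rw [this.deriv, abs_mul, abs_of_pos (by positivity : (0 : ℝ) < 1 / (n + 1)), mul_one_div]
  gcongr
  exact hD _

theorem exists_bound_of_deriv_hasCompactSupport {φ : ℝ → ℝ} (hφ : ContDiff ℝ 1 φ)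
    (hc : HasCompactSupport (deriv φ)) : ∃ B, ∀ x, |φ x| ≤ B := by
  have hd := hφ.continuous_deriv le_rfl
  have hi := hd.integrable_of_hasCompactSupport hc (μ := volume)
  refine ⟨|φ 0| + ∫ t, |deriv φ t|, fun x => ?_⟩
  rw [(IsPrimitive.of_deriv hφ).2 x]
  refine (abs_add_le _ _).trans (add_le_add le_rfl ?_)
  refine (intervalIntegral.norm_integral_le_integral_norm_uIoc (μ := volume) (f := deriv φ)).trans ?_
  exact setIntegral_le_integral hi.abs (ae_of_all _ fun t => abs_nonneg _)

section Poincare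

variable {μ : Measure ℝ} [IsProbabilityMeasure μ] {ρ : ℝ → ℝ}

theorem tendsto_integral_of_bounded {F : ℕ → ℝ → ℝ} {f : ℝ → ℝ} {C : ℝ}
    (hF : ∀ n, Continuous (F n)) (hC : ∀ n x, |F n x| ≤ C)
    (hlim : ∀ x, Tendsto (fun n => F n x) atTop (𝓝 (f x))) :
    Tendsto (fun n => ∫ x, F n x ∂μ) atTop (𝓝 (∫ x, f x ∂μ)) :=
  tendsto_integral_of_dominated_convergence (fun _ => C) (fun n => (hF n).aestronglyMeasurable)
    (integrable_const _) (fun n => ae_of_all _ (hC n)) (ae_of_all _ hlim)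

/-- The Poincaré inequality for functions which are constant near `±∞`. -/
theorem PoincareInequality.extend (hP : PoincareInequality μ) : ∃ C : ℝ, 0 < C ∧
    ∀ φ : ℝ → ℝ, ContDiff ℝ 1 φ → HasCompactSupport (deriv φ) →
      ∫ x, (φ x - ∫ y, φ y ∂μ) ^ 2 ∂μ ≤ C * ∫ x, deriv φ x ^ 2 ∂μ := by
  obtain ⟨C, hC0, hC⟩ := hP
  refine ⟨C, hC0, fun φ hφ hc => ?_⟩
  obtain ⟨B, hB⟩ := exists_bound_of_deriv_hasCompactSupport hφ hc
  obtain ⟨B', hB'⟩ := (hφ.continuous_deriv le_rfl).bounded_above_of_compact_support hc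
  obtain ⟨D, hD0, hD⟩ := exists_deriv_cutoff_bound
  have hB0 : 0 ≤ B := (abs_nonneg _).trans (hB 0)
  have hB0' : 0 ≤ B' := (norm_nonneg _).trans (hB' 0)
  -- The inequality holds for the compactly supported products with the cutoffs. It passes to the
  -- limit by bounded convergence, the derivatives of the cutoffs being `O(1/n)`.
  have hχd := fun n => (contDiff_cutoff n).differentiable one_ne_zero
  have hφd := hφ.differentiable one_ne_zero
  have hder : ∀ n x, deriv (fun x => cutoff n x * φ x) x =
      deriv (cutoff n) x * φ x + cutoff n x * deriv φ x := fun n x =>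
    ((hχd n x).hasDerivAt.mul (hφd x).hasDerivAt).deriv
  have hle : ∀ n x, |cutoff n x * φ x| ≤ B := fun n x => by
    rw [abs_mul, abs_of_nonneg (cutoff_nonneg n x)]
    exact (mul_le_of_le_one_left (abs_nonneg _) (cutoff_le_one n x)).trans (hB x)
  have hlim : ∀ x, Tendsto (fun n => cutoff n x * φ x) atTop (𝓝 (φ x)) := fun x => by
    simpa using (tendsto_cutoff x).mul_const (φ x)
  have hcont : ∀ n, Continuous fun x => cutoff n x * φ x := fun n =>
    (contDiff_cutoff n).continuous.mul hφ.continuous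
  have t1 := tendsto_integral_of_bounded (μ := μ) hcont hle hlim
  have hm : ∀ n, |∫ y, cutoff n y * φ y ∂μ| ≤ B := fun n => by
    have := norm_integral_le_of_norm_le_const (μ := μ) (f := fun y => cutoff n y * φ y) (C := B)
      (ae_of_all _ fun y => hle n y)
    simpa using this
  have t2 : Tendsto (fun n => ∫ x, (cutoff n x * φ x - ∫ y, cutoff n y * φ y ∂μ) ^ 2 ∂μ) atTop
      (𝓝 (∫ x, (φ x - ∫ y, φ y ∂μ) ^ 2 ∂μ)) := by
    refine tendsto_integral_of_bounded (C := (B + B) ^ 2)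
      (fun n => ((hcont n).sub continuous_const).pow 2) (fun n x => ?_)
      fun x => ((hlim x).sub t1).pow 2
    rw [abs_pow]
    exact pow_le_pow_left₀ (abs_nonneg _) ((abs_sub _ _).trans (add_le_add (hle n x) (hm n))) 2
  have hdle : ∀ n x, |deriv (cutoff n) x| ≤ D := fun n x =>
    (hD n x).trans (div_le_self hD0 (by linarith [n.cast_nonneg (α := ℝ)]))
  have t3 : Tendsto (fun n => ∫ x, |deriv (fun x => cutoff n x * φ x) x| ^ 2 ∂μ) atTop
      (𝓝 (∫ x, deriv φ x ^ 2 ∂μ)) := by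
    simp only [hder, sq_abs]
    refine tendsto_integral_of_bounded (C := (D * B + B') ^ 2) (fun n => ?_) (fun n x => ?_)
      fun x => ?_
    · have h1 := (contDiff_cutoff n).continuous_deriv le_rfl
      have h2 := (contDiff_cutoff n).continuous
      have h3 := hφ.continuous_deriv le_rfl
      have h4 := hφ.continuous
      fun_prop
    · rw [abs_pow]
      refine pow_le_pow_left₀ (abs_nonneg _) ((abs_add_le _ _).trans ?_) 2
      rw [abs_mul, abs_mul, abs_of_nonneg (cutoff_nonneg n x)]
      exact add_le_add (mul_le_mul (hdle n x) (hB x) (abs_nonneg _) hD0)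
        ((mul_le_of_le_one_left (abs_nonneg _) (cutoff_le_one n x)).trans (hB' x))
    · have h1 : Tendsto (fun n => deriv (cutoff n) x) atTop (𝓝 0) := by
        refine squeeze_zero_norm (fun n => hD n x) ?_
        exact (tendsto_const_nhds (x := D)).div_atTop
          (tendsto_atTop_add_const_right _ _ tendsto_natCast_atTop_atTop)
      have h2 := ((h1.mul_const (φ x)).add ((tendsto_cutoff x).mul_const (deriv φ x))).pow 2
      simpa using h2
  exact le_of_tendsto_of_tendsto' t2 (t3.const_mul C) fun n =>
    hC _ ((contDiff_cutoff n).mul hφ) ((hasCompactSupport_cutoff n).mul_right)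

theorem sq_integral_mul_le {u v : ℝ → ℝ} (hu : MemLp u 2 μ) (hv : MemLp v 2 μ) :
    (∫ x, u x * v x ∂μ) ^ 2 ≤ (∫ x, u x ^ 2 ∂μ) * ∫ x, v x ^ 2 ∂μ := by
  rw [← norm_toLp_sq hu, ← norm_toLp_sq hv, ← mul_pow, ← sq_abs]
  exact pow_le_pow_left₀ (abs_nonneg _) (abs_integral_mul_le hu hv) 2

variable {v : ℝ → ℝ}

namespace RegularDensity

theorem continuous_tail_div (h : RegularDensity μ ρ) (hv : MemLp v 2 μ) (h0 : ∫ x, v x ∂μ = 0) :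
    Continuous fun x => tail (fun x => ρ x * v x) x / ρ x :=
  (continuous_tail (h.logCharge hv h0).integrable).div h.cont fun x => (h.pos x).ne'

/-- The primitive of the truncation of `ρ⁻¹ ∫_x^∞ v ρ`. -/
noncomputable def truncPrimitive (ρ v : ℝ → ℝ) (n : ℕ) (x : ℝ) : ℝ :=
  ∫ t in (0 : ℝ)..x, cutoff n t * (tail (fun x => ρ x * v x) t / ρ t)

theorem truncPrimitive_spec (h : RegularDensity μ ρ) (hv : MemLp v 2 μ) (h0 : ∫ x, v x ∂μ = 0)
    (n : ℕ) : ContDiff ℝ 1 (truncPrimitive ρ v n) ∧ deriv (truncPrimitive ρ v n) =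
      (fun t => cutoff n t * (tail (fun x => ρ x * v x) t / ρ t)) ∧
      HasCompactSupport (deriv (truncPrimitive ρ v n)) := by
  have hc : Continuous fun t => cutoff n t * (tail (fun x => ρ x * v x) t / ρ t) :=
    (contDiff_cutoff n).continuous.mul (h.continuous_tail_div hv h0)
  have hd : ∀ x, HasDerivAt (truncPrimitive ρ v n)
      (cutoff n x * (tail (fun x => ρ x * v x) x / ρ x)) x := fun x =>
    intervalIntegral.integral_hasDerivAt_right (hc.intervalIntegrable _ _)
      (hc.stronglyMeasurableAtFilter _ _) hc.continuousAt
  have e : deriv (truncPrimitive ρ v n) =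
      fun t => cutoff n t * (tail (fun x => ρ x * v x) t / ρ t) := funext fun x => (hd x).deriv
  refine ⟨?_, e, ?_⟩
  · rw [contDiff_one_iff_deriv, e]
    exact ⟨fun x => (hd x).differentiableAt, hc⟩
  · rw [e]; exact (hasCompactSupport_cutoff n).mul_right

/-- The a priori estimates given by the Poincaré inequality. -/
theorem truncPrimitive_bounds (h : RegularDensity μ ρ) (hP : PoincareInequality μ) (hv : MemLp v 2 μ)
    (h0 : ∫ x, v x ∂μ = 0) : ∃ K, ∀ n,
      ∫ x, cutoff n x * (tail (fun x => ρ x * v x) x ^ 2 / ρ x) ≤ K ∧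
      ∫ x, (truncPrimitive ρ v n x - ∫ y, truncPrimitive ρ v n y ∂μ) ^ 2 ∂μ ≤ K := by
  obtain ⟨C, hC0, hC⟩ := hP.extend
  have hF := h.logCharge hv h0
  set f := tail fun x => ρ x * v x with hf
  have hfc : Continuous f := continuous_tail hF.integrable
  set W := ∫ x, v x ^ 2 ∂μ
  have hW0 : 0 ≤ W := integral_nonneg fun x => sq_nonneg _
  refine ⟨max (W * C) (C * (W * C)), fun n => ?_⟩
  obtain ⟨hφ, hd, hcs⟩ := h.truncPrimitive_spec hv h0 n
  set φ := truncPrimitive ρ v n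
  obtain ⟨B, hB⟩ := exists_bound_of_deriv_hasCompactSupport hφ hcs
  -- With `φ' = χ f/ρ`, where `χ` is the cutoff and `f` the tail, this is the localised version of
  -- `∫ (f/ρ)² dμ`.
  set I := ∫ x, cutoff n x * (f x ^ 2 / ρ x) with hI
  have hI0 : 0 ≤ I := integral_nonneg fun x =>
    mul_nonneg (cutoff_nonneg n x) (div_nonneg (sq_nonneg _) (h.pos x).le)
  have hci : Continuous fun x => cutoff n x * (f x ^ 2 / ρ x) :=
    (contDiff_cutoff n).continuous.mul ((hfc.pow 2).div h.cont fun x => (h.pos x).ne')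
  have hii : Integrable fun x => cutoff n x * (f x ^ 2 / ρ x) :=
    hci.integrable_of_hasCompactSupport (hasCompactSupport_cutoff n).mul_right
  have e0 : (fun x => f x * deriv φ x) = fun x => cutoff n x * (f x ^ 2 / ρ x) := by
    funext x; rw [hd]; simp only [← hf]; ring
  -- Integration by parts: `I = ∫ f φ'`, and `f` has derivative `-ρv`.
  have e1 : I = ∫ x, v x * φ x ∂μ := by
    have := hF.integral_tail_mul_deriv hφ hB (by rw [← hf, e0]; exact hii)
    rw [← hf, e0] at this
    rw [hI, this, h.integral_eq]
    congr 1; funext x; ring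
  set m := ∫ y, φ y ∂μ
  have hφ2 : MemLp (fun x => φ x - m) 2 μ :=
    MemLp.of_bound (hφ.continuous.sub continuous_const).aestronglyMeasurable (B + |m|)
      (ae_of_all _ fun x => (abs_sub _ _).trans (by linarith [hB x]))
  have e2 : I = ∫ x, v x * (φ x - m) ∂μ := by
    simp only [mul_sub]
    have hvi := hv.integrable one_le_two
    rw [integral_sub (hvi.mul_bdd (c := B) hφ.continuous.aestronglyMeasurable (ae_of_all _ hB))
      (hvi.mul_const _), integral_mul_const, h0, e1]
    ring
  -- Here `χ² ≤ χ` is used.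
  have e3 : ∫ x, deriv φ x ^ 2 ∂μ ≤ I := by
    rw [h.integral_eq, hd]
    refine integral_mono_of_nonneg (ae_of_all _ fun x => ?_) hii (ae_of_all _ fun x => ?_)
    · exact mul_nonneg (h.pos x).le (sq_nonneg _)
    · have hp := h.pos x
      have c0 := cutoff_nonneg n x
      have c1 := cutoff_le_one n x
      have e4 : ρ x * (cutoff n x * (f x / ρ x)) ^ 2 = cutoff n x ^ 2 * (f x ^ 2 / ρ x) := by
        field_simp
      simp only [← hf]
      rw [e4]
      refine mul_le_mul_of_nonneg_right ?_ (by positivity)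
      nlinarith
  have hvar : ∫ x, (φ x - m) ^ 2 ∂μ ≤ C * I :=
    (hC φ hφ hcs).trans (mul_le_mul_of_nonneg_left e3 hC0.le)
  -- Cauchy-Schwarz and Poincaré give `I² ≤ W C I`; since `I` is finite thanks to the cutoff, one
  -- factor can be divided out.
  have hle : I ≤ W * C := by
    have h1 := sq_integral_mul_le hv hφ2
    rw [← e2] at h1
    rcases hI0.eq_or_lt with hz | hpos
    · rw [← hz]; positivity
    · have h2 : I * I ≤ W * C * I := by
        calc I * I = I ^ 2 := (sq I).symm
          _ ≤ W * ∫ x, (φ x - m) ^ 2 ∂μ := h1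
          _ ≤ W * (C * I) := mul_le_mul_of_nonneg_left hvar hW0
          _ = _ := by ring
      exact le_of_mul_le_mul_right h2 hpos
  exact ⟨hle.trans (le_max_left _ _),
    (hvar.trans (mul_le_mul_of_nonneg_left hle hC0.le)).trans (le_max_right _ _)⟩

theorem memLp_tail_div (h : RegularDensity μ ρ) (hP : PoincareInequality μ) (hv : MemLp v 2 μ)
    (h0 : ∫ x, v x ∂μ = 0) : MemLp (fun x => tail (fun x => ρ x * v x) x / ρ x) 2 μ := by
  obtain ⟨K, hK⟩ := h.truncPrimitive_bounds hP hv h0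
  have hF := h.logCharge hv h0
  have hc := h.continuous_tail_div hv h0
  have hfc := continuous_tail hF.integrable
  rw [memLp_two_iff_integrable_sq hc.aestronglyMeasurable, h.integrable_iff]
  refine ((integrable_of_tendsto_of_integral_le (C := K)
    (F := fun n x => cutoff n x * (tail (fun x => ρ x * v x) x ^ 2 / ρ x))
    (f := fun x => tail (fun x => ρ x * v x) x ^ 2 / ρ x)
    (fun n => ?_) (fun n x => ?_) (fun n => (hK n).1) (ae_of_all _ fun x => ?_)).1).congr
    (ae_of_all _ fun x => ?_)
  · exact Continuous.integrable_of_hasCompactSupport ((contDiff_cutoff n).continuous.mul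
      ((hfc.pow 2).div h.cont fun x => (h.pos x).ne')) (hasCompactSupport_cutoff n).mul_right
  · exact mul_nonneg (cutoff_nonneg n x) (div_nonneg (sq_nonneg _) (h.pos x).le)
  · simpa using (tendsto_cutoff x).mul_const (tail (fun x => ρ x * v x) x ^ 2 / ρ x)
  · have := (h.pos x).ne'
    simp only
    field_simp

theorem tendsto_truncPrimitive (h : RegularDensity μ ρ) (hv : MemLp v 2 μ)
    (h0 : ∫ x, v x ∂μ = 0) (x : ℝ) : Tendsto (fun n => truncPrimitive ρ v n x) atTop
      (𝓝 (∫ t in (0 : ℝ)..x, tail (fun x => ρ x * v x) t / ρ t)) := by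
  have hc := h.continuous_tail_div hv h0
  refine intervalIntegral.tendsto_integral_filter_of_dominated_convergence
    (fun t => |tail (fun x => ρ x * v x) t / ρ t|) (Eventually.of_forall fun n => ?_)
    (Eventually.of_forall fun n => ae_of_all _ fun t _ => ?_) (hc.abs.intervalIntegrable _ _)
    (ae_of_all _ fun t _ => ?_)
  · exact ((contDiff_cutoff n).continuous.mul hc).aestronglyMeasurable
  · rw [norm_mul, Real.norm_of_nonneg (cutoff_nonneg n t)]
    exact mul_le_of_le_one_left (norm_nonneg _) (cutoff_le_one n t)
  · simpa using (tendsto_cutoff t).mul_const (tail (fun x => ρ x * v x) t / ρ t)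

/-- The estimates control the truncated primitives only up to their means, whose convergence is not
known. Fatou's lemma is therefore applied to the differences between two points, for the product
measure. -/
theorem memLp_primitive (h : RegularDensity μ ρ) (hP : PoincareInequality μ) (hv : MemLp v 2 μ)
    (h0 : ∫ x, v x ∂μ = 0) :
    MemLp (fun x => ∫ t in (0 : ℝ)..x, tail (fun x => ρ x * v x) t / ρ t) 2 μ := by
  obtain ⟨K, hK⟩ := h.truncPrimitive_bounds hP hv h0
  have hc := h.continuous_tail_div hv h0
  set a : ℝ → ℝ := fun x => ∫ t in (0 : ℝ)..x, tail (fun x => ρ x * v x) t / ρ t with ha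
  have hac : Continuous a := intervalIntegral.continuous_primitive
    (fun p q => hc.intervalIntegrable p q) 0
  have key := (integrable_of_tendsto_of_integral_le (ν := μ.prod μ) (C := 4 * K)
    (F := fun n p => (truncPrimitive ρ v n p.1 - truncPrimitive ρ v n p.2) ^ 2)
    (f := fun p : ℝ × ℝ => (a p.1 - a p.2) ^ 2) (fun n => ?_) (fun n p => sq_nonneg _)
    (fun n => ?_) (ae_of_all _ fun p => ?_)).1
  · obtain ⟨y, hy⟩ := (key.prod_left_ae).exists
    have hm : Continuous fun x => a x - a y := hac.sub continuous_const
    have h1 : MemLp (fun x => a x - a y) 2 μ :=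
      (memLp_two_iff_integrable_sq hm.aestronglyMeasurable).2 hy
    have h2 := h1.add (memLp_const (a y))
    refine h2.ae_eq (ae_of_all _ fun x => ?_)
    simp
  · obtain ⟨hφ, hd, hcs⟩ := h.truncPrimitive_spec hv h0 n
    obtain ⟨B, hB⟩ := exists_bound_of_deriv_hasCompactSupport hφ hcs
    have hcont := hφ.continuous
    refine Integrable.of_bound (Continuous.aestronglyMeasurable (by fun_prop)) ((B + B) ^ 2)
      (ae_of_all _ fun p => ?_)
    rw [norm_pow]
    exact pow_le_pow_left₀ (norm_nonneg _) ((abs_sub _ _).trans (add_le_add (hB _) (hB _))) 2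
  · obtain ⟨hφ, hd, hcs⟩ := h.truncPrimitive_spec hv h0 n
    obtain ⟨B, hB⟩ := exists_bound_of_deriv_hasCompactSupport hφ hcs
    have hcont := hφ.continuous
    set φ := truncPrimitive ρ v n
    set m := ∫ y, φ y ∂μ
    have i1 : Integrable (fun x => (φ x - m) ^ 2) μ := by
      refine Integrable.of_bound (Continuous.aestronglyMeasurable (by fun_prop)) ((B + |m|) ^ 2)
        (ae_of_all _ fun p => ?_)
      rw [norm_pow]
      exact pow_le_pow_left₀ (norm_nonneg _) ((abs_sub _ _).trans (by linarith [hB p])) 2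
    have j1 : Integrable (fun p : ℝ × ℝ => 2 * (φ p.1 - m) ^ 2) (μ.prod μ) :=
      (i1.comp_fst μ).const_mul 2
    have j2 : Integrable (fun p : ℝ × ℝ => 2 * (φ p.2 - m) ^ 2) (μ.prod μ) :=
      (i1.comp_snd μ).const_mul 2
    calc ∫ p : ℝ × ℝ, (φ p.1 - φ p.2) ^ 2 ∂(μ.prod μ)
        ≤ ∫ p : ℝ × ℝ, (2 * (φ p.1 - m) ^ 2 + 2 * (φ p.2 - m) ^ 2) ∂(μ.prod μ) := by
          refine integral_mono_of_nonneg (ae_of_all _ fun p => sq_nonneg _) (j1.add j2)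
            (ae_of_all _ fun p => ?_)
          simp only
          nlinarith [sq_nonneg ((φ p.1 - m) + (φ p.2 - m))]
      _ = 4 * ∫ x, (φ x - m) ^ 2 ∂μ := by
          rw [integral_add j1 j2, integral_const_mul, integral_const_mul,
            integral_fun_fst (fun x => (φ x - m) ^ 2), integral_fun_snd (fun x => (φ x - m) ^ 2)]
          simp
          ring
      _ ≤ 4 * K := by linarith [(hK n).2]
  · exact ((h.tendsto_truncPrimitive hv h0 p.1).sub (h.tendsto_truncPrimitive hv h0 p.2)).pow 2

end RegularDensity

end Poincare

/-! ### The space `H` and the operator `A` -/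

theorem hasWeakDeriv_weakDeriv {u : ℝ → ℝ} (h : ∃ v, HasWeakDeriv u v) :
    HasWeakDeriv u (weakDeriv u) := by
  obtain ⟨v, hv⟩ := h
  exact hv.congr (EventuallyEq.refl _ _) hv.weakDeriv_ae.symm

/-- `a ∈ H` satisfies `(a' ρ)' = -v ρ` with `v ∈ L²(μ)`. -/
structure SolvesA (μ : Measure ℝ) (ρ a v : ℝ → ℝ) : Prop where
  memH : MemH μ a
  memLp : MemLp v 2 μ
  hasWeakDeriv : HasWeakDeriv (derivDensity μ a) fun x => -(ρ x * v x)

namespace RegularDensity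

variable {μ : Measure ℝ} [IsProbabilityMeasure μ] {ρ : ℝ → ℝ} {a a' u u' v v' : ℝ → ℝ}

theorem memH_of_hasWeakDeriv (h : RegularDensity μ ρ) (hu : MemLp u 2 μ) (hw : HasWeakDeriv u v)
    (hv : MemLp v 2 μ) (h0 : ∫ x, u x ∂μ = 0) : MemH μ u :=
  ⟨hu, ⟨v, hw⟩, hv.ae_eq (h.ac.ae_eq hw.weakDeriv_ae.symm), h0⟩

theorem memH_congr (h : RegularDensity μ ρ) (hu : MemH μ u) (e : u =ᵐ[μ] u') : MemH μ u' :=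
  h.memH_of_hasWeakDeriv (hu.1.ae_eq e)
    ((hasWeakDeriv_weakDeriv hu.2.1).congr (h.volume_ac.ae_eq e) (EventuallyEq.refl _ _)) hu.2.2.1
    ((integral_congr_ae e).symm.trans hu.2.2.2)

theorem memH_const_mul (h : RegularDensity μ ρ) (c : ℝ) (hu : MemH μ u) :
    MemH μ fun x => c * u x :=
  h.memH_of_hasWeakDeriv (hu.1.const_mul c) ((hasWeakDeriv_weakDeriv hu.2.1).const_mul c)
    (hu.2.2.1.const_mul c) (by rw [integral_const_mul, hu.2.2.2, mul_zero])

theorem memH_sub (h : RegularDensity μ ρ) (hu : MemH μ u) (hv : MemH μ v) :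
    MemH μ fun x => u x - v x :=
  h.memH_of_hasWeakDeriv (hu.1.sub hv.1)
    ((hasWeakDeriv_weakDeriv hu.2.1).sub (hasWeakDeriv_weakDeriv hv.2.1))
    (hu.2.2.1.sub hv.2.2.1) (by
      rw [integral_sub (hu.1.integrable one_le_two) (hv.1.integrable one_le_two), hu.2.2.2,
        hv.2.2.2, sub_zero])

theorem derivDensity_ae (h : RegularDensity μ ρ) (a : ℝ → ℝ) :
    derivDensity μ a =ᵐ[volume] fun x => ρ x * weakDeriv a x := by
  filter_upwards [h.ae_eq] with x hx
  rw [derivDensity, hx, mul_comm]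

theorem solvesA_of_opA (h : RegularDensity μ ρ) (ha : MemH μ a)
    (hex : ∃ g, HasWeakDeriv (derivDensity μ a) g) (hv : MemLp v 2 μ) (e : opA μ a =ᵐ[μ] v) :
    SolvesA μ ρ a v := by
  refine ⟨ha, hv, (hasWeakDeriv_weakDeriv hex).congr (EventuallyEq.refl _ _) ?_⟩
  filter_upwards [h.volume_ac.ae_eq e, h.ae_eq] with x hx hρ
  rw [← hx, opA, hρ]
  have := (h.pos x).ne'
  field_simp

theorem opA_ae (h : RegularDensity μ ρ) (ha : SolvesA μ ρ a v) : opA μ a =ᵐ[μ] v := by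
  refine h.ac.ae_eq ?_
  filter_upwards [ha.hasWeakDeriv.weakDeriv_ae, h.ae_eq] with x hx hρ
  have := (h.pos x).ne'
  rw [opA, hx, hρ]
  field_simp

theorem graphA_iff (h : RegularDensity μ ρ) : GraphA μ a v ↔ SolvesA μ ρ a v ∧ MemH μ v :=
  ⟨fun hg => ⟨h.solvesA_of_opA hg.1 hg.2.2.1 hg.2.1.1 hg.2.2.2, hg.2.1⟩,
    fun hs => ⟨hs.1.memH, hs.2, ⟨_, hs.1.hasWeakDeriv⟩, h.opA_ae hs.1⟩⟩

theorem solvesA_congr (h : RegularDensity μ ρ) (hs : SolvesA μ ρ a v) (e : v =ᵐ[μ] v') :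
    SolvesA μ ρ a v' := by
  refine ⟨hs.memH, hs.memLp.ae_eq e, hs.hasWeakDeriv.congr (EventuallyEq.refl _ _) ?_⟩
  filter_upwards [h.volume_ac.ae_eq e] with x hx
  rw [hx]

/-- An integrable function with integrable derivative forces `vρ` to have integral zero. Then `a'ρ`
and the tail of `vρ` have the same derivative, and their constant difference is integrable on the
line, hence zero. -/
theorem derivDensity_spec (h : RegularDensity μ ρ) (hs : SolvesA μ ρ a v) :
    ∫ x, v x ∂μ = 0 ∧ derivDensity μ a =ᵐ[volume] tail fun x => ρ x * v x := by
  have hD : Integrable (derivDensity μ a) :=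
    ((h.integrable_iff _).1 (hs.memH.2.2.1.integrable one_le_two)).congr (h.derivDensity_ae a).symm
  have hF : Integrable fun x => ρ x * v x := (h.integrable_iff _).1 (hs.memLp.integrable one_le_two)
  obtain ⟨p, hp, e⟩ := hs.hasWeakDeriv.exists_primitive
  have hpi : Integrable p := hD.congr e
  have h0 : ∫ x, v x ∂μ = 0 := by
    have := hp.integral_eq_zero hpi hF.neg
    rw [integral_neg] at this
    rw [h.integral_eq]; linarith
  refine ⟨h0, e.trans (ae_of_all _ fun x => ?_)⟩
  have hc : ∀ x, p x - tail (fun x => ρ x * v x) x = p 0 - tail (fun x => ρ x * v x) 0 := fun x => by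
    rw [hp.2 x, (isPrimitive_tail hF).2 x]; ring
  have hi := hpi.sub (h.logCharge hs.memLp h0).integrable_tail
  have hi' : Integrable (fun _ : ℝ => p 0 - tail (fun x => ρ x * v x) 0) :=
    hi.congr (ae_of_all _ hc)
  rw [integrable_const_iff] at hi'
  rcases hi' with hz | hf
  · have := hc x; rw [hz] at this; linarith
  · exact absurd hf.measure_univ_lt_top (by simp)

theorem solvesA_unique (h : RegularDensity μ ρ) (hs : SolvesA μ ρ a v) (hs' : SolvesA μ ρ a' v')
    (e : v =ᵐ[μ] v') : a =ᵐ[μ] a' := by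
  have h1 := (h.derivDensity_spec hs).2
  have h2 := (h.derivDensity_spec (h.solvesA_congr hs' e.symm)).2
  have hw : weakDeriv a =ᵐ[volume] weakDeriv a' := by
    filter_upwards [h1.trans h2.symm, h.ae_eq] with x hx hρ
    have := h.pos x
    rw [derivDensity, derivDensity, hρ] at hx
    exact mul_right_cancel₀ this.ne' hx
  have hw0 : (fun x => weakDeriv a x - weakDeriv a' x) =ᵐ[volume] fun _ => 0 :=
    hw.mono fun x hx => by simp only [hx, sub_self]
  obtain ⟨c, hc⟩ := (((hasWeakDeriv_weakDeriv hs.memH.2.1).sub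
    (hasWeakDeriv_weakDeriv hs'.memH.2.1)).congr (EventuallyEq.refl _ _) hw0).ae_const
  have hc' := h.ac.ae_eq hc
  have h3 := integral_congr_ae hc'
  rw [integral_sub (hs.memH.1.integrable one_le_two) (hs'.memH.1.integrable one_le_two),
    hs.memH.2.2.2, hs'.memH.2.2.2] at h3
  simp only [sub_self, integral_const, probReal_univ, one_smul] at h3
  filter_upwards [hc'] with x hx
  linarith

/-- The solution of `A[a] = v`. -/
noncomputable def invA (μ : Measure ℝ) (ρ v : ℝ → ℝ) (x : ℝ) : ℝ :=
  (-∫ y, (∫ t in (0 : ℝ)..y, tail (fun x => ρ x * v x) t / ρ t) ∂μ) +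
    ∫ t in (0 : ℝ)..x, tail (fun x => ρ x * v x) t / ρ t

theorem isPrimitive_invA (h : RegularDensity μ ρ) (hv : MemLp v 2 μ) (h0 : ∫ x, v x ∂μ = 0) :
    IsPrimitive (invA μ ρ v) fun x => tail (fun x => ρ x * v x) x / ρ x := by
  unfold invA
  exact LocallyIntegrable.isPrimitive (h.continuous_tail_div hv h0).locallyIntegrable _

theorem memLp_invA (h : RegularDensity μ ρ) (hP : PoincareInequality μ) (hv : MemLp v 2 μ)
    (h0 : ∫ x, v x ∂μ = 0) : MemLp (invA μ ρ v) 2 μ := by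
  have key : ∀ (c : ℝ) {f : ℝ → ℝ}, MemLp f 2 μ → MemLp (fun x => c + f x) 2 μ :=
    fun c f hf => (memLp_const c).add hf
  unfold invA
  exact key _ (h.memLp_primitive hP hv h0)

theorem integral_invA (h : RegularDensity μ ρ) (hP : PoincareInequality μ) (hv : MemLp v 2 μ)
    (h0 : ∫ x, v x ∂μ = 0) : ∫ x, invA μ ρ v x ∂μ = 0 := by
  simp only [invA]
  rw [integral_add (integrable_const _) ((h.memLp_primitive hP hv h0).integrable one_le_two)]
  simp only [integral_const, probReal_univ, one_smul, neg_add_cancel]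

theorem derivDensity_invA (h : RegularDensity μ ρ) (hv : MemLp v 2 μ) (h0 : ∫ x, v x ∂μ = 0) :
    derivDensity μ (invA μ ρ v) =ᵐ[volume] tail fun x => ρ x * v x := by
  filter_upwards [h.derivDensity_ae (invA μ ρ v),
    (h.isPrimitive_invA hv h0).hasWeakDeriv.weakDeriv_ae] with x h1 h2
  rw [h1, h2, mul_div_cancel₀ _ (h.pos x).ne']

theorem solvesA_invA (h : RegularDensity μ ρ) (hP : PoincareInequality μ) (hv : MemLp v 2 μ)
    (h0 : ∫ x, v x ∂μ = 0) : SolvesA μ ρ (invA μ ρ v) v :=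
  ⟨h.memH_of_hasWeakDeriv (h.memLp_invA hP hv h0) (h.isPrimitive_invA hv h0).hasWeakDeriv
    (h.memLp_tail_div hP hv h0) (h.integral_invA hP hv h0), hv,
    (isPrimitive_tail (h.logCharge hv h0).integrable).hasWeakDeriv.congr
      (h.derivDensity_invA hv h0).symm (EventuallyEq.refl _ _)⟩

theorem isInverseAt_graphA (h : RegularDensity μ ρ) (hv : MemH μ v) (ha : SolvesA μ ρ a v) :
    IsInverseAt μ (GraphA μ) v a :=
  ⟨h.graphA_iff.2 ⟨ha, hv⟩, fun _ hw =>
    h.solvesA_unique (h.graphA_iff.1 hw).1 ha (EventuallyEq.refl _ _)⟩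

/-- Integrability at `+∞` allows replacing the base point `0` of the primitive by `+∞`. The change
is a constant, which the normalisation to mean zero removes. -/
theorem explicitInvA_eq (h : RegularDensity μ ρ) (hP : PoincareInequality μ) (hv : MemLp v 2 μ)
    (h0 : ∫ x, v x ∂μ = 0) (hi : IntegrableAtFilter (tailQuotient μ v) atTop volume) :
    explicitInvA μ v = invA μ ρ v := by
  have hc := h.continuous_tail_div hv h0
  have e : tailQuotient μ v =ᵐ[volume] fun x => tail (fun x => ρ x * v x) x / ρ x := by
    filter_upwards [h.ae_eq] with x hx
    have : ∫ t in Ioi x, v t * lebDensity μ t = tail (fun x => ρ x * v x) x :=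
      integral_congr_ae (ae_restrict_of_ae (h.ae_eq.mono fun t ht => by
        simp only [ht, mul_comm]))
    rw [tailQuotient, hx, this]
    ring
  obtain ⟨s, hs, hsi⟩ := hi
  obtain ⟨M, hM⟩ := mem_atTop_sets.1 hs
  have hI : ∀ x, IntegrableOn (fun x => tail (fun x => ρ x * v x) x / ρ x) (Ioi x) := fun x => by
    have h1 : IntegrableOn (fun x => tail (fun x => ρ x * v x) x / ρ x) (Ici M) :=
      (hsi.mono_set fun y hy => hM y hy).congr_fun_ae (ae_restrict_of_ae e)
    exact ((hc.integrableOn_Icc (a := x) (b := M)).union h1).mono_set fun y hy => by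
      rcases le_total y M with hy' | hy'
      · exact Or.inl ⟨(mem_Ioi.1 hy).le, hy'⟩
      · exact Or.inr hy'
  set J := ∫ s in Ioi (0 : ℝ), tail (fun x => ρ x * v x) s / ρ s
  have hT : ∀ x, ∫ s in Ioi x, tailQuotient μ v s =
      J - ∫ t in (0 : ℝ)..x, tail (fun x => ρ x * v x) t / ρ t := fun x => by
    rw [integral_congr_ae (ae_restrict_of_ae e),
      ← intervalIntegral.integral_Ioi_sub_Ioi' (hI 0) (hI x)]
    ring
  funext x
  rw [explicitInvA, integral_lebDensity_mul h.ac, invA]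
  simp only [hT]
  rw [integral_sub (integrable_const _) ((h.memLp_primitive hP hv h0).integrable one_le_two)]
  simp
  ring

end RegularDensity

/-! ### The form of `-L` and the operator `W` -/

namespace RegularDensity

variable {μ : Measure ℝ} [IsProbabilityMeasure μ] {ρ : ℝ → ℝ} {a a' u u' v v' z φ w : ℝ → ℝ}

theorem fourierT_congr {f g : ℝ → ℝ} (e : f =ᵐ[volume] g) : fourierT f = fourierT g :=
  funext fun x => integral_congr_ae (e.mono fun t ht => by simp only [ht])

theorem memFormDomain_of_solvesA (h : RegularDensity μ ρ) (hs : SolvesA μ ρ a v) :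
    MemFormDomain μ a := by
  obtain ⟨h0, e⟩ := h.derivDensity_spec hs
  refine ⟨hs.memH, ⟨_, hs.hasWeakDeriv⟩, hs.memLp.ae_eq (h.opA_ae hs).symm, ?_⟩
  rw [fourierT_congr e]
  exact (h.logCharge hs.memLp h0).memLp_fourierT_tail

theorem solvesA_of_memFormDomain (h : RegularDensity μ ρ) (ha : MemFormDomain μ a) :
    SolvesA μ ρ a (opA μ a) :=
  h.solvesA_of_opA ha.1 ha.2.1 ha.2.2.1 (EventuallyEq.refl _ _)

theorem memLp_potential (h : RegularDensity μ ρ) (hv : MemLp v 2 μ) (h0 : ∫ x, v x ∂μ = 0) :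
    MemLp (chargePotential fun x => ρ x * v x) 2 μ :=
  h.memLp_of_volume (h.logCharge hv h0).memLp_chargePotential

/-- The Fourier term is `-2P ∫ z U_v dμ`, with `U_v` the potential of `vρ`. It differs from `-∫ z
K[v] dμ` only by the constant in `K[v]`, which is annihilated by the mean zero function `z`. -/
theorem formL_eq (h : RegularDensity μ ρ) (P : ℝ) (hz : SolvesA μ ρ φ z) (hv : SolvesA μ ρ w v) :
    formL P μ φ w = ∫ x, z x * (v x - kernelOp μ (logKernel P μ) v x) ∂μ := by
  obtain ⟨hz0, ez⟩ := h.derivDensity_spec hz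
  obtain ⟨hv0, ev⟩ := h.derivDensity_spec hv
  have hzi := hz.memLp.integrable one_le_two
  have hU := h.memLp_potential hv.memLp hv0
  have i1 : Integrable (fun x => z x * v x) μ := hz.memLp.integrable_mul hv.memLp
  have i2 : Integrable (fun x => z x * chargePotential (fun x => ρ x * v x) x) μ :=
    hz.memLp.integrable_mul hU
  rw [formL, fourierT_congr ez, fourierT_congr ev,
    (h.logCharge hz.memLp hz0).integral_abs_mul_fourierT (h.logCharge hv.memLp hv0)]
  have e1 : ∫ x, opA μ φ x * opA μ w x ∂μ = ∫ x, z x * v x ∂μ := by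
    refine integral_congr_ae ?_
    filter_upwards [h.opA_ae hz, h.opA_ae hv] with x h1 h2
    rw [h1, h2]
  have e2 : ∫ x, ρ x * z x * chargePotential (fun x => ρ x * v x) x =
      ∫ x, z x * chargePotential (fun x => ρ x * v x) x ∂μ := by
    rw [h.integral_eq]
    congr 1; funext x; ring
  set c := ∫ y, logPotential μ y * v y ∂μ
  have e3 : (fun x => z x * (v x - kernelOp μ (logKernel P μ) v x)) = fun x =>
      (z x * v x - 2 * P * (z x * chargePotential (fun x => ρ x * v x) x)) + 2 * P * c * z x := by
    funext x
    rw [h.kernelOp_logKernel P hv.memLp]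
    ring
  have i3 : Integrable (fun x => z x * v x -
      2 * P * (z x * chargePotential (fun x => ρ x * v x) x)) μ := i1.sub (i2.const_mul _)
  rw [e1, e2, e3, integral_add i3 (hzi.const_mul _), integral_sub i1 (i2.const_mul _),
    integral_const_mul, integral_const_mul, hz0]
  ring

/-- Since `φ'ρ` is the tail of `zρ`, this is an integration by parts; the boundary terms vanish
because the products involved are integrable. -/
theorem innerH_eq (h : RegularDensity μ ρ) (hz : SolvesA μ ρ φ z) (hu : MemH μ u) :
    innerH μ φ u = ∫ x, z x * u x ∂μ := by
  obtain ⟨hz0, ez⟩ := h.derivDensity_spec hz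
  have hF := h.logCharge hz.memLp hz0
  obtain ⟨p, hp, e⟩ := (hasWeakDeriv_weakDeriv hu.2.1).exists_primitive
  set f := tail fun x => ρ x * z x
  have ef : (fun x => ρ x * weakDeriv φ x) =ᵐ[volume] f := (h.derivDensity_ae φ).symm.trans ez
  have i1 : Integrable fun x => f x * p x := by
    refine ((h.integrable_iff _).1 (hz.memH.2.2.1.integrable_mul hu.1)).congr ?_
    filter_upwards [ef, e] with x h1 h2
    rw [Pi.mul_apply, ← mul_assoc, h1, h2]
  have i2 : Integrable fun x => f x * weakDeriv u x := by
    refine ((h.integrable_iff _).1 (hz.memH.2.2.1.integrable_mul hu.2.2.1)).congr ?_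
    filter_upwards [ef] with x h1
    rw [Pi.mul_apply, ← mul_assoc, h1]
  have i3 : Integrable fun x => -(ρ x * z x) * p x := by
    refine ((h.integrable_iff _).1 (hz.memLp.integrable_mul hu.1)).neg.congr ?_
    filter_upwards [e] with x h2
    simp only [Pi.neg_apply, Pi.mul_apply, h2]; ring
  have key := ((isPrimitive_tail hF.integrable).mul hp).integral_eq_zero i1 (i2.add i3)
  rw [integral_add i2 i3] at key
  have e1 : innerH μ φ u = ∫ x, f x * weakDeriv u x := by
    rw [innerH, h.integral_eq]
    refine integral_congr_ae (ef.mono fun x h1 => ?_)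
    simp only [← h1]; ring
  have e2 : ∫ x, z x * u x ∂μ = -∫ x, -(ρ x * z x) * p x := by
    rw [h.integral_eq, ← integral_neg]
    refine integral_congr_ae (e.mono fun x h1 => ?_)
    simp only [h1]; ring
  rw [e1, e2]
  linarith

/-- The centered potential of `v μ` belongs to `H`. -/
theorem memH_potential (h : RegularDensity μ ρ) (hv : MemLp v 2 μ) (h0 : ∫ x, v x ∂μ = 0) :
    MemH μ fun x => chargePotential (fun x => ρ x * v x) x -
      ∫ y, chargePotential (fun x => ρ x * v x) y ∂μ := by
  have hF := h.logCharge hv h0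
  have hU := h.memLp_potential hv h0
  have hi := hU.integrable one_le_two
  obtain ⟨g, hg, hd⟩ := hF.exists_hasWeakDeriv
  set c := ∫ y, chargePotential (fun x => ρ x * v x) y ∂μ with hc
  have hcd : HasWeakDeriv (fun _ => c) fun _ => (0 : ℝ) :=
    IsPrimitive.hasWeakDeriv ⟨(integrable_zero ℝ ℝ volume).locallyIntegrable, fun x => by simp⟩
  refine h.memH_of_hasWeakDeriv (hU.sub (memLp_const c)) (hd.sub hcd) (v := fun x => g x - 0) ?_ ?_
  · simp only [sub_zero]; exact h.memLp_of_volume hg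
  · rw [integral_sub hi (integrable_const _), ← hc]
    simp

/-- Symmetry of the logarithm and Fubini. It shows that the constant subtracted in `k` makes `K[v]`
exactly the centered potential. -/
theorem integral_potential (h : RegularDensity μ ρ) (hv : MemLp v 2 μ) :
    ∫ y, chargePotential (fun x => ρ x * v x) y ∂μ = ∫ y, logPotential μ y * v y ∂μ := by
  have hk := h.momentKernel_log.l2
  have hone : MemLp (fun _ : ℝ => (1 : ℝ)) 2 μ := memLp_const 1
  have hi := hk.integrable_mul_mul hone hv
  simp only [one_mul] at hi
  simp only [h.chargePotential_eq]
  rw [integral_integral_swap hi]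
  congr 1; funext y
  rw [integral_mul_const, logPotential]
  simp only [abs_sub_comm y]

theorem kernelOp_eq (h : RegularDensity μ ρ) (P : ℝ) (hv : MemLp v 2 μ) :
    kernelOp μ (logKernel P μ) v = fun x => 2 * P * (chargePotential (fun x => ρ x * v x) x -
      ∫ y, chargePotential (fun x => ρ x * v x) y ∂μ) :=
  funext fun x => by rw [h.integral_potential hv, h.kernelOp_logKernel P hv]

theorem memH_kernelOp (h : RegularDensity μ ρ) (P : ℝ) (hv : MemLp v 2 μ)
    (h0 : ∫ x, v x ∂μ = 0) : MemH μ (kernelOp μ (logKernel P μ) v) := by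
  rw [h.kernelOp_eq P hv]
  exact h.memH_const_mul _ (h.memH_potential hv h0)

/-- The Hilbert transform of `a'ρ`, the tail of `vρ`, is the potential of `vρ`; centering it gives
both `-W[a]` and `K[v]/(2P)`. -/
theorem exists_graphW (h : RegularDensity μ ρ) (P : ℝ) (hs : SolvesA μ ρ a v) :
    ∃ g, GraphW μ a g ∧ ∀ x, 2 * P * g x = -kernelOp μ (logKernel P μ) v x := by
  obtain ⟨h0, e⟩ := h.derivDensity_spec hs
  have hF := h.logCharge hs.memLp h0
  have hH := hF.isHilbertTransform
  have hw : IsHilbertTransform (derivDensity μ a) (chargePotential fun x => ρ x * v x) := by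
    refine ⟨hH.1.ae_eq e.symm, hH.2.1, hH.2.2.mono fun x hx => hx.congr fun ε => ?_⟩
    exact integral_congr_ae (ae_restrict_of_ae (e.mono fun t ht => by simp only [ht]))
  refine ⟨fun x => -1 * (chargePotential (fun x => ρ x * v x) x -
    ∫ y, chargePotential (fun x => ρ x * v x) y ∂μ), ⟨hs.memH,
      h.memH_const_mul _ (h.memH_potential hs.memLp h0), _, hw,
      (h.memLp_potential hs.memLp h0).integrable one_le_two, ae_of_all _ fun x => ?_⟩, fun x => ?_⟩
  · ring
  · rw [h.kernelOp_eq P hs.memLp]; ring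

/-- The equation `-L[w] = u` in terms of the kernel operator. -/
theorem graphNegL_iff (h : RegularDensity μ ρ) (hPo : PoincareInequality μ) {P : ℝ}
    (hu : MemH μ u) : GraphNegL P μ w u ↔
      ∃ v, SolvesA μ ρ w v ∧ (fun x => v x - kernelOp μ (logKernel P μ) v x) =ᵐ[μ] u := by
  constructor
  · rintro ⟨hw, -, hform⟩
    have hs := h.solvesA_of_memFormDomain hw
    refine ⟨_, hs, ?_⟩
    obtain ⟨h0, -⟩ := h.derivDensity_spec hs
    set v := opA μ w
    have hK := h.memH_kernelOp P hs.memLp h0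
    set e : ℝ → ℝ := fun x => v x - kernelOp μ (logKernel P μ) v x - u x
    have he : MemLp e 2 μ := (hs.memLp.sub hK.1).sub hu.1
    have hi : Integrable (fun x => v x - kernelOp μ (logKernel P μ) v x) μ :=
      (hs.memLp.sub hK.1).integrable one_le_two
    have he0 : ∫ x, e x ∂μ = 0 := by
      rw [integral_sub hi (hu.1.integrable one_le_two),
        integral_sub (hs.memLp.integrable one_le_two) (hK.1.integrable one_le_two), h0,
        hK.2.2.2, hu.2.2.2]
      simp
    -- Test the weak equation with the preimage under `A` of the residual `e` itself, which gives `∫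
    -- e² dμ = 0`.
    have hφ := h.solvesA_invA hPo he he0
    have h1 := hform _ (h.memFormDomain_of_solvesA hφ)
    rw [h.formL_eq P hφ hs, h.innerH_eq hφ hu] at h1
    have h2 : ∫ x, e x ^ 2 ∂μ = 0 := by
      have i1 : Integrable (fun x => e x * (v x - kernelOp μ (logKernel P μ) v x)) μ :=
        he.integrable_mul (hs.memLp.sub hK.1)
      have i2 : Integrable (fun x => e x * u x) μ := he.integrable_mul hu.1
      have : (fun x => e x ^ 2) = fun x =>
          e x * (v x - kernelOp μ (logKernel P μ) v x) - e x * u x := by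
        funext x; simp only [e]; ring
      rw [this, integral_sub i1 i2, h1, sub_self]
    rw [integral_eq_zero_iff_of_nonneg (fun x => sq_nonneg _) he.integrable_sq] at h2
    filter_upwards [h2] with x hx
    have : e x = 0 := by simpa using hx
    simp only [e] at this
    linarith
  · rintro ⟨v, hs, e⟩
    refine ⟨h.memFormDomain_of_solvesA hs, hu, fun φ hφ => ?_⟩
    have hz := h.solvesA_of_memFormDomain hφ
    rw [h.formL_eq P hz hs, h.innerH_eq hz hu]
    exact integral_congr_ae (e.mono fun x hx => by simp only [hx])

end RegularDensity

/-! ### The main theorem -/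

section Kernel

variable {μ : Measure ℝ} [IsProbabilityMeasure μ] {k s : ℝ → ℝ → ℝ} {g : ℝ → ℝ}

theorem CenteredKernel.integral_kernelOp (h : CenteredKernel μ k s g) {v : ℝ → ℝ}
    (hv : MemLp v 2 μ) : ∫ x, kernelOp μ k v x ∂μ = 0 := by
  have hone : MemLp (fun _ : ℝ => (1 : ℝ)) 2 μ := memLp_const 1
  have hi := h.kern.l2.integrable_mul_mul hone hv
  simp only [one_mul] at hi
  simp only [kernelOp]
  rw [integral_integral_swap hi]
  have h0 : ∀ y, ∫ x, k x y ∂μ = 0 := fun y => by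
    have hs : Integrable (fun x => s y x) μ := (h.symm_kern.left y).integrable
    simp only [h.decomp, h.symm _ y]
    rw [integral_add hs h.moments.integrable, h.mean, h.mean_g, add_zero]
  simp only [integral_mul_const, h0, zero_mul, integral_zero]

theorem CenteredKernel.eq_sub_kernelOp (h : CenteredKernel μ k s g) {u v : ℝ → ℝ}
    (hv : MemLp v 2 μ) (e : (fun x => v x - kernelOp μ k v x) =ᵐ[μ] u) :
    v =ᵐ[μ] fun x => u x - kernelOp μ (resolventKernel μ k) u x := by
  filter_upwards [h.left_inverse hv, e] with x h1 h2
  rw [← h1, kernelOp_congr e, h2]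

end Kernel

namespace RegularDensity

variable {μ : Measure ℝ} [IsProbabilityMeasure μ] {ρ : ℝ → ℝ} {P : ℝ}

theorem solvesA_sub {a a' v v' : ℝ → ℝ} (h : RegularDensity μ ρ) (hs : SolvesA μ ρ a v)
    (hs' : SolvesA μ ρ a' v') : SolvesA μ ρ (fun x => a x - a' x) fun x => v x - v' x := by
  have hw := (hasWeakDeriv_weakDeriv hs.memH.2.1).sub (hasWeakDeriv_weakDeriv hs'.memH.2.1)
  refine ⟨h.memH_sub hs.memH hs'.memH, hs.memLp.sub hs'.memLp,
    (hs.hasWeakDeriv.sub hs'.hasWeakDeriv).congr ?_ (ae_of_all _ fun x => ?_)⟩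
  · filter_upwards [hw.weakDeriv_ae] with x hx
    simp only [derivDensity, hx]; ring
  · simp only; ring

/-- All the assertions come from `f = u - R[u]`: it satisfies `f - K[f] = u`, and the difference of
the two inverse images under `A` is mapped to `f`. -/
theorem solves_resolvent {u : ℝ → ℝ} (h : RegularDensity μ ρ) (hP : 0 < P)
    (hPo : PoincareInequality μ) (hu : MemH μ u)
    (hi : IntegrableAtFilter (tailQuotient μ u) atTop volume) :
    IsInverseAt μ (GraphA μ) u (explicitInvA μ u) ∧
      ∃ b w : ℝ → ℝ,
        IsInverseAt μ (GraphA μ) (kernelOp μ (resolventKernel μ (logKernel P μ)) u) b ∧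
        IsInverseAt μ (GraphNegL P μ) u w ∧
        (∃ f g : ℝ → ℝ, GraphA μ w f ∧ GraphW μ w g ∧ u =ᵐ[μ] fun x => f x + 2 * P * g x) ∧
        w =ᵐ[μ] fun x => explicitInvA μ u x - b x := by
  have hC := h.centeredKernel P (h.centeredLog_neg hP)
  set K := kernelOp μ (logKernel P μ)
  set R := kernelOp μ (resolventKernel μ (logKernel P μ))
  set f : ℝ → ℝ := fun x => u x - R u x with hf
  have hfL : MemLp f 2 μ := hu.1.sub (hC.resolventKernel_l2.memLp_kernelOp hu.1)
  have hfK : (fun x => f x - K f x) = u := funext (hC.right_inverse hu.1)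
  have hKL : MemLp (K f) 2 μ := hC.kern.l2.memLp_kernelOp hfL
  have hf0 : ∫ x, f x ∂μ = 0 := by
    have h1 := congrArg (fun w => ∫ x, w x ∂μ) hfK
    simp only at h1
    rw [integral_sub (hfL.integrable one_le_two) (hKL.integrable one_le_two),
      hC.integral_kernelOp hfL, hu.2.2.2] at h1
    linarith
  -- The identity `R[u] = -K[f]` transfers the regularity of logarithmic potentials to `R[u]`.
  have hR : MemH μ (R u) := by
    refine h.memH_congr (h.memH_const_mul (-1) (h.memH_kernelOp P hfL hf0))
      (ae_of_all _ fun x => ?_)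
    have := congrFun hfK x
    simp only [hf] at this ⊢
    linarith
  have hfH : MemH μ f := h.memH_sub hu hR
  have ha : SolvesA μ ρ (explicitInvA μ u) u := by
    rw [h.explicitInvA_eq hPo hu.1 hu.2.2.2 hi]
    exact h.solvesA_invA hPo hu.1 hu.2.2.2
  have hb := h.solvesA_invA hPo hR.1 hR.2.2.2
  have hw := h.solvesA_sub ha hb
  obtain ⟨g, hg, hgK⟩ := h.exists_graphW P hw
  refine ⟨h.isInverseAt_graphA hu ha, _, _, h.isInverseAt_graphA hR hb,
    ⟨(h.graphNegL_iff hPo hu).2 ⟨f, hw, ae_of_all _ (congrFun hfK)⟩, fun w' hw' => ?_⟩,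
    ⟨f, g, h.graphA_iff.2 ⟨hw, hfH⟩, hg, ae_of_all _ fun x => ?_⟩, EventuallyEq.refl _ _⟩
  -- Any solution satisfies `(id - K) A[w'] = u`; applying `id - R` gives `A[w'] = f`, and `A` is
  -- injective on `H`.
  · obtain ⟨v, hv, e⟩ := (h.graphNegL_iff hPo hu).1 hw'
    exact h.solvesA_unique hv hw (hC.eq_sub_kernelOp hv.memLp e)
  · change u x = f x + 2 * P * g x
    rw [hgK, ← congrFun hfK x, sub_eq_add_neg]

end RegularDensity

theorem mainTheorem10 (V : ℝ → ℝ) (P : ℝ) (hP : 0 < P) (μ : Measure ℝ) [IsProbabilityMeasure μ]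
    (hμ : IsEquilibriumMeasure V P μ) (hV : PotentialAssumptions V μ) :
    -- the kernel is Hilbert-Schmidt; the 2-determinant converges and does not vanish
    (MemLp (fun p : ℝ × ℝ => logKernel P μ p.1 p.2) 2 (μ.prod μ) ∧
      (∀ n : ℕ, Integrable (fun t : Fin n → ℝ =>
        (offDiagMatrix (fun a b => -logKernel P μ a b) t).det) (Measure.pi fun _ => μ)) ∧
      Summable (fun n : ℕ => det2Term μ (fun a b => -logKernel P μ a b) (n + 1)) ∧
      fredholmDet2 μ (fun a b => -logKernel P μ a b) ≠ 0) ∧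
    -- the series of the resolvent kernel converges to a Hilbert-Schmidt kernel
    ((∀ᵐ p : ℝ × ℝ ∂(μ.prod μ),
        (∀ n : ℕ, Integrable (fun t : Fin n → ℝ =>
          (borderedMatrix (logKernel P μ) p.1 p.2 t).det) (Measure.pi fun _ => μ)) ∧
        Summable (fun n : ℕ => resolventTerm μ (logKernel P μ) p.1 p.2 n)) ∧
      MemLp (fun p : ℝ × ℝ => resolventKernel μ (logKernel P μ) p.1 p.2) 2 (μ.prod μ)) ∧
    -- `id - R` is the inverse of `id - K` on `L²(μ)`
    (∀ v : ℝ → ℝ, MemLp v 2 μ →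
      (fun x => (v x - kernelOp μ (resolventKernel μ (logKernel P μ)) v x) -
          kernelOp μ (logKernel P μ)
            (fun y => v y - kernelOp μ (resolventKernel μ (logKernel P μ)) v y) x) =ᵐ[μ] v ∧
      (fun x => (v x - kernelOp μ (logKernel P μ) v x) -
          kernelOp μ (resolventKernel μ (logKernel P μ))
            (fun y => v y - kernelOp μ (logKernel P μ) v y) x) =ᵐ[μ] v) ∧
    -- `A⁻¹[u]` is explicit, `(-L)⁻¹[u] = A⁻¹[u] - A⁻¹[R[u]]`, and `-L = A + 2P W` there
    (∀ u : ℝ → ℝ, MemH μ u → IntegrableAtFilter (tailQuotient μ u) atTop volume →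
      IsInverseAt μ (GraphA μ) u (explicitInvA μ u) ∧
      ∃ b w : ℝ → ℝ,
        IsInverseAt μ (GraphA μ) (kernelOp μ (resolventKernel μ (logKernel P μ)) u) b ∧
        IsInverseAt μ (GraphNegL P μ) u w ∧
        (∃ f g : ℝ → ℝ, GraphA μ w f ∧ GraphW μ w g ∧ u =ᵐ[μ] fun x => f x + 2 * P * g x) ∧
        w =ᵐ[μ] fun x => explicitInvA μ u x - b x) ∧
    -- `2P W ∘ A⁻¹ = -K` on `H`
    (∀ v : ℝ → ℝ, MemH μ v → ∃ a g : ℝ → ℝ,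
      IsInverseAt μ (GraphA μ) v a ∧ GraphW μ a g ∧
      (fun x => 2 * P * g x) =ᵐ[μ] fun x => -kernelOp μ (logKernel P μ) v x) := by
  obtain ⟨ρ, h⟩ := hμ.regularDensity hP hV
  have hC := h.centeredKernel P (h.centeredLog_neg hP)
  have hneg : MomentKernel μ fun a b => -logKernel P μ a b := by
    simpa only [neg_one_mul] using hC.kern.const_mul (-1)
  refine ⟨⟨hC.kern.l2.joint, fun n => (hneg.allMoments_offDiag n).integrable,
    hC.summable_det2Term, hC.fredholmDet2_ne_zero⟩,
    ⟨ae_of_all _ fun p => ⟨fun n => (hC.kern.allMoments_bordered _ _ n).integrable,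
      hC.summable_resolventTerm _ _⟩, hC.resolventKernel_l2.joint⟩,
    fun v hv => ⟨ae_of_all _ (hC.right_inverse hv), hC.left_inverse hv⟩,
    fun u hu hi => h.solves_resolvent hP hV.poincare hu hi, fun v hv => ?_⟩
  have ha := h.solvesA_invA hV.poincare hv.1 hv.2.2.2
  obtain ⟨g, hg, hgK⟩ := h.exists_graphW P ha
  exact ⟨_, g, h.isInverseAt_graphA hv ha, hg, ae_of_all _ hgK⟩
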